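/- Let $q$ be a complex number with $0<|q|<1$. For $n\ge 0$ put $(x;q)_n=\prod_{i=0}^{n-1}(1-q^i x)$, and for an integer $m\ge 1$ put $\Theta_m=\Theta_m(q)=\prod_{i\ge 1}(1-q^{mi})$. Consider the second-order mock theta functions $$A_2(q)=\sum_{n\ge 0}\frac{q^{n+1}(-q^2;q^2)_n}{(q;q^2)_{n+1}},\qquad B_2(q)=\sum_{n\ge 0}\frac{q^n(-q;q^2)_n}{(q;q^2)_{n+1}},\qquad \mu_2(q)=\sum_{n\ge 0}\frac{(-1)^nq^{n^2}(q;q^2)_n}{(-q^2;q^2)_n^2},$$ the sixth-order mock theta functions $$\phi_6(q)=\sum_{n\ge 0}\frac{(-1)^nq^{n^2}(q;q^2)_n}{(-q;q)_{2n}},\qquad \psi_6(q)=\sum_{n\ge 0}\frac{(-1)^nq^{(n+1)^2}(q;q^2)_n}{(-q;q)_{2n+1}},$$ and the eighth-order mock theta function $$U_{0,8}(q)=\sum_{n\ge 0}\frac{q^{n^2}(-q;q^2)_n}{(-q^4;q^4)_n}.$$ Then, for all $q$ with $0<|q|<1$, $$A_2(q)=\frac{A_2(q^9)}{q}-\frac{\phi_6(-q^3)}{2}+\frac{\Theta_6^{11}\Theta_{18}^2}{2\Theta_3^7\Theta_{12}^4\Theta_{36}}+q\,\frac{\Theta_6^4\Theta_9^2\Theta_{12}}{\Theta_3^5\Theta_{18}}+2q^2\,\frac{\Theta_6^3\Theta_{12}\Theta_{18}^2}{\Theta_3^4\Theta_9},$$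 $$\begin{aligned}B_2(q)={}&\frac{\psi_6(q^{12})}{q^5}-\frac{\phi_6(q^{12})}{q}+\frac{1}{4q^5}\left(\frac{\Theta_{24}^2\Theta_{36}^9}{\Theta_{12}^4\Theta_{72}^6}-\frac{\Theta_9\Theta_{12}^9\Theta_{18}^3}{\Theta_3^3\Theta_6\Theta_{24}^5\Theta_{36}^2\Theta_{72}}\right)+\frac{3}{4q^2}\,\frac{\Theta_6^7\Theta_9^2\Theta_{36}^4}{\Theta_3^6\Theta_{12}\Theta_{18}\Theta_{24}^2\Theta_{72}^2}\\&+\frac1q\,\frac{\Theta_{12}^8\Theta_{18}^2}{\Theta_3^4\Theta_{24}^4\Theta_{36}}+\frac{\Theta_6^7\Theta_9^2}{\Theta_3^6\Theta_{12}\Theta_{18}}-2q^7\,\frac{\Theta_{72}^3}{\Theta_{12}\Theta_{24}},\end{aligned}$$ and there is a function $F$ which is a sum of theta quotients, that is, a finite linear combination with constant rational coefficients of functions of the form $q^k\prod_{m\ge1}\Theta_m(q)^{e_m}$ (with $k,e_m\in\mathbb Z$ and only finitely many $e_m$ nonzero), such that for all $q$ with $0<|q|<1$ $$\mu_2(q)=2\phi_6(q^3)-\frac2q\,U_{0,8}(q^9)-\frac{\Theta_3^4\Theta_9\Theta_{36}}{\Theta_6\Theta_{12}^3\Theta_{18}}-q\,\frac{\Theta_6^7\Theta_{36}^2}{\Theta_3\Theta_{12}^6\Theta_{18}}+q^2F(q^3).$$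 -/

import Mathlib

noncomputable section

namespace MockTheta

open Filter Topology

/-- The finite `q`-Pochhammer symbol `(x; q)_n = ∏_{i=0}^{n-1} (1 - q^i x)`. -/
def qPoch (x q : ℂ) (n : ℕ) : ℂ := ∏ i ∈ Finset.range n, (1 - q ^ i * x)

/-- `Θ_m = ∏_{i ≥ 1} (1 - q^{m i})`, as a function of `q`. -/
def Theta (m : ℕ) (q : ℂ) : ℂ := ∏' i : ℕ, (1 - q ^ (m * (i + 1)))

/-- The general term of `A_2(q)`. -/
def A2Term (q : ℂ) (n : ℕ) : ℂ :=
  q ^ (n + 1) * qPoch (-q ^ 2) (q ^ 2) n / qPoch q (q ^ 2) (n + 1)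

/-- The second-order mock theta function
`A_2(q) = ∑_{n ≥ 0} q^{n+1} (-q^2; q^2)_n / (q; q^2)_{n+1}`. -/
def A2 (q : ℂ) : ℂ := ∑' n : ℕ, A2Term q n

/-- The general term of `B_2(q)`. -/
def B2Term (q : ℂ) (n : ℕ) : ℂ :=
  q ^ n * qPoch (-q) (q ^ 2) n / qPoch q (q ^ 2) (n + 1)

/-- The second-order mock theta function
`B_2(q) = ∑_{n ≥ 0} q^n (-q; q^2)_n / (q; q^2)_{n+1}`. -/
def B2 (q : ℂ) : ℂ := ∑' n : ℕ, B2Term q n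

/-- The general term of `μ_2(q)`. -/
def mu2Term (q : ℂ) (n : ℕ) : ℂ :=
  (-1) ^ n * q ^ (n ^ 2) * qPoch q (q ^ 2) n / qPoch (-q ^ 2) (q ^ 2) n ^ 2

/-- The second-order mock theta function
`μ_2(q) = ∑_{n ≥ 0} (-1)^n q^{n^2} (q; q^2)_n / (-q^2; q^2)_n^2`. -/
def mu2 (q : ℂ) : ℂ := ∑' n : ℕ, mu2Term q n

/-- The general term of `φ_6(q)`. -/
def phi6Term (q : ℂ) (n : ℕ) : ℂ :=
  (-1) ^ n * q ^ (n ^ 2) * qPoch q (q ^ 2) n / qPoch (-q) q (2 * n)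

/-- The sixth-order mock theta function
`φ_6(q) = ∑_{n ≥ 0} (-1)^n q^{n^2} (q; q^2)_n / (-q; q)_{2n}`. -/
def phi6 (q : ℂ) : ℂ := ∑' n : ℕ, phi6Term q n

/-- The general term of `ψ_6(q)`. -/
def psi6Term (q : ℂ) (n : ℕ) : ℂ :=
  (-1) ^ n * q ^ ((n + 1) ^ 2) * qPoch q (q ^ 2) n / qPoch (-q) q (2 * n + 1)

/-- The sixth-order mock theta function
`ψ_6(q) = ∑_{n ≥ 0} (-1)^n q^{(n+1)^2} (q; q^2)_n / (-q; q)_{2n+1}`. -/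
def psi6 (q : ℂ) : ℂ := ∑' n : ℕ, psi6Term q n

/-- The general term of `U_{0,8}(q)`. -/
def U08Term (q : ℂ) (n : ℕ) : ℂ :=
  q ^ (n ^ 2) * qPoch (-q) (q ^ 2) n / qPoch (-q ^ 4) (q ^ 4) n

/-- The eighth-order mock theta function
`U_{0,8}(q) = ∑_{n ≥ 0} q^{n^2} (-q; q^2)_n / (-q^4; q^4)_n`. -/
def U08 (q : ℂ) : ℂ := ∑' n : ℕ, U08Term q n

/-- A theta quotient on the punctured unit disc: `q^k ∏_m Θ_m^{e_m}`, where `k` is an integer and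
the `e_m` are integers, only finitely many of them nonzero. -/
def IsThetaQuotient (f : ℂ → ℂ) : Prop :=
  ∃ (k : ℤ) (e : ℕ+ →₀ ℤ), ∀ q : ℂ, 0 < ‖q‖ → ‖q‖ < 1 →
    f q = q ^ k * e.prod fun m a => Theta (m : ℕ) q ^ a

/-- A sum of theta quotients: a finite linear combination, with constant rational coefficients,
of theta quotients. -/
def IsSumOfThetaQuotients (f : ℂ → ℂ) : Prop :=
  ∃ (r : ℕ) (c : Fin r → ℚ) (g : Fin r → ℂ → ℂ), (∀ j, IsThetaQuotient (g j)) ∧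
    ∀ q : ℂ, 0 < ‖q‖ → ‖q‖ < 1 → f q = ∑ j, (c j : ℂ) * g j q

/-! The series and products above converge for `‖q‖ < 1`. -/

theorem multipliable_Theta {q : ℂ} (hq : ‖q‖ < 1) {m : ℕ} (hm : 0 < m) :
    Multipliable fun i : ℕ => 1 - q ^ (m * (i + 1)) := by
  have h : ‖q ^ m‖ < 1 := by
    rw [norm_pow]; exact pow_lt_one₀ (norm_nonneg _) hq hm.ne'
  simpa only [pow_mul] using ModularForm.multipliable_one_sub_pow h

theorem summable_of_ratio {f g : ℕ → ℂ} {l : ℂ} (hl : ‖l‖ < 1) (hg : Tendsto g atTop (𝓝 l))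
    (h : ∀ n, f (n + 1) = g n * f n) : Summable f := by
  obtain ⟨r, hr1, hr2⟩ := exists_between hl
  refine summable_of_ratio_norm_eventually_le (r := r) hr2 ?_
  filter_upwards [hg.norm.eventually_lt_const hr1] with n hn
  rw [h, norm_mul]
  exact mul_le_mul_of_nonneg_right hn.le (norm_nonneg _)

theorem tendsto_pow_affine {q : ℂ} (hq : ‖q‖ < 1) (a b : ℕ) (ha : 0 < a) :
    Tendsto (fun n : ℕ => q ^ (a * n + b)) atTop (𝓝 0) := by
  refine (tendsto_pow_atTop_nhds_zero_of_norm_lt_one hq).comp ?_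
  refine tendsto_atTop_mono (fun n => ?_) tendsto_id
  show n ≤ a * n + b
  nlinarith

theorem summable_A2Term {q : ℂ} (hq : ‖q‖ < 1) : Summable (A2Term q) := by
  refine summable_of_ratio (l := q * (1 + 0) / (1 - 0)) (by simpa using hq)
    (g := fun n => q * (1 + q ^ (2 * n + 2)) / (1 - q ^ (2 * n + 3)))
    (((tendsto_pow_affine hq 2 2 two_pos).const_add 1 |>.const_mul q).div
      ((tendsto_pow_affine hq 2 3 two_pos).const_sub 1) (by simp)) fun n => ?_
  simp only [A2Term, qPoch, Finset.prod_range_succ _ (n + 1), Finset.prod_range_succ _ n]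
  rw [div_mul_div_comm]
  congr 1 <;> ring

theorem summable_B2Term {q : ℂ} (hq : ‖q‖ < 1) : Summable (B2Term q) := by
  refine summable_of_ratio (l := q * (1 + 0) / (1 - 0)) (by simpa using hq)
    (g := fun n => q * (1 + q ^ (2 * n + 1)) / (1 - q ^ (2 * n + 3)))
    (((tendsto_pow_affine hq 2 1 two_pos).const_add 1 |>.const_mul q).div
      ((tendsto_pow_affine hq 2 3 two_pos).const_sub 1) (by simp)) fun n => ?_
  simp only [B2Term, qPoch, Finset.prod_range_succ _ (n + 1), Finset.prod_range_succ _ n]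
  rw [div_mul_div_comm]
  congr 1 <;> ring

theorem summable_mu2Term {q : ℂ} (hq : ‖q‖ < 1) : Summable (mu2Term q) := by
  refine summable_of_ratio (l := -0 * (1 - 0) / (1 + 0) ^ 2) (by simp)
    (g := fun n => -q ^ (2 * n + 1) * (1 - q ^ (2 * n + 1)) / (1 + q ^ (2 * n + 2)) ^ 2)
    (((tendsto_pow_affine hq 2 1 two_pos).neg.mul
      ((tendsto_pow_affine hq 2 1 two_pos).const_sub 1)).div
      (((tendsto_pow_affine hq 2 2 two_pos).const_add 1).pow 2) (by simp)) fun n => ?_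
  simp only [mu2Term, qPoch, Finset.prod_range_succ _ n]
  rw [div_mul_div_comm]
  congr 1 <;> ring

theorem summable_phi6Term {q : ℂ} (hq : ‖q‖ < 1) : Summable (phi6Term q) := by
  refine summable_of_ratio (l := -0 * (1 - 0) / ((1 + 0) * (1 + 0))) (by simp)
    (g := fun n => -q ^ (2 * n + 1) * (1 - q ^ (2 * n + 1)) /
      ((1 + q ^ (2 * n + 1)) * (1 + q ^ (2 * n + 2))))
    (((tendsto_pow_affine hq 2 1 two_pos).neg.mul
      ((tendsto_pow_affine hq 2 1 two_pos).const_sub 1)).div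
      (((tendsto_pow_affine hq 2 1 two_pos).const_add 1).mul
      ((tendsto_pow_affine hq 2 2 two_pos).const_add 1)) (by simp)) fun n => ?_
  simp only [phi6Term, qPoch, Finset.prod_range_succ _ n, show 2 * (n + 1) = 2 * n + 1 + 1 by ring,
    Finset.prod_range_succ _ (2 * n + 1), Finset.prod_range_succ _ (2 * n)]
  rw [div_mul_div_comm]
  congr 1 <;> ring

theorem summable_psi6Term {q : ℂ} (hq : ‖q‖ < 1) : Summable (psi6Term q) := by
  refine summable_of_ratio (l := -0 * (1 - 0) / ((1 + 0) * (1 + 0))) (by simp)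
    (g := fun n => -q ^ (2 * n + 3) * (1 - q ^ (2 * n + 1)) /
      ((1 + q ^ (2 * n + 2)) * (1 + q ^ (2 * n + 3))))
    (((tendsto_pow_affine hq 2 3 two_pos).neg.mul
      ((tendsto_pow_affine hq 2 1 two_pos).const_sub 1)).div
      (((tendsto_pow_affine hq 2 2 two_pos).const_add 1).mul
      ((tendsto_pow_affine hq 2 3 two_pos).const_add 1)) (by simp)) fun n => ?_
  simp only [psi6Term, qPoch, Finset.prod_range_succ _ n,
    show 2 * (n + 1) + 1 = 2 * n + 1 + 1 + 1 by ring,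
    Finset.prod_range_succ _ (2 * n + 1 + 1), Finset.prod_range_succ _ (2 * n + 1)]
  rw [div_mul_div_comm]
  congr 1 <;> ring

theorem summable_U08Term {q : ℂ} (hq : ‖q‖ < 1) : Summable (U08Term q) := by
  refine summable_of_ratio (l := 0 * (1 + 0) / (1 + 0)) (by simp)
    (g := fun n => q ^ (2 * n + 1) * (1 + q ^ (2 * n + 1)) / (1 + q ^ (4 * n + 4)))
    (((tendsto_pow_affine hq 2 1 two_pos).mul
      ((tendsto_pow_affine hq 2 1 two_pos).const_add 1)).div
      ((tendsto_pow_affine hq 4 4 four_pos).const_add 1) (by simp)) fun n => ?_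
  simp only [U08Term, qPoch, Finset.prod_range_succ _ n]
  rw [div_mul_div_comm]
  congr 1 <;> ring

end MockTheta

end

open MockTheta

/-!
Every mock theta function in the theorem is, up to theta functions, an Appell sum
`appell p z w = ∑ r, th p z r / (1 - p ^ r * w)`, a sum over all integers `r` whose numerators
`th p z r` are the terms of the theta series `∑ r, th p z r = jac z p`.

* For `μ₂` and `U_{0,8}` (`mu2_eq`, `U08_eq`) this follows from a partial fraction expansion of the
  summands (`tsum_bailey`) and the evaluation of the inner sums by the `q`-Gauss theorem
  (`tsum_gauss_pair`). For `A₂` and `B₂` (`A2_eq`, `B2_eq`) the series is first brought into the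
  required shape by Fine's transformation `tsum_fine`.
* For `φ₆` and `ψ₆` (`phi6_eq`, `psi6_eq`) the series is the value at `x = -1` of a function of `x`
  that satisfies a first-order functional equation under `x ↦ q ^ 3 * x`; a combination of Appell
  sums satisfies the same equation, and the two agree by `hick_eq_jacAppell`.

The principle behind all relations between Appell sums is `eq_zero_of_multiplier`: a holomorphic
function on the punctured plane with a zero that is multiplied by a constant under `x ↦ p * x`
vanishes. The proof bounds it by a power of `|x|` and applies Liouville's theorem. The
consequences are the change of parameters `jac_mul_appell_sub`, by which Appell sums with the same
quotient `w / z` agree up to a theta quotient, and from it the relation of Weierstrass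
`jac_weierstrass` between theta functions. In particular `μ₂(q)` and `U_{0,8}(q)` are both
expressed by `A₂(-q)` and theta quotients (`mu2_eq_A2`, `U08_eq_A2`).

Grouping the terms by the residue of `r` modulo 3 splits theta functions (`jac_triple`) and Appell
sums (`appell_triple`) into components. The change of parameters expresses the components of the
Appell sums in `A₂` and `B₂` by the mock theta functions on the right-hand side and theta
functions. To avoid inverting the theta function in the denominator, the claimed components of
`A₂` and `B₂` are multiplied by it and compared there (`A2_components`, `B2_components`); the
remaining theta quotient in `μ₂` is treated likewise (`Theta_cube_div_trisect`).

What remains are identities between theta quotients. Those of level 12 become polynomial identities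
in the single function `etaP q`, since by the relation of Weierstrass its translates
`1 - etaP q`, `1 + 2 * etaP q` and so on are themselves theta quotients. Those of level 24 become
polynomial identities in `etaP q`, `etaP (q ^ 2)` and `etaS q`, which generate the function field
of an elliptic curve; they follow from the two relations `etaS_relation` and `etaP_relation`.
-/

noncomputable section

namespace MockTheta

open Filter Topology

/-! ### Infinite `q`-Pochhammer symbols -/

/-- The infinite `q`-Pochhammer symbol `(x; q)_∞ = ∏_{i ≥ 0} (1 - q^i x)`. -/
def qInf (x q : ℂ) : ℂ := ∏' i : ℕ, (1 - q ^ i * x)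

theorem summable_norm_pow_mul {q : ℂ} (hq : ‖q‖ < 1) (x : ℂ) :
    Summable fun i : ℕ => ‖-(q ^ i * x)‖ := by
  simpa [norm_mul, norm_pow] using
    (summable_geometric_of_lt_one (norm_nonneg q) hq).mul_right ‖x‖

theorem multipliable_qInf {q : ℂ} (hq : ‖q‖ < 1) (x : ℂ) :
    Multipliable fun i : ℕ => 1 - q ^ i * x := by
  simpa only [sub_eq_add_neg] using multipliable_one_add_of_summable (summable_norm_pow_mul hq x)

theorem tendsto_qPoch {q : ℂ} (hq : ‖q‖ < 1) (x : ℂ) :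
    Tendsto (qPoch x q) atTop (𝓝 (qInf x q)) :=
  (multipliable_qInf hq x).hasProd.tendsto_prod_nat

@[simp] theorem qPoch_zero (x q : ℂ) : qPoch x q 0 = 1 := by simp [qPoch]

theorem qPoch_succ (x q : ℂ) (n : ℕ) : qPoch x q (n + 1) = qPoch x q n * (1 - q ^ n * x) := by
  simp [qPoch, Finset.prod_range_succ]

theorem qPoch_succ' (x q : ℂ) (n : ℕ) : qPoch x q (n + 1) = (1 - x) * qPoch (q * x) q n := by
  simp only [qPoch, Finset.prod_range_succ']
  rw [mul_comm]
  congr 1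
  · simp
  · exact Finset.prod_congr rfl fun i _ => by ring

theorem qPoch_add (x q : ℂ) (m n : ℕ) :
    qPoch x q (m + n) = qPoch x q m * qPoch (q ^ m * x) q n := by
  simp only [qPoch, Finset.prod_range_add]
  congr 1
  exact Finset.prod_congr rfl fun i _ => by ring

theorem qPoch_ne_zero {x q : ℂ} (h : ∀ i : ℕ, q ^ i * x ≠ 1) (n : ℕ) : qPoch x q n ≠ 0 :=
  Finset.prod_ne_zero_iff.2 fun i _ => sub_ne_zero.2 (h i).symm

theorem qInf_split {q : ℂ} (hq : ‖q‖ < 1) (x : ℂ) (n : ℕ) :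
    qInf x q = qPoch x q n * qInf (q ^ n * x) q := by
  have h1 : Tendsto (fun m => qPoch x q (n + m)) atTop (𝓝 (qInf x q)) := by
    simpa [add_comm] using (tendsto_add_atTop_iff_nat n).2 (tendsto_qPoch hq x)
  simp only [qPoch_add] at h1
  exact tendsto_nhds_unique h1 ((tendsto_qPoch hq _).const_mul _)

theorem qInf_step {q : ℂ} (hq : ‖q‖ < 1) (x : ℂ) : qInf x q = (1 - x) * qInf (q * x) q := by
  simpa [qPoch] using qInf_split hq x 1

theorem qInf_ne_zero {q : ℂ} (hq : ‖q‖ < 1) {x : ℂ} (h : ∀ i : ℕ, q ^ i * x ≠ 1) :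
    qInf x q ≠ 0 := by
  have := tprod_one_add_ne_zero_of_summable (f := fun i : ℕ => -(q ^ i * x))
    (fun i => by rw [← sub_eq_add_neg]; exact sub_ne_zero.2 (h i).symm)
    (summable_norm_pow_mul hq x)
  simpa only [qInf, ← sub_eq_add_neg] using this

theorem qInf_zero (q : ℂ) : qInf 0 q = 1 := by simp [qInf]

theorem pow_mul_ne_one {q x : ℂ} (hq : ‖q‖ < 1) (hx : ‖x‖ < 1) (i : ℕ) : q ^ i * x ≠ 1 := by
  intro h
  have h1 : ‖q ^ i * x‖ < 1 := by
    rw [norm_mul, norm_pow]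
    calc ‖q‖ ^ i * ‖x‖ ≤ 1 * ‖x‖ :=
          mul_le_mul_of_nonneg_right (pow_le_one₀ (norm_nonneg _) hq.le) (norm_nonneg _)
      _ < 1 := by simpa
  rw [h] at h1; simp at h1

theorem qInf_ne_zero_of_lt {q x : ℂ} (hq : ‖q‖ < 1) (hx : ‖x‖ < 1) : qInf x q ≠ 0 :=
  qInf_ne_zero hq (pow_mul_ne_one hq hx)

theorem qPoch_ne_zero_of_lt {q x : ℂ} (hq : ‖q‖ < 1) (hx : ‖x‖ < 1) (n : ℕ) : qPoch x q n ≠ 0 :=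
  qPoch_ne_zero (pow_mul_ne_one hq hx) n

/-- The majorant `∏ (1 + |q|^i |x|)` of `|(x; q)_∞|`. -/
def qMaj (x q : ℝ) : ℝ := ‖qInf (-(x : ℂ)) (q : ℂ)‖

theorem norm_qPoch_neg {x q : ℝ} (hx : 0 ≤ x) (hq : 0 ≤ q) (n : ℕ) :
    ‖qPoch (-(x : ℂ)) (q : ℂ) n‖ = ∏ i ∈ Finset.range n, (1 + q ^ i * x) := by
  rw [qPoch, norm_prod]
  refine Finset.prod_congr rfl fun i _ => ?_
  have h : (1 - (q : ℂ) ^ i * -(x : ℂ)) = ((1 + q ^ i * x : ℝ) : ℂ) := by push_cast; ring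
  rw [h, Complex.norm_real, Real.norm_eq_abs, abs_of_nonneg (by positivity)]

theorem norm_qPoch_le_qMaj {q : ℂ} (hq : ‖q‖ < 1) (x : ℂ) (n : ℕ) :
    ‖qPoch x q n‖ ≤ qMaj ‖x‖ ‖q‖ := by
  have h1 : ‖qPoch x q n‖ ≤ ‖qPoch (-(‖x‖ : ℂ)) (‖q‖ : ℂ) n‖ := by
    rw [norm_qPoch_neg (norm_nonneg _) (norm_nonneg _), qPoch, norm_prod]
    refine Finset.prod_le_prod (fun _ _ => norm_nonneg _) fun i _ => ?_
    refine (norm_sub_le _ _).trans (by simp)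
  have hq' : ‖((‖q‖ : ℝ) : ℂ)‖ < 1 := by simpa using hq
  refine h1.trans (Monotone.ge_of_tendsto (f := fun m => ‖qPoch (-(‖x‖ : ℂ)) (‖q‖ : ℂ) m‖)
    ?_ (tendsto_qPoch hq' _).norm n)
  refine monotone_nat_of_le_succ fun m => ?_
  simp only [norm_qPoch_neg (norm_nonneg x) (norm_nonneg q), Finset.prod_range_succ]
  refine le_mul_of_one_le_right (Finset.prod_nonneg fun i _ => by positivity) ?_
  have : 0 ≤ ‖q‖ ^ m * ‖x‖ := by positivity
  linarith

theorem norm_qInf_le_qMaj {q : ℂ} (hq : ‖q‖ < 1) (x : ℂ) : ‖qInf x q‖ ≤ qMaj ‖x‖ ‖q‖ :=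
  le_of_tendsto' (tendsto_qPoch hq x).norm fun n => norm_qPoch_le_qMaj hq x n

theorem differentiable_qInf {q : ℂ} (hq : ‖q‖ < 1) : Differentiable ℂ fun x => qInf x q := by
  intro x₀
  have h : HasProdLocallyUniformlyOn (fun (i : ℕ) (x : ℂ) => 1 + -(q ^ i * x))
      (fun x => ∏' i : ℕ, (1 + -(q ^ i * x))) (Metric.ball 0 (‖x₀‖ + 1)) := by
    refine Summable.hasProdLocallyUniformlyOn_nat_one_add Metric.isOpen_ball
      (u := fun i => ‖q‖ ^ i * (‖x₀‖ + 1))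
      ((summable_geometric_of_lt_one (norm_nonneg q) hq).mul_right _)
      (.of_forall fun n x hx => ?_) (fun n => by fun_prop)
    rw [norm_neg, norm_mul, norm_pow]
    have : ‖x‖ < ‖x₀‖ + 1 := by simpa using hx
    gcongr
  have h2 := h.differentiableOn
    (.of_forall fun _ => by simpa [Finset.prod_fn] using
      DifferentiableOn.finsetProd (fun _ _ => by fun_prop)) Metric.isOpen_ball
  have h3 := h2.differentiableAt (Metric.isOpen_ball.mem_nhds (by simp : x₀ ∈ _))
  simpa only [qInf, sub_eq_add_neg] using h3

/-- Splitting the factors of `(x; q)_∞` according to the residue of their index modulo `k`. -/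
theorem qInf_residues {q : ℂ} (hq : ‖q‖ < 1) (x : ℂ) {k : ℕ} (hk : 0 < k) :
    qInf x q = ∏ t ∈ Finset.range k, qInf (q ^ t * x) (q ^ k) := by
  have hqk : ‖q ^ k‖ < 1 := by rw [norm_pow]; exact pow_lt_one₀ (norm_nonneg _) hq hk.ne'
  have h1 : Tendsto (fun n => qPoch x q (k * n)) atTop (𝓝 (qInf x q)) :=
    (tendsto_qPoch hq x).comp (tendsto_id.const_mul_atTop' hk)
  have h2 : ∀ n, qPoch x q (k * n) = ∏ t ∈ Finset.range k, qPoch (q ^ t * x) (q ^ k) n := by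
    intro n
    induction n with
    | zero => simp
    | succ n ih =>
      rw [mul_add, mul_one, qPoch_add, ih]
      simp only [qPoch_succ, Finset.prod_mul_distrib]
      congr 1
      exact Finset.prod_congr rfl fun i _ => by ring
  simp only [h2] at h1
  exact tendsto_nhds_unique h1 (tendsto_finsetProd _ fun t _ => tendsto_qPoch hqk _)

/-- The factors of the two products pair up as `(1 - q^i x) (1 + q^i x)`. -/
theorem qInf_mul_neg {q : ℂ} (hq : ‖q‖ < 1) (x : ℂ) :
    qInf x q * qInf (-x) q = qInf (x ^ 2) (q ^ 2) := by
  have hq2 : ‖q ^ 2‖ < 1 := by rw [norm_pow]; exact pow_lt_one₀ (norm_nonneg _) hq two_ne_zero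
  refine tendsto_nhds_unique ((tendsto_qPoch hq x).mul (tendsto_qPoch hq (-x))) ?_
  refine (tendsto_qPoch hq2 (x ^ 2)).congr fun n => ?_
  rw [qPoch, qPoch, qPoch, ← Finset.prod_mul_distrib]
  exact Finset.prod_congr rfl fun i _ => by ring

theorem Theta_eq_qInf (m : ℕ) (q : ℂ) : Theta m q = qInf (q ^ m) (q ^ m) := by
  simp only [Theta, qInf]
  exact tprod_congr fun i => by ring

theorem Theta_eq_qInf_pow (m : ℕ) (q : ℂ) : Theta 1 (q ^ m) = Theta m q := by
  simp [Theta_eq_qInf]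

theorem Theta_pow (k m : ℕ) (q : ℂ) : Theta k (q ^ m) = Theta (m * k) q := by
  simp [Theta_eq_qInf, ← pow_mul]

theorem norm_pow_lt_one {q : ℂ} (hq : ‖q‖ < 1) {m : ℕ} (hm : 0 < m) : ‖q ^ m‖ < 1 := by
  rw [norm_pow]; exact pow_lt_one₀ (norm_nonneg _) hq hm.ne'

theorem Theta_ne_zero {q : ℂ} (hq : ‖q‖ < 1) {m : ℕ} (hm : 0 < m) : Theta m q ≠ 0 := by
  rw [Theta_eq_qInf]
  exact qInf_ne_zero_of_lt (norm_pow_lt_one hq hm) (norm_pow_lt_one hq hm)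

/-- The reciprocals of finite `q`-Pochhammer symbols without zero factors are bounded. -/
theorem exists_bound_inv_qPoch {q x : ℂ} (hq : ‖q‖ < 1) (h : ∀ i : ℕ, q ^ i * x ≠ 1) :
    ∃ C : ℝ, ∀ n, ‖(qPoch x q n)⁻¹‖ ≤ C := by
  have h1 := ((tendsto_qPoch hq x).inv₀ (qInf_ne_zero hq h)).norm
  obtain ⟨C, hC⟩ := h1.bddAbove_range
  exact ⟨C, fun n => hC ⟨n, rfl⟩⟩

/-! ### The `q`-binomial theorem and its consequences -/

/-- Two summations may be interchanged when the terms are dominated by a product of two summable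
families. -/
theorem tsum_comm_of_norm_le_mul {ι κ : Type*} {f : ι → κ → ℂ} {A : ι → ℝ} {B : κ → ℝ}
    (hA : Summable A) (hB : Summable B) (hA0 : ∀ i, 0 ≤ A i) (hB0 : ∀ k, 0 ≤ B k)
    (h : ∀ i k, ‖f i k‖ ≤ A i * B k) : ∑' i, ∑' k, f i k = ∑' k, ∑' i, f i k := by
  have hs : Summable (Function.uncurry f) :=
    Summable.of_norm_bounded (hA.mul_of_nonneg hB hA0 hB0) fun x => h x.1 x.2
  exact hs.tsum_comm.symm

theorem tendsto_pow_zero {q : ℂ} (hq : ‖q‖ < 1) : Tendsto (fun n : ℕ => q ^ n) atTop (𝓝 0) :=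
  tendsto_pow_atTop_nhds_zero_of_norm_lt_one hq

/-- The coefficients `∏_{i < n} (b - a q^i) / (q; q)_n` of `(a z; q)_∞ / (b z; q)_∞`. -/
def binCoef (a b q : ℂ) (n : ℕ) : ℂ := (∏ i ∈ Finset.range n, (b - a * q ^ i)) / qPoch q q n

theorem one_sub_pow_ne_zero {q : ℂ} (hq : ‖q‖ < 1) {n : ℕ} (hn : 0 < n) : 1 - q ^ n ≠ 0 := by
  have := norm_pow_lt_one hq hn
  intro h
  rw [← sub_eq_zero.1 h] at this
  simp at this

theorem qPoch_self_ne_zero {q : ℂ} (hq : ‖q‖ < 1) (n : ℕ) : qPoch q q n ≠ 0 :=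
  qPoch_ne_zero_of_lt hq hq n

theorem binCoef_succ {q : ℂ} (hq : ‖q‖ < 1) (a b : ℂ) (n : ℕ) :
    binCoef a b q (n + 1) * (1 - q ^ (n + 1)) = binCoef a b q n * (b - a * q ^ n) := by
  have h1 := qPoch_self_ne_zero hq n
  have h2 := one_sub_pow_ne_zero hq n.succ_pos
  rw [binCoef, binCoef, qPoch_succ, Finset.prod_range_succ, ← pow_succ]
  field_simp

theorem summable_binCoef {q : ℂ} (hq : ‖q‖ < 1) (a b z : ℂ) (hz : ‖b * z‖ < 1) :
    Summable fun n => binCoef a b q n * z ^ n := by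
  have h0 := tendsto_pow_zero hq
  refine summable_of_ratio (l := (b - a * 0) * z / (1 - 0)) (by simpa using hz)
    (g := fun n => (b - a * q ^ n) * z / (1 - q ^ (n + 1)))
    ((((h0.const_mul a).const_sub b).mul_const z).div
      (((tendsto_add_atTop_iff_nat 1).2 h0).const_sub 1) (by simp)) fun n => ?_
  have h2 := one_sub_pow_ne_zero hq n.succ_pos
  have h3 := binCoef_succ hq a b n
  field_simp
  linear_combination z ^ (n + 1) * h3

/-- The `q`-binomial theorem `∑ ∏_{i < n} (b - a q^i) z^n / (q)_n = (a z)_∞ / (b z)_∞`. -/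
theorem tsum_binCoef {q : ℂ} (hq : ‖q‖ < 1) (a b z : ℂ) (hz : ‖b * z‖ < 1) :
    ∑' n, binCoef a b q n * z ^ n = qInf (a * z) q / qInf (b * z) q := by
  set G : ℂ → ℂ := fun y => ∑' n, binCoef a b q n * y ^ n with hG
  have hsm : ∀ n : ℕ, ‖b * (q ^ n * z)‖ < 1 := fun n => by
    rw [mul_left_comm, norm_mul, norm_pow]
    calc _ ≤ 1 * ‖b * z‖ :=
          mul_le_mul_of_nonneg_right (pow_le_one₀ (norm_nonneg _) hq.le) (norm_nonneg _)
      _ < 1 := by simpa using hz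
  -- With `G` the sum as a function of `z`, the recursion of the coefficients is a `q`-difference
  -- equation relating `G y` and `G (q y)`; iterating it moves the argument to `0`.
  have hstep : ∀ y, ‖b * y‖ < 1 → ‖b * (q * y)‖ < 1 →
      (1 - b * y) * G y = (1 - a * y) * G (q * y) := by
    intro y hy hy'
    have s1 := summable_binCoef hq a b y hy
    have s2 := summable_binCoef hq a b (q * y) hy'
    have e1 : G y = 1 + ∑' n, binCoef a b q (n + 1) * y ^ (n + 1) := by
      show ∑' n, _ = _; rw [s1.tsum_eq_zero_add]; simp [binCoef]
    have e2 : G (q * y) = 1 + ∑' n, binCoef a b q (n + 1) * (q * y) ^ (n + 1) := by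
      show ∑' n, _ = _; rw [s2.tsum_eq_zero_add]; simp [binCoef]
    have t1 := (summable_nat_add_iff 1).2 s1
    have t2 := (summable_nat_add_iff 1).2 s2
    have key : ∑' n, binCoef a b q (n + 1) * y ^ (n + 1) - b * y * G y
        = ∑' n, binCoef a b q (n + 1) * (q * y) ^ (n + 1) - a * y * G (q * y) := by
      rw [hG, ← tsum_mul_left, ← tsum_mul_left, ← t1.tsum_sub (s1.mul_left _),
        ← t2.tsum_sub (s2.mul_left _)]
      refine tsum_congr fun n => ?_
      linear_combination y ^ (n + 1) * binCoef_succ hq a b n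
    linear_combination e1 - e2 + key
  have hit : ∀ n, qPoch (b * z) q n * G z = qPoch (a * z) q n * G (q ^ n * z) := by
    intro n
    induction n with
    | zero => simp
    | succ n ih =>
      have := hstep (q ^ n * z) (hsm n) (by simpa [pow_succ', mul_assoc] using hsm (n + 1))
      rw [qPoch_succ, qPoch_succ, show q ^ (n + 1) * z = q * (q ^ n * z) by ring]
      linear_combination (1 - q ^ n * (b * z)) * ih + qPoch (a * z) q n * this
  have hlim : Tendsto (fun n => G (q ^ n * z)) atTop (𝓝 1) := by
    have h1 : Tendsto (fun n : ℕ => ∑' k, binCoef a b q k * (q ^ n * z) ^ k) atTop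
        (𝓝 (∑' k, if k = 0 then (1 : ℂ) else 0)) := by
      refine tendsto_tsum_of_dominated_convergence
        (bound := fun k => ‖binCoef a b q k * z ^ k‖) (summable_binCoef hq a b z hz).norm ?_ ?_
      · intro k
        have h2 : Tendsto (fun n : ℕ => q ^ n * z) atTop (𝓝 0) := by
          simpa using (tendsto_pow_zero hq).mul_const z
        have h3 := (h2.pow k).const_mul (binCoef a b q k)
        rcases eq_or_ne k 0 with rfl | hk
        · simp [binCoef]
        · simpa [hk] using h3
      · refine .of_forall fun n k => ?_
        rw [norm_mul, norm_mul, mul_pow, norm_mul, ← pow_mul, norm_pow]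
        refine mul_le_mul_of_nonneg_left ?_ (norm_nonneg _)
        exact mul_le_of_le_one_left (norm_nonneg _) (pow_le_one₀ (norm_nonneg _) hq.le)
    simpa using h1
  rw [eq_div_iff (qInf_ne_zero_of_lt hq hz), mul_comm]
  have := tendsto_nhds_unique ((tendsto_qPoch hq (b * z)).mul_const (G z))
    (((tendsto_qPoch hq (a * z)).mul hlim).congr fun n => (hit n).symm)
  rw [this, mul_one]

theorem binCoef_one (a q : ℂ) (n : ℕ) : binCoef a 1 q n = qPoch a q n / qPoch q q n := by
  rw [binCoef, qPoch]
  congr 1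
  exact Finset.prod_congr rfl fun i _ => by ring

theorem choose_two_succ (n : ℕ) : (n + 1).choose 2 = n.choose 2 + n := by
  rw [Nat.choose_succ_succ' n 1, Nat.choose_one_right]; ring

theorem choose_two_add (m n : ℕ) : (m + n).choose 2 = m.choose 2 + n.choose 2 + m * n := by
  induction n with
  | zero => simp
  | succ n ih => rw [← add_assoc, choose_two_succ, choose_two_succ, ih]; ring

theorem binCoef_zero (q : ℂ) (n : ℕ) :
    binCoef 1 0 q n = (-1) ^ n * q ^ n.choose 2 / qPoch q q n := by
  rw [binCoef]
  congr 1
  induction n with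
  | zero => simp
  | succ n ih => rw [Finset.prod_range_succ, ih, choose_two_succ]; ring

/-- Cauchy's `q`-binomial theorem. -/
theorem tsum_cauchy {q : ℂ} (hq : ‖q‖ < 1) (a : ℂ) {z : ℂ} (hz : ‖z‖ < 1) :
    ∑' n, qPoch a q n / qPoch q q n * z ^ n = qInf (a * z) q / qInf z q := by
  simpa only [binCoef_one, one_mul] using tsum_binCoef hq a 1 z (by simpa)

theorem summable_cauchy {q : ℂ} (hq : ‖q‖ < 1) (a : ℂ) {z : ℂ} (hz : ‖z‖ < 1) :
    Summable fun n => qPoch a q n / qPoch q q n * z ^ n := by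
  simpa only [binCoef_one] using summable_binCoef hq a 1 z (by simpa)

theorem summable_euler {q : ℂ} (hq : ‖q‖ < 1) (z : ℂ) :
    Summable fun n : ℕ => (-1) ^ n * q ^ n.choose 2 / qPoch q q n * z ^ n := by
  simpa only [binCoef_zero] using summable_binCoef hq 1 0 z (by simp)

/-- Euler's expansion of `(z; q)_∞` in powers of `z`. -/
theorem tsum_euler {q : ℂ} (hq : ‖q‖ < 1) (z : ℂ) :
    ∑' n : ℕ, (-1) ^ n * q ^ n.choose 2 / qPoch q q n * z ^ n = qInf z q := by
  simpa only [binCoef_zero, one_mul, zero_mul, qInf_zero, div_one] using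
    tsum_binCoef hq 1 0 z (by simp)

/-- The `q`-Pascal rule, summed against an arbitrary function of the two indices. -/
theorem sum_antidiagonal_qPascal {q : ℂ} (hq : ‖q‖ < 1) (f : ℕ → ℕ → ℂ) (N : ℕ) :
    (1 - q ^ (N + 1)) * ∑ x ∈ Finset.HasAntidiagonal.antidiagonal (N + 1),
        f x.1 x.2 / (qPoch q q x.1 * qPoch q q x.2)
      = ∑ x ∈ Finset.HasAntidiagonal.antidiagonal N,
        (f (x.1 + 1) x.2 + q ^ x.1 * f x.1 (x.2 + 1)) / (qPoch q q x.1 * qPoch q q x.2) := by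
  have h0 := qPoch_self_ne_zero hq
  have h1 : (1 - q ^ (N + 1)) * ∑ x ∈ Finset.HasAntidiagonal.antidiagonal (N + 1),
        f x.1 x.2 / (qPoch q q x.1 * qPoch q q x.2)
      = ∑ x ∈ Finset.HasAntidiagonal.antidiagonal (N + 1),
          f x.1 x.2 * (1 - q ^ x.1) / (qPoch q q x.1 * qPoch q q x.2)
        + ∑ x ∈ Finset.HasAntidiagonal.antidiagonal (N + 1),
          f x.1 x.2 * q ^ x.1 * (1 - q ^ x.2) / (qPoch q q x.1 * qPoch q q x.2) := by
    rw [Finset.mul_sum, ← Finset.sum_add_distrib]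
    refine Finset.sum_congr rfl fun x hx => ?_
    rw [← Finset.HasAntidiagonal.mem_antidiagonal.1 hx, pow_add]
    ring
  rw [h1, Finset.Nat.sum_antidiagonal_succ, Finset.Nat.sum_antidiagonal_succ']
  simp only [pow_zero, sub_self, mul_zero, zero_div, zero_add]
  rw [← Finset.sum_add_distrib]
  refine Finset.sum_congr rfl fun x _ => ?_
  have h2 := one_sub_pow_ne_zero hq x.1.succ_pos
  have h3 := one_sub_pow_ne_zero hq x.2.succ_pos
  have h4 := h0 x.1
  have h5 := h0 x.2
  rw [qPoch_succ, qPoch_succ, ← pow_succ, ← pow_succ]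
  field_simp

/-- A form of the `q`-Vandermonde sum. -/
theorem sum_antidiagonal_vandermonde {q : ℂ} (hq : ‖q‖ < 1) (a : ℂ) (N : ℕ) :
    ∑ x ∈ Finset.HasAntidiagonal.antidiagonal N, qPoch a q x.1 * a ^ x.2 / (qPoch q q x.1 * qPoch q q x.2)
      = 1 / qPoch q q N := by
  induction N with
  | zero => simp
  | succ N ih =>
    have h1 := sum_antidiagonal_qPascal hq (fun m k => qPoch a q m * a ^ k) N
    have h2 : 1 - q ^ (N + 1) ≠ 0 := one_sub_pow_ne_zero hq N.succ_pos
    have h3 := qPoch_self_ne_zero hq N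
    have h4 : ∀ x : ℕ × ℕ, qPoch a q (x.1 + 1) * a ^ x.2 + q ^ x.1 * (qPoch a q x.1 * a ^ (x.2 + 1))
        = qPoch a q x.1 * a ^ x.2 := fun x => by rw [qPoch_succ]; ring
    simp only [h4, ih] at h1
    rw [qPoch_succ, ← pow_succ, eq_div_iff (mul_ne_zero h3 h2)]
    field_simp at h1
    linear_combination h1

/-- The confluent `q`-Gauss sum. -/
theorem tsum_qGauss {q : ℂ} (hq : ‖q‖ < 1) (a g : ℂ) (hc : ∀ i : ℕ, q ^ i * (a * g) ≠ 1) :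
    ∑' m : ℕ, qPoch a q m * ((-1) ^ m * q ^ m.choose 2 * g ^ m)
        / (qPoch q q m * qPoch (a * g) q m) = qInf g q / qInf (a * g) q := by
  have h0 := qPoch_self_ne_zero hq
  have hc0 := qInf_ne_zero hq hc
  set F : ℕ × ℕ → ℂ := fun x => qPoch a q x.1 * ((-1) ^ x.1 * q ^ x.1.choose 2 * g ^ x.1)
    / qPoch q q x.1 * ((-1) ^ x.2 * q ^ x.2.choose 2 / qPoch q q x.2 * (q ^ x.1 * (a * g)) ^ x.2)
    with hF
  have hsF : Summable F := by
    refine Summable.of_norm_bounded (g := fun x : ℕ × ℕ =>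
      (qMaj ‖a‖ ‖q‖ * ‖(-1) ^ x.1 * q ^ x.1.choose 2 / qPoch q q x.1 * g ^ x.1‖) *
        ‖(-1) ^ x.2 * q ^ x.2.choose 2 / qPoch q q x.2 * (a * g) ^ x.2‖)
      (((summable_euler hq g).norm.mul_left _).mul_of_nonneg (summable_euler hq (a * g)).norm
        (fun _ => mul_nonneg (norm_nonneg _) (norm_nonneg _)) fun _ => norm_nonneg _) fun x => ?_
    have e : F x = (qPoch a q x.1 * ((-1) ^ x.1 * q ^ x.1.choose 2 / qPoch q q x.1 * g ^ x.1)) *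
        (((-1) ^ x.2 * q ^ x.2.choose 2 / qPoch q q x.2 * (a * g) ^ x.2) * (q ^ x.1) ^ x.2) := by
      simp only [hF]; ring
    rw [e, norm_mul, norm_mul (qPoch a q x.1)]
    refine mul_le_mul (mul_le_mul_of_nonneg_right (norm_qPoch_le_qMaj hq a _) (norm_nonneg _))
      ?_ (norm_nonneg _) (mul_nonneg (norm_nonneg _) (norm_nonneg _))
    rw [norm_mul]
    refine mul_le_of_le_one_right (norm_nonneg _) ?_
    rw [← pow_mul, norm_pow]
    exact pow_le_one₀ (norm_nonneg _) hq.le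
  -- Summing `F` over the second index first gives the series, by Euler's expansion of `(q^m a g;
  -- q)_∞`.
  have h1 : ∑' x, F x = qInf (a * g) q * ∑' m : ℕ, qPoch a q m * ((-1) ^ m * q ^ m.choose 2 * g ^ m)
        / (qPoch q q m * qPoch (a * g) q m) := by
    rw [hsF.tsum_prod, ← tsum_mul_left]
    refine tsum_congr fun m => ?_
    simp only [hF]
    rw [tsum_mul_left, tsum_euler hq, qInf_split hq (a * g) m]
    have h2 := qPoch_ne_zero hc m
    have h3 := h0 m
    field_simp
  -- Summing `F` along antidiagonals gives `(g; q)_∞`, by the `q`-Vandermonde sum.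
  have h2 : ∑' x, F x = qInf g q := by
    have hs' := (Finset.HasAntidiagonal.sigmaAntidiagonalEquivProd (A := ℕ)).summable_iff.2 hsF
    rw [← (Finset.HasAntidiagonal.sigmaAntidiagonalEquivProd (A := ℕ)).tsum_eq, ← tsum_euler hq g]
    refine hs'.tsum_sigma.trans ?_
    refine tsum_congr fun N => ?_
    rw [tsum_fintype]
    have h3 : ∀ x : Finset.HasAntidiagonal.antidiagonal N,
        F (Finset.HasAntidiagonal.sigmaAntidiagonalEquivProd ⟨N, x⟩) = (-1) ^ N * q ^ N.choose 2 * g ^ N *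
          (qPoch a q x.1.1 * a ^ x.1.2 / (qPoch q q x.1.1 * qPoch q q x.1.2)) := by
      rintro ⟨⟨m, k⟩, hx⟩
      obtain rfl := Finset.HasAntidiagonal.mem_antidiagonal.1 hx
      simp only [hF, Finset.HasAntidiagonal.sigmaAntidiagonalEquivProd_apply]
      rw [choose_two_add]
      ring
    refine (Finset.sum_congr rfl fun x _ => h3 x).trans ?_
    rw [← Finset.mul_sum, Finset.sum_coe_sort (Finset.HasAntidiagonal.antidiagonal N)
      (fun x => qPoch a q x.1 * a ^ x.2 / (qPoch q q x.1 * qPoch q q x.2)),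
      sum_antidiagonal_vandermonde hq]
    ring
  rw [eq_div_iff hc0, ← h2, h1, mul_comm]

/-! ### Fine's transformation -/

/-- Fine's `∑ (b)_n / (c)_n z^n` as a rapidly convergent series. -/
theorem tsum_fine {q : ℂ} (hq : ‖q‖ < 1) (b c z : ℂ) (hc : ‖c‖ < 1) (hz : ‖z‖ < 1) :
    ∑' n, qPoch b q n / qPoch c q n * z ^ n
      = ∑' n : ℕ, z ^ n * q ^ n.choose 2 * (∏ i ∈ Finset.range n, (c * q ^ i - b))
        / (qPoch c q n * qPoch z q (n + 1)) := by
  have hpow : ∀ {y : ℂ}, ‖y‖ < 1 → ∀ N : ℕ, ‖q ^ N * y‖ < 1 := fun {y} hy N => by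
    rw [norm_mul, norm_pow]
    exact (mul_le_of_le_one_left (norm_nonneg _) (pow_le_one₀ (norm_nonneg _) hq.le)).trans_lt hy
  obtain ⟨C, hC⟩ := exists_bound_inv_qPoch hq (pow_mul_ne_one hq hc)
  have hC0 : 0 ≤ C := (norm_nonneg _).trans (hC 0)
  have hM0 : 0 ≤ qMaj ‖b‖ ‖q‖ := norm_nonneg _
  have hN0 : 0 ≤ qMaj ‖c‖ ‖q‖ := norm_nonneg _
  have hcn := fun n => qPoch_ne_zero_of_lt hq hc n
  have hzn := fun n => qPoch_ne_zero_of_lt hq hz n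
  -- `f N` is the series with `c` and `z` replaced by `q^N c` and `q^N z`; `t n` are the terms of
  -- the transformed series.
  set f : ℕ → ℂ := fun N => ∑' n, qPoch b q n / qPoch (q ^ N * c) q n * (q ^ N * z) ^ n with hf
  set t : ℕ → ℂ := fun n => z ^ n * q ^ n.choose 2 * (∏ i ∈ Finset.range n, (c * q ^ i - b))
        / (qPoch c q n * qPoch z q (n + 1)) with ht
  have hbd : ∀ N n, ‖qPoch b q n / qPoch (q ^ N * c) q n * (q ^ N * z) ^ n‖
      ≤ qMaj ‖b‖ ‖q‖ * (qMaj ‖c‖ ‖q‖ * C) * ‖z‖ ^ n := by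
    intro N n
    have e : qPoch b q n / qPoch (q ^ N * c) q n * (q ^ N * z) ^ n
        = qPoch b q n * (qPoch c q N * (qPoch c q (N + n))⁻¹) * z ^ n * (q ^ N) ^ n := by
      have h1 := hcn N
      have h2 := qPoch_ne_zero_of_lt hq (hpow hc N) n
      rw [qPoch_add]
      field_simp
      ring
    rw [e, norm_mul, norm_mul, norm_mul, norm_mul, norm_pow z]
    have h1 := norm_qPoch_le_qMaj hq b n
    have h2 := norm_qPoch_le_qMaj hq c N
    have h3 := hC (N + n)
    have h4 : ‖(q ^ N) ^ n‖ ≤ 1 := by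
      rw [← pow_mul, norm_pow]; exact pow_le_one₀ (norm_nonneg _) hq.le
    refine (mul_le_of_le_one_right (by positivity) h4).trans ?_
    gcongr
  have hgeo := (summable_geometric_of_lt_one (norm_nonneg z) hz).mul_left
    (qMaj ‖b‖ ‖q‖ * (qMaj ‖c‖ ‖q‖ * C))
  have hsum : ∀ N, Summable fun n => qPoch b q n / qPoch (q ^ N * c) q n * (q ^ N * z) ^ n :=
    fun N => Summable.of_norm_bounded hgeo (hbd N)
  -- Subtracting `q^N z` times the series from itself shifted by one relates `f N` to `f (N + 1)`.
  have hstep : ∀ N, (1 - q ^ N * z) * f N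
      = 1 + q ^ N * z * (q ^ N * c - b) / (1 - q ^ N * c) * f (N + 1) := by
    intro N
    have hs := hsum N
    have e1 : f N = 1 + ∑' n, qPoch b q (n + 1) / qPoch (q ^ N * c) q (n + 1) *
        (q ^ N * z) ^ (n + 1) := by
      show ∑' n, _ = _; rw [hs.tsum_eq_zero_add]; simp
    have e2 : ∑' n, qPoch b q (n + 1) / qPoch (q ^ N * c) q (n + 1) * (q ^ N * z) ^ (n + 1)
        - q ^ N * z * f N = q ^ N * z * (q ^ N * c - b) / (1 - q ^ N * c) * f (N + 1) := by
      rw [hf, ← tsum_mul_left, ← ((summable_nat_add_iff 1).2 hs).tsum_sub (hs.mul_left _),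
        ← tsum_mul_left]
      refine tsum_congr fun n => ?_
      have h1 : 1 - q ^ N * c ≠ 0 := by
        simpa [qPoch_succ] using qPoch_ne_zero_of_lt hq (hpow hc N) 1
      have h2 := qPoch_ne_zero_of_lt hq (hpow hc (N + 1)) n
      have h3 := qPoch_ne_zero_of_lt hq (hpow hc N) n
      have h4 : qPoch (q ^ N * c) q (n + 1) = (1 - q ^ N * c) * qPoch (q ^ (N + 1) * c) q n := by
        rw [qPoch_succ']; congr 2; ring
      have h5 : 1 - q ^ n * (q ^ N * c) ≠ 0 := by
        have h6 := qPoch_ne_zero_of_lt hq (hpow hc N) (n + 1)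
        rw [qPoch_succ] at h6
        exact right_ne_zero_of_mul h6
      have h7 : 1 / qPoch (q ^ N * c) q n
          = (1 - q ^ n * (q ^ N * c)) / ((1 - q ^ N * c) * qPoch (q ^ (N + 1) * c) q n) := by
        rw [← h4, qPoch_succ, eq_div_iff (mul_ne_zero h3 h5), one_div, inv_mul_cancel_left₀ h3]
      rw [h4, qPoch_succ b, div_eq_mul_one_div (qPoch b q n) (qPoch (q ^ N * c) q n), h7]
      field_simp
      ring
    linear_combination e1 + e2
  have hit : ∀ N, f 0 = ∑ n ∈ Finset.range N, t n + t N * (1 - q ^ N * z) * f N := by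
    intro N
    induction N with
    | zero =>
      have : 1 - z ≠ 0 := by simpa [qPoch_succ] using hzn 1
      simp [ht, qPoch_succ]
      field_simp
    | succ N ih =>
      have h1 := hcn (N + 1)
      have h2 := hzn (N + 2)
      rw [qPoch_succ] at h1
      rw [qPoch_succ, qPoch_succ] at h2
      have h3 := right_ne_zero_of_mul h1
      have h4 := left_ne_zero_of_mul h1
      have h5 := right_ne_zero_of_mul h2
      have h6 := right_ne_zero_of_mul (left_ne_zero_of_mul h2)
      have h7 := left_ne_zero_of_mul (left_ne_zero_of_mul h2)
      rw [Finset.sum_range_succ, ih, mul_assoc, hstep N, add_assoc]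
      congr 1
      have h8 : t (N + 1) * (1 - q ^ (N + 1) * z)
          = t N * (q ^ N * z * (q ^ N * c - b) / (1 - q ^ N * c)) := by
        simp only [ht]
        rw [choose_two_succ, qPoch_succ c, qPoch_succ z (n := N + 1), Finset.prod_range_succ,
          qPoch_succ]
        generalize 1 - q ^ (N + 1) * z = u at *
        field_simp
        ring
      rw [h8]; ring
  have hts : Summable t := by
    have h0 := tendsto_pow_zero hq
    refine summable_of_ratio (l := z * 0 * (c * 0 - b) / ((1 - 0 * c) * (1 - 0 * z))) (by simp)
      (g := fun n => z * q ^ n * (c * q ^ n - b) / ((1 - q ^ n * c) * (1 - q ^ (n + 1) * z)))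
      (((h0.const_mul z).mul ((h0.const_mul c).sub_const b)).div
        (((h0.mul_const c).const_sub 1).mul
          ((((tendsto_add_atTop_iff_nat 1).2 h0).mul_const z).const_sub 1)) (by simp))
      fun n => ?_
    simp only [ht]
    rw [choose_two_succ, qPoch_succ c, qPoch_succ z (n := n + 1), Finset.prod_range_succ,
      div_mul_div_comm]
    congr 1 <;> ring
  have hfb : ∃ K : ℝ, ∀ N, ‖f N‖ ≤ K :=
    ⟨_, fun N => tsum_of_norm_bounded hgeo.hasSum (hbd N)⟩
  obtain ⟨K, hK⟩ := hfb
  -- The `f N` stay bounded while `t N` tends to `0`, so the remainder in `hit` disappears.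
  have hlim : Tendsto (fun N => t N * (1 - q ^ N * z) * f N) atTop (𝓝 0) := by
    have h1 : Tendsto (fun N => t N * (1 - q ^ N * z)) atTop (𝓝 0) := by
      simpa using hts.tendsto_atTop_zero.mul (((tendsto_pow_zero hq).mul_const z).const_sub 1)
    exact h1.zero_mul_isBoundedUnder_le (isBoundedUnder_of ⟨K, hK⟩)
  have h9 := hts.hasSum.tendsto_sum_nat.add hlim
  have h10 : f 0 = ∑' n, t n := by
    rw [add_zero] at h9
    exact tendsto_nhds_unique (tendsto_const_nhds.congr hit) h9
  simpa [hf] using h10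

/-! ### The theta weights -/

/-- `p^{r(r-1)/2}` for an integer `r`. -/
def te (p : ℂ) (r : ℤ) : ℂ := p ^ (r * (r - 1) / 2)

theorem te_zero (p : ℂ) : te p 0 = 1 := by simp [te]

theorem te_succ {p : ℂ} (hp : p ≠ 0) (r : ℤ) : te p (r + 1) = te p r * p ^ r := by
  rw [te, te, ← zpow_add₀ hp]
  congr 1
  rw [show (r + 1) * (r + 1 - 1) = r * (r - 1) + r * 2 by ring,
    Int.add_mul_ediv_right _ _ two_ne_zero]

/-- The reflection `r ↦ 1 - r` that leaves `r(r-1)/2` unchanged. -/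
theorem te_one_sub (p : ℂ) (r : ℤ) : te p (1 - r) = te p r := by
  rw [te, te]; congr 2; ring

theorem te_neg {p : ℂ} (hp : p ≠ 0) (r : ℤ) : te p (-r) = te p r * p ^ r := by
  rw [← te_succ hp, ← te_one_sub]; congr 1; ring

theorem te_sq (p : ℂ) (r : ℤ) : te (p ^ 2) r = p ^ (r * (r - 1)) := by
  rw [te, ← zpow_natCast, ← zpow_mul]
  congr 1
  rw [Nat.cast_ofNat, Int.mul_ediv_cancel' (Int.even_mul_pred_self r).two_dvd]

theorem te_ne_zero {p : ℂ} (hp : p ≠ 0) (r : ℤ) : te p r ≠ 0 := zpow_ne_zero _ hp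

/-- The general term `(-1)^r p^{r(r-1)/2} x^r` of the theta series. -/
def th (p x : ℂ) (r : ℤ) : ℂ := (-1) ^ r * te p r * x ^ r

theorem th_zero (p x : ℂ) : th p x 0 = 1 := by simp [th, te_zero]

theorem neg_one_zpow_succ (r : ℤ) : (-1 : ℂ) ^ (r + 1) = -(-1) ^ r := by
  rw [zpow_add_one₀ (by norm_num)]; ring

theorem th_succ {p x : ℂ} (hp : p ≠ 0) (hx : x ≠ 0) (r : ℤ) :
    th p x (r + 1) = -(p ^ r * x) * th p x r := by
  rw [th, th, te_succ hp, zpow_add_one₀ hx, neg_one_zpow_succ]; ring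

theorem th_mul (p x y : ℂ) (r : ℤ) : th p (x * y) r = y ^ r * th p x r := by
  rw [th, th, mul_zpow]; ring

theorem th_ne_zero {p x : ℂ} (hp : p ≠ 0) (hx : x ≠ 0) (r : ℤ) : th p x r ≠ 0 :=
  mul_ne_zero (mul_ne_zero (zpow_ne_zero _ (by norm_num)) (te_ne_zero hp r)) (zpow_ne_zero _ hx)

theorem norm_th (p x : ℂ) (r : ℤ) : ‖th p x r‖ = ‖te p r‖ * ‖x‖ ^ r := by
  simp [th]

theorem summable_th {p : ℂ} (hp : p ≠ 0) (hp1 : ‖p‖ < 1) (x : ℂ) (hx : x ≠ 0) :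
    Summable (th p x) := by
  have h0 := tendsto_pow_zero hp1
  refine Summable.of_nat_of_neg (summable_of_ratio (l := -(0 * x)) (by simp)
    (g := fun n : ℕ => -(p ^ n * x)) (h0.mul_const x).neg fun n => ?_)
    (summable_of_ratio (l := -(0 * x⁻¹)) (by simp)
    (g := fun n : ℕ => -(p ^ (n + 1) * x⁻¹))
    (((tendsto_add_atTop_iff_nat 1).2 h0).mul_const _).neg fun n => ?_)
  · rw [Nat.cast_add_one, th_succ hp hx, zpow_natCast]
  · have h := th_succ hp hx (-((n + 1 : ℕ) : ℤ))
    rw [show -((n + 1 : ℕ) : ℤ) + 1 = -(n : ℤ) by push_cast; ring] at h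
    rw [h, zpow_neg, zpow_natCast]
    field_simp

/-! ### Reciprocals of `q`-factorials -/

/-- `1 / (q; q)_k` for `k ≥ 0` and `0` for `k < 0`. -/
def rPoch (q : ℂ) : ℤ → ℂ
  | .ofNat n => 1 / qPoch q q n
  | .negSucc _ => 0

theorem rPoch_natCast (q : ℂ) (n : ℕ) : rPoch q n = 1 / qPoch q q n := rfl

theorem rPoch_zero (q : ℂ) : rPoch q 0 = 1 := by
  have := rPoch_natCast q 0
  simpa using this

theorem rPoch_of_neg (q : ℂ) {k : ℤ} (hk : k < 0) : rPoch q k = 0 := by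
  cases k with
  | ofNat n => exact absurd hk (by simp)
  | negSucc n => rfl

/-- Because `1 / (q; q)_k` is taken to be `0` for `k < 0`, the recursion holds for all integers
`k`. -/
theorem rPoch_rec {q : ℂ} (hq : ‖q‖ < 1) (k : ℤ) :
    (1 - q ^ k) * rPoch q k = rPoch q (k - 1) := by
  rcases lt_trichotomy k 0 with h | rfl | h
  · rw [rPoch_of_neg q h, rPoch_of_neg q (by lia), mul_zero]
  · rw [rPoch_of_neg q (show (0 : ℤ) - 1 < 0 by norm_num)]; simp
  · obtain ⟨n, rfl⟩ : ∃ n : ℕ, k = (n + 1 : ℕ) := ⟨(k - 1).toNat, by lia⟩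
    rw [show (((n + 1 : ℕ) : ℤ) - 1) = (n : ℕ) by push_cast; ring, rPoch_natCast, rPoch_natCast,
      zpow_natCast, qPoch_succ, ← pow_succ]
    have h1 := qPoch_self_ne_zero hq n
    have h2 : 1 - q ^ (n + 1) ≠ 0 := one_sub_pow_ne_zero hq n.succ_pos
    field_simp

theorem exists_bound_rPoch {q : ℂ} (hq : ‖q‖ < 1) : ∃ C : ℝ, 0 ≤ C ∧ ∀ k, ‖rPoch q k‖ ≤ C := by
  obtain ⟨C, hC⟩ := exists_bound_inv_qPoch hq (pow_mul_ne_one hq hq)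
  have hC0 : 0 ≤ C := (norm_nonneg _).trans (hC 0)
  refine ⟨C, hC0, fun k => ?_⟩
  cases k with
  | ofNat n => simpa [rPoch] using hC n
  | negSucc n => simpa [rPoch] using hC0

theorem tendsto_rPoch_add {q : ℂ} (hq : ‖q‖ < 1) (k : ℤ) :
    Tendsto (fun n : ℕ => rPoch q (n + k)) atTop (𝓝 (1 / qInf q q)) := by
  have h1 : Tendsto (fun n : ℕ => rPoch q n) atTop (𝓝 (1 / qInf q q)) := by
    simp only [rPoch_natCast]
    exact tendsto_const_nhds.div (tendsto_qPoch hq q) (qInf_ne_zero_of_lt hq hq)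
  have h2 : Tendsto (fun n : ℕ => ((n : ℤ) + k).toNat) atTop atTop := by
    refine tendsto_atTop.2 fun b => ?_
    filter_upwards [eventually_ge_atTop (b + k.natAbs)] with n hn
    lia
  refine (h1.comp h2).congr' ?_
  filter_upwards [eventually_ge_atTop k.natAbs] with n hn
  simp only [Function.comp]
  rw [Int.toNat_of_nonneg (by lia)]

theorem summable_mul_rPoch {q : ℂ} (hq : ‖q‖ < 1) {f : ℤ → ℂ} (hf : Summable f) (a b : ℤ) :
    Summable fun j : ℤ => f j * (rPoch q (a - j) * rPoch q (b + j)) := by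
  obtain ⟨C, hC0, hC⟩ := exists_bound_rPoch hq
  refine Summable.of_norm_bounded (hf.norm.mul_right (C * C)) fun j => ?_
  rw [norm_mul, norm_mul]
  have h1 := hC (a - j)
  have h2 := hC (b + j)
  gcongr

/-! ### The finite and the infinite triple product -/

theorem th_neg {p x : ℂ} (hp : p ≠ 0) (r : ℤ) : th p x (-r) = th p (p / x) r := by
  rw [th, th, te_neg hp, div_zpow, zpow_neg, zpow_neg, ← inv_zpow, inv_neg_one]
  ring

/-- The step `a ↦ a + 1` in the finite triple product: `1 - q^{a+b+1}` is split according to the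
two lower indices `a + 1 - j` and `b + j`, and the second part is the first with `j` shifted. -/
theorem tsum_jtp_step {q : ℂ} (hq0 : q ≠ 0) (hq : ‖q‖ < 1) {x : ℂ} (hx : x ≠ 0) (a b : ℤ) :
    (1 - q ^ (a + b + 1)) * ∑' j : ℤ, th q x j * (rPoch q (a + 1 - j) * rPoch q (b + j))
      = (1 - q ^ a * x) * ∑' j : ℤ, th q x j * (rPoch q (a - j) * rPoch q (b + j)) := by
  have hS := summable_mul_rPoch hq (summable_th hq0 hq x hx)
  have e1 : ∑' j : ℤ, th q x j * (q ^ (a + 1 - j) * rPoch q (a + 1 - j) * rPoch q (b - 1 + j))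
      = -(q ^ a * x) * ∑' j : ℤ, th q x j * (rPoch q (a - j) * rPoch q (b + j)) := by
    rw [← (Equiv.addRight (1 : ℤ)).tsum_eq, ← tsum_mul_left]
    refine tsum_congr fun j => ?_
    simp only [Equiv.coe_addRight]
    rw [th_succ hq0 hx, show a + 1 - (j + 1) = a - j by ring,
      show b - 1 + (j + 1) = b + j by ring, zpow_sub₀ hq0]
    have := zpow_ne_zero j hq0
    field_simp
  have e2 : ∀ j : ℤ, (1 - q ^ (a + b + 1)) * (th q x j * (rPoch q (a + 1 - j) * rPoch q (b + j)))
      = th q x j * (rPoch q (a - j) * rPoch q (b + j))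
        + th q x j * (q ^ (a + 1 - j) * rPoch q (a + 1 - j) * rPoch q (b - 1 + j)) := by
    intro j
    have r1 := rPoch_rec hq (a + 1 - j)
    have r2 := rPoch_rec hq (b + j)
    rw [show a + 1 - j - 1 = a - j by ring] at r1
    rw [show b + j - 1 = b - 1 + j by ring] at r2
    rw [← r1, ← r2, show a + b + 1 = (a + 1 - j) + (b + j) by ring, zpow_add₀ hq0]
    ring
  have s1 : Summable fun j : ℤ =>
      th q x j * (q ^ (a + 1 - j) * rPoch q (a + 1 - j) * rPoch q (b - 1 + j)) := by
    refine ((hS (a + 1) (b - 1)).sub (hS a (b - 1))).congr fun j => ?_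
    have r1 := rPoch_rec hq (a + 1 - j)
    rw [show a + 1 - j - 1 = a - j by ring] at r1
    rw [← r1]; ring
  rw [← tsum_mul_left, tsum_congr e2, (hS a b).tsum_add s1, e1]
  ring

/-- The finite form of the Jacobi triple product. -/
theorem tsum_finite_jtp {q : ℂ} (hq0 : q ≠ 0) (hq : ‖q‖ < 1) {x : ℂ} (hx : x ≠ 0) (m n : ℕ) :
    ∑' j : ℤ, th q x j * (rPoch q (m - j) * rPoch q (n + j))
      = qPoch x q m * qPoch (q / x) q n / qPoch q q (m + n) := by
  have key : ∀ {y : ℂ}, y ≠ 0 → ∀ m n : ℕ,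
      ∑' j : ℤ, th q y j * (rPoch q ((m + 1 : ℕ) - j) * rPoch q (n + j))
      = (1 - q ^ m * y) / (1 - q ^ (m + n + 1)) *
        ∑' j : ℤ, th q y j * (rPoch q (m - j) * rPoch q (n + j)) := by
    intro y hy m n
    have h1 : 1 - q ^ (m + n + 1) ≠ 0 := one_sub_pow_ne_zero hq (Nat.succ_pos _)
    have h2 := tsum_jtp_step hq0 hq hy m n
    have h3 : q ^ ((m : ℤ) + n + 1) = q ^ (m + n + 1) := by
      rw [← zpow_natCast]; push_cast; rfl
    rw [h3, zpow_natCast] at h2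
    rw [div_mul_eq_mul_div, eq_div_iff h1, ← h2]
    push_cast
    ring
  -- The substitution `j ↦ -j` exchanges the two lower indices, so the step in `n` follows from
  -- the step in `m`.
  have flip : ∀ {y : ℂ} (_ : y ≠ 0) (a b : ℤ),
      ∑' j : ℤ, th q y j * (rPoch q (a - j) * rPoch q (b + j))
      = ∑' j : ℤ, th q (q / y) j * (rPoch q (b - j) * rPoch q (a + j)) := by
    intro y _ a b
    rw [← (Equiv.neg ℤ).tsum_eq]
    refine tsum_congr fun j => ?_
    simp only [Equiv.neg_apply]
    rw [th_neg hq0, sub_neg_eq_add, ← sub_eq_add_neg]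
    ring
  have hxq : q / x ≠ 0 := div_ne_zero hq0 hx
  induction n with
  | zero =>
    induction m with
    | zero =>
      rw [tsum_eq_single 0]
      · simp [th_zero, rPoch_zero]
      · intro j hj
        rcases lt_or_gt_of_ne hj with h | h
        · simp [rPoch_of_neg q h]
        · simp [rPoch_of_neg q (neg_lt_zero.2 h)]
    | succ m ih =>
      have h1 : 1 - q ^ (m + 1) ≠ 0 := one_sub_pow_ne_zero hq (Nat.succ_pos _)
      have h2 := qPoch_self_ne_zero hq m
      rw [key hx m 0, ih]
      simp only [add_zero, qPoch_zero, qPoch_succ, ← pow_succ]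
      field_simp
  | succ n ih =>
    have h1 : 1 - q ^ (m + n + 1) ≠ 0 := one_sub_pow_ne_zero hq (Nat.succ_pos _)
    have h2 := qPoch_self_ne_zero hq (m + n)
    rw [flip hx, key hxq n m, flip hxq, div_div_cancel₀ hq0, ih, ← add_assoc, qPoch_succ,
      qPoch_succ, ← pow_succ, add_comm n m]
    field_simp

/-- The theta function `(x; p)_∞ (p/x; p)_∞ (p; p)_∞`. -/
def jac (x p : ℂ) : ℂ := qInf x p * qInf (p / x) p * qInf p p

/-- The Jacobi triple product. -/
theorem tsum_th {q : ℂ} (hq0 : q ≠ 0) (hq : ‖q‖ < 1) {x : ℂ} (hx : x ≠ 0) :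
    ∑' j : ℤ, th q x j = jac x q := by
  have hJ := qInf_ne_zero_of_lt hq hq
  obtain ⟨C, hC0, hC⟩ := exists_bound_rPoch hq
  have h1 : Tendsto (fun n : ℕ => ∑' j : ℤ, th q x j * (rPoch q (n - j) * rPoch q (n + j))) atTop
      (𝓝 (∑' j : ℤ, th q x j * (1 / qInf q q * (1 / qInf q q)))) := by
    refine tendsto_tsum_of_dominated_convergence (bound := fun j => ‖th q x j‖ * (C * C))
      ((summable_th hq0 hq x hx).norm.mul_right _) (fun j => ?_) (.of_forall fun n j => ?_)
    · exact ((tendsto_rPoch_add hq (-j)).mul (tendsto_rPoch_add hq j)).const_mul _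
    · rw [norm_mul, norm_mul]
      have h1 := hC (n - j)
      have h2 := hC (n + j)
      gcongr
  have hnn : Tendsto (fun n : ℕ => n + n) atTop atTop :=
    tendsto_atTop_mono (fun n => Nat.le_add_left n n) tendsto_id
  have h2 : Tendsto (fun n : ℕ => qPoch x q n * qPoch (q / x) q n / qPoch q q (n + n)) atTop
      (𝓝 (qInf x q * qInf (q / x) q / qInf q q)) :=
    ((tendsto_qPoch hq x).mul (tendsto_qPoch hq _)).div
      ((tendsto_qPoch hq q).comp hnn) hJ
  have h3 := tendsto_nhds_unique h1 (h2.congr fun n => (tsum_finite_jtp hq0 hq hx n n).symm)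
  rw [tsum_mul_right] at h3
  rw [jac]
  field_simp at h3
  rw [h3]
  ring

/-! ### Appell sums and partial fractions -/

/-- The Appell sum `∑_r (-1)^r p^{r(r-1)/2} z^r / (1 - p^r w)`. -/
def appell (p z w : ℂ) : ℂ := ∑' r : ℤ, th p z r / (1 - p ^ r * w)

/-- Uniform bound for the reciprocals of `1 - p^r w`, which tend to `1` as `r → ∞` and to `0` as
`r → -∞`. If a factor vanishes, its inverse is `0` by convention, and the bound still holds. -/
theorem exists_bound_inv_one_sub {p : ℂ} (hp : p ≠ 0) (hp1 : ‖p‖ < 1) (w : ℂ) :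
    ∃ C : ℝ, ∀ r : ℤ, ‖(1 - p ^ r * w)⁻¹‖ ≤ C := by
  have h0 := tendsto_pow_zero hp1
  rcases eq_or_ne w 0 with rfl | hw
  · exact ⟨1, fun r => by simp⟩
  have h1 : Tendsto (fun n : ℕ => ‖(1 - p ^ n * w)⁻¹‖) atTop (𝓝 ‖(1 - 0 * w)⁻¹‖) :=
    (((h0.mul_const w).const_sub 1).inv₀ (by simp)).norm
  have h2 : Tendsto (fun n : ℕ => ‖p ^ n * (p ^ n - w)⁻¹‖) atTop (𝓝 ‖0 * (0 - w)⁻¹‖) :=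
    (h0.mul ((h0.sub_const w).inv₀ (by simpa))).norm
  obtain ⟨C, hC⟩ := h1.bddAbove_range
  obtain ⟨D, hD⟩ := h2.bddAbove_range
  refine ⟨max C D, fun r => ?_⟩
  obtain ⟨n, rfl | rfl⟩ := r.eq_nat_or_neg
  · rw [zpow_natCast]; exact (hC ⟨n, rfl⟩).trans (le_max_left _ _)
  · refine le_trans (le_of_eq ?_) ((hD ⟨n, rfl⟩).trans (le_max_right _ _))
    have h3 : 1 - p ^ (-(n : ℤ)) * w = (p ^ n)⁻¹ * (p ^ n - w) := by
      have := pow_ne_zero n hp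
      rw [zpow_neg, zpow_natCast]; field_simp
    rw [h3, mul_inv, inv_inv]

theorem summable_appell {p z : ℂ} (hp : p ≠ 0) (hp1 : ‖p‖ < 1) (hz : z ≠ 0) (w : ℂ) :
    Summable fun r : ℤ => th p z r / (1 - p ^ r * w) := by
  obtain ⟨C, hC⟩ := exists_bound_inv_one_sub hp hp1 w
  refine Summable.of_norm_bounded ((summable_th hp hp1 z hz).norm.mul_right C) fun r => ?_
  rw [div_eq_mul_inv, norm_mul]
  exact mul_le_mul_of_nonneg_left (hC r) (norm_nonneg _)

theorem ne_zero_of_zpow_mul_ne_one {p x : ℂ} (hx : x ≠ 0) (hp : p ≠ 0) (r : ℤ)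
    (h : p ^ r * x ≠ 1) : 1 - p ^ (-r) / x ≠ 0 := by
  intro h1
  apply h
  rw [sub_eq_zero, zpow_neg] at h1
  have := zpow_ne_zero r hp
  field_simp at h1
  exact h1

/-- Partial fractions of the reciprocal of `(x; p)_{a+1} (p/x; p)_b`. -/
theorem tsum_partial_fractions {p x : ℂ} (hp : p ≠ 0) (hp1 : ‖p‖ < 1) (hx : x ≠ 0)
    (h : ∀ r : ℤ, p ^ r * x ≠ 1) (a b : ℕ) :
    ∑' r : ℤ, th p p r / (1 - p ^ r * x) * (rPoch p (a - r) * rPoch p (b + r))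
      = 1 / (qPoch x p (a + 1) * qPoch (p / x) p b) := by
  have hS := fun a b : ℤ => summable_mul_rPoch hp1 (summable_appell hp hp1 hp x) a b
  have hz : ∀ r : ℤ, 1 - p ^ r * x ≠ 0 := fun r => sub_ne_zero.2 (h r).symm
  -- Raising `a` by one: the defect is a multiple of the finite triple product at `x = 1`, which
  -- vanishes.
  have hA : ∀ a b : ℕ, (1 - p ^ (a + 1) * x) *
      ∑' r : ℤ, th p p r / (1 - p ^ r * x) * (rPoch p ((a + 1 : ℕ) - r) * rPoch p (b + r))
      = ∑' r : ℤ, th p p r / (1 - p ^ r * x) * (rPoch p (a - r) * rPoch p (b + r)) := by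
    intro a b
    have h1 := tsum_finite_jtp hp hp1 one_ne_zero (a + 1) b
    have h2 : qPoch 1 p (a + 1) = 0 := by rw [qPoch_succ']; simp
    have h3 := summable_mul_rPoch hp1 (summable_th hp hp1 1 one_ne_zero) ((a + 1 : ℕ) : ℤ) b
    rw [h2, zero_mul, zero_div] at h1
    rw [← tsum_mul_left, ← add_zero (∑' r : ℤ, _ * (rPoch p (a - r) * _)),
      ← mul_zero (p ^ (a + 1)), ← h1, ← tsum_mul_left, ← (hS a b).tsum_add (h3.mul_left _)]
    refine tsum_congr fun r => ?_
    have r1 := rPoch_rec hp1 ((a + 1 : ℕ) - r)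
    rw [show ((a + 1 : ℕ) : ℤ) - r - 1 = a - r by push_cast; ring, zpow_sub₀ hp, zpow_natCast] at r1
    rw [← r1]
    have h4 : th p p r = p ^ r * th p 1 r := by rw [← th_mul, one_mul]
    have h5 := hz r
    have h6 := zpow_ne_zero r hp
    rw [h4, div_mul_eq_mul_div, div_mul_eq_mul_div, ← mul_div_assoc, div_add' _ _ _ h5]
    congr 1
    field_simp
    ring
  -- Raising `b` by one: the defect is a multiple of the finite triple product at `x = p`, which
  -- vanishes.
  have hB : ∀ a b : ℕ, (1 - p ^ (b + 1) / x) *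
      ∑' r : ℤ, th p p r / (1 - p ^ r * x) * (rPoch p (a - r) * rPoch p ((b + 1 : ℕ) + r))
      = ∑' r : ℤ, th p p r / (1 - p ^ r * x) * (rPoch p (a - r) * rPoch p (b + r)) := by
    intro a b
    have h1 := tsum_finite_jtp hp hp1 hp a (b + 1)
    have h2 : qPoch (p / p) p (b + 1) = 0 := by rw [qPoch_succ', div_self hp]; simp
    have h3 := summable_mul_rPoch hp1 (summable_th hp hp1 p hp) a ((b + 1 : ℕ) : ℤ)
    rw [h2, mul_zero, zero_div] at h1
    rw [← tsum_mul_left, ← add_zero (∑' r : ℤ, _ * (_ * rPoch p (b + r))),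
      ← mul_zero (-(p ^ (b + 1) / x)), ← h1, ← tsum_mul_left,
      ← (hS a b).tsum_add (h3.mul_left _)]
    refine tsum_congr fun r => ?_
    have r1 := rPoch_rec hp1 ((b + 1 : ℕ) + r)
    rw [show ((b + 1 : ℕ) : ℤ) + r - 1 = b + r by push_cast; ring, zpow_add₀ hp, zpow_natCast] at r1
    rw [← r1]
    rw [div_mul_eq_mul_div, div_mul_eq_mul_div, ← mul_div_assoc, div_add' _ _ _ (hz r)]
    congr 1
    field_simp
    ring
  have hxa : ∀ n : ℕ, 1 - p ^ n * x ≠ 0 := fun n => by simpa using hz n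
  have hxb : ∀ n : ℕ, 1 - p ^ n * (p / x) ≠ 0 := fun n => by
    have := ne_zero_of_zpow_mul_ne_one hx hp (-(n + 1 : ℕ)) (h _)
    rw [neg_neg, zpow_natCast, pow_succ, mul_div_assoc] at this
    exact this
  have hqa : ∀ n : ℕ, qPoch x p n ≠ 0 := qPoch_ne_zero fun i => by simpa using h i
  have hqb : ∀ n : ℕ, qPoch (p / x) p n ≠ 0 :=
    qPoch_ne_zero fun i => (sub_ne_zero.1 (hxb i)).symm
  induction b with
  | zero =>
    induction a with
    | zero =>
      rw [tsum_eq_single 0]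
      · simp [th_zero, rPoch_zero, qPoch_succ]
      · intro j hj
        rcases lt_or_gt_of_ne hj with h | h
        · simp [rPoch_of_neg p h]
        · simp [rPoch_of_neg p (neg_lt_zero.2 h)]
    | succ a ih =>
      have h1 := hA a 0
      rw [ih] at h1
      rw [← mul_right_inj' (hxa (a + 1)), h1, qPoch_succ x p (a + 1)]
      have := hxa (a + 1)
      have := hqa (a + 1)
      generalize 1 - p ^ (a + 1) * x = u at *
      field_simp
  | succ b ih =>
    have h1 := hB a b
    have h2 := hxb b
    have h3 := hqa (a + 1)
    have h4 := hqb b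
    rw [pow_succ, mul_div_assoc, ih] at h1
    rw [← mul_right_inj' h2, h1, qPoch_succ _ p b]
    generalize 1 - p ^ b * (p / x) = u at *
    field_simp

/-- Interchanging summations after inserting the partial fractions. The inner sum on the right is
the sum over a Bailey pair; for the weights `W` used below it is evaluated in closed form. -/
theorem tsum_bailey {p x : ℂ} (hp : p ≠ 0) (hp1 : ‖p‖ < 1) (hx : x ≠ 0)
    (h : ∀ r : ℤ, p ^ r * x ≠ 1) {W : ℕ → ℂ} (hW : Summable W) (s : ℕ) :
    ∑' n : ℕ, W n / (qPoch x p (n + 1) * qPoch (p / x) p (n + s))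
      = ∑' r : ℤ, th p p r / (1 - p ^ r * x) *
          ∑' n : ℕ, W n * (rPoch p (n - r) * rPoch p (n + s + r)) := by
  obtain ⟨C, hC0, hC⟩ := exists_bound_rPoch hp1
  calc _ = ∑' n : ℕ, ∑' r : ℤ, W n *
        (th p p r / (1 - p ^ r * x) * (rPoch p (n - r) * rPoch p (n + s + r))) := by
        refine tsum_congr fun n => ?_
        have h1 := tsum_partial_fractions hp hp1 hx h n (n + s)
        push_cast at h1
        rw [tsum_mul_left, h1, mul_one_div]
    _ = ∑' r : ℤ, ∑' n : ℕ, W n *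
        (th p p r / (1 - p ^ r * x) * (rPoch p (n - r) * rPoch p (n + s + r))) := by
        refine tsum_comm_of_norm_le_mul (A := fun n => ‖W n‖)
          (B := fun r => ‖th p p r / (1 - p ^ r * x)‖ * (C * C)) hW.norm
          ((summable_appell hp hp1 hp x).norm.mul_right _) (fun _ => norm_nonneg _)
          (fun _ => by positivity) fun n r => ?_
        rw [norm_mul, norm_mul _ (rPoch _ _ * _), norm_mul (rPoch _ _)]
        have h1 := hC (n - r)
        have h2 := hC (n + s + r)
        gcongr
    _ = _ := by
        refine tsum_congr fun r => ?_
        rw [← tsum_mul_left]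
        exact tsum_congr fun n => by ring

/-- A sum over `n ≥ 0` supported on `n ≥ k` is a sum over the shifted index. -/
theorem tsum_nat_shift {f : ℕ → ℂ} (k : ℕ) (h : ∀ n < k, f n = 0) :
    ∑' n, f n = ∑' m, f (m + k) := by
  have hinj : Function.Injective fun m : ℕ => m + k := add_left_injective k
  refine (hinj.tsum_eq fun n hn => ?_).symm
  have : k ≤ n := by
    by_contra hlt
    exact hn (h n (by omega))
  exact ⟨n - k, by simp; omega⟩

/-- The inner sum of a Bailey pair, summed by the confluent `q`-Gauss sum. -/
theorem tsum_gauss_pair {p a : ℂ} (hp1 : ‖p‖ < 1) (g : ℂ) (k s : ℕ)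
    (hg : p ^ k * a * g = p ^ (2 * k + s + 1)) (W : ℕ → ℂ)
    (hW : ∀ m, W (m + k) = W k / qPoch a p k * qPoch a p (m + k) *
      ((-1) ^ m * p ^ m.choose 2 * g ^ m)) :
    ∑' n : ℕ, W n * (rPoch p (n - k) * rPoch p (n + s + k))
      = W k * qInf g p / qInf p p := by
  rw [tsum_nat_shift k fun n hn => by rw [rPoch_of_neg p (by lia)]; ring]
  have h0 := qPoch_self_ne_zero hp1
  have hc : ∀ i : ℕ, p ^ i * (p ^ k * a * g) ≠ 1 := fun i => by
    rw [hg]; exact pow_mul_ne_one hp1 (norm_pow_lt_one hp1 (by omega)) i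
  have h1 := tsum_qGauss hp1 (p ^ k * a) g hc
  have h2 := qInf_split hp1 p (2 * k + s)
  rw [← pow_succ, ← hg] at h2
  have h3 : qInf (p ^ k * a * g) p ≠ 0 := qInf_ne_zero hp1 hc
  have h4 := h0 (2 * k + s)
  by_cases hWk : W k = 0
  · rw [hWk, zero_mul, zero_div]
    simp only [hW, hWk]
    simp
  have ha : qPoch a p k ≠ 0 := by
    intro ha
    have := hW 0
    simp [ha] at this
    exact hWk this
  have e : ∀ m : ℕ, W (m + k) * (rPoch p ((m + k : ℕ) - k) * rPoch p ((m + k : ℕ) + s + k))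
      = W k / qPoch p p (2 * k + s) * (qPoch (p ^ k * a) p m * ((-1) ^ m * p ^ m.choose 2 * g ^ m)
        / (qPoch p p m * qPoch (p ^ k * a * g) p m)) := by
    intro m
    rw [show ((m + k : ℕ) : ℤ) - k = m by push_cast; ring,
      show ((m + k : ℕ) : ℤ) + s + k = (2 * k + s + m : ℕ) by push_cast; ring,
      rPoch_natCast, rPoch_natCast, qPoch_add p p (2 * k + s) m, ← pow_succ, ← hg, hW,
      add_comm m k, qPoch_add a p k m]
    have h5 := h0 m
    have h6 := qPoch_ne_zero hc m
    field_simp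
  rw [tsum_congr e, tsum_mul_left, h1, h2]
  field_simp

/-! ### Bilateral series for the mock theta functions of orders two and eight -/

theorem zpow_ne_one {q : ℂ} (hq : ‖q‖ < 1) {k : ℤ} (hk : k ≠ 0) : q ^ k ≠ 1 := by
  intro h
  have h1 : ‖q‖ ^ k = 1 := by rw [← norm_zpow, h, norm_one]
  rcases (zpow_eq_one_iff_of_ne_zero₀ hk).1 h1 with h | ⟨h, -⟩
  · linarith
  · linarith [norm_nonneg q]

/-- A nontrivial root of unity does not lie on the spiral `p^ℤ`. -/
theorem zpow_mul_ne_one_of_pow_eq_one {p x : ℂ} (hp1 : ‖p‖ < 1) {k : ℕ} (hk : k ≠ 0)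
    (hx : x ^ k = 1) (hx1 : x ≠ 1) (r : ℤ) : p ^ r * x ≠ 1 := by
  intro h
  have h1 : p ^ (r * k) = 1 := by
    rw [zpow_mul, zpow_natCast, ← mul_one ((p ^ r) ^ k), ← hx, ← mul_pow, h, one_pow, hx]
  have h2 : r = 0 := by
    by_contra hr
    exact zpow_ne_one hp1 (mul_ne_zero hr (by exact_mod_cast hk)) h1
  rw [h2, zpow_zero, one_mul] at h
  exact hx1 h

theorem sq_zpow (d : ℂ) (r : ℤ) : (d ^ 2) ^ r = d ^ (2 * r) := by
  rw [← zpow_natCast d 2, ← zpow_mul]; rfl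

theorem te_pow_four (q : ℂ) (r : ℤ) : te (q ^ 4) r = q ^ (2 * (r * (r - 1))) := by
  rw [show q ^ 4 = (q ^ 2) ^ 2 by ring, te_sq, sq_zpow]

theorem prod_mul_pow_sub (q c : ℂ) {b : ℂ} (hb : b ≠ 0) (n : ℕ) :
    ∏ i ∈ Finset.range n, (c * q ^ i - b) = (-b) ^ n * qPoch (c / b) q n := by
  induction n with
  | zero => simp
  | succ n ih =>
    rw [Finset.prod_range_succ, ih, qPoch_succ]
    field_simp
    ring

theorem neg_one_zpow_sq (r : ℤ) : (-1 : ℂ) ^ r * (-1) ^ r = 1 := by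
  rw [← mul_zpow]; simp

theorem two_mul_choose_two_add (m : ℕ) : 2 * m.choose 2 + m = m ^ 2 := by
  induction m with
  | zero => rfl
  | succ m ih => rw [choose_two_succ]; nlinarith

theorem sq_pow_choose_two (d : ℂ) (m : ℕ) : (d ^ 2) ^ m.choose 2 * d ^ m = d ^ (m ^ 2) := by
  rw [← pow_mul, ← pow_add, two_mul_choose_two_add]

/-- A sum that depends on the pair `{n - r, n + s + r}` only through its two members. -/
theorem tsum_rPoch_symm (p : ℂ) (W : ℕ → ℂ) (s : ℕ) (r : ℤ) :
    ∑' n : ℕ, W n * (rPoch p (n - r) * rPoch p (n + s + r))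
      = ∑' n : ℕ, W n * (rPoch p (n - (-s - r)) * rPoch p (n + s + (-s - r))) := by
  refine tsum_congr fun n => ?_
  rw [show (n : ℤ) - (-s - r) = n + s + r by ring, show (n : ℤ) + s + (-s - r) = n - r by ring,
    mul_comm (rPoch p _)]

theorem summable_sq_pow_mul_qPoch {q : ℂ} (hq : ‖q‖ < 1) (x p : ℂ) (hp : ‖p‖ < 1) (a : ℕ) :
    Summable fun n : ℕ => q ^ (n ^ 2 + a * n) * qPoch x p n := by
  refine summable_of_ratio (l := 0 * (1 - 0 * x)) (by simp)
    (g := fun n => q ^ (2 * n + (1 + a)) * (1 - p ^ n * x))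
    ((tendsto_pow_affine hq 2 _ two_pos).mul
      (((tendsto_pow_zero hp).mul_const x).const_sub 1)) fun n => ?_
  rw [qPoch_succ]
  ring

/-- The sum `∑ (-1)^n d^{n²} (d; d²)_n / ((x; d²)_{n+1} (d²/x; d²)_n)`. -/
theorem tsum_pair_zero {d : ℂ} (hd : d ≠ 0) (hd1 : ‖d‖ < 1) {x : ℂ} (hx : x ≠ 0)
    (h : ∀ r : ℤ, (d ^ 2) ^ r * x ≠ 1) :
    ∑' n : ℕ, (-1) ^ n * d ^ (n ^ 2) * qPoch d (d ^ 2) n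
        / (qPoch x (d ^ 2) (n + 1) * qPoch (d ^ 2 / x) (d ^ 2) n)
      = qInf d (d ^ 2) / qInf (d ^ 2) (d ^ 2) *
        ∑' r : ℤ, d ^ (2 * r ^ 2 + r) / (1 - d ^ (2 * r) * x) := by
  have hp : d ^ 2 ≠ 0 := pow_ne_zero 2 hd
  have hp1 := norm_pow_lt_one hd1 two_pos
  have hs : Summable fun n : ℕ => (-1) ^ n * d ^ (n ^ 2) * qPoch d (d ^ 2) n := by
    refine (summable_sq_pow_mul_qPoch hd1 d (d ^ 2) hp1 0).norm.of_norm_bounded fun n => ?_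
    simp
  have h1 := tsum_bailey hp hp1 hx h hs 0
  simp only [add_zero, Nat.cast_zero] at h1
  rw [h1, ← tsum_mul_left]
  refine tsum_congr fun r => ?_
  -- The inner sum at `r = k ≥ 0`, by the confluent `q`-Gauss sum.
  have hnat : ∀ k : ℕ, ∑' n : ℕ, ((-1) ^ n * d ^ (n ^ 2) * qPoch d (d ^ 2) n) *
      (rPoch (d ^ 2) (n - k) * rPoch (d ^ 2) (n + k))
      = (-1) ^ (k : ℤ) * d ^ ((k : ℤ) ^ 2) * (qInf d (d ^ 2) / qInf (d ^ 2) (d ^ 2)) := by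
    intro k
    have h0 := qPoch_ne_zero_of_lt hp1 hd1 k
    have h2 := tsum_gauss_pair hp1 (a := d) (d ^ (2 * k + 1)) k 0 (by ring)
      (fun n => (-1) ^ n * d ^ (n ^ 2) * qPoch d (d ^ 2) n) fun m => by
        have e : d ^ ((m + k) ^ 2) = d ^ (k ^ 2) * ((d ^ 2) ^ m.choose 2 * (d ^ (2 * k + 1)) ^ m) := by
          rw [show (m + k) ^ 2 = m ^ 2 + (k ^ 2 + 2 * k * m) by ring, pow_add, ← sq_pow_choose_two]
          ring
        simp only [e]
        field_simp
        ring
    simp only [Nat.cast_zero, add_zero] at h2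
    rw [h2, qInf_split hp1 d k, ← pow_mul, ← pow_succ, zpow_natCast]
    norm_cast
    ring
  have hint : ∑' n : ℕ, ((-1) ^ n * d ^ (n ^ 2) * qPoch d (d ^ 2) n) *
      (rPoch (d ^ 2) (n - r) * rPoch (d ^ 2) (n + r))
      = (-1) ^ r * d ^ (r ^ 2) * (qInf d (d ^ 2) / qInf (d ^ 2) (d ^ 2)) := by
    obtain ⟨k, rfl | rfl⟩ := r.eq_nat_or_neg
    · exact hnat k
    · have h3 := tsum_rPoch_symm (d ^ 2) (fun n => (-1) ^ n * d ^ (n ^ 2) * qPoch d (d ^ 2) n) 0 (-k)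
      simp only [Nat.cast_zero, add_zero, neg_zero, zero_sub, neg_neg] at h3
      rw [h3, hnat, neg_sq, zpow_neg, ← inv_zpow, inv_neg_one]
  rw [hint, th, te_sq, sq_zpow]
  have e2 : d ^ (2 * r ^ 2 + r) = d ^ (r * (r - 1)) * d ^ (2 * r) * d ^ (r ^ 2) := by
    rw [← zpow_add₀ hd, ← zpow_add₀ hd]; congr 1; ring
  rw [e2]
  linear_combination (d ^ (r * (r - 1)) * d ^ (2 * r) * d ^ (r ^ 2) / (1 - d ^ (2 * r) * x)
    * (qInf d (d ^ 2) / qInf (d ^ 2) (d ^ 2))) * neg_one_zpow_sq r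

/-- The identity `tsum_pair_zero` at `x = -1`. -/
theorem mu2_eq {q : ℂ} (hq0 : q ≠ 0) (hq : ‖q‖ < 1) :
    mu2 q = 2 * (qInf q (q ^ 2) / qInf (q ^ 2) (q ^ 2)) *
      ∑' r : ℤ, q ^ (2 * r ^ 2 + r) / (1 + q ^ (2 * r)) := by
  have h1 := tsum_pair_zero hq0 hq (x := -1) (by norm_num)
    (zpow_mul_ne_one_of_pow_eq_one (norm_pow_lt_one hq two_pos) two_ne_zero
      (by norm_num) (by norm_num))
  simp only [mul_neg_one, sub_neg_eq_add] at h1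
  rw [mul_assoc, ← h1, mu2, ← tsum_mul_left]
  refine tsum_congr fun n => ?_
  rw [mu2Term, qPoch_succ', div_neg, div_one, mul_neg_one, sub_neg_eq_add, one_add_one_eq_two]
  field_simp

/-- The identity `tsum_pair_zero` at `x = i`, with `-q` in place of `q`. -/
theorem U08_eq {q : ℂ} (hq0 : q ≠ 0) (hq : ‖q‖ < 1) :
    U08 q = 2 * (qInf (-q) (q ^ 2) / qInf (q ^ 2) (q ^ 2)) * appell (q ^ 4) (q ^ 3) (-1) := by
  have hI : (Complex.I : ℂ) ≠ 1 := fun h => by simpa using congrArg Complex.re h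
  have hI1 : 1 - Complex.I ≠ 0 := sub_ne_zero.2 hI.symm
  have h1 := tsum_pair_zero (neg_ne_zero.2 hq0) (by simpa) (x := Complex.I) Complex.I_ne_zero
    (zpow_mul_ne_one_of_pow_eq_one (norm_pow_lt_one (by simpa) two_pos) four_ne_zero Complex.I_pow_four hI)
  rw [neg_sq] at h1
  -- The two factors with `i` and `-i` multiply to `(-q^4; q^4)_n`.
  have h2 : U08 q = (1 - Complex.I) * ∑' n : ℕ, (-1) ^ n * (-q) ^ (n ^ 2) * qPoch (-q) (q ^ 2) n
        / (qPoch Complex.I (q ^ 2) (n + 1) * qPoch (q ^ 2 / Complex.I) (q ^ 2) n) := by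
    rw [U08, ← tsum_mul_left]
    refine tsum_congr fun n => ?_
    have e1 : qPoch (q ^ 2 * Complex.I) (q ^ 2) n * qPoch (q ^ 2 / Complex.I) (q ^ 2) n
        = qPoch (-q ^ 4) (q ^ 4) n := by
      rw [qPoch, qPoch, qPoch, ← Finset.prod_mul_distrib]
      refine Finset.prod_congr rfl fun i _ => ?_
      rw [Complex.div_I]
      linear_combination -(q ^ 2) ^ (2 * i) * q ^ 4 * Complex.I_sq
    have e2 : (-1) ^ n * (-q) ^ (n ^ 2) = q ^ (n ^ 2) := by
      rw [neg_pow q, ← mul_assoc, ← pow_add, show n + n ^ 2 = n * (n + 1) by ring,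
        (Nat.even_mul_succ_self n).neg_one_pow, one_mul]
    rw [U08Term, e2, qPoch_succ', mul_assoc, e1]
    field_simp
  have hp4 : q ^ 4 ≠ 0 := pow_ne_zero 4 hq0
  have hp41 := norm_pow_lt_one hq four_pos
  have hs := summable_appell hp4 hp41 (pow_ne_zero 3 hq0) (-1)
  have hs' := (Equiv.neg ℤ).summable_iff.2 hs
  -- With `y = q^{2r}`, write `1 / (1 - i y) = (1 + i y) / (1 + y²)`; the part with the factor `i
  -- y` is the other part at `-r`.
  have h3 : ∑' r : ℤ, (-q) ^ (2 * r ^ 2 + r) / (1 - (-q) ^ (2 * r) * Complex.I)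
      = (1 + Complex.I) * appell (q ^ 4) (q ^ 3) (-1) := by
    have e : ∀ r : ℤ, (-q) ^ (2 * r ^ 2 + r) / (1 - (-q) ^ (2 * r) * Complex.I)
        = th (q ^ 4) (q ^ 3) r / (1 - (q ^ 4) ^ r * (-1))
          + Complex.I * ((fun r : ℤ => th (q ^ 4) (q ^ 3) r / (1 - (q ^ 4) ^ r * (-1))) ∘
            (Equiv.neg ℤ)) r := by
      intro r
      have hv : 1 + q ^ (2 * r) * q ^ (2 * r) ≠ 0 := by
        have h4 := zpow_mul_ne_one_of_pow_eq_one hp41 two_ne_zero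
          (x := -1) (by norm_num) (by norm_num) r
        rw [← zpow_add₀ hq0, show 2 * r + 2 * r = (4 : ℕ) * r by push_cast; ring, zpow_mul,
          zpow_natCast]
        intro h5
        exact h4 (by linear_combination -h5)
      have hv1 : 1 - q ^ (2 * r) * Complex.I ≠ 0 := by
        intro h5
        apply hv
        linear_combination (1 + q ^ (2 * r) * Complex.I) * h5
          + q ^ (2 * r) * q ^ (2 * r) * Complex.I_sq
      have hv0 : q ^ (2 * r) ≠ 0 := zpow_ne_zero _ hq0
      have e4 : ∀ s : ℤ, (q ^ 4) ^ s = q ^ (2 * s) * q ^ (2 * s) := fun s => by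
        rw [← zpow_add₀ hq0, ← zpow_natCast q 4, ← zpow_mul]; congr 1; push_cast; ring
      have e5 : (q ^ 3) ^ r = q ^ (3 * r) := by rw [← zpow_natCast q 3, ← zpow_mul]; rfl
      have e6 : (q ^ 3) ^ (-r) = q ^ (-(3 * r)) := by
        rw [← zpow_natCast q 3, ← zpow_mul]; congr 1; push_cast; ring
      have e7 : (-q) ^ (2 * r) = q ^ (2 * r) := (even_two_mul r).neg_zpow q
      have e8 : (-q) ^ (2 * r ^ 2 + r) = (-1) ^ r * q ^ (2 * r ^ 2 + r) := by
        rw [← neg_one_mul, mul_zpow]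
        congr 1
        rw [zpow_add₀ (by norm_num), (even_two_mul (r ^ 2)).neg_one_zpow, one_mul]
      have e9 : q ^ (2 * (r * (r - 1))) * q ^ (3 * r) = q ^ (2 * r ^ 2 + r) := by
        rw [← zpow_add₀ hq0]; congr 1; ring
      have e10 : q ^ (2 * (-r * (-r - 1))) * q ^ (-(3 * r)) * (q ^ (2 * r) * q ^ (2 * r))
          = q ^ (2 * r ^ 2 + r) * q ^ (2 * r) := by
        rw [← zpow_add₀ hq0, ← zpow_add₀ hq0, ← zpow_add₀ hq0, ← zpow_add₀ hq0]; congr 1; ring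
      have e11 : (-1 : ℂ) ^ (-r) = (-1) ^ r := by rw [zpow_neg, ← inv_zpow, inv_neg_one]
      have e12 : q ^ (2 * -r) = (q ^ (2 * r))⁻¹ := by rw [← zpow_neg]; congr 1; ring
      simp only [Function.comp, Equiv.neg_apply, th, te_pow_four, e4, e5, e6, e7, e8, e11, e12]
      rw [mul_assoc _ (q ^ (2 * (r * (r - 1)))), e9, mul_assoc _ (q ^ (2 * (-r * (-r - 1))))]
      have e13 : (-1) ^ r * (q ^ (2 * (-r * (-r - 1))) * q ^ (-(3 * r))) /
          (1 - (q ^ (2 * r))⁻¹ * (q ^ (2 * r))⁻¹ * -1)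
          = (-1) ^ r * (q ^ (2 * r ^ 2 + r) * q ^ (2 * r)) / (1 + q ^ (2 * r) * q ^ (2 * r)) := by
        rw [← e10, div_eq_div_iff _ hv]
        · field_simp
          ring
        · intro h5
          apply hv
          field_simp at h5
          linear_combination h5
      rw [e13, mul_neg_one, sub_neg_eq_add, mul_div_assoc', ← add_div, div_eq_div_iff hv1 hv]
      linear_combination (-1) ^ r * q ^ (2 * r ^ 2 + r) * q ^ (2 * r) * q ^ (2 * r) * Complex.I_sq
    have h4 := (Equiv.neg ℤ).tsum_eq fun r : ℤ => th (q ^ 4) (q ^ 3) r / (1 - (q ^ 4) ^ r * (-1))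
    rw [tsum_congr e, hs.tsum_add (hs'.mul_left _), tsum_mul_left, appell]
    simp only [Function.comp_def] at h4 ⊢
    rw [h4]
    ring
  rw [h2, h1, h3]
  linear_combination -(qInf (-q) (q ^ 2) / qInf (q ^ 2) (q ^ 2)) * appell (q ^ 4) (q ^ 3) (-1)
    * Complex.I_sq

theorem qPoch_odd_succ (q : ℂ) (n : ℕ) :
    qPoch q (q ^ 2) (n + 1) = (1 - q) * qPoch (q ^ 3) (q ^ 2) n := by
  rw [qPoch_succ', ← pow_succ]

/-- Fine's transformation turns the series into one to which `tsum_bailey` applies, with `x = q`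
and `s = 1`. -/
theorem A2_eq {q : ℂ} (hq0 : q ≠ 0) (hq : ‖q‖ < 1) :
    A2 q = q * (qInf (-q) (q ^ 2) / qInf (q ^ 2) (q ^ 2)) * appell (q ^ 4) (q ^ 5) (q ^ 2) := by
  have hp := pow_ne_zero 2 hq0
  have hp1 := norm_pow_lt_one hq two_pos
  have hne : ∀ r : ℤ, (q ^ 2) ^ r * q ≠ 1 := fun r => by
    rw [sq_zpow, ← zpow_add_one₀ hq0]; exact zpow_ne_one hq (by lia)
  have hterm : ∀ n : ℕ, A2Term q n
      = q / (1 - q) * (qPoch (-q ^ 2) (q ^ 2) n / qPoch (q ^ 3) (q ^ 2) n * q ^ n) := by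
    intro n
    rw [A2Term, qPoch_odd_succ, div_eq_mul_inv, mul_inv]
    ring
  have h1 : A2 q = q * ∑' n : ℕ, q ^ (n ^ 2 + 2 * n) * qPoch (-q) (q ^ 2) n
        / (qPoch q (q ^ 2) (n + 1) * qPoch (q ^ 2 / q) (q ^ 2) (n + 1)) := by
    rw [A2, tsum_congr hterm, tsum_mul_left,
      tsum_fine hp1 (-q ^ 2) (q ^ 3) q (norm_pow_lt_one hq three_pos) hq, ← tsum_mul_left,
      ← tsum_mul_left]
    refine tsum_congr fun n => ?_
    have e1 : q ^ 2 / q = q := by field_simp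
    have e2 : q ^ 3 / (-q ^ 2) = -q := by field_simp
    have e3 : (1 - q) * (qPoch (q ^ 3) (q ^ 2) n * qPoch q (q ^ 2) (n + 1))
        = qPoch q (q ^ 2) (n + 1) * qPoch q (q ^ 2) (n + 1) := by
      rw [qPoch_odd_succ]; ring
    have e4 : q ^ (n ^ 2 + 2 * n) = q ^ n * (q ^ 2) ^ n.choose 2 * (q ^ 2) ^ n := by
      rw [pow_add, ← sq_pow_choose_two]; ring
    rw [prod_mul_pow_sub _ _ (neg_ne_zero.2 hp), neg_neg, e1, e2, e4, div_mul_div_comm, e3]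
    ring
  have hs := summable_sq_pow_mul_qPoch hq (-q) (q ^ 2) hp1 2
  have h2 := tsum_bailey hp hp1 hq0 hne hs 1
  rw [h1, h2, mul_assoc]
  congr 1
  rw [appell, ← tsum_mul_left]
  refine tsum_congr fun r => ?_
  have hpl : ∀ k : ℕ, 1 + q ^ (2 * (k : ℤ) + 1) ≠ 0 := fun k h => by
    have h3 := pow_mul_ne_one hp1 (show ‖-q‖ < 1 by simpa) k
    apply h3
    have e5 : q ^ (2 * (k : ℤ) + 1) = q ^ (2 * k + 1) := by norm_cast
    rw [e5] at h
    linear_combination -h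
  -- The inner sum at `r = k ≥ 0`, by the confluent `q`-Gauss sum.
  have hnat : ∀ k : ℕ, ∑' n : ℕ, (q ^ (n ^ 2 + 2 * n) * qPoch (-q) (q ^ 2) n) *
      (rPoch (q ^ 2) (n - k) * rPoch (q ^ 2) (n + (1 : ℕ) + k))
      = q ^ ((k : ℤ) ^ 2 + 2 * k) / (1 + q ^ (2 * (k : ℤ) + 1)) *
        (qInf (-q) (q ^ 2) / qInf (q ^ 2) (q ^ 2)) := by
    intro k
    have hn : ‖-q‖ < 1 := by simpa
    have h0 := qPoch_ne_zero_of_lt hp1 hn k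
    have h3 := tsum_gauss_pair hp1 (a := -q) (-q ^ (2 * k + 3)) k 1 (by ring)
      (fun n => q ^ (n ^ 2 + 2 * n) * qPoch (-q) (q ^ 2) n) fun m => by
        have e : q ^ ((m + k) ^ 2 + 2 * (m + k)) = q ^ (k ^ 2 + 2 * k) *
            ((-1) ^ m * (q ^ 2) ^ m.choose 2 * (-q ^ (2 * k + 3)) ^ m) := by
          rw [show (m + k) ^ 2 + 2 * (m + k) = m ^ 2 + (k ^ 2 + 2 * k + 2 * k * m + 2 * m) by ring,
            pow_add, ← sq_pow_choose_two, neg_pow (q ^ (2 * k + 3))]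
          have : ((-1 : ℂ) ^ m) * (-1) ^ m = 1 := by rw [← mul_pow]; simp
          linear_combination (-(q ^ 2) ^ m.choose 2 * q ^ (k ^ 2 + 2 * k) *
            (q ^ (2 * k + 3)) ^ m) * this
        simp only [e]
        field_simp
    rw [h3, qInf_split hp1 (-q) (k + 1), qPoch_succ]
    have e1 : (q ^ 2) ^ (k + 1) * -q = -q ^ (2 * k + 3) := by ring
    have e2 : 1 - (q ^ 2) ^ k * -q = 1 + q ^ (2 * k + 1) := by ring
    have e3 := hpl k
    have e5 : q ^ (2 * (k : ℤ) + 1) = q ^ (2 * k + 1) := by norm_cast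
    rw [e5] at e3
    rw [e1, e2]
    norm_cast
    field_simp
  -- A negative `r` is reflected to `-1 - r`.
  have hint : ∑' n : ℕ, (q ^ (n ^ 2 + 2 * n) * qPoch (-q) (q ^ 2) n) *
      (rPoch (q ^ 2) (n - r) * rPoch (q ^ 2) (n + (1 : ℕ) + r))
      = q ^ (r ^ 2 + 2 * r) / (1 + q ^ (2 * r + 1)) *
        (qInf (-q) (q ^ 2) / qInf (q ^ 2) (q ^ 2)) := by
    rcases le_or_gt 0 r with hr | hr
    · obtain ⟨k, rfl⟩ := Int.eq_ofNat_of_zero_le hr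
      exact hnat k
    · obtain ⟨k, rfl⟩ : ∃ k : ℕ, r = -(1 : ℕ) - k := ⟨(-1 - r).toNat, by lia⟩
      rw [tsum_rPoch_symm, sub_sub_cancel, hnat]
      congr 1
      have e1 : q ^ ((-(1 : ℕ) - (k : ℤ)) ^ 2 + 2 * (-(1 : ℕ) - (k : ℤ)))
          = q ^ ((k : ℤ) ^ 2 + 2 * k) * (q ^ (2 * (k : ℤ) + 1))⁻¹ := by
        rw [← zpow_neg, ← zpow_add₀ hq0]; congr 1; push_cast; ring
      have e2 : q ^ (2 * (-(1 : ℕ) - (k : ℤ)) + 1) = (q ^ (2 * (k : ℤ) + 1))⁻¹ := by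
        rw [← zpow_neg]; congr 1; push_cast; ring
      have e3 := hpl k
      have e4 : q ^ (2 * (k : ℤ) + 1) ≠ 0 := zpow_ne_zero _ hq0
      have e5 : 1 + (q ^ (2 * (k : ℤ) + 1))⁻¹ ≠ 0 := by
        intro h; apply e3; field_simp at h; linear_combination h
      rw [e1, e2, div_eq_div_iff e3 e5]
      field_simp
      ring
  have e1 : q ^ (r * (r - 1)) * q ^ (2 * r) * q ^ (r ^ 2 + 2 * r)
      = q ^ (2 * (r * (r - 1))) * q ^ (5 * r) := by
    rw [← zpow_add₀ hq0, ← zpow_add₀ hq0, ← zpow_add₀ hq0]; congr 1; ring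
  have e2 : (q ^ 5) ^ r = q ^ (5 * r) := by rw [← zpow_natCast q 5, ← zpow_mul]; rfl
  have e3 : 1 - (q ^ 4) ^ r * q ^ 2 = (1 - q ^ (2 * r + 1)) * (1 + q ^ (2 * r + 1)) := by
    rw [show q ^ 4 = (q ^ 2) ^ 2 by ring, sq_zpow, sq_zpow, zpow_add_one₀ hq0,
      two_mul (2 * r), zpow_add₀ hq0]
    ring
  have e4 : (q ^ 2) ^ r * q = q ^ (2 * r + 1) := by rw [sq_zpow, zpow_add_one₀ hq0]
  rw [hint, th, th, te_sq, te_pow_four, e3, e4, e2, sq_zpow, mul_assoc ((-1 : ℂ) ^ r) (q ^ (2 * _)),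
    ← e1, div_eq_mul_inv _ (_ * _), mul_inv]
  ring

/-- As for `A2_eq`: Fine's transformation, then `tsum_bailey` with `x = q` and `s = 1`. -/
theorem B2_eq {q : ℂ} (hq0 : q ≠ 0) (hq : ‖q‖ < 1) :
    B2 q = qInf (-q ^ 2) (q ^ 2) / qInf (q ^ 2) (q ^ 2) *
      ∑' r : ℤ, (-1) ^ r * q ^ (2 * r ^ 2 + 2 * r) / (1 - q ^ (2 * r + 1)) := by
  have hp := pow_ne_zero 2 hq0
  have hp1 := norm_pow_lt_one hq two_pos
  have hne : ∀ r : ℤ, (q ^ 2) ^ r * q ≠ 1 := fun r => by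
    rw [sq_zpow, ← zpow_add_one₀ hq0]; exact zpow_ne_one hq (by lia)
  have hterm : ∀ n : ℕ, B2Term q n
      = 1 / (1 - q) * (qPoch (-q) (q ^ 2) n / qPoch (q ^ 3) (q ^ 2) n * q ^ n) := by
    intro n
    rw [B2Term, qPoch_odd_succ, div_eq_mul_inv, mul_inv]
    ring
  have h1 : B2 q = ∑' n : ℕ, q ^ (n ^ 2 + 1 * n) * qPoch (-q ^ 2) (q ^ 2) n
        / (qPoch q (q ^ 2) (n + 1) * qPoch (q ^ 2 / q) (q ^ 2) (n + 1)) := by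
    rw [B2, tsum_congr hterm, tsum_mul_left,
      tsum_fine hp1 (-q) (q ^ 3) q (norm_pow_lt_one hq three_pos) hq, ← tsum_mul_left]
    refine tsum_congr fun n => ?_
    have e1 : q ^ 2 / q = q := by field_simp
    have e2 : q ^ 3 / (-q) = -q ^ 2 := by field_simp
    have e3 : (1 - q) * (qPoch (q ^ 3) (q ^ 2) n * qPoch q (q ^ 2) (n + 1))
        = qPoch q (q ^ 2) (n + 1) * qPoch q (q ^ 2) (n + 1) := by
      rw [qPoch_odd_succ]; ring
    have e4 : q ^ (n ^ 2 + 1 * n) = q ^ n * (q ^ 2) ^ n.choose 2 * q ^ n := by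
      rw [pow_add, ← sq_pow_choose_two]; ring
    rw [prod_mul_pow_sub _ _ (neg_ne_zero.2 hq0), neg_neg, e1, e2, e4, div_mul_div_comm, e3]
    ring
  have hs := summable_sq_pow_mul_qPoch hq (-q ^ 2) (q ^ 2) hp1 1
  have h2 := tsum_bailey hp hp1 hq0 hne hs 1
  rw [h1, h2, ← tsum_mul_left]
  refine tsum_congr fun r => ?_
  have hnat : ∀ k : ℕ, ∑' n : ℕ, (q ^ (n ^ 2 + 1 * n) * qPoch (-q ^ 2) (q ^ 2) n) *
      (rPoch (q ^ 2) (n - k) * rPoch (q ^ 2) (n + (1 : ℕ) + k))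
      = q ^ ((k : ℤ) ^ 2 + k) * (qInf (-q ^ 2) (q ^ 2) / qInf (q ^ 2) (q ^ 2)) := by
    intro k
    have hn : ‖-q ^ 2‖ < 1 := by rwa [norm_neg]
    have h0 := qPoch_ne_zero_of_lt hp1 hn k
    have h3 := tsum_gauss_pair hp1 (a := -q ^ 2) (-q ^ (2 * k + 2)) k 1 (by ring)
      (fun n => q ^ (n ^ 2 + 1 * n) * qPoch (-q ^ 2) (q ^ 2) n) fun m => by
        have e : q ^ ((m + k) ^ 2 + 1 * (m + k)) = q ^ (k ^ 2 + 1 * k) *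
            ((-1) ^ m * (q ^ 2) ^ m.choose 2 * (-q ^ (2 * k + 2)) ^ m) := by
          rw [show (m + k) ^ 2 + 1 * (m + k) = m ^ 2 + (k ^ 2 + 1 * k + 2 * k * m + m) by ring,
            pow_add, ← sq_pow_choose_two, neg_pow (q ^ (2 * k + 2))]
          have : ((-1 : ℂ) ^ m) * (-1) ^ m = 1 := by rw [← mul_pow]; simp
          linear_combination (-(q ^ 2) ^ m.choose 2 * q ^ (k ^ 2 + 1 * k) *
            (q ^ (2 * k + 2)) ^ m) * this
        simp only [e]
        field_simp
    have e1 : (q ^ 2) ^ k * -q ^ 2 = -q ^ (2 * k + 2) := by ring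
    rw [h3, qInf_split hp1 (-q ^ 2) k, e1]
    norm_cast
    ring
  have hint : ∑' n : ℕ, (q ^ (n ^ 2 + 1 * n) * qPoch (-q ^ 2) (q ^ 2) n) *
      (rPoch (q ^ 2) (n - r) * rPoch (q ^ 2) (n + (1 : ℕ) + r))
      = q ^ (r ^ 2 + r) * (qInf (-q ^ 2) (q ^ 2) / qInf (q ^ 2) (q ^ 2)) := by
    rcases le_or_gt 0 r with hr | hr
    · obtain ⟨k, rfl⟩ := Int.eq_ofNat_of_zero_le hr
      exact hnat k
    · obtain ⟨k, rfl⟩ : ∃ k : ℕ, r = -(1 : ℕ) - k := ⟨(-1 - r).toNat, by lia⟩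
      rw [tsum_rPoch_symm, sub_sub_cancel, hnat]
      congr 2
      push_cast
      ring
  have e1 : q ^ (r * (r - 1)) * q ^ (2 * r) * q ^ (r ^ 2 + r) = q ^ (2 * r ^ 2 + 2 * r) := by
    rw [← zpow_add₀ hq0, ← zpow_add₀ hq0]; congr 1; ring
  have e4 : (q ^ 2) ^ r * q = q ^ (2 * r + 1) := by rw [sq_zpow, zpow_add_one₀ hq0]
  rw [hint, th, te_sq, e4, sq_zpow, ← e1]
  ring

/-! ### The theta function -/

/-- Quasi-periodicity of the theta function. -/
theorem jac_mul_left_self {p : ℂ} (hp : p ≠ 0) (hp1 : ‖p‖ < 1) {x : ℂ} (hx : x ≠ 0) :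
    jac (p * x) p = -x⁻¹ * jac x p := by
  rw [jac, jac, qInf_step hp1 x, show p / (p * x) = x⁻¹ by field_simp, qInf_step hp1 x⁻¹,
    ← div_eq_mul_inv]
  field_simp
  ring

theorem jac_self_div {p : ℂ} (hp : p ≠ 0) (x : ℂ) :
    jac (p / x) p = jac x p := by
  rw [jac, jac, div_div_cancel₀ hp, mul_comm (qInf x p)]

theorem jac_inv {p : ℂ} (hp : p ≠ 0) (hp1 : ‖p‖ < 1) {x : ℂ} (hx : x ≠ 0) :
    jac x⁻¹ p = -x⁻¹ * jac x p := by
  rw [← jac_mul_left_self hp hp1 hx, ← jac_self_div hp x⁻¹, div_inv_eq_mul]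

theorem jac_one {p : ℂ} (hp1 : ‖p‖ < 1) : jac 1 p = 0 := by
  rw [jac, qInf_step hp1 1]; simp

/-- Iterated quasi-periodicity of the theta function. -/
theorem th_mul_jac {p : ℂ} (hp : p ≠ 0) (hp1 : ‖p‖ < 1) {x : ℂ} (hx : x ≠ 0) (r : ℤ) :
    th p x r * jac (p ^ r * x) p = jac x p := by
  have hstep : ∀ r : ℤ, th p x (r + 1) * jac (p ^ (r + 1) * x) p
      = th p x r * jac (p ^ r * x) p := fun r => by
    have h1 : p ^ r * x ≠ 0 := mul_ne_zero (zpow_ne_zero r hp) hx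
    rw [th_succ hp hx, zpow_add_one₀ hp, show p ^ r * p * x = p * (p ^ r * x) by ring,
      jac_mul_left_self hp hp1 h1]
    field_simp
  induction r with
  | zero => simp [th_zero]
  | succ n ih => rw [hstep, ih]
  | pred n ih => rw [← ih, ← hstep, sub_add_cancel]

theorem jac_ne_zero {p : ℂ} (hp : p ≠ 0) (hp1 : ‖p‖ < 1) {x : ℂ} (hx : x ≠ 0)
    (h : ∀ r : ℤ, p ^ r * x ≠ 1) : jac x p ≠ 0 := by
  refine mul_ne_zero (mul_ne_zero ?_ ?_) (qInf_ne_zero_of_lt hp1 hp1)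
  · exact qInf_ne_zero hp1 fun i => by simpa using h i
  · refine qInf_ne_zero hp1 fun i h1 => ?_
    apply h (-(i + 1 : ℕ))
    have h2 : p ^ (i + 1) ≠ 0 := pow_ne_zero _ hp
    rw [zpow_neg, zpow_natCast, inv_mul_eq_one₀ h2, pow_succ]
    field_simp at h1
    exact h1

theorem differentiableOn_jac {p : ℂ} (hp1 : ‖p‖ < 1) :
    DifferentiableOn ℂ (fun x => jac x p) {0}ᶜ := by
  have h := differentiable_qInf hp1
  refine ((h.differentiableOn).mul ?_).mul_const _
  exact h.comp_differentiableOn ((differentiableOn_const p).div differentiableOn_id fun x hx => hx)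

/-! ### The kernel of the Appell sums -/

/-- The quotient `jac w p / (1 - p^r w)`, written so that it makes sense at its removable
singularity. -/
def jacKer (p : ℂ) (r : ℤ) (w : ℂ) : ℂ :=
  th p w r * (qInf (p * (p ^ r * w)) p * qInf (p / (p ^ r * w)) p * qInf p p)

theorem jac_eq_mul_jacKer {p : ℂ} (hp : p ≠ 0) (hp1 : ‖p‖ < 1) {w : ℂ} (hw : w ≠ 0) (r : ℤ) :
    jac w p = (1 - p ^ r * w) * jacKer p r w := by
  rw [← th_mul_jac hp hp1 hw r, jac, qInf_step hp1 (p ^ r * w), jacKer]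
  ring

theorem jacKer_mul_self {p : ℂ} (hp : p ≠ 0) {w : ℂ} (hw : w ≠ 0) (r : ℤ) :
    jacKer p r (p * w) = -w⁻¹ * jacKer p (r + 1) w := by
  rw [jacKer, jacKer, th_succ hp hw, mul_comm p w, th_mul, zpow_add_one₀ hp,
    show p ^ r * p * w = p ^ r * (w * p) by ring]
  field_simp

theorem jacKer_one_zero (p : ℂ) : jacKer p 0 1 = qInf p p ^ 3 := by
  simp [jacKer, th_zero]; ring

/-- Together with `jacKer_one_zero`: at `w = 1` the kernel is nonzero only for `r = 0`, so a sum
over `r` collapses to one term. -/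
theorem jacKer_one_of_ne {p : ℂ} (hp : p ≠ 0) (hp1 : ‖p‖ < 1) {r : ℤ} (hr : r ≠ 0) :
    jacKer p r 1 = 0 := by
  have h := jac_eq_mul_jacKer hp hp1 one_ne_zero r
  rw [jac_one hp1, mul_one] at h
  exact (mul_eq_zero.1 h.symm).resolve_left (sub_ne_zero.2 (zpow_ne_one hp1 hr).symm)

theorem jacKer_ne_zero {p : ℂ} (hp : p ≠ 0) (hp1 : ‖p‖ < 1) {w : ℂ} {r : ℤ} (h : p ^ r * w = 1) :
    jacKer p r w ≠ 0 := by
  have hw : w ≠ 0 := by rintro rfl; simp at h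
  rw [jacKer, h]
  have := qInf_ne_zero_of_lt hp1 hp1
  refine mul_ne_zero (th_ne_zero hp hw r) ?_
  simpa using this

/-- A bound for the kernel that is independent of the index. -/
theorem norm_jacKer_le {p : ℂ} (hp : p ≠ 0) (hp1 : ‖p‖ < 1) {w : ℂ} (hw : w ≠ 0) (r : ℤ) :
    ‖jacKer p r w‖ ≤ ‖qInf p p‖ / ‖qInf (‖p‖ : ℂ) (‖p‖ : ℂ)‖ * ‖jac (-(‖w‖ : ℂ)) (‖p‖ : ℂ)‖ := by
  have hP1 : ‖((‖p‖ : ℝ) : ℂ)‖ < 1 := by simpa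
  have hP : ((‖p‖ : ℝ) : ℂ) ≠ 0 := by simpa
  have hW : -((‖w‖ : ℝ) : ℂ) ≠ 0 := by simpa
  have hJ : ‖qInf (‖p‖ : ℂ) (‖p‖ : ℂ)‖ ≠ 0 := norm_ne_zero_iff.2 (qInf_ne_zero_of_lt hP1 hP1)
  set u := p ^ r * w with hu
  have hu0 : 0 ≤ ‖u‖ := norm_nonneg _
  have h1 : ‖qInf (p * u) p‖ ≤ ‖qInf (-(‖u‖ : ℂ)) (‖p‖ : ℂ)‖ := by
    refine (norm_qInf_le_qMaj hp1 _).trans ?_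
    have h2 := qInf_step hP1 (-(‖u‖ : ℂ))
    rw [qMaj, norm_mul p u, h2, norm_mul (1 - _)]
    push_cast
    rw [mul_neg]
    refine le_mul_of_one_le_left (norm_nonneg _) ?_
    rw [sub_neg_eq_add, ← Complex.ofReal_one, ← Complex.ofReal_add, Complex.norm_real,
      Real.norm_of_nonneg (by positivity)]
    linarith
  have h2 : ‖qInf (p / u) p‖ ≤ ‖qInf ((‖p‖ : ℂ) / -(‖u‖ : ℂ)) (‖p‖ : ℂ)‖ := by
    refine (norm_qInf_le_qMaj hp1 _).trans (le_of_eq ?_)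
    rw [qMaj, norm_div]
    push_cast
    rw [div_neg]
  -- Replacing `p` and `w` by `|p|` and `-|w|` bounds every factor from above, and there
  -- quasi-periodicity makes the product independent of `r`.
  have h3 := congrArg norm (th_mul_jac hP hP1 hW r)
  have h4 : (‖p‖ : ℂ) ^ r * -(‖w‖ : ℂ) = -(‖u‖ : ℂ) := by
    rw [hu, norm_mul, norm_zpow]; push_cast; ring
  rw [norm_mul, h4] at h3
  have h5 : ‖th (‖p‖ : ℂ) (-(‖w‖ : ℂ)) r‖ = ‖th p w r‖ := by
    rw [norm_th, norm_th, te, te, norm_zpow, norm_zpow, norm_neg, Complex.norm_real,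
      Complex.norm_real, norm_norm, norm_norm]
  rw [← h3, h5, jacKer, norm_mul, norm_mul, norm_mul, jac, norm_mul, norm_mul]
  calc ‖th p w r‖ * (‖qInf (p * u) p‖ * ‖qInf (p / u) p‖ * ‖qInf p p‖)
      ≤ ‖th p w r‖ * (‖qInf (-(‖u‖ : ℂ)) (‖p‖ : ℂ)‖ *
        ‖qInf ((‖p‖ : ℂ) / -(‖u‖ : ℂ)) (‖p‖ : ℂ)‖ * ‖qInf p p‖) := by gcongr
    _ = _ := by field_simp

theorem differentiableOn_jacKer {p : ℂ} (hp : p ≠ 0) (hp1 : ‖p‖ < 1) (r : ℤ) :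
    DifferentiableOn ℂ (jacKer p r) {0}ᶜ := by
  have h := differentiable_qInf hp1
  have h1 : DifferentiableOn ℂ (fun w : ℂ => p / (p ^ r * w)) {0}ᶜ :=
    (differentiableOn_const p).div (by fun_prop) fun x hx =>
      mul_ne_zero (zpow_ne_zero r hp) hx
  have h2 : DifferentiableOn ℂ (fun w : ℂ => th p w r) {0}ᶜ :=
    (differentiableOn_id.zpow (Or.inl fun x hx => hx)).const_mul _
  refine h2.mul (((h.comp_differentiableOn ?_).mul (h.comp_differentiableOn h1)).mul_const _)
  fun_prop

/-- Bilateral sums with theta-like decay are holomorphic in the punctured plane. -/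
theorem differentiableOn_tsum_of_te {p : ℂ} (hp : p ≠ 0) (hp1 : ‖p‖ < 1) {f : ℤ → ℂ → ℂ}
    {A B : ℝ → ℝ} (hf : ∀ r, DifferentiableOn ℂ (f r) {0}ᶜ) (hA : ContinuousOn A (Set.Ioi 0))
    (hA0 : ∀ t, 0 < t → 0 < A t) (hB : ContinuousOn B (Set.Ioi 0))
    (h : ∀ r x, x ≠ 0 → ‖f r x‖ ≤ ‖te p r‖ * A ‖x‖ ^ r * B ‖x‖) :
    DifferentiableOn ℂ (fun x => ∑' r, f r x) {0}ᶜ := by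
  intro x₀ hx₀
  have hx₀' : 0 < ‖x₀‖ := norm_pos_iff.2 hx₀
  set K := Set.Icc (‖x₀‖ / 2) (2 * ‖x₀‖) with hK
  have hKs : K ⊆ Set.Ioi 0 := fun t ht => lt_of_lt_of_le (by positivity) ht.1
  have hKn : K.Nonempty := ⟨‖x₀‖, by constructor <;> linarith⟩
  -- On a closed annulus around `|x₀|`, `A ^ r` is bounded by the sum of its values at the minimum
  -- and the maximum of `A`, whatever the sign of `r`.
  obtain ⟨a, haK, ha⟩ := isCompact_Icc.exists_isMinOn hKn (hA.mono hKs)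
  obtain ⟨b, hbK, hb⟩ := isCompact_Icc.exists_isMaxOn hKn (hA.mono hKs)
  obtain ⟨m, hmK, hm⟩ := isCompact_Icc.exists_isMaxOn hKn (hB.mono hKs)
  have hAa := hA0 a (hKs haK)
  have hAb := hA0 b (hKs hbK)
  have hU : Metric.ball x₀ (‖x₀‖ / 2) ⊆ {0}ᶜ := fun x hx h0 => by
    rw [Set.mem_singleton_iff.1 h0, mem_ball_iff_norm, zero_sub, norm_neg] at hx
    linarith
  have hn : ∀ x ∈ Metric.ball x₀ (‖x₀‖ / 2), ‖x‖ ∈ K := fun x hx => by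
    rw [mem_ball_iff_norm] at hx
    have h1 := norm_sub_norm_le x x₀
    have h2 := norm_sub_norm_le x₀ x
    rw [norm_sub_rev] at h2
    constructor <;> linarith
  have hsum : Summable fun r : ℤ =>
      (‖th p (A a : ℂ) r‖ + ‖th p (A b : ℂ) r‖) * |B m| :=
    ((summable_th hp hp1 _ (by exact_mod_cast hAa.ne')).norm.add
      (summable_th hp hp1 _ (by exact_mod_cast hAb.ne')).norm).mul_right _
  have hd := Complex.differentiableOn_tsum_of_summable_norm hsum (fun r => (hf r).mono hU)
    Metric.isOpen_ball fun r x hx => by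
      have hxK := hn x hx
      have h1 : A a ≤ A ‖x‖ := ha hxK
      have h2 : A ‖x‖ ≤ A b := hb hxK
      have h3 : B ‖x‖ ≤ B m := hm hxK
      have h4 := hA0 ‖x‖ (hKs hxK)
      have h5 : A ‖x‖ ^ r ≤ A a ^ r + A b ^ r := by
        rcases le_or_gt 0 r with hr | hr
        · have := zpow_le_zpow_left₀ hr h4.le h2
          have := zpow_pos hAa r
          linarith
        · have := zpow_le_zpow_left₀ (n := -r) (by lia) hAa.le h1
          rw [zpow_neg, zpow_neg, inv_le_inv₀ (zpow_pos hAa r) (zpow_pos h4 r)] at this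
          have := zpow_pos hAb r
          linarith
      rw [norm_th, norm_th, Complex.norm_real, Complex.norm_real, Real.norm_of_nonneg hAa.le,
        Real.norm_of_nonneg hAb.le, ← mul_add]
      refine (h r x (hU hx)).trans ?_
      refine (mul_le_mul_of_nonneg_left (h3.trans (le_abs_self _)) ?_).trans ?_
      · exact mul_nonneg (norm_nonneg _) (zpow_pos h4 r).le
      · gcongr
  exact (hd.differentiableAt (Metric.isOpen_ball.mem_nhds
    (Metric.mem_ball_self (by positivity)))).differentiableWithinAt

/-- A function on the punctured plane that is multiplied by a constant under `x ↦ p x` and has a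
zero vanishes identically. -/
theorem eq_zero_of_multiplier {p : ℂ} (hp : p ≠ 0) (hp1 : ‖p‖ < 1) {H : ℂ → ℂ} {c a : ℂ}
    (hd : DifferentiableOn ℂ H {0}ᶜ) (hH : ∀ x ≠ 0, H (p * x) = c * H x) (ha : a ≠ 0)
    (hHa : H a = 0) {x : ℂ} (hx : x ≠ 0) : H x = 0 := by
  rcases eq_or_ne c 0 with rfl | hc
  · have := hH (x / p) (div_ne_zero hx hp)
    rwa [mul_div_cancel₀ _ hp, zero_mul] at this
  have hp0 : 0 < ‖p‖ := norm_pos_iff.2 hp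
  have hc0 : 0 < ‖c‖ := norm_pos_iff.2 hc
  have hlog : Real.log ‖p‖ ≠ 0 := (Real.log_neg hp0 hp1).ne
  -- The exponent `α` is chosen so that `|H x| |x|^{-α}` is invariant under `x ↦ p x`. It is then
  -- bounded, because the annulus `1 ≤ |x| ≤ |p|⁻¹` is compact and meets every orbit.
  set α : ℝ := Real.log ‖c‖ / Real.log ‖p‖ with hα
  have hpα : ‖p‖ ^ (-α) = ‖c‖⁻¹ := by
    rw [Real.rpow_neg hp0.le, Real.rpow_def_of_pos hp0, hα, mul_div_cancel₀ _ hlog,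
      Real.exp_log hc0]
  set φ : ℂ → ℝ := fun x => ‖H x‖ * ‖x‖ ^ (-α) with hφ
  have hφp : ∀ x ≠ 0, φ (p * x) = φ x := fun x hx => by
    simp only [hφ]
    rw [hH x hx, norm_mul, norm_mul, Real.mul_rpow hp0.le (norm_nonneg _), hpα]
    field_simp
  have hφk : ∀ (k : ℤ) (x : ℂ), x ≠ 0 → φ (p ^ k * x) = φ x := by
    intro k x hx
    induction k with
    | zero => simp
    | succ n ih =>
      rw [zpow_add_one₀ hp, mul_comm _ p, mul_assoc, hφp _ (mul_ne_zero (zpow_ne_zero _ hp) hx), ih]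
    | pred n ih =>
      rw [← ih, ← hφp _ (mul_ne_zero (zpow_ne_zero _ hp) hx), ← mul_assoc, ← zpow_one_add₀ hp]
      congr 3; ring
  obtain ⟨M, hM⟩ : ∃ M, ∀ x ≠ 0, φ x ≤ M := by
    have hK : IsCompact (Metric.closedBall (0 : ℂ) ‖p‖⁻¹ \ Metric.ball 0 1) :=
      (isCompact_closedBall _ _).diff Metric.isOpen_ball
    have hK0 : ∀ x ∈ Metric.closedBall (0 : ℂ) ‖p‖⁻¹ \ Metric.ball 0 1, x ≠ 0 := by
      rintro x hx rfl
      exact hx.2 (Metric.mem_ball_self one_pos)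
    have hcont : ContinuousOn φ (Metric.closedBall (0 : ℂ) ‖p‖⁻¹ \ Metric.ball 0 1) :=
      (hd.continuousOn.mono fun x hx => hK0 x hx).norm.mul
        (continuousOn_id.norm.rpow_const fun x hx => Or.inl (norm_ne_zero_iff.2 (hK0 x hx)))
    obtain ⟨M, hM⟩ := hK.bddAbove_image hcont
    refine ⟨M, fun x hx => ?_⟩
    obtain ⟨k, hk1, hk2⟩ := exists_mem_Ico_zpow (norm_pos_iff.2 hx) ((one_lt_inv₀ hp0).2 hp1)
    rw [← hφk k x hx]
    refine hM ⟨_, ⟨?_, ?_⟩, rfl⟩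
    · rw [mem_closedBall_zero_iff, norm_mul, norm_zpow]
      rw [inv_zpow] at hk1 hk2
      rw [zpow_add_one₀ hp0.ne', mul_inv] at hk2
      have h1 := zpow_pos hp0 k
      calc ‖p‖ ^ k * ‖x‖ ≤ ‖p‖ ^ k * ((‖p‖ ^ k)⁻¹ * ‖p‖⁻¹) := by gcongr
        _ = ‖p‖⁻¹ := by field_simp
    · rw [mem_ball_zero_iff, norm_mul, norm_zpow, not_lt]
      rw [inv_zpow] at hk1
      have h1 := zpow_pos hp0 k
      calc 1 = ‖p‖ ^ k * (‖p‖ ^ k)⁻¹ := by field_simp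
        _ ≤ _ := by gcongr
  -- Hence `s ↦ H(e^s) e^{-αs}` is a bounded entire function, and constant by Liouville's theorem.
  set g : ℂ → ℂ := fun s => H (Complex.exp s) * Complex.exp (-α * s) with hg
  have hgd : Differentiable ℂ g := by
    refine Differentiable.mul (fun s => ?_) (by fun_prop)
    have h1 := (hd.differentiableAt (isOpen_compl_singleton.mem_nhds (Complex.exp_ne_zero s)))
    exact h1.comp s Complex.differentiableAt_exp
  have hgb : Bornology.IsBounded (Set.range g) := by
    rw [isBounded_iff_forall_norm_le]
    refine ⟨M, ?_⟩
    rintro _ ⟨s, rfl⟩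
    refine le_trans (le_of_eq ?_) (hM (Complex.exp s) (Complex.exp_ne_zero s))
    simp only [hg, hφ]
    rw [norm_mul, Complex.norm_exp, Complex.norm_exp, ← Real.exp_mul]
    congr 2
    simp [mul_comm]
  have h1 := hgd.apply_eq_apply_of_bounded hgb (Complex.log x) (Complex.log a)
  simp only [hg] at h1
  rw [Complex.exp_log hx, Complex.exp_log ha, hHa, zero_mul] at h1
  exact (mul_eq_zero.1 h1).resolve_right (Complex.exp_ne_zero _)

/-- A function vanishing on `p^ℤ` is divisible by the theta function. -/
theorem exists_eq_jac_mul {p : ℂ} (hp : p ≠ 0) (hp1 : ‖p‖ < 1) {F : ℂ → ℂ}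
    (hd : DifferentiableOn ℂ F {0}ᶜ) (h0 : ∀ (r : ℤ) (x : ℂ), p ^ r * x = 1 → F x = 0) :
    ∃ H : ℂ → ℂ, DifferentiableOn ℂ H {0}ᶜ ∧ ∀ x ≠ 0, F x = jac x p * H x := by
  classical
  -- At a zero `p^{-r}` of the theta function the quotient takes its limiting value, where `jac x
  -- p` is replaced by the derivative `-p^r * jacKer p r x`.
  set H : ℂ → ℂ := fun x =>
    if h : ∃ r : ℤ, p ^ r * x = 1 then deriv F x / (-p ^ h.choose * jacKer p h.choose x)
    else F x / jac x p with hH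
  have hH1 : ∀ x ≠ 0, F x = jac x p * H x := by
    intro x hx
    by_cases h : ∃ r : ℤ, p ^ r * x = 1
    · obtain ⟨r, hr⟩ := h
      rw [h0 r x hr, jac_eq_mul_jacKer hp hp1 hx r, hr, sub_self, zero_mul, zero_mul]
    · have h2 := jac_ne_zero hp hp1 hx fun r hr => h ⟨r, hr⟩
      simp only [hH, dif_neg h]
      field_simp
  refine ⟨H, fun x hx => ?_, hH1⟩
  have hx0 : x ≠ 0 := hx
  have hnhds : ({0}ᶜ : Set ℂ) ∈ 𝓝 x := isOpen_compl_singleton.mem_nhds hx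
  have hjd := differentiableOn_jac hp1
  refine DifferentiableAt.differentiableWithinAt ?_
  by_cases h : ∃ r : ℤ, p ^ r * x = 1
  · set r := h.choose with hr
    have hrx : p ^ r * x = 1 := h.choose_spec
    have hk := jacKer_ne_zero hp hp1 hrx
    have hkd := (differentiableOn_jacKer hp hp1 r).differentiableAt hnhds
    have hpr := zpow_ne_zero r hp
    -- Near such a zero the quotient is `dslope F x` divided by a nonvanishing function.
    have hds : DifferentiableAt ℂ (dslope F x) x :=
      ((Complex.differentiableOn_dslope hnhds).2 hd).differentiableAt hnhds
    have hq : DifferentiableAt ℂ (fun y => dslope F x y / (-p ^ r * jacKer p r y)) x :=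
      hds.div (hkd.const_mul _) (mul_ne_zero (neg_ne_zero.2 hpr) hk)
    refine hq.congr_of_eventuallyEq ?_
    filter_upwards [hkd.continuousAt.eventually_ne hk, hnhds] with y hy hy0
    rcases eq_or_ne y x with rfl | hyx
    · simp only [hH, dif_pos h, dslope_same, hr]
    · have h2 : 1 - p ^ r * y ≠ 0 := by
        rw [← hrx, ← mul_sub]
        exact mul_ne_zero hpr (sub_ne_zero.2 hyx.symm)
      have h3 : jac y p ≠ 0 := by
        rw [jac_eq_mul_jacKer hp hp1 hy0 r]
        exact mul_ne_zero h2 hy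
      have h4 := hH1 y hy0
      have h5 : H y = F y / jac y p := by rw [h4]; field_simp
      have h6 : y - x ≠ 0 := sub_ne_zero.2 hyx
      rw [h5, dslope_of_ne _ hyx, slope_def_field, h0 r x hrx, sub_zero,
        jac_eq_mul_jacKer hp hp1 hy0 r, div_div, div_eq_div_iff (mul_ne_zero h2 hy)
          (mul_ne_zero h6 (mul_ne_zero (neg_ne_zero.2 hpr) hy))]
      linear_combination (F y * jacKer p r y) * hrx
  · have h2 := jac_ne_zero hp hp1 hx0 fun r hr => h ⟨r, hr⟩
    have hq : DifferentiableAt ℂ (fun y => F y / jac y p) x :=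
      (hd.differentiableAt hnhds).div (hjd.differentiableAt hnhds) h2
    refine hq.congr_of_eventuallyEq ?_
    filter_upwards [(hjd.differentiableAt hnhds).continuousAt.eventually_ne h2, hnhds] with y hy hy0
    rw [hH1 y hy0]
    field_simp

/-! ### The change of parameters in an Appell sum -/

/-- The product of `jac w p` and `appell p z w`, which has no poles in `w`. -/
def jacAppell (p z w : ℂ) : ℂ := ∑' r : ℤ, th p z r * jacKer p r w

theorem summable_jacAppell {p : ℂ} (hp : p ≠ 0) (hp1 : ‖p‖ < 1) {z w : ℂ} (hz : z ≠ 0)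
    (hw : w ≠ 0) : Summable fun r : ℤ => th p z r * jacKer p r w := by
  refine Summable.of_norm_bounded ((summable_th hp hp1 z hz).norm.mul_right
    (‖qInf p p‖ / ‖qInf (‖p‖ : ℂ) (‖p‖ : ℂ)‖ * ‖jac (-(‖w‖ : ℂ)) (‖p‖ : ℂ)‖)) fun r => ?_
  rw [norm_mul]
  exact mul_le_mul_of_nonneg_left (norm_jacKer_le hp hp1 hw r) (norm_nonneg _)

theorem jacAppell_eq {p : ℂ} (hp : p ≠ 0) (hp1 : ‖p‖ < 1) {w : ℂ} (hw : w ≠ 0)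
    (h : ∀ r : ℤ, p ^ r * w ≠ 1) (z : ℂ) : jacAppell p z w = jac w p * appell p z w := by
  rw [jacAppell, appell, ← tsum_mul_left]
  refine tsum_congr fun r => ?_
  rw [jac_eq_mul_jacKer hp hp1 hw r]
  have := sub_ne_zero.2 (h r).symm
  field_simp

theorem jacAppell_one {p : ℂ} (hp : p ≠ 0) (hp1 : ‖p‖ < 1) (z : ℂ) :
    jacAppell p z 1 = qInf p p ^ 3 := by
  rw [jacAppell, tsum_eq_single 0, th_zero, jacKer_one_zero, one_mul]
  intro r hr
  rw [jacKer_one_of_ne hp hp1 hr, mul_zero]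

/-- The functional equation of an Appell sum under `w ↦ p w`, freed of denominators. -/
theorem jacAppell_mul_right {p : ℂ} (hp : p ≠ 0) (hp1 : ‖p‖ < 1) {z w : ℂ} (hz : z ≠ 0)
    (hw : w ≠ 0) :
    jacAppell p z (p * w) = p / z * jacAppell p z w - w⁻¹ * jac w p * jac z p := by
  have h1 := jac_mul_left_self hp hp1 (x := z / p) (div_ne_zero hz hp)
  rw [mul_div_cancel₀ _ hp, ← tsum_th hp hp1 (div_ne_zero hz hp)] at h1
  have hs := summable_jacAppell hp hp1 hz hw
  have hs' := summable_th hp hp1 (z / p) (div_ne_zero hz hp)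
  have h2 : ∀ r : ℤ, th p z (r - 1) * jacKer p (r - 1) (p * w)
      = p / z * (th p z r * jacKer p r w) + p / (z * w) * jac w p * th p (z / p) r := by
    intro r
    have h3 := th_succ hp hz (r - 1)
    rw [sub_add_cancel, zpow_sub_one₀ hp] at h3
    have h4 : th p (z / p) r = (p ^ r)⁻¹ * th p z r := by
      rw [div_eq_mul_inv, th_mul, inv_zpow]
    have h5 := zpow_ne_zero r hp
    rw [h4, h3, jac_eq_mul_jacKer hp hp1 hw r, jacKer_mul_self hp hw, sub_add_cancel]
    field_simp
    ring
  rw [h1, jacAppell, ← (Equiv.subRight (1 : ℤ)).tsum_eq]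
  simp only [Equiv.subRight_apply, h2]
  rw [(hs.mul_left _).tsum_add (hs'.mul_left _), tsum_mul_left, tsum_mul_left, jacAppell]
  field_simp
  ring

theorem continuousOn_jac_neg {p : ℂ} (hp1 : ‖p‖ < 1) :
    ContinuousOn (fun t : ℝ => ‖jac (-(t : ℂ)) p‖) (Set.Ioi 0) := by
  refine ((differentiableOn_jac hp1).continuousOn.comp
    (Complex.continuous_ofReal.neg.continuousOn) fun t ht => ?_).norm
  simpa using (ne_of_gt ht : t ≠ 0)

theorem differentiableOn_jacAppell {p : ℂ} (hp : p ≠ 0) (hp1 : ‖p‖ < 1) {z : ℂ} (hz : z ≠ 0) :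
    DifferentiableOn ℂ (jacAppell p z) {0}ᶜ := by
  have hP1 : ‖((‖p‖ : ℝ) : ℂ)‖ < 1 := by simpa
  refine differentiableOn_tsum_of_te hp hp1 (A := fun _ => ‖z‖)
    (B := fun t => ‖qInf p p‖ / ‖qInf (‖p‖ : ℂ) (‖p‖ : ℂ)‖ * ‖jac (-(t : ℂ)) (‖p‖ : ℂ)‖)
    (fun r => (differentiableOn_jacKer hp hp1 r).const_mul _) continuousOn_const
    (fun _ _ => norm_pos_iff.2 hz) ((continuousOn_jac_neg hP1).const_mul _) fun r x hx => ?_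
  rw [norm_mul, norm_th]
  exact mul_le_mul_of_nonneg_left (norm_jacKer_le hp hp1 hx r) (by positivity)

theorem differentiableOn_jac_mul {p : ℂ} (hp1 : ‖p‖ < 1) {c : ℂ} (hc : c ≠ 0) :
    DifferentiableOn ℂ (fun x => jac (c * x) p) {0}ᶜ :=
  (differentiableOn_jac hp1).comp (by fun_prop) fun _ hx => mul_ne_zero hc hx

/-- A continuous function whose product with the theta function vanishes is zero, since the zeros
of the theta function have empty interior. -/
theorem eq_zero_of_jac_mul {p : ℂ} (hp : p ≠ 0) (hp1 : ‖p‖ < 1) {K : ℂ → ℂ}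
    (hK : ContinuousOn K {0}ᶜ) (h : ∀ x ≠ 0, jac x p * K x = 0) {x : ℂ} (hx : x ≠ 0) : K x = 0 := by
  by_contra hKx
  have hnhds : ({0}ᶜ : Set ℂ) ∈ 𝓝 x := isOpen_compl_singleton.mem_nhds hx
  have h0 := (mul_eq_zero.1 (h x hx)).resolve_right hKx
  obtain ⟨r, hr⟩ : ∃ r : ℤ, p ^ r * x = 1 := by
    by_contra hne
    exact jac_ne_zero hp hp1 hx (fun r hr => hne ⟨r, hr⟩) h0
  have h1 : ∀ᶠ y in 𝓝 x, y = x := by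
    filter_upwards [(hK.continuousAt hnhds).eventually_ne hKx, hnhds,
      ((differentiableOn_jacKer hp hp1 r).differentiableAt hnhds).continuousAt.eventually_ne
        (jacKer_ne_zero hp hp1 hr)] with y hy1 hy2 hy3
    have h2 := (mul_eq_zero.1 (h y hy2)).resolve_right hy1
    rw [jac_eq_mul_jacKer hp hp1 hy2 r] at h2
    have h3 := (mul_eq_zero.1 h2).resolve_right hy3
    rw [← hr, ← mul_sub] at h3
    exact (sub_eq_zero.1 ((mul_eq_zero.1 h3).resolve_left (zpow_ne_zero r hp))).symm
  obtain ⟨y, hy1, hy2⟩ := ((h1.filter_mono nhdsWithin_le_nhds).and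
    (self_mem_nhdsWithin (s := ({x}ᶜ : Set ℂ)))).exists
  exact hy2 hy1

/-- The change of parameters: the quotients `appell p z w / jac z p` with a fixed value of `w / z`
differ by theta quotients. -/
theorem jac_mul_appell_sub {p : ℂ} (hp : p ≠ 0) (hp1 : ‖p‖ < 1) {z w l : ℂ} (hz : z ≠ 0)
    (hw : w ≠ 0) (hl : l ≠ 0) (h1 : ∀ r : ℤ, p ^ r * l ≠ 1) (h2 : ∀ r : ℤ, p ^ r * w ≠ 1)
    (h3 : ∀ r : ℤ, p ^ r * (l * w) ≠ 1) :
    jac z p * appell p (l * z) (l * w) - jac (l * z) p * appell p z w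
      = -w * qInf p p ^ 3 * jac l p * jac (l * z * w) p / (jac w p * jac (l * w) p) := by
  have hlz := mul_ne_zero hl hz
  -- `F` is the difference of the two sides as a function of `w`, cleared of denominators. It is
  -- quasi-periodic with a multiplier `-(p / (l z w))`, so that its two zeros at `w = 1` and `w =
  -- l⁻¹` force it to vanish identically.
  set F : ℂ → ℂ := fun w => jac z p * jac w p * jacAppell p (l * z) (l * w)
    - jac (l * z) p * jac (l * w) p * jacAppell p z w
    + w * qInf p p ^ 3 * jac l p * jac (l * z * w) p with hF
  have hd : DifferentiableOn ℂ F {0}ᶜ := by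
    have d1 := differentiableOn_jac hp1
    have d2 := differentiableOn_jac_mul hp1 hl
    have d3 := differentiableOn_jac_mul hp1 hlz
    have d4 := differentiableOn_jacAppell hp hp1 hz
    have d5 : DifferentiableOn ℂ (fun w => jacAppell p (l * z) (l * w)) {0}ᶜ :=
      (differentiableOn_jacAppell hp hp1 hlz).comp (by fun_prop) fun _ hx => mul_ne_zero hl hx
    exact (((d1.const_mul _).mul d5).sub ((d2.const_mul _).mul d4)).add
      (((differentiableOn_id.mul_const _).mul_const _).mul d3)
  have hFp : ∀ w ≠ 0, F (p * w) = -(p / (l * z * w)) * F w := by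
    intro w hw
    have hlw := mul_ne_zero hl hw
    simp only [hF]
    rw [mul_left_comm l p w, mul_left_comm (l * z) p w, jacAppell_mul_right hp hp1 hlz hlw,
      jacAppell_mul_right hp hp1 hz hw, jac_mul_left_self hp hp1 hw, jac_mul_left_self hp hp1 hlw,
      jac_mul_left_self hp hp1 (mul_ne_zero hlz hw)]
    field_simp
    ring
  have hF1 : F 1 = 0 := by
    simp only [hF]
    rw [jac_one hp1, jacAppell_one hp hp1]
    ring_nf
  have hFinv : F l⁻¹ = 0 := by
    simp only [hF]
    rw [mul_inv_cancel₀ hl, jac_one hp1, jacAppell_one hp hp1, jac_inv hp hp1 hl,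
      show l * z * l⁻¹ = z by field_simp]
    ring
  have hF0 : ∀ (r : ℤ) (x : ℂ), p ^ r * x = 1 → F x = 0 := by
    have hup : ∀ x ≠ 0, F x = 0 ↔ F (p * x) = 0 := fun x hx => by
      rw [hFp x hx, mul_eq_zero, or_iff_right]
      exact neg_ne_zero.2 (div_ne_zero hp (mul_ne_zero hlz hx))
    have : ∀ r : ℤ, F (p ^ r) = 0 := by
      intro r
      induction r with
      | zero => simpa using hF1
      | succ n ih => rw [zpow_add_one₀ hp, mul_comm, ← hup _ (zpow_ne_zero _ hp)]; exact ih
      | pred n ih =>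
        rw [hup _ (zpow_ne_zero _ hp), ← zpow_one_add₀ hp, add_sub_cancel]; exact ih
    intro r x hx
    rw [show x = p ^ (-r) by rw [zpow_neg]; exact eq_inv_of_mul_eq_one_right hx]
    exact this _
  -- Dividing by the theta function leaves a constant multiplier and the zero at `l⁻¹`.
  obtain ⟨H, hHd, hH⟩ := exists_eq_jac_mul hp hp1 hd hF0
  have hjl : jac l⁻¹ p ≠ 0 := by
    rw [jac_inv hp hp1 hl]
    exact mul_ne_zero (neg_ne_zero.2 (inv_ne_zero hl)) (jac_ne_zero hp hp1 hl h1)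
  have hHl : H l⁻¹ = 0 := by
    have := hH _ (inv_ne_zero hl)
    rw [hFinv] at this
    exact (mul_eq_zero.1 this.symm).resolve_left hjl
  have hHp : ∀ x ≠ 0, H (p * x) = p / (l * z) * H x := by
    intro x hx
    refine sub_eq_zero.1 (eq_zero_of_jac_mul hp hp1 (K := fun x => H (p * x) - p / (l * z) * H x)
      ?_ (fun x hx => ?_) hx)
    · exact (hHd.continuousOn.comp (by fun_prop) fun _ hx => mul_ne_zero hp hx).sub
        (hHd.continuousOn.const_mul _)
    · have h4 := hFp x hx
      rw [hH _ (mul_ne_zero hp hx), hH x hx, jac_mul_left_self hp hp1 hx] at h4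
      field_simp at h4 ⊢
      linear_combination -h4
  have hFw : F w = 0 := by
    rw [hH w hw, eq_zero_of_multiplier hp hp1 hHd hHp (inv_ne_zero hl) hHl hw, mul_zero]
  simp only [hF] at hFw
  have hj1 := jac_ne_zero hp hp1 hw h2
  have hj2 := jac_ne_zero hp hp1 (mul_ne_zero hl hw) h3
  rw [jacAppell_eq hp hp1 hw h2, jacAppell_eq hp hp1 (mul_ne_zero hl hw) h3] at hFw
  rw [eq_div_iff (mul_ne_zero hj1 hj2)]
  linear_combination hFw

/-! ### Consequences of the change of parameters, and product identities for theta functions -/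

/-- At `z = p` the sum is a theta quotient: the product `jacAppell p p w` is invariant under `w ↦
p w`, hence constant, and its value is read off at `w = 1`. -/
theorem appell_self {p : ℂ} (hp : p ≠ 0) (hp1 : ‖p‖ < 1) {w : ℂ} (hw : w ≠ 0)
    (h : ∀ r : ℤ, p ^ r * w ≠ 1) : appell p p w = qInf p p ^ 3 / jac w p := by
  have hjp : jac p p = 0 := by
    rw [← jac_self_div hp, div_self hp, jac_one hp1]
  have h1 := eq_zero_of_multiplier hp hp1 (H := fun w => jacAppell p p w - qInf p p ^ 3) (c := 1)
    ((differentiableOn_jacAppell hp hp1 hp).sub_const _) (fun x hx => by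
      rw [jacAppell_mul_right hp hp1 hp hx, hjp, div_self hp]; ring) one_ne_zero
    (by rw [jacAppell_one hp hp1, sub_self]) hw
  rw [jacAppell_eq hp hp1 hw h] at h1
  rw [eq_div_iff (jac_ne_zero hp hp1 hw h)]
  linear_combination h1

theorem zpow_mul_self_ne_one {p w : ℂ} (hp : p ≠ 0) (h : ∀ r : ℤ, p ^ r * w ≠ 1) (r : ℤ) :
    p ^ r * (p * w) ≠ 1 := by
  rw [← mul_assoc, ← zpow_add_one₀ hp]; exact h _

theorem appell_mul_right {p : ℂ} (hp : p ≠ 0) (hp1 : ‖p‖ < 1) {z w : ℂ} (hz : z ≠ 0)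
    (hw : w ≠ 0) (h : ∀ r : ℤ, p ^ r * w ≠ 1) :
    appell p z (p * w) = jac z p - p * w / z * appell p z w := by
  have h1 := jacAppell_mul_right hp hp1 hz hw
  have h2 := jac_ne_zero hp hp1 hw h
  rw [jacAppell_eq hp hp1 hw h, jacAppell_eq hp hp1 (mul_ne_zero hp hw)
    (zpow_mul_self_ne_one hp h), jac_mul_left_self hp hp1 hw] at h1
  field_simp at h1 ⊢
  linear_combination -h1

theorem appell_mul_left {p : ℂ} (hp : p ≠ 0) (hp1 : ‖p‖ < 1) {z w : ℂ} (hz : z ≠ 0)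
    (hw : w ≠ 0) (h : ∀ r : ℤ, p ^ r * w ≠ 1) :
    appell p (p * z) w = (appell p z w - jac z p) / w := by
  rw [eq_div_iff hw, appell, appell, ← tsum_th hp hp1 hz,
    ← (summable_appell hp hp1 hz w).tsum_sub (summable_th hp hp1 z hz), ← tsum_mul_right]
  refine tsum_congr fun r => ?_
  have h1 := sub_ne_zero.2 (h r).symm
  rw [mul_comm p z, th_mul, div_mul_eq_mul_div, div_sub' h1]
  congr 1
  ring

/-- The substitution `r ↦ -r`. It holds without a condition on `w`: a vanishing denominator
vanishes on both sides. -/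
theorem appell_inv {p : ℂ} (hp : p ≠ 0) (z : ℂ) {w : ℂ} (hw : w ≠ 0) :
    appell p z w⁻¹ = -w * appell p (p ^ 2 / z) w := by
  rw [appell, appell, ← (Equiv.neg ℤ).tsum_eq, ← tsum_mul_left]
  refine tsum_congr fun r => ?_
  have h1 := zpow_ne_zero r hp
  simp only [Equiv.neg_apply]
  rw [th_neg hp, show p ^ 2 / z = p / z * p by ring, th_mul, zpow_neg]
  by_cases h : p ^ r * w = 1
  · rw [← mul_inv, h]; simp
  have h2 := sub_ne_zero.2 (Ne.symm h)
  have h3 : 1 - (p ^ r)⁻¹ * w⁻¹ = -(1 - p ^ r * w) / (p ^ r * w) := by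
    field_simp; ring
  rw [h3, div_div_eq_mul_div, div_neg, mul_div_assoc', neg_mul, neg_div]
  congr 2
  ring

/-- The three-term relation of Weierstrass. -/
theorem jac_weierstrass {p : ℂ} (hp : p ≠ 0) (hp1 : ‖p‖ < 1) {z w k l : ℂ} (hz : z ≠ 0)
    (hw : w ≠ 0) (hk : k ≠ 0) (hl : l ≠ 0) (h1 : ∀ r : ℤ, p ^ r * w ≠ 1)
    (h2 : ∀ r : ℤ, p ^ r * l ≠ 1) (h3 : ∀ r : ℤ, p ^ r * k ≠ 1) (h4 : ∀ r : ℤ, p ^ r * (k / l) ≠ 1)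
    (h5 : ∀ r : ℤ, p ^ r * (l * w) ≠ 1) (h6 : ∀ r : ℤ, p ^ r * (k * w) ≠ 1) :
    jac (k * z) p * jac l p * jac (l * z * w) p * jac (k * w) p
      + l * jac z p * jac (k / l) p * jac (k * l * z * w) p * jac w p
      = jac (l * z) p * jac k p * jac (k * z * w) p * jac (l * w) p := by
  have e1 : k / l * (l * z) = k * z := by field_simp
  have e2 : k / l * (l * w) = k * w := by field_simp
  have e3 : k * z * (l * w) = k * l * z * w := by ring
  -- Three changes of parameters, from `z` to `l z`, from `z` to `k z` and from `l z` to `k z`,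
  -- relate three Appell sums; eliminating these leaves a relation between theta functions.
  have c1 := jac_mul_appell_sub hp hp1 hz hw hl h2 h1 h5
  have c2 := jac_mul_appell_sub hp hp1 hz hw hk h3 h1 h6
  have c3 := jac_mul_appell_sub hp hp1 (mul_ne_zero hl hz) (mul_ne_zero hl hw)
    (div_ne_zero hk hl) h4 h5 (by rwa [e2])
  rw [e1, e2, e3] at c3
  have n1 := jac_ne_zero hp hp1 hw h1
  have n2 := jac_ne_zero hp hp1 (mul_ne_zero hl hw) h5
  have n3 := jac_ne_zero hp hp1 (mul_ne_zero hk hw) h6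
  have n4 := pow_ne_zero 3 (qInf_ne_zero_of_lt hp1 hp1)
  rw [eq_div_iff (mul_ne_zero n1 n2)] at c1
  rw [eq_div_iff (mul_ne_zero n1 n3)] at c2
  rw [eq_div_iff (mul_ne_zero n2 n3)] at c3
  have n5 := mul_ne_zero hw n4
  refine mul_left_cancel₀ n5 ?_
  linear_combination jac (k * z) p * jac (k * w) p * c1 - jac (l * z) p * jac (l * w) p * c2
    + jac z p * jac w p * c3

/-- The theta function of base `q` in terms of those of base `q^3`. -/
theorem jac_cube {q : ℂ} (hq0 : q ≠ 0) (hq : ‖q‖ < 1) (x : ℂ) :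
    jac x q = qInf q q / qInf (q ^ 3) (q ^ 3) ^ 3 *
      (jac x (q ^ 3) * jac (q * x) (q ^ 3) * jac (q ^ 2 * x) (q ^ 3)) := by
  have h := qInf_ne_zero_of_lt (norm_pow_lt_one hq three_pos) (norm_pow_lt_one hq three_pos)
  rw [jac, qInf_residues hq x (Nat.succ_pos 2), qInf_residues hq (q / x) (Nat.succ_pos 2)]
  simp only [Finset.prod_range_succ, Finset.prod_range_zero, pow_zero, pow_one, one_mul]
  rw [jac, jac, jac, show q ^ 3 / x = q ^ 2 * (q / x) by ring,
    show q ^ 3 / (q * x) = q * (q / x) by field_simp,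
    show q ^ 3 / (q ^ 2 * x) = q / x by field_simp]
  field_simp

/-- The theta function of base `q` in terms of those of base `q^2`. -/
theorem jac_sq {q : ℂ} (hq0 : q ≠ 0) (hq : ‖q‖ < 1) (x : ℂ) :
    jac x q = qInf q q / qInf (q ^ 2) (q ^ 2) ^ 2 * (jac x (q ^ 2) * jac (q * x) (q ^ 2)) := by
  have h := qInf_ne_zero_of_lt (norm_pow_lt_one hq two_pos) (norm_pow_lt_one hq two_pos)
  rw [jac, qInf_residues hq x (Nat.succ_pos 1), qInf_residues hq (q / x) (Nat.succ_pos 1)]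
  simp only [Finset.prod_range_succ, Finset.prod_range_zero, pow_zero, pow_one, one_mul]
  rw [jac, jac, show q ^ 2 / x = q * (q / x) by ring,
    show q ^ 2 / (q * x) = q / x by field_simp]
  field_simp

theorem jac_mul_jac_neg {q : ℂ} (hq : ‖q‖ < 1) (x : ℂ) :
    jac x q * jac (-x) q = jac (x ^ 2) (q ^ 2) * qInf q q ^ 2 / qInf (q ^ 2) (q ^ 2) := by
  have h := qInf_ne_zero_of_lt (norm_pow_lt_one hq two_pos) (norm_pow_lt_one hq two_pos)
  have h1 := qInf_mul_neg hq x
  have h2 := qInf_mul_neg hq (q / x)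
  rw [eq_div_iff h, jac, jac, jac, ← h1, ← div_pow, ← h2, div_neg]
  ring

theorem jac_neg_one {q : ℂ} (hq : ‖q‖ < 1) :
    jac (-1) q = 2 * qInf (-q) q ^ 2 * qInf q q := by
  rw [jac, qInf_step hq (-1), div_neg, div_one, mul_neg_one]; ring

/-! ### A series of sixth-order type and its functional equation -/

/-- The partial theta function `∑_{k ≥ 0} (-1)^k q^{k(k+1)/2 + kN}`. -/
def partialTheta (q : ℂ) (N : ℕ) : ℂ := ∑' k : ℕ, (-1) ^ k * q ^ k.choose 2 * (q ^ (N + 1)) ^ k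

theorem summable_neg_one_pow_choose {q : ℂ} (hq : ‖q‖ < 1) (z : ℂ) :
    Summable fun k : ℕ => (-1) ^ k * q ^ k.choose 2 * z ^ k := by
  refine summable_of_ratio (l := -0 * z) (by simp) (g := fun n => -q ^ n * z)
    ((tendsto_pow_zero hq).neg.mul_const z) fun n => ?_
  rw [choose_two_succ]; ring

theorem partialTheta_eq {q : ℂ} (hq : ‖q‖ < 1) (N : ℕ) :
    partialTheta q N = 1 - q ^ (N + 1) * partialTheta q (N + 1) := by
  rw [partialTheta, (summable_neg_one_pow_choose hq _).tsum_eq_zero_add, partialTheta,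
    ← tsum_mul_left, sub_eq_add_neg, ← tsum_neg]
  congr 1
  · simp
  · refine tsum_congr fun k => ?_
    rw [choose_two_succ]; ring

/-- Euler's expansion of `(q^{m+N+1}; q)_∞` is inserted, and the sum over `m` is evaluated by the
`q`-binomial theorem. -/
theorem tsum_rPoch_shift {q : ℂ} (hq : ‖q‖ < 1) (N : ℕ) :
    ∑' m : ℕ, q ^ m * (rPoch q m * rPoch q (m + N : ℕ)) = partialTheta q N / qInf q q ^ 2 := by
  have hJ := qInf_ne_zero_of_lt hq hq
  have h0 := qPoch_self_ne_zero hq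
  have e1 : ∀ m : ℕ, q ^ m * (rPoch q m * rPoch q (m + N : ℕ))
      = 1 / qInf q q * ∑' k : ℕ, q ^ m / qPoch q q m *
        ((-1) ^ k * q ^ k.choose 2 / qPoch q q k * (q ^ (m + N + 1)) ^ k) := by
    intro m
    rw [tsum_mul_left, tsum_euler hq, rPoch_natCast, rPoch_natCast]
    have h1 := qInf_split hq q (m + N)
    rw [← pow_succ] at h1
    have h2 : qInf (q ^ (m + N + 1)) q ≠ 0 :=
      qInf_ne_zero_of_lt hq (norm_pow_lt_one hq (Nat.succ_pos _))
    rw [h1]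
    have := h0 (m + N)
    have := h0 m
    field_simp
  obtain ⟨C, hC⟩ := exists_bound_inv_qPoch hq (pow_mul_ne_one hq hq)
  have hs := summable_euler hq (q ^ (N + 1))
  rw [tsum_congr e1, tsum_mul_left,
    tsum_comm_of_norm_le_mul (A := fun m => ‖q‖ ^ m * C)
      (B := fun k => ‖(-1) ^ k * q ^ k.choose 2 / qPoch q q k * (q ^ (N + 1)) ^ k‖)
      ((summable_geometric_of_lt_one (norm_nonneg q) hq).mul_right C) hs.norm
      (fun m => mul_nonneg (by positivity) ((norm_nonneg _).trans (hC 0))) (fun _ => norm_nonneg _)]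
  · have e2 : ∀ k : ℕ, ∑' m : ℕ, q ^ m / qPoch q q m *
        ((-1) ^ k * q ^ k.choose 2 / qPoch q q k * (q ^ (m + N + 1)) ^ k)
        = 1 / qInf q q * ((-1) ^ k * q ^ k.choose 2 * (q ^ (N + 1)) ^ k) := by
      intro k
      have h1 := tsum_cauchy hq 0 (norm_pow_lt_one hq k.succ_pos)
      have h2 := qInf_split hq q k
      have h3 : qInf (q ^ (k + 1)) q ≠ 0 :=
        qInf_ne_zero_of_lt hq (norm_pow_lt_one hq k.succ_pos)
      have h4 := h0 k
      rw [zero_mul, qInf_zero] at h1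
      rw [← pow_succ] at h2
      have e3 : ∀ m : ℕ, q ^ m / qPoch q q m *
          ((-1) ^ k * q ^ k.choose 2 / qPoch q q k * (q ^ (m + N + 1)) ^ k)
          = (-1) ^ k * q ^ k.choose 2 / qPoch q q k * (q ^ (N + 1)) ^ k *
            (qPoch 0 q m / qPoch q q m * (q ^ (k + 1)) ^ m) := by
        intro m
        have : qPoch 0 q m = 1 := by simp [qPoch]
        rw [this]; ring
      rw [tsum_congr e3, tsum_mul_left, Nat.succ_eq_add_one] at *
      rw [h1, h2]
      field_simp
    rw [tsum_congr e2, tsum_mul_left, partialTheta]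
    field_simp
  · intro m k
    have e : q ^ m / qPoch q q m *
        ((-1) ^ k * q ^ k.choose 2 / qPoch q q k * (q ^ (m + N + 1)) ^ k)
        = q ^ m * (qPoch q q m)⁻¹ * (((-1) ^ k * q ^ k.choose 2 / qPoch q q k * (q ^ (N + 1)) ^ k)
          * (q ^ m) ^ k) := by ring
    rw [e, norm_mul, norm_mul (q ^ m), norm_mul _ ((q ^ m) ^ k), norm_pow q m]
    have h1 : ‖(q ^ m) ^ k‖ ≤ 1 := by
      rw [← pow_mul, norm_pow]; exact pow_le_one₀ (norm_nonneg _) hq.le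
    have h2 := hC m
    have h0' := (norm_nonneg _).trans h2
    have h3 := mul_le_of_le_one_right
      (norm_nonneg ((-1) ^ k * q ^ k.choose 2 / qPoch q q k * (q ^ (N + 1)) ^ k)) h1
    gcongr

/-- The coefficients of the theta-like expansion of `∑ q^n (x)_{n+s} (q/x)_n / (q)_{2n+s}`. -/
def hickCoef (q : ℂ) (s : ℕ) (j : ℤ) : ℂ :=
  ∑' n : ℕ, q ^ n * (rPoch q ((n + s : ℕ) - j) * rPoch q (n + j))

theorem norm_hickCoef_le {q : ℂ} (hq : ‖q‖ < 1) (s : ℕ) :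
    ∃ C : ℝ, ∀ j, ‖hickCoef q s j‖ ≤ C := by
  obtain ⟨C, hC0, hC⟩ := exists_bound_rPoch hq
  refine ⟨∑' n : ℕ, ‖q‖ ^ n * (C * C), fun j => tsum_of_norm_bounded
    ((summable_geometric_of_lt_one (norm_nonneg q) hq).mul_right (C * C)).hasSum fun n => ?_⟩
  rw [norm_mul, norm_mul, norm_pow]
  have h1 := hC ((n + s : ℕ) - j)
  have h2 := hC (n + j)
  gcongr

theorem hickCoef_symm (q : ℂ) (s : ℕ) (j : ℤ) : hickCoef q s (s - j) = hickCoef q s j := by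
  refine tsum_congr fun n => ?_
  rw [show ((n + s : ℕ) : ℤ) - (s - j) = n + j by push_cast; ring,
    show (n : ℤ) + (s - j) = (n + s : ℕ) - j by push_cast; ring, mul_comm (rPoch q _)]

theorem hickCoef_add {q : ℂ} (hq : ‖q‖ < 1) (s i : ℕ) :
    hickCoef q s (s + i : ℕ) = q ^ i * partialTheta q (s + 2 * i) / qInf q q ^ 2 := by
  rw [hickCoef, tsum_nat_shift i fun n hn => by
    rw [rPoch_of_neg q (by push_cast; lia)]; ring, mul_div_assoc, ← tsum_rPoch_shift hq,
    ← tsum_mul_left]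
  refine tsum_congr fun m => ?_
  rw [show ((m + i + s : ℕ) : ℤ) - (s + i : ℕ) = m by push_cast; ring,
    show ((m + i : ℕ) : ℤ) + (s + i : ℕ) = (m + (s + 2 * i) : ℕ) by push_cast; ring]
  ring

/-- First-order recursion of the coefficients. It is proved for `j ≥ s + 1` from the expansion in
partial theta functions, and carried to `j ≤ 0` by the symmetry `j ↦ s - j`. For `s ≤ 1` the only
remaining case is `s = j = 1`. -/
theorem hickCoef_rec {q : ℂ} (hq0 : q ≠ 0) (hq : ‖q‖ < 1) {s : ℕ} (hs : s ≤ 1) (j : ℤ) :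
    hickCoef q s (j - 1) = q ^ (4 * j - 2 - 2 * s) * hickCoef q s j
      + (q ^ (j - 1 - s) - q ^ (3 * j - 2 - 2 * s)) / qInf q q ^ 2 := by
  have hJ := qInf_ne_zero_of_lt hq hq
  have main : ∀ i : ℕ, hickCoef q s (s + i : ℕ) = q ^ (4 * ((s + i + 1 : ℕ) : ℤ) - 2 - 2 * s) *
      hickCoef q s (s + i + 1 : ℕ) + (q ^ (((s + i + 1 : ℕ) : ℤ) - 1 - s)
        - q ^ (3 * ((s + i + 1 : ℕ) : ℤ) - 2 - 2 * s)) / qInf q q ^ 2 := by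
    intro i
    rw [hickCoef_add hq, add_assoc, hickCoef_add hq, partialTheta_eq hq (s + 2 * i),
      partialTheta_eq hq (s + 2 * i + 1), show s + 2 * (i + 1) = s + 2 * i + 1 + 1 by ring]
    have e1 : q ^ (4 * ((s + (i + 1) : ℕ) : ℤ) - 2 - 2 * s) = q ^ (2 * s + 4 * i + 2) := by
      rw [← zpow_natCast]; congr 1; push_cast; ring
    have e2 : q ^ (((s + (i + 1) : ℕ) : ℤ) - 1 - s) = q ^ i := by
      rw [← zpow_natCast]; congr 1; push_cast; ring
    have e3 : q ^ (3 * ((s + (i + 1) : ℕ) : ℤ) - 2 - 2 * s) = q ^ (s + 3 * i + 1) := by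
      rw [← zpow_natCast]; congr 1; push_cast; ring
    rw [e1, e2, e3]
    field_simp
    ring
  -- The recursion is invariant under the reflection `j ↦ s + 1 - j`.
  have refl : ∀ j : ℤ, (hickCoef q s ((s + 1 - j) - 1)
      = q ^ (4 * (s + 1 - j) - 2 - 2 * s) * hickCoef q s (s + 1 - j)
      + (q ^ ((s + 1 - j) - 1 - s) - q ^ (3 * (s + 1 - j) - 2 - 2 * s)) / qInf q q ^ 2) →
      hickCoef q s (j - 1) = q ^ (4 * j - 2 - 2 * s) * hickCoef q s j
      + (q ^ (j - 1 - s) - q ^ (3 * j - 2 - 2 * s)) / qInf q q ^ 2 := by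
    intro j h
    rw [show (s : ℤ) + 1 - j - 1 = s - j by ring, hickCoef_symm,
      show (s : ℤ) + 1 - j = s - (j - 1) by ring, hickCoef_symm] at h
    have e0 : q ^ (4 * j - 2 - 2 * s) * q ^ (4 * (s - (j - 1)) - 2 - 2 * s) = 1 := by
      rw [← zpow_add₀ hq0, ← zpow_zero q]; congr 1; ring
    have e1 : q ^ (4 * j - 2 - 2 * s) * q ^ ((s : ℤ) - j - s) = q ^ (3 * j - 2 - 2 * s) := by
      rw [← zpow_add₀ hq0]; congr 1; ring
    have e2 : q ^ (4 * j - 2 - 2 * s) * q ^ (3 * (s - (j - 1)) - 2 - 2 * s) = q ^ (j - 1 - s) := by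
      rw [← zpow_add₀ hq0]; congr 1; ring
    rw [h]
    linear_combination (-hickCoef q s (j - 1)) * e0 - e1 / qInf q q ^ 2 + e2 / qInf q q ^ 2
  have pos : ∀ j : ℤ, s + 1 ≤ j → hickCoef q s (j - 1) = q ^ (4 * j - 2 - 2 * s) * hickCoef q s j
      + (q ^ (j - 1 - s) - q ^ (3 * j - 2 - 2 * s)) / qInf q q ^ 2 := by
    intro j hj
    obtain ⟨i, rfl⟩ : ∃ i : ℕ, j = (s + i + 1 : ℕ) := ⟨(j - s - 1).toNat, by push_cast; lia⟩
    rw [← main i]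
    congr 1; push_cast; ring
  rcases le_or_gt ((s : ℤ) + 1) j with hj | hj
  · exact pos j hj
  · rcases le_or_gt j 0 with hj0 | hj0
    · exact refl j (pos _ (by lia))
    · have hs1 : s = 1 := by lia
      have hj1 : j = 1 := by lia
      subst hs1 hj1
      have := hickCoef_symm q 1 1
      simp only [Nat.cast_one, sub_self] at this ⊢
      rw [this]
      norm_num

/-- Inserting the finite triple product and interchanging the summations. -/
theorem tsum_th_mul_hickCoef {q : ℂ} (hq0 : q ≠ 0) (hq : ‖q‖ < 1) (s : ℕ) {x : ℂ} (hx : x ≠ 0) :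
    ∑' j : ℤ, th q x j * hickCoef q s j
      = ∑' n : ℕ, q ^ n * (qPoch x q (n + s) * qPoch (q / x) q n / qPoch q q (n + s + n)) := by
  obtain ⟨C, hC0, hC⟩ := exists_bound_rPoch hq
  calc _ = ∑' j : ℤ, ∑' n : ℕ, q ^ n *
        (th q x j * (rPoch q ((n + s : ℕ) - j) * rPoch q (n + j))) := by
        refine tsum_congr fun j => ?_
        rw [hickCoef, ← tsum_mul_left]
        exact tsum_congr fun n => by ring
    _ = ∑' n : ℕ, ∑' j : ℤ, q ^ n *
        (th q x j * (rPoch q ((n + s : ℕ) - j) * rPoch q (n + j))) := by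
        refine tsum_comm_of_norm_le_mul (A := fun j => ‖th q x j‖ * (C * C)) (B := fun n => ‖q‖ ^ n)
          ((summable_th hq0 hq x hx).norm.mul_right _)
          (summable_geometric_of_lt_one (norm_nonneg q) hq) (fun _ => by positivity)
          (fun _ => by positivity) fun j n => ?_
        rw [norm_mul, norm_mul, norm_mul (rPoch _ _), norm_pow, mul_comm]
        have h1 := hC ((n + s : ℕ) - j)
        have h2 := hC (n + j)
        gcongr
    _ = _ := by
        refine tsum_congr fun n => ?_
        rw [tsum_mul_left, tsum_finite_jtp hq0 hq hx]

/-- The functional equation of the series `∑ q^n (x)_{n+s} (q/x)_n / (q)_{2n+s}`. -/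
theorem hick_functional {q : ℂ} (hq0 : q ≠ 0) (hq : ‖q‖ < 1) {s : ℕ} (hs : s ≤ 1) {x : ℂ}
    (hx : x ≠ 0) :
    ∑' j : ℤ, th q (q ^ 3 * x) j * hickCoef q s j
      = -q ^ (1 + 2 * s) * x * ∑' j : ℤ, th q x j * hickCoef q s j
        + (q⁻¹ * x⁻¹ ^ 2 - q ^ (1 + s)) * jac x q / qInf q q ^ 2 := by
  obtain ⟨C, hC⟩ := norm_hickCoef_le hq s
  have hsum : ∀ y : ℂ, y ≠ 0 → Summable fun j : ℤ => th q y j * hickCoef q s j := fun y hy =>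
    Summable.of_norm_bounded ((summable_th hq0 hq y hy).norm.mul_right C) fun j => by
      rw [norm_mul]; exact mul_le_mul_of_nonneg_left (hC j) (norm_nonneg _)
  have hx2 : q ^ 2 * x ≠ 0 := mul_ne_zero (pow_ne_zero 2 hq0) hx
  have hx3 : q ^ 3 * x ≠ 0 := mul_ne_zero (pow_ne_zero 3 hq0) hx
  have h2 : jac (q ^ 2 * x) q = q⁻¹ * x⁻¹ ^ 2 * jac x q := by
    rw [show q ^ 2 * x = q * (q * x) by ring, jac_mul_left_self hq0 hq (mul_ne_zero hq0 hx),
      jac_mul_left_self hq0 hq hx, mul_inv]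
    ring
  have key : ∀ j : ℤ, th q (q ^ 3 * x) j * hickCoef q s j
      = -q ^ (1 + 2 * s) * x * (th q x (j - 1) * hickCoef q s (j - 1))
        + (1 / qInf q q ^ 2 * th q (q ^ 2 * x) j - q ^ (1 + s) / qInf q q ^ 2 * th q x j) := by
    intro j
    have h3 := th_succ hq0 hx (j - 1)
    rw [sub_add_cancel] at h3
    have h4 : th q (q ^ 3 * x) j = q ^ (3 * j) * th q x j := by
      rw [mul_comm (q ^ 3), th_mul, ← zpow_natCast q 3, ← zpow_mul]; rfl
    have h5 : th q (q ^ 2 * x) j = q ^ (2 * j) * th q x j := by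
      rw [mul_comm (q ^ 2), th_mul, sq_zpow]
    have e1 : q ^ (2 * (s : ℤ) + 2 - j) * q ^ (4 * j - 2 - 2 * s) = q ^ (3 * j) := by
      rw [← zpow_add₀ hq0]; congr 1; ring
    have e2 : q ^ (2 * (s : ℤ) + 2 - j) * q ^ (j - 1 - s) = q ^ (1 + s) := by
      rw [← zpow_natCast, ← zpow_add₀ hq0]; congr 1; push_cast; ring
    have e3 : q ^ (2 * (s : ℤ) + 2 - j) * q ^ (3 * j - 2 - 2 * s) = q ^ (2 * j) := by
      rw [← zpow_add₀ hq0]; congr 1; ring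
    have e4 : q ^ (1 + 2 * s) * x * th q x (j - 1) = -q ^ (2 * (s : ℤ) + 2 - j) * th q x j := by
      rw [h3, ← zpow_natCast]
      have : q ^ (2 * (s : ℤ) + 2 - j) * q ^ (j - 1) = q ^ ((1 + 2 * s : ℕ) : ℤ) := by
        rw [← zpow_add₀ hq0]; congr 1; push_cast; ring
      rw [← this]; ring
    rw [h4, h5, hickCoef_rec hq0 hq hs]
    linear_combination (q ^ (4 * j - 2 - 2 * s) * hickCoef q s j
      + (q ^ (j - 1 - s) - q ^ (3 * j - 2 - 2 * s)) / qInf q q ^ 2) * e4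
      - th q x j * hickCoef q s j * e1 - th q x j / qInf q q ^ 2 * e2
      + th q x j / qInf q q ^ 2 * e3
  have hshift := (Equiv.subRight (1 : ℤ)).tsum_eq fun j : ℤ => th q x j * hickCoef q s j
  have hsh := (Equiv.subRight (1 : ℤ)).summable_iff.2 (hsum x hx)
  simp only [Equiv.subRight_apply, Function.comp_def] at hshift hsh
  have s1 := summable_th hq0 hq _ hx2
  have s2 := summable_th hq0 hq _ hx
  rw [tsum_congr key, (hsh.mul_left _).tsum_add ((s1.mul_left _).sub (s2.mul_left _)),
    (s1.mul_left _).tsum_sub (s2.mul_left _), tsum_mul_left, tsum_mul_left, tsum_mul_left, hshift,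
    tsum_th hq0 hq hx2, tsum_th hq0 hq hx, h2]
  ring

/-! ### The sixth-order functions as Appell sums -/

theorem jacAppell_mul_left {p : ℂ} (hp : p ≠ 0) (hp1 : ‖p‖ < 1) {z w : ℂ} (hz : z ≠ 0)
    (hw : w ≠ 0) :
    jacAppell p (p * z) w = (jacAppell p z w - jac w p * jac z p) / w := by
  rw [eq_div_iff hw, jacAppell, jacAppell, ← tsum_th hp hp1 hz, ← tsum_mul_left,
    ← (summable_jacAppell hp hp1 hz hw).tsum_sub ((summable_th hp hp1 z hz).mul_left _),
    ← tsum_mul_right]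
  refine tsum_congr fun r => ?_
  rw [mul_comm p z, th_mul, jac_eq_mul_jacKer hp hp1 hw r]
  ring

theorem jacAppell_mul_left_div_right {p : ℂ} (hp : p ≠ 0) (hp1 : ‖p‖ < 1) {z w : ℂ} (hz : z ≠ 0)
    (hw : w ≠ 0) :
    jacAppell p (p * z) (w / p)
      = z / w * (jacAppell p z w - jac w p * jac z p) + jac w p * jac z p := by
  have hwp := div_ne_zero hw hp
  have h1 := jacAppell_mul_right hp hp1 hz hwp
  have h2 := jac_mul_left_self hp hp1 hwp
  rw [mul_div_cancel₀ _ hp] at h1 h2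
  rw [jacAppell_mul_left hp hp1 hz hwp, h1, h2]
  field_simp
  ring

theorem differentiableOn_hick {q : ℂ} (hq0 : q ≠ 0) (hq : ‖q‖ < 1) (s : ℕ) :
    DifferentiableOn ℂ (fun x => ∑' j : ℤ, th q x j * hickCoef q s j) {0}ᶜ := by
  obtain ⟨C, hC⟩ := norm_hickCoef_le hq s
  refine differentiableOn_tsum_of_te hq0 hq (A := fun t => t) (B := fun _ => C) (fun r => ?_)
    continuousOn_id (fun t ht => ht) continuousOn_const fun r x hx => ?_
  · exact (((differentiableOn_id.zpow (Or.inl fun x hx => hx)).const_mul _)).mul_const _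
  · rw [norm_mul, norm_th]
    exact mul_le_mul_of_nonneg_left (hC r) (by positivity)

theorem differentiableOn_jacAppell_diag {p : ℂ} (hp : p ≠ 0) (hp1 : ‖p‖ < 1) {a b : ℂ} (ha : a ≠ 0)
    (hb : b ≠ 0) : DifferentiableOn ℂ (fun x => jacAppell p (a * x) (b / x)) {0}ᶜ := by
  have hP1 : ‖((‖p‖ : ℝ) : ℂ)‖ < 1 := by simpa
  refine differentiableOn_tsum_of_te hp hp1 (A := fun t => ‖a‖ * t)
    (B := fun t => ‖qInf p p‖ / ‖qInf (‖p‖ : ℂ) (‖p‖ : ℂ)‖ * ‖jac (-((‖b‖ / t : ℝ) : ℂ)) (‖p‖ : ℂ)‖)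
    (fun r => ?_) (by fun_prop) (fun t ht => mul_pos (norm_pos_iff.2 ha) ht) ?_ fun r x hx => ?_
  · have h1 : DifferentiableOn ℂ (fun x : ℂ => b / x) {0}ᶜ :=
      (differentiableOn_const b).div differentiableOn_id fun x hx => hx
    have h2 : DifferentiableOn ℂ (fun x : ℂ => th p (a * x) r) {0}ᶜ :=
      (((differentiableOn_id.const_mul a).zpow
        (Or.inl fun x hx => mul_ne_zero ha hx)).const_mul _)
    exact h2.mul ((differentiableOn_jacKer hp hp1 r).comp h1 fun x hx => div_ne_zero hb hx)
  · have hc : ContinuousOn (fun t : ℝ => ‖b‖ / t) (Set.Ioi 0) :=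
      continuousOn_const.div continuousOn_id fun t ht => ne_of_gt ht
    have hj := (continuousOn_jac_neg hP1).comp hc fun t ht => div_pos (norm_pos_iff.2 hb) ht
    exact continuousOn_const.mul hj
  · rw [norm_mul, norm_th, norm_mul, ← norm_div b x]
    exact mul_le_mul_of_nonneg_left (norm_jacKer_le hp hp1 (div_ne_zero hb hx) r) (by positivity)

/-- The expansion `∑ q^n (x)_{n+s} (q/x)_n / (q)_{2n+s}` as an Appell sum of base `q^3`. -/
theorem hick_eq_jacAppell {q : ℂ} (hq0 : q ≠ 0) (hq : ‖q‖ < 1) {s : ℕ} (hs : s ≤ 1) {x : ℂ}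
    (hx : x ≠ 0) (hxj : jac x (q ^ 3) ≠ 0) :
    qInf q q * qInf (q ^ 3) (q ^ 3) ^ 3 * ∑' j : ℤ, th q x j * hickCoef q s j
      = q ^ (2 - s) * jac (q ^ (1 - s) * x) (q ^ 3) *
        jacAppell (q ^ 3) (q ^ s * x) ((q ^ 2)⁻¹ / x) := by
  set p := q ^ 3 with hpdef
  have hp : p ≠ 0 := pow_ne_zero 3 hq0
  have hp1 : ‖p‖ < 1 := norm_pow_lt_one hq three_pos
  have hJ := qInf_ne_zero_of_lt hq hq
  have hJp := qInf_ne_zero_of_lt hp1 hp1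
  have hb : (q ^ 2)⁻¹ ≠ 0 := inv_ne_zero (pow_ne_zero 2 hq0)
  -- Both sides satisfy the same inhomogeneous functional equation under `x ↦ p x`. Their
  -- difference times the theta function has a constant multiplier and vanishes at `x = 1`, hence
  -- everywhere.
  set F : ℂ → ℂ := fun x => qInf q q * qInf p p ^ 3 * ∑' j : ℤ, th q x j * hickCoef q s j with hF
  set G : ℂ → ℂ := fun x => q ^ (2 - s) * jac (q ^ (1 - s) * x) p *
        jacAppell p (q ^ s * x) ((q ^ 2)⁻¹ / x) with hG
  have hFd : DifferentiableOn ℂ F {0}ᶜ := (differentiableOn_hick hq0 hq s).const_mul _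
  have hGd : DifferentiableOn ℂ G {0}ᶜ :=
    ((differentiableOn_jac_mul hp1 (pow_ne_zero _ hq0)).const_mul _).mul
      (differentiableOn_jacAppell_diag hp hp1 (pow_ne_zero _ hq0) hb)
  have hFp : ∀ x ≠ 0, F (p * x) = -q ^ (1 + 2 * s) * x * F x
      + (q⁻¹ * x⁻¹ ^ 2 - q ^ (1 + s)) * (jac x p * jac (q * x) p * jac (q ^ 2 * x) p) := by
    intro x hx
    simp only [hF]
    rw [hick_functional hq0 hq hs hx, jac_cube hq0 hq x, ← hpdef]
    field_simp
  have hGp : ∀ x ≠ 0, G (p * x) = -q ^ (1 + 2 * s) * x * G x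
      + (q⁻¹ * x⁻¹ ^ 2 - q ^ (1 + s)) * (jac x p * jac (q * x) p * jac (q ^ 2 * x) p) := by
    intro x hx
    have hz : q ^ s * x ≠ 0 := mul_ne_zero (pow_ne_zero _ hq0) hx
    have hw : (q ^ 2)⁻¹ / x ≠ 0 := div_ne_zero hb hx
    have h1 := jacAppell_mul_left_div_right hp hp1 hz hw
    have h2 : jac (q ^ 2 * x) p = -(q ^ 2 * x) * jac ((q ^ 2)⁻¹ / x) p := by
      have h3 := jac_inv hp hp1 (mul_ne_zero (pow_ne_zero 2 hq0) hx)
      rw [show (q ^ 2)⁻¹ / x = (q ^ 2 * x)⁻¹ by rw [mul_inv]; rfl, h3]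
      have := pow_ne_zero 2 hq0
      field_simp
    -- One of the exponents `s` and `1 - s` is `0`, the other is `1`.
    have h4 : jac x p * jac (q * x) p = jac (q ^ s * x) p * jac (q ^ (1 - s) * x) p := by
      rcases Nat.le_one_iff_eq_zero_or_eq_one.1 hs with rfl | rfl
      · simp
      · simp [mul_comm]
    simp only [hG]
    rw [h4, h2, mul_left_comm _ p x, mul_left_comm _ p x, show (q ^ 2)⁻¹ / (p * x)
      = (q ^ 2)⁻¹ / x / p by field_simp, h1, jac_mul_left_self hp hp1
      (mul_ne_zero (pow_ne_zero _ hq0) hx)]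
    generalize jacAppell p (q ^ s * x) ((q ^ 2)⁻¹ / x) = A
    generalize jac ((q ^ 2)⁻¹ / x) p = B
    generalize jac (q ^ s * x) p = C
    generalize jac (q ^ (1 - s) * x) p = D
    rcases Nat.le_one_iff_eq_zero_or_eq_one.1 hs with rfl | rfl
    · norm_num
      field_simp
      ring
    · norm_num
      field_simp
      ring
  have hH := eq_zero_of_multiplier hp hp1 (H := fun x => (F x - G x) * jac x p)
    (c := q ^ (1 + 2 * s)) ((hFd.sub hGd).mul (differentiableOn_jac hp1)) (fun x hx => by
      rw [hFp x hx, hGp x hx, jac_mul_left_self hp hp1 hx]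
      field_simp
      ring) one_ne_zero (by show _ * jac 1 p = 0; rw [jac_one hp1, mul_zero]) hx
  exact sub_eq_zero.1 ((mul_eq_zero.1 hH).resolve_right hxj)

theorem qPoch_self_two_mul (q : ℂ) (m : ℕ) :
    qPoch q q (2 * m) = qPoch q (q ^ 2) m * qPoch (q ^ 2) (q ^ 2) m := by
  induction m with
  | zero => simp
  | succ m ih =>
    rw [show 2 * (m + 1) = 2 * m + 1 + 1 by ring]
    simp only [qPoch_succ, ih]
    ring

/-- The mock theta functions of order six as the values at `x = -1` of the series expanded in
`hick_eq_jacAppell`, up to a factor: the reciprocal of `(q; q²)_{n+s}` is expanded by Euler's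
identity, and the sum over `n` is evaluated by Cauchy's `q`-binomial theorem. -/
theorem tsum_sixth {q : ℂ} (hq0 : q ≠ 0) (hq : ‖q‖ < 1) (s : ℕ) :
    qInf q (q ^ 2) * qInf q q / qInf (-q) q *
      ∑' n : ℕ, q ^ n * qPoch (-q ^ s) q n / (qPoch q q n * qPoch q (q ^ 2) (n + s))
      = ∑' m : ℕ, (-1) ^ m * q ^ (m ^ 2 + 2 * s * m) * qPoch q (q ^ 2) m
        / qPoch (-q) q (2 * m + s) := by
  have hq2 := norm_pow_lt_one hq two_pos
  have hqn : ‖-q‖ < 1 := by simpa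
  have h0 := qPoch_self_ne_zero hq
  have hJ := qInf_ne_zero_of_lt hq hq
  have hO := qInf_ne_zero_of_lt hq2 hq
  have hN := qInf_ne_zero_of_lt hq hqn
  have hO' := fun n => qPoch_ne_zero_of_lt hq2 hq n
  have hN' := fun n => qPoch_ne_zero_of_lt hq hqn n
  have h02 := qPoch_self_ne_zero hq2
  have e1 : ∀ n : ℕ, q ^ n * qPoch (-q ^ s) q n / (qPoch q q n * qPoch q (q ^ 2) (n + s))
      = 1 / qInf q (q ^ 2) * ∑' m : ℕ, q ^ n * qPoch (-q ^ s) q n / qPoch q q n *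
        ((-1) ^ m * (q ^ 2) ^ m.choose 2 / qPoch (q ^ 2) (q ^ 2) m * (q ^ (2 * n + 2 * s + 1)) ^ m)
      := by
    intro n
    rw [tsum_mul_left, tsum_euler hq2, qInf_split hq2 q (n + s), ← pow_mul, ← pow_succ,
      show 2 * (n + s) + 1 = 2 * n + 2 * s + 1 by ring]
    have h1 : qInf (q ^ (2 * n + 2 * s + 1)) (q ^ 2) ≠ 0 :=
      qInf_ne_zero_of_lt hq2 (norm_pow_lt_one hq (Nat.succ_pos _))
    have h2 := hO' (n + s)
    have h3 := h0 n
    field_simp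
  have hs1 := summable_euler hq2 (q ^ (2 * s + 1))
  have hs2 := (summable_cauchy hq (-q ^ s) hq)
  rw [tsum_congr e1, tsum_mul_left, tsum_comm_of_norm_le_mul (f := fun n m =>
      q ^ n * qPoch (-q ^ s) q n / qPoch q q n *
        ((-1) ^ m * (q ^ 2) ^ m.choose 2 / qPoch (q ^ 2) (q ^ 2) m * (q ^ (2 * n + 2 * s + 1)) ^ m))
      (A := fun n => ‖qPoch (-q ^ s) q n / qPoch q q n * q ^ n‖)
      (B := fun m => ‖(-1) ^ m * (q ^ 2) ^ m.choose 2 / qPoch (q ^ 2) (q ^ 2) m *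
        (q ^ (2 * s + 1)) ^ m‖) hs2.norm hs1.norm (fun _ => norm_nonneg _) (fun _ => norm_nonneg _)]
  · have e2 : ∀ m : ℕ, ∑' n : ℕ, q ^ n * qPoch (-q ^ s) q n / qPoch q q n *
        ((-1) ^ m * (q ^ 2) ^ m.choose 2 / qPoch (q ^ 2) (q ^ 2) m * (q ^ (2 * n + 2 * s + 1)) ^ m)
        = qInf (-q) q / qInf q q * ((-1) ^ m * q ^ (m ^ 2 + 2 * s * m) * qPoch q (q ^ 2) m
        / qPoch (-q) q (2 * m + s)) := by
      intro m
      have e3 : ∀ n : ℕ, q ^ n * qPoch (-q ^ s) q n / qPoch q q n *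
          ((-1) ^ m * (q ^ 2) ^ m.choose 2 / qPoch (q ^ 2) (q ^ 2) m *
            (q ^ (2 * n + 2 * s + 1)) ^ m)
          = (-1) ^ m * (q ^ 2) ^ m.choose 2 / qPoch (q ^ 2) (q ^ 2) m * (q ^ (2 * s + 1)) ^ m *
            (qPoch (-q ^ s) q n / qPoch q q n * (q ^ (2 * m + 1)) ^ n) := fun n => by ring
      have h1 := qInf_split hq q (2 * m)
      have h2 := qInf_split hq (-q) (2 * m + s)
      rw [← pow_succ] at h1
      have h3 : -q ^ s * q ^ (2 * m + 1) = q ^ (2 * m + s) * -q := by ring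
      have h4 : qInf (q ^ (2 * m + 1)) q ≠ 0 :=
        qInf_ne_zero_of_lt hq (norm_pow_lt_one hq (Nat.succ_pos _))
      have h5 : qPoch q q (2 * m) = qPoch q (q ^ 2) m * qPoch (q ^ 2) (q ^ 2) m :=
        qPoch_self_two_mul q m
      have h6 : q ^ (m ^ 2 + 2 * s * m) = (q ^ 2) ^ m.choose 2 * (q ^ (2 * s + 1)) ^ m := by
        rw [pow_add, ← sq_pow_choose_two]; ring
      rw [tsum_congr e3, tsum_mul_left, tsum_cauchy hq _ (norm_pow_lt_one hq (Nat.succ_pos _)), h3,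
        h6, h1, h2, h5]
      have := hN' (2 * m + s)
      have := h02 m
      have := hO' m
      field_simp
    rw [tsum_congr e2, tsum_mul_left]
    field_simp
  · intro n m
    have e : q ^ n * qPoch (-q ^ s) q n / qPoch q q n *
        ((-1) ^ m * (q ^ 2) ^ m.choose 2 / qPoch (q ^ 2) (q ^ 2) m * (q ^ (2 * n + 2 * s + 1)) ^ m)
        = (qPoch (-q ^ s) q n / qPoch q q n * q ^ n) *
          (((-1) ^ m * (q ^ 2) ^ m.choose 2 / qPoch (q ^ 2) (q ^ 2) m * (q ^ (2 * s + 1)) ^ m)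
          * q ^ (2 * n * m)) := by ring
    rw [e, norm_mul, norm_mul _ (q ^ (2 * n * m)), norm_pow q]
    refine mul_le_mul_of_nonneg_left ?_ (norm_nonneg _)
    exact mul_le_of_le_one_right (norm_nonneg _) (pow_le_one₀ (norm_nonneg _) hq.le)

/-- On the points `ε q^m` with `|ε| = 1`, the condition of not lying in `(q^N)^ℤ` can be read off
from the exponent and the sign. -/
theorem zpow_mul_unit_mul_zpow_ne_one {q : ℂ} (hq0 : q ≠ 0) (hq : ‖q‖ < 1) {N : ℕ} {m : ℤ} {ε : ℂ}
    (hε : ‖ε‖ = 1) (h : ε ≠ 1 ∨ ¬ (N : ℤ) ∣ m) (r : ℤ) : (q ^ N) ^ r * (ε * q ^ m) ≠ 1 := by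
  intro h1
  have h2 : ε * q ^ (N * r + m) = 1 := by
    rw [zpow_add₀ hq0, zpow_mul, zpow_natCast]
    linear_combination h1
  have h3 : ‖q‖ ^ (N * r + m) = 1 := by
    simpa [hε] using congrArg norm h2
  have h4 : N * r + m = 0 := by
    by_contra h5
    exact h5 ((zpow_eq_one_iff_right₀ (norm_nonneg q) hq.ne).1 h3)
  rw [h4, zpow_zero, mul_one] at h2
  exact h.elim (fun h => h h2) fun h => h ⟨-r, by linarith⟩

theorem zpow_mul_zpow_ne_one {q : ℂ} (hq0 : q ≠ 0) (hq : ‖q‖ < 1) {N : ℕ} {m : ℤ}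
    (h : ¬ (N : ℤ) ∣ m) (r : ℤ) : (q ^ N) ^ r * q ^ m ≠ 1 := by
  simpa using zpow_mul_unit_mul_zpow_ne_one hq0 hq (ε := 1) (by simp) (Or.inr h) r

theorem zpow_mul_neg_zpow_ne_one {q : ℂ} (hq0 : q ≠ 0) (hq : ‖q‖ < 1) (N : ℕ) (m r : ℤ) :
    (q ^ N) ^ r * -q ^ m ≠ 1 := by
  simpa using zpow_mul_unit_mul_zpow_ne_one hq0 hq (ε := -1) (N := N) (m := m) (by simp)
    (Or.inl (by norm_num)) r

theorem zpow_mul_pow_ne_one {q : ℂ} (hq0 : q ≠ 0) (hq : ‖q‖ < 1) {N m : ℕ}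
    (h : ¬ N ∣ m) (r : ℤ) : (q ^ N) ^ r * q ^ m ≠ 1 := by
  simpa using zpow_mul_zpow_ne_one hq0 hq (N := N) (m := m) (by exact_mod_cast h) r

theorem zpow_mul_neg_pow_ne_one {q : ℂ} (hq0 : q ≠ 0) (hq : ‖q‖ < 1) (N m : ℕ) (r : ℤ) :
    (q ^ N) ^ r * -q ^ m ≠ 1 := by
  simpa using zpow_mul_neg_zpow_ne_one hq0 hq N m r

/-- Euler's identity `(q; q²)_∞ (-q; q)_∞ = 1`. -/
theorem qInf_mul_qInf_neg_self {q : ℂ} (hq : ‖q‖ < 1) : qInf q (q ^ 2) * qInf (-q) q = 1 := by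
  have h1 := qInf_mul_neg hq q
  have h2 := qInf_residues hq q (Nat.succ_pos 1)
  simp only [Finset.prod_range_succ, Finset.prod_range_zero, pow_zero, one_mul, pow_one] at h2
  have h3 := qInf_ne_zero_of_lt (norm_pow_lt_one hq two_pos) (norm_pow_lt_one hq two_pos)
  rw [h2, ← pow_two] at h1
  change qInf q (q ^ 2) * qInf (q ^ 2) (q ^ 2) * _ = _ at h1
  exact mul_right_cancel₀ h3 (by linear_combination h1)

/-- The case `s = 0` is `φ₆`, the case `s = 1` is `ψ₆` up to a factor `q`; both combine
`tsum_sixth` with the value of `hick_eq_jacAppell` at `x = -1`. -/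
theorem phi6_psi6_aux {q : ℂ} (hq0 : q ≠ 0) (hq : ‖q‖ < 1) {s : ℕ} (hs : s ≤ 1) :
    ∑' m : ℕ, (-1) ^ m * q ^ (m ^ 2 + 2 * s * m) * qPoch q (q ^ 2) m
        / qPoch (-q) q (2 * m + s)
      = 2 * (2 * q)⁻¹ ^ s * appell (q ^ 3) (-q ^ s) (-q ^ (-2 : ℤ)) / jac (-q ^ s) (q ^ 3) := by
  have hp : q ^ 3 ≠ 0 := pow_ne_zero 3 hq0
  have hp1 := norm_pow_lt_one hq three_pos
  have hJ := qInf_ne_zero_of_lt hq hq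
  have hJ3 := qInf_ne_zero_of_lt hp1 hp1
  have hj0 : jac (-1) (q ^ 3) ≠ 0 := jac_ne_zero hp hp1 (by norm_num) fun r => by
    simpa using zpow_mul_neg_pow_ne_one hq0 hq 3 0 r
  have hj1 : jac (-q) (q ^ 3) ≠ 0 := jac_ne_zero hp hp1 (neg_ne_zero.2 hq0) fun r => by
    simpa using zpow_mul_neg_pow_ne_one hq0 hq 3 1 r
  have h1 := tsum_th_mul_hickCoef hq0 hq s (x := -1) (by norm_num)
  have h2 : ∀ n : ℕ, q ^ n * (qPoch (-1) q (n + s) * qPoch (q / -1) q n / qPoch q q (n + s + n))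
      = 2 ^ s * (q ^ n * qPoch (-q ^ s) q n / (qPoch q q n * qPoch q (q ^ 2) (n + s))) := by
    intro n
    have a1 := qPoch_self_two_mul q n
    have a2 : qPoch (q ^ 2) (q ^ 2) n = qPoch q q n * qPoch (-q) q n := by
      simp only [qPoch, ← Finset.prod_mul_distrib]
      exact Finset.prod_congr rfl fun i _ => by ring
    have b1 := qPoch_self_ne_zero hq n
    have b2 := qPoch_ne_zero_of_lt hq (x := -q) (by simpa) n
    have b3 := qPoch_ne_zero_of_lt (norm_pow_lt_one hq two_pos) hq (n + s)
    rw [div_neg, div_one]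
    rcases Nat.le_one_iff_eq_zero_or_eq_one.1 hs with rfl | rfl
    · rw [add_zero, ← two_mul, a1, a2]
      rw [add_zero] at b3
      simp only [pow_zero]
      field_simp
    · have a3 : qPoch q q (n + 1 + n) = qPoch q (q ^ 2) (n + 1) * qPoch (q ^ 2) (q ^ 2) n := by
        rw [show n + 1 + n = 2 * n + 1 by ring, qPoch_succ, qPoch_succ, a1]; ring
      rw [a3, a2, qPoch_succ']
      simp only [pow_one, mul_neg, mul_one]
      field_simp
      ring
  rw [tsum_congr h2, tsum_mul_left] at h1
  have h3 := hick_eq_jacAppell hq0 hq hs (x := -1) (by norm_num) hj0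
  have hw : -q ^ (-2 : ℤ) ≠ 0 := neg_ne_zero.2 (zpow_ne_zero _ hq0)
  have e1 : (q ^ 2)⁻¹ / -1 = -q ^ (-2 : ℤ) := by rw [zpow_neg, div_neg, div_one]; rfl
  have h4 : jac (-q ^ (-2 : ℤ)) (q ^ 3) = (q ^ 2)⁻¹ * jac (-q) (q ^ 3) := by
    have a1 := jac_inv hp hp1 (x := -q ^ 2) (neg_ne_zero.2 (pow_ne_zero 2 hq0))
    have a2 := jac_self_div hp (-q : ℂ)
    rw [show q ^ 3 / -q = -q ^ 2 by field_simp] at a2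
    rw [show -q ^ (-2 : ℤ) = (-q ^ 2)⁻¹ by rw [inv_neg, zpow_neg]; rfl, a1, a2, inv_neg, neg_neg]
  have h5 : jac (-q ^ 2) (q ^ 3) = jac (-q) (q ^ 3) := by
    have a2 := jac_self_div hp (-q : ℂ)
    rwa [show q ^ 3 / -q = -q ^ 2 by field_simp] at a2
  have h6 := jac_cube hq0 hq (-1)
  rw [jac_neg_one hq, mul_neg_one, mul_neg_one, h5] at h6
  rw [e1, jacAppell_eq hp hp1 hw (zpow_mul_neg_zpow_ne_one hq0 hq 3 (-2)), h4, h1] at h3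
  rw [← tsum_sixth hq0 hq s]
  have h7 := qInf_mul_qInf_neg_self hq
  have hN := qInf_ne_zero_of_lt hq (x := -q) (by simpa)
  have hO := qInf_ne_zero_of_lt (norm_pow_lt_one hq two_pos) hq
  set S := ∑' n : ℕ, q ^ n * qPoch (-q ^ s) q n / (qPoch q q n * qPoch q (q ^ 2) (n + s))
  have h8 : qInf q (q ^ 2) = (qInf (-q) q)⁻¹ := eq_inv_of_mul_eq_one_left h7
  rw [h8]
  have h9 : 2 * qInf (-q) q ^ 2 * qInf (q ^ 3) (q ^ 3) ^ 3
      = jac (-1) (q ^ 3) * jac (-q) (q ^ 3) ^ 2 := by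
    field_simp at h6
    linear_combination h6
  have hq2 := pow_ne_zero 2 hq0
  refine mul_left_cancel₀ (pow_ne_zero 3 hJ3) ?_
  rcases Nat.le_one_iff_eq_zero_or_eq_one.1 hs with rfl | rfl
  · simp only [pow_zero, one_mul, mul_neg_one, tsub_zero, pow_one] at h3 ⊢
    generalize appell (q ^ 3) (-1) (-q ^ (-2 : ℤ)) = X at *
    have h3' : qInf q q * qInf (q ^ 3) (q ^ 3) ^ 3 * S = jac (-q) (q ^ 3) ^ 2 * X := by
      rw [h3]; field_simp
    rw [mul_div_assoc', eq_div_iff hj0]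
    have : qInf (q ^ 3) (q ^ 3) ^ 3 * ((qInf (-q) q)⁻¹ * qInf q q / qInf (-q) q * S)
      = (qInf q q * qInf (q ^ 3) (q ^ 3) ^ 3 * S) / qInf (-q) q ^ 2 := by field_simp
    rw [this, h3', div_mul_eq_mul_div, div_eq_iff (pow_ne_zero 2 hN)]
    linear_combination -X * h9
  · simp only [pow_zero, mul_neg_one, tsub_self, pow_one] at h3 ⊢
    generalize appell (q ^ 3) (-q) (-q ^ (-2 : ℤ)) = X at *
    have h3' : qInf q q * qInf (q ^ 3) (q ^ 3) ^ 3 * S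
        = jac (-1) (q ^ 3) * jac (-q) (q ^ 3) * X / (2 * q) := by
      rw [eq_div_iff (mul_ne_zero two_ne_zero hq0)]
      have e : q * jac (-1) (q ^ 3) * ((q ^ 2)⁻¹ * jac (-q) (q ^ 3) * X)
        = jac (-1) (q ^ 3) * jac (-q) (q ^ 3) * X / q := by field_simp
      rw [show 2 - 1 = 1 from rfl, pow_one, e, eq_div_iff hq0] at h3
      linear_combination h3
    rw [mul_div_assoc', eq_div_iff hj1]
    have : qInf (q ^ 3) (q ^ 3) ^ 3 * ((qInf (-q) q)⁻¹ * qInf q q / qInf (-q) q * S)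
      = (qInf q q * qInf (q ^ 3) (q ^ 3) ^ 3 * S) / qInf (-q) q ^ 2 := by field_simp
    rw [this, h3', div_div, div_mul_eq_mul_div,
      div_eq_iff (mul_ne_zero (mul_ne_zero two_ne_zero hq0) (pow_ne_zero 2 hN))]
    have e : 2 * (2 * q)⁻¹ * X * (2 * q * qInf (-q) q ^ 2) = X * (2 * qInf (-q) q ^ 2) := by
      field_simp
    have e' : qInf (q ^ 3) (q ^ 3) ^ 3 * (2 * (2 * q)⁻¹ * X) * (2 * q * qInf (-q) q ^ 2)
      = qInf (q ^ 3) (q ^ 3) ^ 3 * (2 * (2 * q)⁻¹ * X * (2 * q * qInf (-q) q ^ 2)) := by ring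
    rw [e', e]
    linear_combination -X * h9

/-- The mock theta function `φ₆` as an Appell sum. -/
theorem phi6_eq {q : ℂ} (hq0 : q ≠ 0) (hq : ‖q‖ < 1) :
    phi6 q = 2 * appell (q ^ 3) (-1) (-q ^ (-2 : ℤ)) / jac (-1) (q ^ 3) := by
  simpa [phi6, phi6Term] using phi6_psi6_aux hq0 hq (Nat.zero_le 1)

/-- The mock theta function `ψ₆` as an Appell sum. -/
theorem psi6_eq {q : ℂ} (hq0 : q ≠ 0) (hq : ‖q‖ < 1) :
    psi6 q = appell (q ^ 3) (-q) (-q ^ (-2 : ℤ)) / jac (-q) (q ^ 3) := by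
  have h1 := phi6_psi6_aux hq0 hq le_rfl
  have h2 : psi6 q = q * ∑' m : ℕ, (-1) ^ m * q ^ (m ^ 2 + 2 * 1 * m) * qPoch q (q ^ 2) m
        / qPoch (-q) q (2 * m + 1) := by
    rw [psi6, ← tsum_mul_left]
    refine tsum_congr fun m => ?_
    rw [psi6Term]
    ring
  rw [h2, h1, pow_one, pow_one, mul_inv]
  field_simp

/-! ### Dissections of theta functions and Appell sums -/

/-- The terms of a theta series along a residue class modulo 2 form a theta series of base `p^4`.
-/
theorem th_double {p z : ℂ} (hp : p ≠ 0) (hz : z ≠ 0) (t m : ℤ) :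
    th p z (2 * m + t) = th p z t * th (p ^ 4) (-(p ^ (1 + 2 * t) * z ^ 2)) m := by
  have hp4 : p ^ 4 ≠ 0 := pow_ne_zero 4 hp
  have hx : -(p ^ (1 + 2 * t) * z ^ 2) ≠ 0 :=
    neg_ne_zero.2 (mul_ne_zero (zpow_ne_zero _ hp) (pow_ne_zero 2 hz))
  have hstep : ∀ m : ℤ, (th p z (2 * (m + 1) + t)
        = th p z t * th (p ^ 4) (-(p ^ (1 + 2 * t) * z ^ 2)) (m + 1)
      ↔ th p z (2 * m + t) = th p z t * th (p ^ 4) (-(p ^ (1 + 2 * t) * z ^ 2)) m) := by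
    intro m
    have e : p ^ (2 * m + t + 1) * p ^ (2 * m + t) = (p ^ 4) ^ m * p ^ (1 + 2 * t) := by
      rw [← zpow_natCast p 4, ← zpow_mul, ← zpow_add₀ hp, ← zpow_add₀ hp]; congr 1; push_cast; ring
    have h0 : (p ^ 4) ^ m * p ^ (1 + 2 * t) * z ^ 2 ≠ 0 :=
      mul_ne_zero (mul_ne_zero (zpow_ne_zero _ hp4) (zpow_ne_zero _ hp)) (pow_ne_zero 2 hz)
    rw [show 2 * (m + 1) + t = 2 * m + t + 1 + 1 by ring, th_succ hp hz, th_succ hp hz,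
      th_succ hp4 hx, ← mul_right_inj' h0 (b := th p z (2 * m + t))]
    constructor <;> intro h
    · linear_combination h - z ^ 2 * th p z (2 * m + t) * e
    · linear_combination h + z ^ 2 * th p z (2 * m + t) * e
  induction m with
  | zero => simp [th_zero]
  | succ m ih => exact (hstep m).2 ih
  | pred m ih =>
    have := hstep (-m - 1)
    rw [sub_add_cancel] at this
    exact this.1 ih

/-- The terms of a theta series along a residue class modulo 3 form a theta series of base `p^9`.
-/
theorem th_triple {p z : ℂ} (hp : p ≠ 0) (hz : z ≠ 0) (t m : ℤ) :
    th p z (3 * m + t) = th p z t * th (p ^ 9) (p ^ (3 + 3 * t) * z ^ 3) m := by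
  have hp9 : p ^ 9 ≠ 0 := pow_ne_zero 9 hp
  have hx : p ^ (3 + 3 * t) * z ^ 3 ≠ 0 := mul_ne_zero (zpow_ne_zero _ hp) (pow_ne_zero 3 hz)
  have hstep : ∀ m : ℤ, (th p z (3 * (m + 1) + t)
        = th p z t * th (p ^ 9) (p ^ (3 + 3 * t) * z ^ 3) (m + 1)
      ↔ th p z (3 * m + t) = th p z t * th (p ^ 9) (p ^ (3 + 3 * t) * z ^ 3) m) := by
    intro m
    have e : p ^ (3 * m + t + 1 + 1) * p ^ (3 * m + t + 1) * p ^ (3 * m + t)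
        = (p ^ 9) ^ m * p ^ (3 + 3 * t) := by
      rw [← zpow_natCast p 9, ← zpow_mul, ← zpow_add₀ hp, ← zpow_add₀ hp, ← zpow_add₀ hp]
      congr 1; push_cast; ring
    have h0 : (p ^ 9) ^ m * p ^ (3 + 3 * t) * z ^ 3 ≠ 0 :=
      mul_ne_zero (mul_ne_zero (zpow_ne_zero _ hp9) (zpow_ne_zero _ hp)) (pow_ne_zero 3 hz)
    rw [show 3 * (m + 1) + t = 3 * m + t + 1 + 1 + 1 by ring, th_succ hp hz, th_succ hp hz,
      th_succ hp hz, th_succ hp9 hx, ← mul_right_inj' h0 (b := th p z (3 * m + t))]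
    constructor <;> intro h
    · linear_combination -h - z ^ 3 * th p z (3 * m + t) * e
    · linear_combination -h - z ^ 3 * th p z (3 * m + t) * e
  induction m with
  | zero => simp [th_zero]
  | succ m ih => exact (hstep m).2 ih
  | pred m ih =>
    have := hstep (-m - 1)
    rw [sub_add_cancel] at this
    exact this.1 ih

/-- A bilateral series split according to residues. -/
theorem tsum_int_residues {f : ℤ → ℂ} (hf : Summable f) (k : ℕ) [NeZero k] :
    ∑' r : ℤ, f r = ∑ t : Fin k, ∑' m : ℤ, f (k * m + (t : ℕ)) := by
  let e : Fin k × ℤ ≃ ℤ := (Equiv.prodComm _ _).trans (Int.divModEquiv k).symm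
  have h2 : Summable fun x : Fin k × ℤ => f (e x) := e.summable_iff.2 hf
  rw [← e.tsum_eq f, h2.tsum_prod, tsum_fintype]
  refine Finset.sum_congr rfl fun t _ => tsum_congr fun m => ?_
  show f (m * k + (t : ℕ)) = _
  rw [mul_comm]

theorem tsum_int_residues_two {f : ℤ → ℂ} (hf : Summable f) :
    ∑' r : ℤ, f r = ∑' m : ℤ, f (2 * m) + ∑' m : ℤ, f (2 * m + 1) := by
  simpa [Fin.sum_univ_succ] using tsum_int_residues hf 2

theorem tsum_int_residues_three {f : ℤ → ℂ} (hf : Summable f) :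
    ∑' r : ℤ, f r
      = ∑' m : ℤ, f (3 * m) + ∑' m : ℤ, f (3 * m + 1) + ∑' m : ℤ, f (3 * m + 2) := by
  simpa [Fin.sum_univ_succ, add_assoc] using tsum_int_residues hf 3

/-- The 2-dissection of the theta function. -/
theorem jac_double {p z : ℂ} (hp : p ≠ 0) (hp1 : ‖p‖ < 1) (hz : z ≠ 0) :
    jac z p = jac (-(p * z ^ 2)) (p ^ 4) - z * jac (-(p ^ 3 * z ^ 2)) (p ^ 4) := by
  have hp4 : p ^ 4 ≠ 0 := pow_ne_zero 4 hp
  have hq4 := norm_pow_lt_one hp1 four_pos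
  have hz2 := pow_ne_zero 2 hz
  have h0 : ∀ m : ℤ, th p z (2 * m) = th (p ^ 4) (-(p * z ^ 2)) m := fun m => by
    simpa [th_zero] using th_double hp hz 0 m
  have t1 : th p z 1 = -z := by simpa [th_zero] using th_succ hp hz 0
  have h1 : ∀ m : ℤ, th p z (2 * m + 1) = -z * th (p ^ 4) (-(p ^ 3 * z ^ 2)) m := fun m => by
    have := th_double hp hz 1 m
    rwa [t1] at this
  rw [← tsum_th hp hp1 hz, tsum_int_residues_two (summable_th hp hp1 z hz), tsum_congr h0,
    tsum_congr h1, tsum_mul_left, tsum_th hp4 hq4 (neg_ne_zero.2 (mul_ne_zero hp hz2)),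
    tsum_th hp4 hq4 (neg_ne_zero.2 (mul_ne_zero (pow_ne_zero 3 hp) hz2))]
  ring

theorem th_one {p z : ℂ} (hp : p ≠ 0) (hz : z ≠ 0) : th p z 1 = -z := by
  simpa [th_zero] using th_succ hp hz 0

theorem th_two {p z : ℂ} (hp : p ≠ 0) (hz : z ≠ 0) : th p z 2 = p * z ^ 2 := by
  have := th_succ hp hz 1
  rw [th_one hp hz, zpow_one] at this
  rw [show (2 : ℤ) = 1 + 1 by norm_num, this]
  ring

/-- The 3-dissection of the theta function. -/
theorem jac_triple {p z : ℂ} (hp : p ≠ 0) (hp1 : ‖p‖ < 1) (hz : z ≠ 0) :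
    jac z p = jac (p ^ 3 * z ^ 3) (p ^ 9) - z * jac (p ^ 6 * z ^ 3) (p ^ 9)
      + p * z ^ 2 * jac (p ^ 9 * z ^ 3) (p ^ 9) := by
  have hp9 : p ^ 9 ≠ 0 := pow_ne_zero 9 hp
  have hq9 := norm_pow_lt_one hp1 (Nat.succ_pos 8)
  have hz3 := pow_ne_zero 3 hz
  have hpk := fun k : ℕ => mul_ne_zero (pow_ne_zero k hp) hz3
  have h0 : ∀ m : ℤ, th p z (3 * m) = th (p ^ 9) (p ^ 3 * z ^ 3) m := fun m => by
    have := th_triple hp hz 0 m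
    simpa [th_zero] using this
  have h1 : ∀ m : ℤ, th p z (3 * m + 1) = -z * th (p ^ 9) (p ^ 6 * z ^ 3) m := fun m => by
    have := th_triple hp hz 1 m
    rwa [th_one hp hz] at this
  have h2 : ∀ m : ℤ, th p z (3 * m + 2) = p * z ^ 2 * th (p ^ 9) (p ^ 9 * z ^ 3) m := fun m => by
    have := th_triple hp hz 2 m
    rwa [th_two hp hz] at this
  rw [← tsum_th hp hp1 hz, tsum_int_residues_three (summable_th hp hp1 z hz), tsum_congr h0,
    tsum_congr h1, tsum_congr h2, tsum_mul_left, tsum_mul_left, tsum_th hp9 hq9 (hpk 3),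
    tsum_th hp9 hq9 (hpk 6), tsum_th hp9 hq9 (hpk 9)]
  ring

/-- The 3-dissection of the Appell sum: each of the three residue classes is further split with
`1/(1-y) = (1+y+y^2)/(1-y^3)`. -/
theorem appell_triple {p z w : ℂ} (hp : p ≠ 0) (hp1 : ‖p‖ < 1) (hz : z ≠ 0)
    (hw : ∀ r : ℤ, (p ^ 3) ^ r * w ^ 3 ≠ 1) :
    appell p z w = ∑ t ∈ Finset.range 3, ∑ j ∈ Finset.range 3,
      th p z t * (p ^ t * w) ^ j *
        appell (p ^ 9) (p ^ (3 * (1 + t + j)) * z ^ 3) (p ^ (3 * t) * w ^ 3) := by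
  have hp9 : p ^ 9 ≠ 0 := pow_ne_zero 9 hp
  have hq9 := norm_pow_lt_one hp1 (Nat.succ_pos 8)
  have hz3 := pow_ne_zero 3 hz
  have hw0 : ∀ r : ℤ, 1 - (p ^ 3) ^ r * w ^ 3 ≠ 0 := fun r => sub_ne_zero.2 (hw r).symm
  -- The identity `1/(1 - y) = (1 + y + y²)/(1 - y³)` with `y = p^{3m+t} w`, term by term.
  have key : ∀ (t : ℕ) (m : ℤ), th p z (3 * m + t) / (1 - p ^ (3 * m + t : ℤ) * w)
      = ∑ j ∈ Finset.range 3, th p z t * (p ^ t * w) ^ j *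
        (th (p ^ 9) (p ^ (3 * (1 + t + j)) * z ^ 3) m / (1 - (p ^ 9) ^ m * (p ^ (3 * t) * w ^ 3))) := by
    intro t m
    have e1 : (p ^ 9) ^ m * (p ^ (3 * t) * w ^ 3) = (p ^ 3) ^ (3 * m + t : ℤ) * w ^ 3 := by
      rw [zpow_add₀ (pow_ne_zero 3 hp), zpow_mul, zpow_natCast, zpow_ofNat, ← pow_mul, pow_mul]; ring
    have e2 : (p ^ 3) ^ (3 * m + t : ℤ) = (p ^ (3 * m + t : ℤ)) ^ 3 := by
      rw [← zpow_natCast, ← zpow_natCast, zpow_comm]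
    have e3 : p ^ (3 * m + t : ℤ) = p ^ (3 * m) * p ^ t := by rw [zpow_add₀ hp, zpow_natCast]
    have e4 : ∀ j : ℕ, th (p ^ 9) (p ^ (3 * (1 + t + j)) * z ^ 3) m
        = (p ^ (3 * m)) ^ j * th (p ^ 9) (p ^ (3 + 3 * t) * z ^ 3) m := by
      intro j
      rw [show p ^ (3 * (1 + t + j)) * z ^ 3 = p ^ (3 + 3 * t) * z ^ 3 * p ^ (3 * j) by ring, th_mul]
      congr 1
      rw [← zpow_natCast, ← zpow_natCast, ← zpow_mul, ← zpow_mul]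
      congr 1; push_cast; ring
    have e5 : th p z (3 * m + t) = th p z t * th (p ^ 9) (p ^ (3 + 3 * t) * z ^ 3) m := by
      rw [th_triple hp hz, ← zpow_natCast p (3 + 3 * t)]; push_cast; rfl
    have h1 := hw0 (3 * m + t)
    simp only [e4, e1, e5]
    rw [e2, ← mul_pow] at h1 ⊢
    have h2 : 1 - p ^ (3 * m + t : ℤ) * w ≠ 0 := by
      intro h
      apply h1
      linear_combination (1 + p ^ (3 * m + t : ℤ) * w + (p ^ (3 * m + t : ℤ) * w) ^ 2) * h
    rw [← sub_eq_zero]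
    have e6 : ∀ j : ℕ, th p z t * (p ^ t * w) ^ j *
        ((p ^ (3 * m)) ^ j * th (p ^ 9) (p ^ (3 + 3 * t) * z ^ 3) m /
          (1 - (p ^ (3 * m + t : ℤ) * w) ^ 3))
        = th p z t * th (p ^ 9) (p ^ (3 + 3 * t) * z ^ 3) m * (p ^ (3 * m + t : ℤ) * w) ^ j
          / (1 - (p ^ (3 * m + t : ℤ) * w) ^ 3) := by
      intro j; rw [e3]; ring
    simp only [e6, Finset.sum_range_succ, Finset.sum_range_zero]
    generalize p ^ (3 * m + t : ℤ) * w = y at *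
    field_simp
    ring
  have hsum : Summable fun r : ℤ => th p z r / (1 - p ^ r * w) := summable_appell hp hp1 hz w
  have hs : ∀ t : ℕ, ∑' m : ℤ, th p z (3 * m + t) / (1 - p ^ (3 * m + t : ℤ) * w)
      = ∑ j ∈ Finset.range 3, th p z t * (p ^ t * w) ^ j *
        appell (p ^ 9) (p ^ (3 * (1 + t + j)) * z ^ 3) (p ^ (3 * t) * w ^ 3) := by
    intro t
    rw [tsum_congr (key t), Summable.tsum_finsetSum]
    · exact Finset.sum_congr rfl fun j _ => tsum_mul_left
    · exact fun j _ => (summable_appell hp9 hq9 (mul_ne_zero (pow_ne_zero _ hp) hz3) _).mul_left _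
  have h0 := hs 0
  have h1 := hs 1
  have h2 := hs 2
  push_cast at h0 h1 h2
  simp only [add_zero] at h0
  rw [appell, tsum_int_residues_three hsum, h0, h1, h2]
  simp [Finset.sum_range_succ]

/-! ### Relations among the mock theta functions -/

/-- The sum `∑ p^{2m²+m}/(1 - p^{2m} w)`: the even-indexed part of an Appell sum of base `p`. -/
def evenAppell (p w : ℂ) : ℂ := ∑' m : ℤ, th (p ^ 4) (-p ^ 3) m / (1 - p ^ (2 * m) * w)

/-- The sum `∑ p^{2m²+3m+1}/(1 - p^{2m+1} w)`: the odd-indexed part of an Appell sum of base `p`. -/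
def oddAppell (p w : ℂ) : ℂ := ∑' m : ℤ, p * th (p ^ 4) (-p ^ 5) m / (1 - p ^ (2 * m + 1) * w)

theorem th_neg_self_even {p : ℂ} (hp : p ≠ 0) (m : ℤ) :
    th p (-p) (2 * m) = th (p ^ 4) (-p ^ 3) m := by
  have := th_double hp (neg_ne_zero.2 hp) 0 m
  rwa [add_zero, th_zero, one_mul, mul_zero, add_zero, zpow_one,
    show -(p * (-p) ^ 2) = -p ^ 3 by ring] at this

theorem th_neg_self_odd {p : ℂ} (hp : p ≠ 0) (m : ℤ) :
    th p (-p) (2 * m + 1) = p * th (p ^ 4) (-p ^ 5) m := by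
  have := th_double hp (neg_ne_zero.2 hp) 1 m
  rwa [th_one hp (neg_ne_zero.2 hp), neg_neg, show -(p ^ (1 + 2 * 1 : ℤ) * (-p) ^ 2) = -p ^ 5 by
    rw [show (1 + 2 * 1 : ℤ) = (3 : ℕ) by norm_num, zpow_natCast]; ring] at this

theorem th_self_even {p : ℂ} (hp : p ≠ 0) (m : ℤ) :
    th p p (2 * m) = th (p ^ 4) (-p ^ 3) m := by
  have := th_double hp hp 0 m
  rwa [add_zero, th_zero, one_mul, mul_zero, add_zero, zpow_one,
    show -(p * p ^ 2) = -p ^ 3 by ring] at this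

theorem th_self_odd {p : ℂ} (hp : p ≠ 0) (m : ℤ) :
    th p p (2 * m + 1) = -(p * th (p ^ 4) (-p ^ 5) m) := by
  have := th_double hp hp 1 m
  rwa [th_one hp hp, show -(p ^ (1 + 2 * 1 : ℤ) * p ^ 2) = -p ^ 5 by
    rw [show (1 + 2 * 1 : ℤ) = (3 : ℕ) by norm_num, zpow_natCast]; ring, neg_mul] at this

theorem summable_evenAppell {p : ℂ} (hp : p ≠ 0) (hp1 : ‖p‖ < 1) (w : ℂ) :
    Summable fun m : ℤ => th (p ^ 4) (-p ^ 3) m / (1 - p ^ (2 * m) * w) := by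
  have := (summable_appell hp hp1 (neg_ne_zero.2 hp) w).comp_injective
    (i := fun m : ℤ => 2 * m) fun a b h => by simpa using h
  refine this.congr fun m => ?_
  rw [Function.comp, th_neg_self_even hp]

theorem summable_oddAppell {p : ℂ} (hp : p ≠ 0) (hp1 : ‖p‖ < 1) (w : ℂ) :
    Summable fun m : ℤ => p * th (p ^ 4) (-p ^ 5) m / (1 - p ^ (2 * m + 1) * w) := by
  have := (summable_appell hp hp1 (neg_ne_zero.2 hp) w).comp_injective
    (i := fun m : ℤ => 2 * m + 1) fun a b h => by simpa using h
  refine this.congr fun m => ?_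
  rw [Function.comp, th_neg_self_odd hp]

theorem appell_neg_self_eq_add {p : ℂ} (hp : p ≠ 0) (hp1 : ‖p‖ < 1) (w : ℂ) :
    appell p (-p) w = evenAppell p w + oddAppell p w := by
  rw [appell, tsum_int_residues_two (summable_appell hp hp1 (neg_ne_zero.2 hp) w)]
  simp only [th_neg_self_even hp, th_neg_self_odd hp]
  rfl

theorem appell_self_eq_sub {p : ℂ} (hp : p ≠ 0) (hp1 : ‖p‖ < 1) (w : ℂ) :
    appell p p w = evenAppell p w - oddAppell p w := by
  rw [appell, tsum_int_residues_two (summable_appell hp hp1 hp w), sub_eq_add_neg, oddAppell,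
    ← tsum_neg]
  simp only [th_self_even hp, th_self_odd hp, neg_div]
  rfl

/-- Multiplying numerator and denominator by `1 + p^{2m} w` turns the even part into Appell sums
of base `p^4`. -/
theorem evenAppell_eq {p w : ℂ} (hp : p ≠ 0) (hp1 : ‖p‖ < 1)
    (hw : ∀ r : ℤ, (p ^ 4) ^ r * w ^ 2 ≠ 1) :
    evenAppell p w = appell (p ^ 4) (-p ^ 3) (w ^ 2) + w * appell (p ^ 4) (-p ^ 5) (w ^ 2) := by
  have hp4 : p ^ 4 ≠ 0 := pow_ne_zero 4 hp
  have hq4 := norm_pow_lt_one hp1 four_pos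
  have hp3 : -p ^ 3 ≠ 0 := neg_ne_zero.2 (pow_ne_zero 3 hp)
  have hp5 : -p ^ 5 ≠ 0 := neg_ne_zero.2 (pow_ne_zero 5 hp)
  rw [appell, appell, ← tsum_mul_left, ← (summable_appell hp4 hq4 hp3 _).tsum_add
    ((summable_appell hp4 hq4 hp5 _).mul_left _)]
  refine tsum_congr fun m => ?_
  have e1 : (p ^ 4) ^ m = (p ^ (2 * m)) ^ 2 := by
    rw [← zpow_natCast, ← zpow_natCast, ← zpow_mul, ← zpow_mul]; congr 1; push_cast; ring
  have e2 : th (p ^ 4) (-p ^ 5) m = p ^ (2 * m) * th (p ^ 4) (-p ^ 3) m := by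
    rw [show -p ^ 5 = -p ^ 3 * p ^ 2 by ring, th_mul, sq_zpow]
  have h1 := sub_ne_zero.2 (hw m).symm
  rw [e2, e1, ← mul_pow] at *
  have h2 : 1 - p ^ (2 * m) * w ≠ 0 := fun h => h1 (by
    linear_combination (1 + p ^ (2 * m) * w) * h)
  rw [div_eq_iff h2]
  have e3 : 1 - (p ^ (2 * m) * w) ^ 2 = (1 - p ^ (2 * m) * w) * (1 + p ^ (2 * m) * w) := by ring
  rw [e3] at h1 ⊢
  have h3 := right_ne_zero_of_mul h1
  generalize p ^ (2 * m) = y at *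
  rw [mul_div_assoc', ← add_div, div_mul_eq_mul_div, eq_div_iff h1]
  ring

/-- The even part of an Appell sum of base `p` is the mean of two Appell sums, one of which is a
theta quotient. -/
theorem two_mul_evenAppell {p w : ℂ} (hp : p ≠ 0) (hp1 : ‖p‖ < 1) (hw0 : w ≠ 0)
    (hw : ∀ r : ℤ, p ^ r * w ≠ 1) :
    2 * evenAppell p w = appell p (-p) w + qInf p p ^ 3 / jac w p := by
  rw [← appell_self hp hp1 hw0 hw, appell_neg_self_eq_add hp hp1, appell_self_eq_sub hp hp1]
  ring

theorem jac_neg_one_eq_two_mul {p : ℂ} (hp : p ≠ 0) (hp1 : ‖p‖ < 1) :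
    jac (-1) p = 2 * jac (-p) (p ^ 4) := by
  have h := jac_self_div (pow_ne_zero 4 hp) (-p)
  rw [show p ^ 4 / -p = -p ^ 3 by field_simp] at h
  rw [jac_double hp hp1 (by norm_num), show (-1 : ℂ) ^ 2 = 1 by norm_num, mul_one, mul_one, h]
  ring

/-- The prefactor of the Appell sums in `A2_eq` and `U08_eq` is the reciprocal of the theta
function `jac q (q^4)`. -/
theorem jac_pow_four_mul {q : ℂ} (hq0 : q ≠ 0) (hq : ‖q‖ < 1) :
    jac q (q ^ 4) * qInf (-q) (q ^ 2) = qInf (q ^ 2) (q ^ 2) := by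
  have hq2 := norm_pow_lt_one hq two_pos
  have h1 := qInf_mul_neg hq2 q
  have h2 := qInf_residues hq2 q (k := 2) two_pos
  have h3 := qInf_residues hq2 (q ^ 2) (k := 2) two_pos
  simp only [Finset.prod_range_succ, Finset.prod_range_zero, one_mul, ← pow_mul]
    at h1 h2 h3
  norm_num at h1 h2 h3
  rw [← pow_succ] at h2
  rw [← pow_add] at h3
  rw [jac, show q ^ 4 / q = q ^ 3 by field_simp]
  norm_num at h1 h2 h3
  rw [h2] at h1
  rw [h3]
  linear_combination qInf (q ^ 4) (q ^ 4) * h1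

theorem jac_self_pow_four_ne_zero {q : ℂ} (hq0 : q ≠ 0) (hq : ‖q‖ < 1) : jac q (q ^ 4) ≠ 0 := by
  have h := jac_pow_four_mul hq0 hq
  have := qInf_ne_zero_of_lt (norm_pow_lt_one hq two_pos) (norm_pow_lt_one hq two_pos)
  rw [← h] at this
  exact left_ne_zero_of_mul this

theorem qInf_div_eq_inv_jac {q : ℂ} (hq0 : q ≠ 0) (hq : ‖q‖ < 1) :
    qInf (-q) (q ^ 2) / qInf (q ^ 2) (q ^ 2) = (jac q (q ^ 4))⁻¹ := by
  have h := jac_pow_four_mul hq0 hq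
  have h1 := qInf_ne_zero_of_lt (norm_pow_lt_one hq two_pos) (norm_pow_lt_one hq two_pos)
  rw [div_eq_iff h1, ← h, inv_mul_cancel_left₀ (jac_self_pow_four_ne_zero hq0 hq)]

theorem A2_eq_div {q : ℂ} (hq0 : q ≠ 0) (hq : ‖q‖ < 1) :
    A2 q = q * appell (q ^ 4) (q ^ 5) (q ^ 2) / jac q (q ^ 4) := by
  rw [A2_eq hq0 hq, qInf_div_eq_inv_jac hq0 hq]; ring

theorem U08_eq_div {q : ℂ} (hq0 : q ≠ 0) (hq : ‖q‖ < 1) :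
    U08 q = 2 * appell (q ^ 4) (q ^ 3) (-1) / jac q (q ^ 4) := by
  rw [U08_eq hq0 hq, qInf_div_eq_inv_jac hq0 hq]; ring

theorem mu2_eq_div {q : ℂ} (hq0 : q ≠ 0) (hq : ‖q‖ < 1) :
    mu2 q = 2 * evenAppell q (-1) / jac (-q) (q ^ 4) := by
  have h := qInf_div_eq_inv_jac (neg_ne_zero.2 hq0) (by rwa [norm_neg])
  rw [neg_neg, neg_sq, show (-q) ^ 4 = q ^ 4 by ring] at h
  have e : evenAppell q (-1) = ∑' r : ℤ, q ^ (2 * r ^ 2 + r) / (1 + q ^ (2 * r)) := by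
    refine tsum_congr fun r => ?_
    rw [mul_neg_one, sub_neg_eq_add, th, te_pow_four]
    congr 1
    have e1 : (-1 : ℂ) ^ r * (-1) ^ r = 1 := by rw [← mul_zpow]; norm_num
    have e2 : q ^ (2 * r ^ 2 + r) = q ^ (2 * (r * (r - 1))) * (q ^ 3) ^ r := by
      rw [← zpow_natCast q 3, ← zpow_mul, ← zpow_add₀ hq0]; congr 1; push_cast; ring
    rw [neg_eq_neg_one_mul (q ^ 3), mul_zpow, e2]
    linear_combination q ^ (2 * (r * (r - 1))) * (q ^ 3) ^ r * e1
  rw [mu2_eq hq0 hq, h, e]; ring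

/-- The mock theta function `φ₆` in terms of an Appell sum to which the even-odd splitting
applies. -/
theorem phi6_eq_appell_neg_self {q : ℂ} (hq0 : q ≠ 0) (hq : ‖q‖ < 1) :
    phi6 q = 2 * appell (q ^ 3) (-q ^ 3) (-q) / jac (-1) (q ^ 3) := by
  have hp : q ^ 3 ≠ 0 := pow_ne_zero 3 hq0
  have hp1 := norm_pow_lt_one hq three_pos
  have hnp := neg_ne_zero.2 hp
  have hn1 : (-1 : ℂ) ≠ 0 := by norm_num
  have hw := neg_ne_zero.2 (pow_ne_zero 2 hq0)
  have hwn := zpow_mul_neg_pow_ne_one hq0 hq 3 2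
  have h1 := appell_inv hp (-1) hw
  have h2 := appell_mul_left hp hp1 hnp hw hwn
  have h3 := appell_inv hp (-q ^ 3) (neg_ne_zero.2 hq0)
  have h4 := appell_mul_right hp hp1 hnp (inv_ne_zero (neg_ne_zero.2 hq0)) fun r => by
    have := zpow_mul_neg_zpow_ne_one hq0 hq 3 (-1) r
    rwa [zpow_neg_one, ← inv_neg] at this
  rw [show q ^ 3 * (-q)⁻¹ = -q ^ 2 by field_simp, h3, show (q ^ 3) ^ 2 / -q ^ 3 = -q ^ 3 by
    field_simp, show -q ^ 2 / -q ^ 3 = q⁻¹ by field_simp] at h4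
  rw [show (q ^ 3) ^ 2 / -1 = q ^ 3 * -q ^ 3 by ring, h2, h4] at h1
  rw [phi6_eq hq0 hq, show -q ^ (-2 : ℤ) = (-q ^ 2)⁻¹ by rw [inv_neg, zpow_neg]; rfl, h1]
  congr 2
  field_simp
  ring

/-- `φ₆(-q)` in terms of Appell sums of base `q^12`. -/
theorem phi6_neg_eq {q : ℂ} (hq0 : q ≠ 0) (hq : ‖q‖ < 1) :
    phi6 (-q) = (2 * (appell (q ^ 12) (q ^ 9) (q ^ 2) + q * appell (q ^ 12) (q ^ 15) (q ^ 2))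
      - qInf (-q ^ 3) (-q ^ 3) ^ 3 / jac q (-q ^ 3)) / jac (q ^ 3) (q ^ 12) := by
  have hp : -q ^ 3 ≠ 0 := neg_ne_zero.2 (pow_ne_zero 3 hq0)
  have hp1 : ‖-q ^ 3‖ < 1 := by rw [norm_neg]; exact norm_pow_lt_one hq three_pos
  have h1 := phi6_eq_appell_neg_self (neg_ne_zero.2 hq0) (by rwa [norm_neg])
  rw [show (-q) ^ 3 = -q ^ 3 by ring, neg_neg q, jac_neg_one_eq_two_mul hp hp1] at h1
  have e4 : (-q ^ 3) ^ 4 = q ^ 12 := by ring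
  have hw2 : ∀ r : ℤ, ((-q ^ 3) ^ 4) ^ r * q ^ 2 ≠ 1 := by
    rw [e4]; exact zpow_mul_pow_ne_one hq0 hq (by norm_num)
  have hw : ∀ r : ℤ, (-q ^ 3) ^ r * q ≠ 1 := by
    intro r h
    refine zpow_mul_pow_ne_one hq0 hq (N := 6) (m := 2) (by norm_num) r ?_
    rw [show q ^ 6 = (-q ^ 3) ^ 2 by ring, sq_zpow, mul_comm 2 r, zpow_mul]
    have := congrArg (· ^ 2) h
    simpa [mul_pow] using this
  have h2 := two_mul_evenAppell hp hp1 hq0 hw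
  rw [evenAppell_eq hp hp1 hw2, e4, show -(-q ^ 3) ^ 3 = q ^ 9 by ring,
    show -(-q ^ 3) ^ 5 = q ^ 15 by ring] at h2
  rw [h1, e4, h2, neg_neg, add_sub_cancel_right, mul_div_mul_left _ _ two_ne_zero]

/-- The two Appell sums are exchanged by `w ↦ w⁻¹` followed by `w ↦ p w`. -/
theorem appell_pow_three_add {q : ℂ} (hq0 : q ≠ 0) (hq : ‖q‖ < 1) :
    appell (q ^ 4) (-q ^ 3) (q ^ 2) + q * appell (q ^ 4) (-q ^ 5) (q ^ 2) = jac (-q) (q ^ 4) := by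
  have hp : q ^ 4 ≠ 0 := pow_ne_zero 4 hq0
  have hp1 := norm_pow_lt_one hq four_pos
  have hq2 := pow_ne_zero 2 hq0
  have h1 := appell_inv hp (-q ^ 5) hq2
  have h2 := appell_mul_right hp hp1 (neg_ne_zero.2 (pow_ne_zero 5 hq0)) (inv_ne_zero hq2) fun r => by
    have := zpow_mul_zpow_ne_one hq0 hq (N := 4) (m := -2) (by norm_num) r
    rwa [zpow_neg, show q ^ (2 : ℤ) = q ^ 2 from rfl] at this
  have h3 := jac_mul_left_self hp hp1 (neg_ne_zero.2 hq0)
  rw [show q ^ 4 * -q = -q ^ 5 by ring] at h3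
  rw [h1, h3, show q ^ 4 * (q ^ 2)⁻¹ = q ^ 2 by field_simp, show (q ^ 4) ^ 2 / -q ^ 5 = -q ^ 3 by
    field_simp] at h2
  rw [h2]
  field_simp
  ring

/-- `μ₂(q) + 4 A₂(-q)` is a theta quotient. -/
theorem mu2_eq_A2 {q : ℂ} (hq0 : q ≠ 0) (hq : ‖q‖ < 1) :
    mu2 q = -4 * A2 (-q) + qInf q q ^ 3 / jac (-q) (q ^ 4) ^ 2 := by
  have hn : ∀ r : ℤ, q ^ r * -1 ≠ 1 := fun r => by
    simpa using zpow_mul_neg_pow_ne_one hq0 hq 1 0 r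
  have h1 := appell_self_eq_sub hq0 hq (-1)
  rw [appell_self hq0 hq (by norm_num) hn, jac_neg_one_eq_two_mul hq0 hq] at h1
  have h4 : ∀ r : ℤ, (q ^ 4) ^ r * (-q) ^ 2 ≠ 1 := by
    rw [neg_sq]; exact zpow_mul_pow_ne_one hq0 hq (by norm_num)
  have h2 := evenAppell_eq hq0 hq h4
  rw [neg_sq] at h2
  have h3 := appell_pow_three_add hq0 hq
  have hp : q ^ 4 ≠ 0 := pow_ne_zero 4 hq0
  have hp1 := norm_pow_lt_one hq four_pos
  have hp3 : -q ^ 3 ≠ 0 := neg_ne_zero.2 (pow_ne_zero 3 hq0)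
  have hp5 : -q ^ 5 ≠ 0 := neg_ne_zero.2 (pow_ne_zero 5 hq0)
  -- The even part at `w = -q` and the odd part at `w = -1` have the same denominators; their sum
  -- is a theta series.
  have h5 : evenAppell q (-q) + oddAppell q (-1) = jac (-q) (q ^ 4) := by
    have e : q ^ 4 / -q = -q ^ 3 := by field_simp
    rw [← jac_self_div hp (-q), e, ← tsum_th hp hp1 hp3, evenAppell, oddAppell]
    rw [← (summable_evenAppell hq0 hq (-q)).tsum_add (summable_oddAppell hq0 hq (-1))]
    refine tsum_congr fun m => ?_
    have e2 : th (q ^ 4) (-q ^ 5) m = q ^ (2 * m) * th (q ^ 4) (-q ^ 3) m := by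
      rw [show -q ^ 5 = -q ^ 3 * q ^ 2 by ring, th_mul, sq_zpow]
    have e3 : 1 - q ^ (2 * m) * -q ≠ 0 := by
      rw [mul_neg, ← zpow_add_one₀ hq0, ← mul_neg_one]
      exact sub_ne_zero.2 (hn _).symm
    have e4 : 1 - q ^ (2 * m + 1) * -1 = 1 - q ^ (2 * m) * -q := by
      rw [zpow_add_one₀ hq0]; ring
    rw [e4, e2, ← add_div, div_eq_iff e3]
    ring
  have h6 := A2_eq_div (neg_ne_zero.2 hq0) (by rwa [norm_neg])
  rw [neg_sq, show (-q) ^ 4 = q ^ 4 by ring, show (-q) ^ 5 = -q ^ 5 by ring] at h6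
  have h7 := jac_self_pow_four_ne_zero (neg_ne_zero.2 hq0) (by rwa [norm_neg])
  rw [show (-q) ^ 4 = q ^ 4 by ring] at h7
  rw [mu2_eq_div hq0 hq, h6]
  have h8 : evenAppell q (-1) = 2 * q * appell (q ^ 4) (-q ^ 5) (q ^ 2)
      + qInf q q ^ 3 / (2 * jac (-q) (q ^ 4)) := by
    linear_combination -h3 - h2 - h1 + h5
  rw [h8]
  field_simp
  ring

/-- `U_{0,8}(q) + 2 A₂(-q)` is a theta quotient. -/
theorem U08_eq_A2 {q : ℂ} (hq0 : q ≠ 0) (hq : ‖q‖ < 1) :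
    U08 q = -2 * A2 (-q) + 2 * qInf (q ^ 4) (q ^ 4) ^ 3 * jac (-q ^ 2) (q ^ 4) /
      (jac (-1) (q ^ 4) * jac (q ^ 2) (q ^ 4) * jac (-q) (q ^ 4)) := by
  have hp : q ^ 4 ≠ 0 := pow_ne_zero 4 hq0
  have hp1 := norm_pow_lt_one hq four_pos
  -- The change of parameters that takes `w = -1` to `w = q²` and `z = q³` to `z = -q⁵`.
  have h1 := jac_mul_appell_sub hp hp1 (z := q ^ 3) (w := -1) (l := -q ^ 2) (pow_ne_zero 3 hq0)
    (by norm_num) (neg_ne_zero.2 (pow_ne_zero 2 hq0)) (zpow_mul_neg_pow_ne_one hq0 hq 4 2)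
    (fun r => by simpa using zpow_mul_neg_pow_ne_one hq0 hq 4 0 r)
    (fun r => by simpa using zpow_mul_pow_ne_one hq0 hq (N := 4) (m := 2) (by norm_num) r)
  have a1 := jac_mul_left_self hp hp1 (neg_ne_zero.2 hq0)
  have a2 := jac_mul_left_self hp hp1 hq0
  have a3 := jac_self_div hp q
  rw [show q ^ 4 / q = q ^ 3 by field_simp] at a3
  rw [show -q ^ 2 * q ^ 3 = q ^ 4 * -q by ring, show -q ^ 2 * -1 = q ^ 2 by ring,
    show q ^ 4 * -q * -1 = q ^ 4 * q by ring, a1, a2, a3] at h1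
  have h6 := A2_eq_div (neg_ne_zero.2 hq0) (by rwa [norm_neg])
  rw [neg_sq, show (-q) ^ 4 = q ^ 4 by ring, show (-q) ^ 5 = q ^ 4 * -q by ring] at h6
  have h7 := jac_self_pow_four_ne_zero (neg_ne_zero.2 hq0) (by rwa [norm_neg])
  rw [show (-q) ^ 4 = q ^ 4 by ring] at h7
  have h8 := jac_self_pow_four_ne_zero hq0 hq
  rw [U08_eq_div hq0 hq, h6]
  have h9 : jac (-1) (q ^ 4) ≠ 0 := jac_ne_zero hp hp1 (by norm_num)
    (fun r => by simpa using zpow_mul_neg_pow_ne_one hq0 hq 4 0 r)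
  have h10 : jac (q ^ 2) (q ^ 4) ≠ 0 := jac_ne_zero hp hp1 (pow_ne_zero 2 hq0)
    (fun r => by simpa using zpow_mul_pow_ne_one hq0 hq (N := 4) (m := 2) (by norm_num) r)
  generalize jac (-q) (q ^ 4) = J at *
  generalize jac q (q ^ 4) = K at *
  generalize appell (q ^ 4) (q ^ 4 * -q) (q ^ 2) = X at *
  generalize jac (-q ^ 2) (q ^ 4) = J2 at *
  have h11 : appell (q ^ 4) (q ^ 3) (-1) = q / J * (K * X + q⁻¹ * K * qInf (q ^ 4) (q ^ 4) ^ 3 * J2 /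
      (jac (-1) (q ^ 4) * jac (q ^ 2) (q ^ 4))) := by
    rw [eq_comm, div_mul_eq_mul_div, div_eq_iff h7]
    rw [inv_neg, neg_neg] at h1
    have h12 : q * q⁻¹ = 1 := mul_inv_cancel₀ hq0
    linear_combination q * h1 + J * appell (q ^ 4) (q ^ 3) (-1) * h12
  rw [h11]
  field_simp

/-- `q B₂(q)` in terms of an Appell sum, up to a theta quotient. -/
theorem B2_eq_sub {q : ℂ} (hq0 : q ≠ 0) (hq : ‖q‖ < 1) :
    jac (q ^ 2) (q ^ 4) * (q * B2 q) = q * (qInf (q ^ 4) (q ^ 4) ^ 3 / jac (q ^ 2) (q ^ 4))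
      - appell (q ^ 4) (q ^ 2) (q ^ (-2 : ℤ)) := by
  have hp : q ^ 4 ≠ 0 := pow_ne_zero 4 hq0
  have hp1 := norm_pow_lt_one hq four_pos
  have hq2 := norm_pow_lt_one hq two_pos
  have hqq := pow_ne_zero 2 hq0
  have hw := zpow_mul_pow_ne_one hq0 hq (N := 4) (m := 2) (by norm_num)
  have h1 : jac (q ^ 2) (q ^ 4) * qInf (-q ^ 2) (q ^ 2) = qInf (q ^ 2) (q ^ 2) := by
    have a1 := qInf_mul_qInf_neg_self hq2
    have a2 := qInf_residues hq2 (q ^ 2) (k := 2) two_pos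
    simp only [Finset.prod_range_succ, Finset.prod_range_zero, one_mul, ← pow_mul] at a1 a2
    norm_num at a1 a2
    rw [← pow_add] at a2
    norm_num at a2
    rw [jac, show q ^ 4 / q ^ 2 = q ^ 2 by field_simp, a2]
    linear_combination qInf (q ^ 2) (q ^ 4) * qInf (q ^ 4) (q ^ 4) * a1
  -- Multiplying numerator and denominator by `1 + q^{2r+1}` splits the bilateral series into two
  -- Appell sums of base `q^4`; the first of them is a theta quotient by `appell_self`.
  have h2 : ∑' r : ℤ, (-1) ^ r * q ^ (2 * r ^ 2 + 2 * r) / (1 - q ^ (2 * r + 1))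
      = appell (q ^ 4) (q ^ 4) (q ^ 2) + q * appell (q ^ 4) (q ^ 6) (q ^ 2) := by
    rw [appell, appell, ← tsum_mul_left, ← (summable_appell hp hp1 hp _).tsum_add
      ((summable_appell hp hp1 (pow_ne_zero 6 hq0) _).mul_left _)]
    refine tsum_congr fun r => ?_
    have e1 : (q ^ 4) ^ r = (q ^ (2 * r)) ^ 2 := by
      rw [← zpow_natCast, ← zpow_natCast, ← zpow_mul, ← zpow_mul]; congr 1; push_cast; ring
    have e2 : th (q ^ 4) (q ^ 6) r = q ^ (2 * r) * th (q ^ 4) (q ^ 4) r := by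
      rw [show q ^ 6 = q ^ 4 * q ^ 2 by ring, th_mul, sq_zpow]
    have e3 : (-1) ^ r * q ^ (2 * r ^ 2 + 2 * r) = th (q ^ 4) (q ^ 4) r := by
      rw [th, te_pow_four, mul_assoc, ← zpow_natCast q 4, ← zpow_mul, ← zpow_add₀ hq0]
      congr 2; push_cast; ring
    have h3 := sub_ne_zero.2 (hw r).symm
    rw [e3, e2, e1, zpow_add_one₀ hq0]
    rw [e1, ← mul_pow] at h3
    have e4 : 1 - (q ^ (2 * r) * q) ^ 2 = (1 - q ^ (2 * r) * q) * (1 + q ^ (2 * r) * q) := by ring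
    rw [e4] at h3
    have h5 := left_ne_zero_of_mul h3
    rw [← mul_pow, e4, div_eq_iff h5, mul_div_assoc', ← add_div, div_mul_eq_mul_div,
      eq_div_iff h3]
    ring
  have h3 := appell_inv hp (q ^ 2) hqq
  rw [show (q ^ 4) ^ 2 / q ^ 2 = q ^ 6 by field_simp] at h3
  rw [zpow_neg, show q ^ (2 : ℤ) = q ^ 2 from rfl, h3, B2_eq hq0 hq, h2, ← h1,
    appell_self hp hp1 hqq hw]
  have h4 := qInf_ne_zero_of_lt hq2 hq2
  rw [← h1] at h4
  have h5 := left_ne_zero_of_mul h4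
  have h6 := right_ne_zero_of_mul h4
  generalize jac (q ^ 2) (q ^ 4) = J at *
  generalize qInf (-q ^ 2) (q ^ 2) = K at *
  field_simp
  ring

/-! ### Special values of theta functions as products of the `Theta m` -/

theorem qInf_self_sq {q : ℂ} (hq : ‖q‖ < 1) : qInf q (q ^ 2) = Theta 1 q / Theta 2 q := by
  rw [eq_div_iff (Theta_ne_zero hq two_pos), Theta_eq_qInf, Theta_eq_qInf, pow_one]
  have h := qInf_residues hq q (k := 2) two_pos
  simp only [Finset.prod_range_succ, Finset.prod_range_zero, one_mul, pow_zero, pow_one] at h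
  rw [h, ← pow_two]

theorem qInf_neg_self_sq {q : ℂ} (hq : ‖q‖ < 1) :
    qInf (-q) (q ^ 2) = Theta 2 q ^ 2 / (Theta 1 q * Theta 4 q) := by
  have h1 := qInf_mul_neg (norm_pow_lt_one hq two_pos) q
  have h2 := qInf_self_sq (norm_pow_lt_one hq two_pos)
  rw [h2, qInf_self_sq hq, Theta_pow, Theta_pow] at h1
  norm_num at h1
  have n1 := Theta_ne_zero hq one_pos
  have n2 := Theta_ne_zero hq two_pos
  have n4 := Theta_ne_zero hq four_pos
  field_simp at h1 ⊢
  linear_combination h1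

theorem Theta_one_neg {q : ℂ} (hq : ‖q‖ < 1) :
    Theta 1 (-q) = Theta 2 q ^ 3 / (Theta 1 q * Theta 4 q) := by
  have h := qInf_residues (q := -q) (by rwa [norm_neg]) (-q) (k := 2) two_pos
  simp only [Finset.prod_range_succ, Finset.prod_range_zero, one_mul, pow_zero, pow_one,
    neg_sq, ← pow_two] at h
  rw [Theta_eq_qInf, pow_one, h, qInf_neg_self_sq hq, ← Theta_eq_qInf]
  ring

theorem Theta_neg_of_even {m : ℕ} (hm : Even m) (q : ℂ) : Theta m (-q) = Theta m q := by
  simp only [Theta, (hm.mul_right _).neg_pow]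

theorem Theta_neg_of_odd {m : ℕ} (hm : Odd m) {q : ℂ} (hq : ‖q‖ < 1) :
    Theta m (-q) = Theta (2 * m) q ^ 3 / (Theta m q * Theta (4 * m) q) := by
  rw [← Theta_eq_qInf_pow, hm.neg_pow, Theta_one_neg (norm_pow_lt_one hq hm.pos), Theta_pow,
    Theta_pow, Theta_pow, mul_one, mul_comm m 2, mul_comm m 4]

theorem jac_self_sq {q : ℂ} (hq0 : q ≠ 0) (hq : ‖q‖ < 1) :
    jac q (q ^ 2) = Theta 1 q ^ 2 / Theta 2 q := by
  have n2 := Theta_ne_zero hq two_pos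
  rw [jac, show q ^ 2 / q = q by field_simp, qInf_self_sq hq, ← Theta_eq_qInf]
  field_simp

theorem jac_self_four {q : ℂ} (hq0 : q ≠ 0) (hq : ‖q‖ < 1) :
    jac q (q ^ 4) = Theta 1 q * Theta 4 q / Theta 2 q := by
  have h := jac_pow_four_mul hq0 hq
  rw [qInf_neg_self_sq hq, ← Theta_eq_qInf] at h
  have n1 := Theta_ne_zero hq one_pos
  have n2 := Theta_ne_zero hq two_pos
  have n4 := Theta_ne_zero hq four_pos
  field_simp at h ⊢
  exact h

theorem jac_self_cube {q : ℂ} (hq0 : q ≠ 0) (hq : ‖q‖ < 1) : jac q (q ^ 3) = Theta 1 q := by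
  have h := qInf_residues hq q (k := 3) three_pos
  simp only [Finset.prod_range_succ, Finset.prod_range_zero, one_mul, pow_zero, pow_one] at h
  rw [jac, show q ^ 3 / q = q * q by field_simp, Theta_eq_qInf, pow_one, h, ← pow_succ]

theorem jac_neg_self_cube {q : ℂ} (hq0 : q ≠ 0) (hq : ‖q‖ < 1) :
    jac (-q) (q ^ 3) = Theta 2 q * Theta 3 q ^ 2 / (Theta 1 q * Theta 6 q) := by
  have h := jac_mul_jac_neg (norm_pow_lt_one hq three_pos) q
  rw [jac_self_cube hq0 hq, show (q ^ 3) ^ 2 = (q ^ 2) ^ 3 by ring,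
    jac_self_cube (pow_ne_zero 2 hq0) (norm_pow_lt_one hq two_pos), ← pow_mul, Theta_pow,
    ← Theta_eq_qInf, ← Theta_eq_qInf] at h
  norm_num at h
  have n1 := Theta_ne_zero hq one_pos
  have n6 := Theta_ne_zero hq (m := 6) (by norm_num)
  rw [eq_div_iff (mul_ne_zero n1 n6), ← mul_assoc, mul_comm (jac (-q) _), h,
    div_mul_cancel₀ _ n6]

theorem jac_self_six {q : ℂ} (hq0 : q ≠ 0) (hq : ‖q‖ < 1) :
    jac q (q ^ 6) = Theta 1 q * Theta 6 q ^ 2 / (Theta 2 q * Theta 3 q) := by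
  have hq2 := norm_pow_lt_one hq two_pos
  have h := qInf_residues hq2 q (k := 3) three_pos
  simp only [Finset.prod_range_succ, Finset.prod_range_zero, one_mul, ← pow_mul, ← pow_succ] at h
  norm_num at h
  have h3 := qInf_self_sq (norm_pow_lt_one hq three_pos)
  rw [Theta_pow, Theta_pow, ← pow_mul] at h3
  norm_num at h3
  rw [h3, qInf_self_sq hq] at h
  have n1 := Theta_ne_zero hq one_pos
  have n2 := Theta_ne_zero hq two_pos
  have n3 := Theta_ne_zero hq three_pos
  have n6 := Theta_ne_zero hq (m := 6) (by norm_num)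
  rw [jac, show q ^ 6 / q = q ^ 5 by field_simp, ← Theta_eq_qInf]
  field_simp at h ⊢
  linear_combination -h

theorem jac_sq_six {q : ℂ} (hq0 : q ≠ 0) (hq : ‖q‖ < 1) : jac (q ^ 2) (q ^ 6) = Theta 2 q := by
  have h := jac_self_cube (pow_ne_zero 2 hq0) (norm_pow_lt_one hq two_pos)
  rwa [← pow_mul, Theta_pow] at h

theorem jac_cube_six {q : ℂ} (hq0 : q ≠ 0) (hq : ‖q‖ < 1) :
    jac (q ^ 3) (q ^ 6) = Theta 3 q ^ 2 / Theta 6 q := by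
  have h := jac_self_sq (pow_ne_zero 3 hq0) (norm_pow_lt_one hq three_pos)
  rwa [← pow_mul, Theta_pow, Theta_pow] at h

theorem jac_neg_one_eq {q : ℂ} (hq : ‖q‖ < 1) :
    jac (-1) q = 2 * Theta 2 q ^ 2 / Theta 1 q := by
  have h := qInf_mul_qInf_neg_self hq
  rw [qInf_self_sq hq] at h
  have n1 := Theta_ne_zero hq (m := 1) (by norm_num)
  have n2 := Theta_ne_zero hq (m := 2) (by norm_num)
  have e : qInf q q = Theta 1 q := by rw [Theta_eq_qInf, pow_one]
  have : qInf (-q) q = Theta 2 q / Theta 1 q := by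
    field_simp at h ⊢
    linear_combination h
  rw [jac_neg_one hq, e, this]
  field_simp

theorem jac_neg_one_six {q : ℂ} (hq : ‖q‖ < 1) :
    jac (-1) (q ^ 6) = 2 * Theta 12 q ^ 2 / Theta 6 q := by
  simpa only [Theta_pow, Nat.reduceMul] using
    jac_neg_one_eq (norm_pow_lt_one hq (m := 6) (by norm_num))

theorem jac_neg_six {q : ℂ} (hq : ‖q‖ < 1) {x : ℂ} (hx : jac x (q ^ 6) ≠ 0) :
    jac (-x) (q ^ 6)
      = jac (x ^ 2) ((q ^ 2) ^ 6) * Theta 6 q ^ 2 / (Theta 12 q * jac x (q ^ 6)) := by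
  have h := jac_mul_jac_neg (norm_pow_lt_one hq (m := 6) (by norm_num)) x
  rw [show (q ^ 6) ^ 2 = (q ^ 2) ^ 6 by ring, ← pow_mul, ← Theta_eq_qInf, ← Theta_eq_qInf] at h
  have n12 := Theta_ne_zero hq (m := 2 * 6) (by norm_num)
  rw [eq_div_iff (mul_ne_zero n12 hx), mul_comm, mul_assoc, h, mul_div_cancel₀ _ n12, pow_mul q 2 6]

theorem jac_neg_self_six {q : ℂ} (hq0 : q ≠ 0) (hq : ‖q‖ < 1) :
    jac (-q) (q ^ 6) = Theta 2 q ^ 2 * Theta 3 q * Theta 12 q /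
      (Theta 1 q * Theta 4 q * Theta 6 q) := by
  have n1 := Theta_ne_zero hq one_pos
  have n2 := Theta_ne_zero hq two_pos
  have n3 := Theta_ne_zero hq three_pos
  have n4 := Theta_ne_zero hq four_pos
  have n6 := Theta_ne_zero hq (m := 6) (by norm_num)
  have n12 := Theta_ne_zero hq (m := 12) (by norm_num)
  have h1 := jac_self_six hq0 hq
  have hx : jac q (q ^ 6) ≠ 0 := by rw [h1]; positivity
  rw [jac_neg_six hq hx, h1, jac_self_six (pow_ne_zero 2 hq0) (norm_pow_lt_one hq two_pos)]
  simp only [Theta_pow]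
  norm_num
  field_simp

theorem jac_neg_sq_six {q : ℂ} (hq0 : q ≠ 0) (hq : ‖q‖ < 1) :
    jac (-q ^ 2) (q ^ 6) = Theta 4 q * Theta 6 q ^ 2 / (Theta 2 q * Theta 12 q) := by
  have n2 := Theta_ne_zero hq two_pos
  have n12 := Theta_ne_zero hq (m := 12) (by norm_num)
  have h1 := jac_sq_six hq0 hq
  have hx : jac (q ^ 2) (q ^ 6) ≠ 0 := by rw [h1]; exact n2
  rw [jac_neg_six hq hx, h1, jac_sq_six (pow_ne_zero 2 hq0) (norm_pow_lt_one hq two_pos)]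
  simp only [Theta_pow]
  norm_num
  field_simp

theorem jac_neg_cube_six {q : ℂ} (hq0 : q ≠ 0) (hq : ‖q‖ < 1) :
    jac (-q ^ 3) (q ^ 6) = Theta 6 q ^ 5 / (Theta 3 q ^ 2 * Theta 12 q ^ 2) := by
  have n3 := Theta_ne_zero hq three_pos
  have n6 := Theta_ne_zero hq (m := 6) (by norm_num)
  have n12 := Theta_ne_zero hq (m := 12) (by norm_num)
  have h1 := jac_cube_six hq0 hq
  have hx : jac (q ^ 3) (q ^ 6) ≠ 0 := by rw [h1]; positivity
  have h2 := jac_cube_six (pow_ne_zero 2 hq0) (norm_pow_lt_one hq two_pos)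
  rw [← pow_mul, mul_comm 2 3, pow_mul] at h2
  rw [jac_neg_six hq hx, h1, h2]
  simp only [Theta_pow]
  norm_num
  field_simp

/-! ### The Hauptmodul of level 12 -/

/-- A Hauptmodul of level 12. The five functions `p`, `1 - p`, `1 + p`, `1 + 2p`, `2 + p` are
theta quotients, and every theta quotient of level 12 and weight 0 that occurs below is a monomial
in them. -/
def etaP (q : ℂ) : ℂ :=
  2 * q * Theta 2 q ^ 3 * Theta 3 q ^ 3 * Theta 12 q ^ 6 /
    (Theta 1 q * Theta 4 q ^ 2 * Theta 6 q ^ 9)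

theorem jac_neg_inv_six {q : ℂ} (hq0 : q ≠ 0) (hq : ‖q‖ < 1) :
    jac (-q⁻¹) (q ^ 6) = q⁻¹ * jac (-q) (q ^ 6) := by
  have h := jac_inv (pow_ne_zero 6 hq0) (norm_pow_lt_one hq (m := 6) (by norm_num))
    (neg_ne_zero.2 hq0)
  rwa [inv_neg, neg_neg] at h

theorem jac_pow_four_six {q : ℂ} (hq0 : q ≠ 0) (hq : ‖q‖ < 1) :
    jac (q ^ 4) (q ^ 6) = Theta 2 q := by
  rw [← jac_self_div (pow_ne_zero 6 hq0), show q ^ 6 / q ^ 4 = q ^ 2 by field_simp,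
    jac_sq_six hq0 hq]

theorem jac_neg_pow_four_six {q : ℂ} (hq0 : q ≠ 0) :
    jac (-q ^ 4) (q ^ 6) = jac (-q ^ 2) (q ^ 6) := by
  rw [← jac_self_div (pow_ne_zero 6 hq0), show q ^ 6 / -q ^ 4 = -q ^ 2 by field_simp]

theorem jac_neg_pow_five_six {q : ℂ} (hq0 : q ≠ 0) :
    jac (-q ^ 5) (q ^ 6) = jac (-q) (q ^ 6) := by
  rw [← jac_self_div (pow_ne_zero 6 hq0), show q ^ 6 / -q ^ 5 = -q by field_simp]

/-- An instance of the relation of Weierstrass with base `q^6` and parameters `±q^m`, as are the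
next three identities. -/
theorem one_sub_etaP {q : ℂ} (hq0 : q ≠ 0) (hq : ‖q‖ < 1) :
    1 - etaP q = Theta 1 q ^ 2 * Theta 2 q * Theta 3 q ^ 2 * Theta 12 q ^ 3 /
      (Theta 4 q * Theta 6 q ^ 7) := by
  have hp := pow_ne_zero 6 hq0
  have hp1 := norm_pow_lt_one hq (m := 6) (by norm_num)
  have n1 := Theta_ne_zero hq one_pos
  have n2 := Theta_ne_zero hq two_pos
  have n3 := Theta_ne_zero hq three_pos
  have n4 := Theta_ne_zero hq four_pos
  have n6 := Theta_ne_zero hq (m := 6) (by norm_num)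
  have n12 := Theta_ne_zero hq (m := 12) (by norm_num)
  have h := jac_weierstrass hp hp1 (z := -1) (w := -q) (k := q) (l := -q ^ 2) (by norm_num)
    (neg_ne_zero.2 hq0) hq0 (neg_ne_zero.2 (pow_ne_zero 2 hq0))
    (fun r => by simpa using zpow_mul_neg_pow_ne_one hq0 hq 6 1 r)
    (zpow_mul_neg_pow_ne_one hq0 hq 6 2)
    (fun r => by simpa using zpow_mul_pow_ne_one hq0 hq (N := 6) (m := 1) (by norm_num) r)
    (fun r => by
      have := zpow_mul_neg_zpow_ne_one hq0 hq 6 (-1) r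
      rwa [zpow_neg_one, show -q⁻¹ = q / -q ^ 2 by field_simp] at this)
    (fun r => by
      have := zpow_mul_pow_ne_one hq0 hq (N := 6) (m := 3) (by norm_num) r
      rwa [show q ^ 3 = -q ^ 2 * -q by ring] at this)
    (fun r => by
      have := zpow_mul_neg_pow_ne_one hq0 hq 6 2 r
      rwa [show -q ^ 2 = q * -q by ring] at this)
  rw [show q * -1 = -q by ring, show -q ^ 2 * -1 * -q = -q ^ 3 by ring,
    show q * -q = -q ^ 2 by ring, show q / -q ^ 2 = -q⁻¹ by field_simp,
    show q * -q ^ 2 * -1 * -q = -q ^ 4 by ring, show -q ^ 2 * -1 = q ^ 2 by ring,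
    show -q * -q = q ^ 2 by ring, show -q ^ 2 * -q = q ^ 3 by ring, jac_neg_inv_six hq0 hq,
    jac_neg_pow_four_six hq0, jac_neg_self_six hq0 hq, jac_neg_sq_six hq0 hq,
    jac_neg_cube_six hq0 hq, jac_neg_one_six hq, jac_sq_six hq0 hq, jac_self_six hq0 hq,
    jac_cube_six hq0 hq] at h
  rw [etaP]
  field_simp at h ⊢
  linear_combination h

theorem one_add_etaP {q : ℂ} (hq0 : q ≠ 0) (hq : ‖q‖ < 1) :
    1 + etaP q = Theta 2 q ^ 3 * Theta 3 q ^ 6 * Theta 12 q ^ 3 /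
      (Theta 1 q ^ 2 * Theta 4 q * Theta 6 q ^ 9) := by
  have hp := pow_ne_zero 6 hq0
  have hp1 := norm_pow_lt_one hq (m := 6) (by norm_num)
  have n1 := Theta_ne_zero hq one_pos
  have n2 := Theta_ne_zero hq two_pos
  have n3 := Theta_ne_zero hq three_pos
  have n4 := Theta_ne_zero hq four_pos
  have n6 := Theta_ne_zero hq (m := 6) (by norm_num)
  have n12 := Theta_ne_zero hq (m := 12) (by norm_num)
  have h := jac_weierstrass hp hp1 (z := q) (w := q ^ 2) (k := q) (l := -q) hq0
    (pow_ne_zero 2 hq0) hq0 (neg_ne_zero.2 hq0)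
    (zpow_mul_pow_ne_one hq0 hq (by norm_num))
    (fun r => by simpa using zpow_mul_neg_pow_ne_one hq0 hq 6 1 r)
    (fun r => by simpa using zpow_mul_pow_ne_one hq0 hq (N := 6) (m := 1) (by norm_num) r)
    (fun r => by
      have := zpow_mul_neg_pow_ne_one hq0 hq 6 0 r
      rwa [show -q ^ 0 = q / -q by field_simp] at this)
    (fun r => by
      have := zpow_mul_neg_pow_ne_one hq0 hq 6 3 r
      rwa [show -q ^ 3 = -q * q ^ 2 by ring] at this)
    (fun r => by
      have := zpow_mul_pow_ne_one hq0 hq (N := 6) (m := 3) (by norm_num) r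
      rwa [show q ^ 3 = q * q ^ 2 by ring] at this)
  rw [show q * q = q ^ 2 by ring, show -q * q * q ^ 2 = -q ^ 4 by ring,
    show q * q ^ 2 = q ^ 3 by ring, show q / -q = -1 by field_simp,
    show q * -q * q * q ^ 2 = -q ^ 5 by ring, show -q * q = -q ^ 2 by ring,
    show q ^ 2 * q ^ 2 = q ^ 4 by ring, show -q * q ^ 2 = -q ^ 3 by ring,
    jac_neg_pow_four_six hq0, jac_neg_pow_five_six hq0, jac_neg_self_six hq0 hq,
    jac_neg_sq_six hq0 hq, jac_pow_four_six hq0 hq,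
    jac_neg_cube_six hq0 hq, jac_neg_one_six hq, jac_sq_six hq0 hq, jac_self_six hq0 hq,
    jac_cube_six hq0 hq] at h
  rw [etaP]
  field_simp at h ⊢
  linear_combination -h

theorem one_add_two_mul_etaP {q : ℂ} (hq0 : q ≠ 0) (hq : ‖q‖ < 1) :
    1 + 2 * etaP q = Theta 2 q ^ 10 * Theta 3 q ^ 4 * Theta 12 q ^ 4 /
      (Theta 1 q ^ 4 * Theta 4 q ^ 4 * Theta 6 q ^ 10) := by
  have hp := pow_ne_zero 6 hq0
  have hp1 := norm_pow_lt_one hq (m := 6) (by norm_num)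
  have n1 := Theta_ne_zero hq one_pos
  have n2 := Theta_ne_zero hq two_pos
  have n3 := Theta_ne_zero hq three_pos
  have n4 := Theta_ne_zero hq four_pos
  have n6 := Theta_ne_zero hq (m := 6) (by norm_num)
  have n12 := Theta_ne_zero hq (m := 12) (by norm_num)
  have h := jac_weierstrass hp hp1 (z := q) (w := q) (k := q ^ 2) (l := -1) hq0
    hq0 (pow_ne_zero 2 hq0) (by norm_num)
    (fun r => by simpa using zpow_mul_pow_ne_one hq0 hq (N := 6) (m := 1) (by norm_num) r)
    (fun r => by simpa using zpow_mul_neg_pow_ne_one hq0 hq 6 0 r)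
    (zpow_mul_pow_ne_one hq0 hq (by norm_num))
    (fun r => by simpa [div_neg] using zpow_mul_neg_pow_ne_one hq0 hq 6 2 r)
    (fun r => by simpa using zpow_mul_neg_pow_ne_one hq0 hq 6 1 r)
    (fun r => by
      have := zpow_mul_pow_ne_one hq0 hq (N := 6) (m := 3) (by norm_num) r
      rwa [show q ^ 3 = q ^ 2 * q by ring] at this)
  rw [show q ^ 2 * q = q ^ 3 by ring, show -1 * q * q = -q ^ 2 by ring,
    show q ^ 2 / -1 = -q ^ 2 by ring, show q ^ 2 * -1 * q * q = -q ^ 4 by ring,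
    show -1 * q = -q by ring, show q ^ 3 * q = q ^ 4 by ring,
    jac_neg_pow_four_six hq0, jac_neg_self_six hq0 hq,
    jac_neg_sq_six hq0 hq, jac_pow_four_six hq0 hq,
    jac_neg_one_six hq, jac_sq_six hq0 hq, jac_self_six hq0 hq,
    jac_cube_six hq0 hq] at h
  have h1 := one_add_etaP hq0 hq
  rw [show 1 + 2 * etaP q = 2 * (1 + etaP q) - 1 by ring, h1]
  field_simp at h ⊢
  linear_combination h

theorem two_add_etaP {q : ℂ} (hq0 : q ≠ 0) (hq : ‖q‖ < 1) :
    2 + etaP q = 2 * Theta 2 q * Theta 3 q ^ 3 * Theta 4 q ^ 2 * Theta 12 q ^ 2 /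
      (Theta 1 q * Theta 6 q ^ 7) := by
  have hp := pow_ne_zero 6 hq0
  have hp1 := norm_pow_lt_one hq (m := 6) (by norm_num)
  have n1 := Theta_ne_zero hq one_pos
  have n2 := Theta_ne_zero hq two_pos
  have n3 := Theta_ne_zero hq three_pos
  have n4 := Theta_ne_zero hq four_pos
  have n6 := Theta_ne_zero hq (m := 6) (by norm_num)
  have n12 := Theta_ne_zero hq (m := 12) (by norm_num)
  have h := jac_weierstrass hp hp1 (z := q) (w := q) (k := q) (l := -1) hq0
    hq0 hq0 (by norm_num)
    (fun r => by simpa using zpow_mul_pow_ne_one hq0 hq (N := 6) (m := 1) (by norm_num) r)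
    (fun r => by simpa using zpow_mul_neg_pow_ne_one hq0 hq 6 0 r)
    (fun r => by simpa using zpow_mul_pow_ne_one hq0 hq (N := 6) (m := 1) (by norm_num) r)
    (fun r => by simpa [div_neg] using zpow_mul_neg_pow_ne_one hq0 hq 6 1 r)
    (fun r => by simpa using zpow_mul_neg_pow_ne_one hq0 hq 6 1 r)
    (fun r => by
      have := zpow_mul_pow_ne_one hq0 hq (N := 6) (m := 2) (by norm_num) r
      rwa [pow_two] at this)
  rw [show q * q = q ^ 2 by ring, show -1 * q * q = -q ^ 2 by ring,
    show q / -1 = -q by ring, show q * -1 * q * q = -q ^ 3 by ring,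
    show -1 * q = -q by ring, show q ^ 2 * q = q ^ 3 by ring,
    jac_neg_cube_six hq0 hq, jac_neg_self_six hq0 hq,
    jac_neg_sq_six hq0 hq, jac_neg_one_six hq, jac_sq_six hq0 hq, jac_self_six hq0 hq,
    jac_cube_six hq0 hq] at h
  have h1 := one_add_etaP hq0 hq
  rw [show 2 + etaP q = 1 + (1 + etaP q) by ring, h1]
  field_simp at h ⊢
  linear_combination -h

/-! ### The second parameter at level 24 -/

/-- Only the product of these two values is a quotient of products `Theta m`; the single values
are not. -/
theorem jac_mul_jac_pow_five {q : ℂ} (hq0 : q ≠ 0) (hq : ‖q‖ < 1) :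
    jac q (q ^ 12) * jac (q ^ 5) (q ^ 12)
      = Theta 1 q * Theta 6 q * Theta 12 q ^ 2 / (Theta 2 q * Theta 3 q) := by
  have hq6 := norm_pow_lt_one hq (m := 6) (by norm_num)
  have n2 := Theta_ne_zero hq two_pos
  have n3 := Theta_ne_zero hq three_pos
  have n12 := Theta_ne_zero hq (m := 12) (by norm_num)
  have n6 := Theta_ne_zero hq (m := 6) (by norm_num)
  have h := jac_sq (pow_ne_zero 6 hq0) hq6 q
  have h5 := jac_self_div (pow_ne_zero 12 hq0) (q ^ 5)
  rw [show q ^ 12 / q ^ 5 = q ^ 6 * q by field_simp] at h5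
  rw [jac_self_six hq0 hq, ← pow_mul, ← Theta_eq_qInf, ← Theta_eq_qInf] at h
  norm_num at h
  rw [h5] at h
  field_simp at h ⊢
  linear_combination -h

/-- The second function of level 24: its square is a rational function of `etaP (q^2)`, see
`etaS_relation`, and `etaP q` is a rational function of `etaS q` and `etaP (q^2)`, see
`etaP_relation`. -/
def etaS (q : ℂ) : ℂ :=
  q * Theta 4 q ^ 6 * Theta 6 q ^ 2 * Theta 24 q ^ 4 /
    (Theta 2 q ^ 2 * Theta 8 q ^ 4 * Theta 12 q ^ 6)

/-- The values at `ε q^k`, with `k` even, of the theta function of base `q^12`. -/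
theorem jac_even_twelve {q : ℂ} (hq0 : q ≠ 0) (hq : ‖q‖ < 1) :
    (jac (q ^ 2) (q ^ 12) = Theta 2 q * Theta 12 q ^ 2 / (Theta 4 q * Theta 6 q) ∧
      jac (q ^ 4) (q ^ 12) = Theta 4 q ∧
      jac (q ^ 6) (q ^ 12) = Theta 6 q ^ 2 / Theta 12 q) ∧
    jac (-1) (q ^ 12) = 2 * Theta 24 q ^ 2 / Theta 12 q ∧
    jac (-q ^ 2) (q ^ 12) = Theta 4 q ^ 2 * Theta 6 q * Theta 24 q /
      (Theta 2 q * Theta 8 q * Theta 12 q) ∧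
    jac (-q ^ 4) (q ^ 12) = Theta 8 q * Theta 12 q ^ 2 / (Theta 4 q * Theta 24 q) ∧
    jac (-q ^ 6) (q ^ 12) = Theta 12 q ^ 5 / (Theta 6 q ^ 2 * Theta 24 q ^ 2) := by
  have h0 := pow_ne_zero 2 hq0
  have h1 := norm_pow_lt_one hq two_pos
  have a1 := jac_self_six h0 h1
  have a2 := jac_sq_six h0 h1
  have a3 := jac_cube_six h0 h1
  have a4 := jac_neg_one_six h1
  have a5 := jac_neg_self_six h0 h1
  have a6 := jac_neg_sq_six h0 h1
  have a7 := jac_neg_cube_six h0 h1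
  simp only [← pow_mul, Theta_pow] at a1 a2 a3 a4 a5 a6 a7
  exact ⟨⟨a1, a2, a3⟩, a4, a5, a6, a7⟩

theorem jac_cube_twelve {q : ℂ} (hq0 : q ≠ 0) (hq : ‖q‖ < 1) :
    jac (q ^ 3) (q ^ 12) = Theta 3 q * Theta 12 q / Theta 6 q := by
  have h := jac_self_four (pow_ne_zero 3 hq0) (norm_pow_lt_one hq three_pos)
  simpa only [← pow_mul, Theta_pow] using h

theorem jac_neg_cube_twelve {q : ℂ} (hq0 : q ≠ 0) (hq : ‖q‖ < 1) :
    jac (-q ^ 3) (q ^ 12) = Theta 6 q ^ 2 / Theta 3 q := by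
  have h := jac_self_four (q := -q ^ 3) (neg_ne_zero.2 (pow_ne_zero 3 hq0))
    (by rw [norm_neg]; exact norm_pow_lt_one hq three_pos)
  have n3 := Theta_ne_zero hq three_pos
  have n6 := Theta_ne_zero hq (m := 6) (by norm_num)
  have n12 := Theta_ne_zero hq (m := 12) (by norm_num)
  rw [Theta_one_neg (norm_pow_lt_one hq three_pos), Theta_neg_of_even (by decide),
    Theta_neg_of_even (by decide), show (-q ^ 3) ^ 4 = q ^ 12 by ring] at h
  simp only [Theta_pow] at h
  norm_num at h
  rw [h]
  field_simp

/-- An instance of the relation of Weierstrass with base `q^12`. -/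
theorem one_add_etaS {q : ℂ} (hq0 : q ≠ 0) (hq : ‖q‖ < 1) :
    1 + etaS q = Theta 2 q ^ 2 * Theta 4 q * Theta 6 q ^ 4 * Theta 24 q ^ 2 /
      (Theta 1 q * Theta 3 q * Theta 8 q ^ 2 * Theta 12 q ^ 5) := by
  have hp := pow_ne_zero 12 hq0
  have hp1 := norm_pow_lt_one hq (m := 12) (by norm_num)
  have n1 := Theta_ne_zero hq one_pos
  have n2 := Theta_ne_zero hq two_pos
  have n3 := Theta_ne_zero hq three_pos
  have n4 := Theta_ne_zero hq four_pos
  have n6 := Theta_ne_zero hq (m := 6) (by norm_num)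
  have n8 := Theta_ne_zero hq (m := 8) (by norm_num)
  have n12 := Theta_ne_zero hq (m := 12) (by norm_num)
  have n24 := Theta_ne_zero hq (m := 24) (by norm_num)
  have h := jac_weierstrass hp hp1 (z := q) (w := -q ^ 2) (k := q) (l := -q ^ 3) hq0
    (neg_ne_zero.2 (pow_ne_zero 2 hq0)) hq0 (neg_ne_zero.2 (pow_ne_zero 3 hq0))
    (zpow_mul_neg_pow_ne_one hq0 hq 12 2) (zpow_mul_neg_pow_ne_one hq0 hq 12 3)
    (fun r => by simpa using zpow_mul_pow_ne_one hq0 hq (N := 12) (m := 1) (by norm_num) r)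
    (fun r => by
      have := zpow_mul_neg_zpow_ne_one hq0 hq 12 (-2) r
      rwa [zpow_neg, show -(q ^ (2 : ℤ))⁻¹ = q / -q ^ 3 by
        rw [show q ^ (2 : ℤ) = q ^ 2 from rfl]; field_simp] at this)
    (fun r => by
      have := zpow_mul_pow_ne_one hq0 hq (N := 12) (m := 5) (by norm_num) r
      rwa [show q ^ 5 = -q ^ 3 * -q ^ 2 by ring] at this)
    (fun r => by
      have := zpow_mul_neg_pow_ne_one hq0 hq 12 3 r
      rwa [show -q ^ 3 = q * -q ^ 2 by ring] at this)
  have i1 : jac (-(q ^ 2)⁻¹) (q ^ 12) = (q ^ 2)⁻¹ * jac (-q ^ 2) (q ^ 12) := by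
    have h := jac_inv hp hp1 (neg_ne_zero.2 (pow_ne_zero 2 hq0))
    rwa [inv_neg, neg_neg] at h
  have i2 : jac (q ^ 7) (q ^ 12) = jac (q ^ 5) (q ^ 12) := by
    rw [← jac_self_div hp, show q ^ 12 / q ^ 7 = q ^ 5 by field_simp]
  rw [show q * q = q ^ 2 by ring, show -q ^ 3 * q * -q ^ 2 = q ^ 6 by ring,
    show q * -q ^ 2 = -q ^ 3 by ring, show q / -q ^ 3 = -(q ^ 2)⁻¹ by field_simp,
    show q * -q ^ 3 * q * -q ^ 2 = q ^ 7 by ring, show -q ^ 3 * q = -q ^ 4 by ring,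
    show q ^ 2 * -q ^ 2 = -q ^ 4 by ring, show -q ^ 3 * -q ^ 2 = q ^ 5 by ring, i1, i2] at h
  have h15 := jac_mul_jac_pow_five hq0 hq
  obtain ⟨⟨e2, e4, e6⟩, f0, f2, f4, f6⟩ := jac_even_twelve hq0 hq
  have h' : jac (q ^ 2) (q ^ 12) * jac (-q ^ 3) (q ^ 12) ^ 2 * jac (q ^ 6) (q ^ 12)
      = jac q (q ^ 12) * jac (q ^ 5) (q ^ 12) *
        (jac (-q ^ 4) (q ^ 12) ^ 2 + q * jac (-q ^ 2) (q ^ 12) ^ 2) := by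
    field_simp at h
    linear_combination h
  rw [h15, e2, e6, f2, f4, jac_neg_cube_twelve hq0 hq] at h'
  rw [etaS]
  field_simp at h' ⊢
  linear_combination -h'

/-! ### Theta quotient identities of level 12 -/

theorem Theta_ne_zero_twelve {q : ℂ} (hq : ‖q‖ < 1) :
    Theta 1 q ≠ 0 ∧ Theta 2 q ≠ 0 ∧ Theta 3 q ≠ 0 ∧ Theta 4 q ≠ 0 ∧ Theta 6 q ≠ 0 ∧
      Theta 12 q ≠ 0 :=
  ⟨Theta_ne_zero hq (by norm_num), Theta_ne_zero hq (by norm_num), Theta_ne_zero hq (by norm_num),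
    Theta_ne_zero hq (by norm_num), Theta_ne_zero hq (by norm_num), Theta_ne_zero hq (by norm_num)⟩

theorem etaP_ne_zero {q : ℂ} (hq0 : q ≠ 0) (hq : ‖q‖ < 1) : etaP q ≠ 0 := by
  obtain ⟨n1, n2, n3, n4, n6, n12⟩ := Theta_ne_zero_twelve hq
  simp [etaP, *]

theorem one_sub_etaP_ne_zero {q : ℂ} (hq0 : q ≠ 0) (hq : ‖q‖ < 1) : 1 - etaP q ≠ 0 := by
  obtain ⟨n1, n2, n3, n4, n6, n12⟩ := Theta_ne_zero_twelve hq
  rw [one_sub_etaP hq0 hq]; simp [*]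

theorem one_add_etaP_ne_zero {q : ℂ} (hq0 : q ≠ 0) (hq : ‖q‖ < 1) : 1 + etaP q ≠ 0 := by
  obtain ⟨n1, n2, n3, n4, n6, n12⟩ := Theta_ne_zero_twelve hq
  rw [one_add_etaP hq0 hq]; simp [*]

theorem one_add_two_mul_etaP_ne_zero {q : ℂ} (hq0 : q ≠ 0) (hq : ‖q‖ < 1) :
    1 + 2 * etaP q ≠ 0 := by
  obtain ⟨n1, n2, n3, n4, n6, n12⟩ := Theta_ne_zero_twelve hq
  rw [one_add_two_mul_etaP hq0 hq]; simp [*]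

theorem two_add_etaP_ne_zero {q : ℂ} (hq0 : q ≠ 0) (hq : ‖q‖ < 1) : 2 + etaP q ≠ 0 := by
  obtain ⟨n1, n2, n3, n4, n6, n12⟩ := Theta_ne_zero_twelve hq
  rw [two_add_etaP hq0 hq]; simp [*]

theorem etaP_eq (q : ℂ) : etaP q = 2 * q * Theta 2 q ^ 3 * Theta 3 q ^ 3 * Theta 12 q ^ 6 /
    (Theta 1 q * Theta 4 q ^ 2 * Theta 6 q ^ 9) := rfl

/-- Every term is the first term times a monomial in `etaP q`, `1 - etaP q`, `1 + 2 * etaP q` and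
the like; after division by the first term a polynomial identity in `etaP q` remains. The other
identities of level 12 have the same proof. -/
theorem A2_thetaQuotient_one {q : ℂ} (hq0 : q ≠ 0) (hq : ‖q‖ < 1) : Theta 2 q ^ 2 *
      Theta 4 q ^ 2 * Theta 6 q ^ 4 / (Theta 1 q ^ 4 * Theta 12 q ^ 2) - Theta 2 q ^ 11 *
      Theta 3 q * Theta 6 q / (2 * Theta 1 q ^ 7 * Theta 4 q ^ 4) - Theta 2 q ^ 2 *
      Theta 6 q ^ 4 / (2 * Theta 1 q * Theta 3 q * Theta 4 q * Theta 12 q) = 0 := by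
  obtain ⟨n1, n2, n3, n4, n6, n12⟩ := Theta_ne_zero_twelve hq
  have e1 := one_sub_etaP hq0 hq
  have e3 := one_add_two_mul_etaP hq0 hq
  have e4 := two_add_etaP hq0 hq
  have r1 : Theta 2 q ^ 11 * Theta 3 q * Theta 6 q / (2 * Theta 1 q ^ 7 * Theta 4 q ^ 4) =
      Theta 2 q ^ 2 * Theta 4 q ^ 2 * Theta 6 q ^ 4 / (Theta 1 q ^ 4 * Theta 12 q ^ 2) *
      ((1 + 2 * etaP q) / (2 + etaP q)) := by
    rw [e4, e3]
    field_simp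
  have r2 : Theta 2 q ^ 2 * Theta 6 q ^ 4 / (2 * Theta 1 q * Theta 3 q * Theta 4 q * Theta 12 q) =
      Theta 2 q ^ 2 * Theta 4 q ^ 2 * Theta 6 q ^ 4 / (Theta 1 q ^ 4 * Theta 12 q ^ 2) *
      ((1 - etaP q) / (2 + etaP q)) := by
    rw [e4, e1]
    field_simp
  rw [r1, r2]
  have m4 := two_add_etaP_ne_zero hq0 hq
  clear e1 e3 e4 r1 r2
  generalize etaP q = p at *
  field_simp
  ring

theorem A2_thetaQuotient_two {q : ℂ} (hq0 : q ≠ 0) (hq : ‖q‖ < 1) : 2 * Theta 2 q *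
      Theta 4 q ^ 2 * Theta 6 q ^ 7 / (Theta 1 q ^ 3 * Theta 3 q ^ 3 * Theta 12 q ^ 2) -
      Theta 2 q ^ 4 * Theta 3 q ^ 3 * Theta 4 q * Theta 12 q / (Theta 1 q ^ 5 * Theta 6 q ^ 2) -
      Theta 2 q ^ 2 * Theta 4 q * Theta 12 q / (Theta 1 q * Theta 3 q) = 0 := by
  obtain ⟨n1, n2, n3, n4, n6, n12⟩ := Theta_ne_zero_twelve hq
  have e1 := one_sub_etaP hq0 hq
  have e2 := one_add_etaP hq0 hq
  have r1 : Theta 2 q ^ 4 * Theta 3 q ^ 3 * Theta 4 q * Theta 12 q / (Theta 1 q ^ 5 *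
      Theta 6 q ^ 2) = 2 * Theta 2 q * Theta 4 q ^ 2 * Theta 6 q ^ 7 / (Theta 1 q ^ 3 *
      Theta 3 q ^ 3 * Theta 12 q ^ 2) * ((1 + etaP q) / 2) := by
    rw [e2]
    field_simp
  have r2 : Theta 2 q ^ 2 * Theta 4 q * Theta 12 q / (Theta 1 q * Theta 3 q) = 2 * Theta 2 q *
      Theta 4 q ^ 2 * Theta 6 q ^ 7 / (Theta 1 q ^ 3 * Theta 3 q ^ 3 * Theta 12 q ^ 2) *
      ((1 - etaP q) / 2) := by
    rw [e1]
    field_simp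
  rw [r1, r2]
  clear e1 e2 r1 r2
  generalize etaP q = p at *
  field_simp
  ring

theorem A2_thetaQuotient_zero {q : ℂ} (hq0 : q ≠ 0) (hq : ‖q‖ < 1) : Theta 6 q ^ 10 /
      (2 * Theta 3 q ^ 4 * Theta 12 q ^ 4) + Theta 2 q ^ 9 * Theta 6 q ^ 7 / (2 * Theta 1 q ^ 6 *
      Theta 3 q ^ 2 * Theta 4 q ^ 3 * Theta 12 q ^ 3) - 2 * q * Theta 2 q ^ 3 * Theta 4 q *
      Theta 6 q * Theta 12 q / Theta 1 q ^ 4 - Theta 2 q * Theta 4 q ^ 2 * Theta 6 q ^ 3 /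
      (Theta 1 q * Theta 3 q * Theta 12 q ^ 2) = 0 := by
  obtain ⟨n1, n2, n3, n4, n6, n12⟩ := Theta_ne_zero_twelve hq
  have e0 := etaP_eq q
  have e1 := one_sub_etaP hq0 hq
  have e3 := one_add_two_mul_etaP hq0 hq
  have e4 := two_add_etaP hq0 hq
  have r1 : Theta 2 q ^ 9 * Theta 6 q ^ 7 / (2 * Theta 1 q ^ 6 * Theta 3 q ^ 2 * Theta 4 q ^ 3 *
      Theta 12 q ^ 3) = Theta 6 q ^ 10 / (2 * Theta 3 q ^ 4 * Theta 12 q ^ 4) *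
      ((1 + 2 * etaP q) / (1 - etaP q)) := by
    rw [e3, e1]
    field_simp
  have r2 : 2 * q * Theta 2 q ^ 3 * Theta 4 q * Theta 6 q * Theta 12 q / Theta 1 q ^ 4 =
      Theta 6 q ^ 10 / (2 * Theta 3 q ^ 4 * Theta 12 q ^ 4) * (etaP q * (2 + etaP q) /
      (1 - etaP q)) := by
    rw [e4, e1, e0]
    field_simp
  have r3 : Theta 2 q * Theta 4 q ^ 2 * Theta 6 q ^ 3 / (Theta 1 q * Theta 3 q * Theta 12 q ^ 2) =
      Theta 6 q ^ 10 / (2 * Theta 3 q ^ 4 * Theta 12 q ^ 4) * ((2 + etaP q)) := by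
    rw [e4]
    field_simp
  rw [r1, r2, r3]
  have m1 := one_sub_etaP_ne_zero hq0 hq
  clear e0 e1 e3 e4 r1 r2 r3
  generalize etaP q = p at *
  field_simp
  ring

theorem mu2_thetaQuotient_zero {q : ℂ} (hq0 : q ≠ 0) (hq : ‖q‖ < 1) : 2 * Theta 1 q ^ 6 *
      Theta 3 q ^ 2 * Theta 4 q ^ 3 * Theta 6 q / (Theta 2 q ^ 9 * Theta 12 q) - Theta 1 q ^ 3 *
      Theta 3 q ^ 3 * Theta 12 q / (Theta 4 q ^ 3 * Theta 6 q ^ 2) + 9 * q * Theta 1 q ^ 4 *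
      Theta 6 q ^ 6 / Theta 2 q ^ 8 - Theta 3 q ^ 4 / Theta 6 q ^ 2 = 0 := by
  obtain ⟨n1, n2, n3, n4, n6, n12⟩ := Theta_ne_zero_twelve hq
  have e0 := etaP_eq q
  have e1 := one_sub_etaP hq0 hq
  have e3 := one_add_two_mul_etaP hq0 hq
  have e4 := two_add_etaP hq0 hq
  have r1 : Theta 1 q ^ 3 * Theta 3 q ^ 3 * Theta 12 q / (Theta 4 q ^ 3 * Theta 6 q ^ 2) =
      2 * Theta 1 q ^ 6 * Theta 3 q ^ 2 * Theta 4 q ^ 3 * Theta 6 q / (Theta 2 q ^ 9 *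
      Theta 12 q) * ((1 + 2 * etaP q) / (2 + etaP q)) := by
    rw [e4, e3]
    field_simp
  have r2 : 9 * q * Theta 1 q ^ 4 * Theta 6 q ^ 6 / Theta 2 q ^ 8 = 2 * Theta 1 q ^ 6 *
      Theta 3 q ^ 2 * Theta 4 q ^ 3 * Theta 6 q / (Theta 2 q ^ 9 * Theta 12 q) * (9 * etaP q /
      (2 * (1 - etaP q) * (2 + etaP q))) := by
    rw [e4, e1, e0]
    field_simp
  have r3 : Theta 3 q ^ 4 / Theta 6 q ^ 2 = 2 * Theta 1 q ^ 6 * Theta 3 q ^ 2 * Theta 4 q ^ 3 *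
      Theta 6 q / (Theta 2 q ^ 9 * Theta 12 q) * ((1 + 2 * etaP q) / (2 * (1 - etaP q))) := by
    rw [e3, e1]
    field_simp
  rw [r1, r2, r3]
  have m1 := one_sub_etaP_ne_zero hq0 hq
  have m4 := two_add_etaP_ne_zero hq0 hq
  clear e0 e1 e3 e4 r1 r2 r3
  generalize etaP q = p at *
  field_simp
  ring

theorem mu2_thetaQuotient_one {q : ℂ} (hq0 : q ≠ 0) (hq : ‖q‖ < 1) : -4 * Theta 1 q ^ 4 *
      Theta 4 q ^ 6 * Theta 6 q ^ 4 / (Theta 2 q ^ 10 * Theta 12 q ^ 2) - Theta 2 q ^ 8 *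
      Theta 3 q ^ 2 * Theta 12 q ^ 2 / (Theta 1 q ^ 2 * Theta 4 q ^ 6 * Theta 6 q ^ 2) +
      2 * Theta 1 q ^ 7 * Theta 4 q ^ 3 * Theta 6 q ^ 4 / (Theta 2 q ^ 10 * Theta 3 q *
      Theta 12 q) - Theta 1 q ^ 4 * Theta 6 q * Theta 12 q / (Theta 2 q * Theta 4 q ^ 3) + 4 *
      Theta 1 q * Theta 3 q * Theta 6 q / Theta 2 q = 0 := by
  obtain ⟨n1, n2, n3, n4, n6, n12⟩ := Theta_ne_zero_twelve hq
  have e1 := one_sub_etaP hq0 hq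
  have e3 := one_add_two_mul_etaP hq0 hq
  have e4 := two_add_etaP hq0 hq
  have r1 : Theta 2 q ^ 8 * Theta 3 q ^ 2 * Theta 12 q ^ 2 / (Theta 1 q ^ 2 * Theta 4 q ^ 6 *
      Theta 6 q ^ 2) = 4 * Theta 1 q ^ 4 * Theta 4 q ^ 6 * Theta 6 q ^ 4 / (Theta 2 q ^ 10 *
      Theta 12 q ^ 2) * ((1 + 2 * etaP q) ^ 2 / (2 + etaP q) ^ 2) := by
    rw [e4, e3]
    field_simp
    norm_num
  have r2 : 2 * Theta 1 q ^ 7 * Theta 4 q ^ 3 * Theta 6 q ^ 4 / (Theta 2 q ^ 10 * Theta 3 q *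
      Theta 12 q) = 4 * Theta 1 q ^ 4 * Theta 4 q ^ 6 * Theta 6 q ^ 4 / (Theta 2 q ^ 10 *
      Theta 12 q ^ 2) * ((1 - etaP q) / (2 + etaP q)) := by
    rw [e4, e1]
    field_simp
    norm_num
  have r3 : Theta 1 q ^ 4 * Theta 6 q * Theta 12 q / (Theta 2 q * Theta 4 q ^ 3) = 4 *
      Theta 1 q ^ 4 * Theta 4 q ^ 6 * Theta 6 q ^ 4 / (Theta 2 q ^ 10 * Theta 12 q ^ 2) *
      ((1 - etaP q) * (1 + 2 * etaP q) / (2 + etaP q) ^ 2) := by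
    rw [e4, e3, e1]
    field_simp
    norm_num
  have r4 : 4 * Theta 1 q * Theta 3 q * Theta 6 q / Theta 2 q = 4 * Theta 1 q ^ 4 *
      Theta 4 q ^ 6 * Theta 6 q ^ 4 / (Theta 2 q ^ 10 * Theta 12 q ^ 2) * (2 * (1 + 2 * etaP q) /
      (2 + etaP q)) := by
    rw [e4, e3]
    field_simp
  rw [r1, r2, r3, r4]
  have m4 := two_add_etaP_ne_zero hq0 hq
  clear e1 e3 e4 r1 r2 r3 r4
  generalize etaP q = p at *
  field_simp
  ring

theorem mu2_thetaQuotient_two {q : ℂ} (hq0 : q ≠ 0) (hq : ‖q‖ < 1) : 9 * Theta 1 q ^ 3 *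
      Theta 3 q ^ 3 * Theta 6 q ^ 3 / Theta 2 q ^ 7 - 4 * Theta 1 q ^ 5 * Theta 4 q ^ 6 *
      Theta 6 q ^ 7 / (Theta 2 q ^ 11 * Theta 3 q ^ 3 * Theta 12 q ^ 2) - Theta 2 q ^ 7 *
      Theta 6 q * Theta 12 q ^ 2 / (Theta 1 q * Theta 3 q * Theta 4 q ^ 6) - 4 * Theta 1 q ^ 2 *
      Theta 6 q ^ 4 / (Theta 2 q ^ 2 * Theta 3 q ^ 2) = 0 := by
  obtain ⟨n1, n2, n3, n4, n6, n12⟩ := Theta_ne_zero_twelve hq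
  have e2 := one_add_etaP hq0 hq
  have e3 := one_add_two_mul_etaP hq0 hq
  have e4 := two_add_etaP hq0 hq
  have r1 : 4 * Theta 1 q ^ 5 * Theta 4 q ^ 6 * Theta 6 q ^ 7 / (Theta 2 q ^ 11 * Theta 3 q ^ 3 *
      Theta 12 q ^ 2) = 9 * Theta 1 q ^ 3 * Theta 3 q ^ 3 * Theta 6 q ^ 3 / Theta 2 q ^ 7 *
      ((2 + etaP q) ^ 2 / (9 * (1 + etaP q) ^ 2)) := by
    rw [e4, e2]
    field_simp
    norm_num
  have r2 : Theta 2 q ^ 7 * Theta 6 q * Theta 12 q ^ 2 / (Theta 1 q * Theta 3 q * Theta 4 q ^ 6) =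
      9 * Theta 1 q ^ 3 * Theta 3 q ^ 3 * Theta 6 q ^ 3 / Theta 2 q ^ 7 * ((1 + 2 * etaP q) ^ 2 /
      (9 * (1 + etaP q) ^ 2)) := by
    rw [e3, e2]
    field_simp
  have r3 : 4 * Theta 1 q ^ 2 * Theta 6 q ^ 4 / (Theta 2 q ^ 2 * Theta 3 q ^ 2) = 9 *
      Theta 1 q ^ 3 * Theta 3 q ^ 3 * Theta 6 q ^ 3 / Theta 2 q ^ 7 * (2 * (1 + 2 * etaP q) *
      (2 + etaP q) / (9 * (1 + etaP q) ^ 2)) := by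
    rw [e4, e3, e2]
    field_simp
    norm_num
  rw [r1, r2, r3]
  have m2 := one_add_etaP_ne_zero hq0 hq
  clear e2 e3 e4 r1 r2 r3
  generalize etaP q = p at *
  field_simp
  ring

/-! ### Theta quotient identities of level 24 -/

theorem Theta_ne_zero_twentyfour {q : ℂ} (hq : ‖q‖ < 1) :
    Theta 4 q ≠ 0 ∧ Theta 8 q ≠ 0 ∧ Theta 12 q ≠ 0 ∧ Theta 24 q ≠ 0 :=
  ⟨Theta_ne_zero hq (by norm_num), Theta_ne_zero hq (by norm_num), Theta_ne_zero hq (by norm_num),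
    Theta_ne_zero hq (by norm_num)⟩

theorem etaP_sq_eq (q : ℂ) : etaP (q ^ 2) =
    2 * q ^ 2 * Theta 4 q ^ 3 * Theta 6 q ^ 3 * Theta 24 q ^ 6 /
      (Theta 2 q * Theta 8 q ^ 2 * Theta 12 q ^ 9) := by
  simp only [etaP, Theta_pow, Nat.reduceMul]

theorem one_sub_etaP_sq {q : ℂ} (hq0 : q ≠ 0) (hq : ‖q‖ < 1) :
    1 - etaP (q ^ 2) = Theta 2 q ^ 2 * Theta 4 q * Theta 6 q ^ 2 * Theta 24 q ^ 3 /
      (Theta 8 q * Theta 12 q ^ 7) := by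
  simpa only [Theta_pow, Nat.reduceMul] using
    one_sub_etaP (pow_ne_zero 2 hq0) (norm_pow_lt_one hq two_pos)

theorem one_add_etaP_sq {q : ℂ} (hq0 : q ≠ 0) (hq : ‖q‖ < 1) :
    1 + etaP (q ^ 2) = Theta 4 q ^ 3 * Theta 6 q ^ 6 * Theta 24 q ^ 3 /
      (Theta 2 q ^ 2 * Theta 8 q * Theta 12 q ^ 9) := by
  simpa only [Theta_pow, Nat.reduceMul] using
    one_add_etaP (pow_ne_zero 2 hq0) (norm_pow_lt_one hq two_pos)

theorem one_add_two_mul_etaP_sq {q : ℂ} (hq0 : q ≠ 0) (hq : ‖q‖ < 1) :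
    1 + 2 * etaP (q ^ 2) = Theta 4 q ^ 10 * Theta 6 q ^ 4 * Theta 24 q ^ 4 /
      (Theta 2 q ^ 4 * Theta 8 q ^ 4 * Theta 12 q ^ 10) := by
  simpa only [Theta_pow, Nat.reduceMul] using
    one_add_two_mul_etaP (pow_ne_zero 2 hq0) (norm_pow_lt_one hq two_pos)

theorem two_add_etaP_sq {q : ℂ} (hq0 : q ≠ 0) (hq : ‖q‖ < 1) :
    2 + etaP (q ^ 2) = 2 * Theta 4 q * Theta 6 q ^ 3 * Theta 8 q ^ 2 * Theta 24 q ^ 2 /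
      (Theta 2 q * Theta 12 q ^ 7) := by
  simpa only [Theta_pow, Nat.reduceMul] using
    two_add_etaP (pow_ne_zero 2 hq0) (norm_pow_lt_one hq two_pos)

theorem etaS_eq (q : ℂ) : etaS q = q * Theta 4 q ^ 6 * Theta 6 q ^ 2 * Theta 24 q ^ 4 /
    (Theta 2 q ^ 2 * Theta 8 q ^ 4 * Theta 12 q ^ 6) := rfl

theorem etaS_ne_zero {q : ℂ} (hq0 : q ≠ 0) (hq : ‖q‖ < 1) : etaS q ≠ 0 := by
  obtain ⟨n1, n2, n3, n4, n6, n12⟩ := Theta_ne_zero_twelve hq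
  obtain ⟨-, n8, -, n24⟩ := Theta_ne_zero_twentyfour hq
  simp [etaS, *]

theorem one_add_etaS_ne_zero {q : ℂ} (hq0 : q ≠ 0) (hq : ‖q‖ < 1) : 1 + etaS q ≠ 0 := by
  obtain ⟨n1, n2, n3, n4, n6, n12⟩ := Theta_ne_zero_twelve hq
  obtain ⟨-, n8, -, n24⟩ := Theta_ne_zero_twentyfour hq
  rw [one_add_etaS hq0 hq]; simp [*]

/-- With `etaS_relation` and `etaP_relation`, all functions below live on the elliptic curve
`s² (2 + r) = r (1 + 2 r)`, where `r = etaP (q^2)` and `s = etaS q`. -/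
theorem etaS_relation {q : ℂ} (hq0 : q ≠ 0) (hq : ‖q‖ < 1) :
    etaS q ^ 2 * (2 + etaP (q ^ 2)) = etaP (q ^ 2) * (1 + 2 * etaP (q ^ 2)) := by
  obtain ⟨n1, n2, n3, n4, n6, n12⟩ := Theta_ne_zero_twelve hq
  obtain ⟨-, n8, -, n24⟩ := Theta_ne_zero_twentyfour hq
  rw [two_add_etaP_sq hq0 hq, one_add_two_mul_etaP_sq hq0 hq, etaP_sq_eq, etaS]
  field_simp

/-- Obtained from the product formulas for `1 + etaS q` and `1 - etaP q` by means of
`etaS_relation`. -/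
theorem etaP_relation {q : ℂ} (hq0 : q ≠ 0) (hq : ‖q‖ < 1) :
    etaP q * (1 + etaP (q ^ 2)) ^ 2 = etaP (q ^ 2) + etaS q * (2 + etaP (q ^ 2)) := by
  have h : (1 + etaS q) ^ 2 * (2 + etaP (q ^ 2)) * (1 - etaP q) = 2 * (1 - etaP (q ^ 2)) ^ 2 := by
    obtain ⟨n1, n2, n3, n4, n6, n12⟩ := Theta_ne_zero_twelve hq
    obtain ⟨-, n8, -, n24⟩ := Theta_ne_zero_twentyfour hq
    rw [two_add_etaP_sq hq0 hq, one_add_etaS hq0 hq, one_sub_etaP hq0 hq, one_sub_etaP_sq hq0 hq]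
    field_simp
  have hs := etaS_relation hq0 hq
  have k1 := one_add_etaS_ne_zero hq0 hq
  have k2 := two_add_etaP_ne_zero (pow_ne_zero 2 hq0) (norm_pow_lt_one hq two_pos)
  generalize etaP q = p at *
  generalize etaP (q ^ 2) = r at *
  generalize etaS q = s at *
  refine mul_left_cancel₀ (mul_ne_zero (pow_ne_zero 2 k1) k2) ?_
  linear_combination -(1 + r) ^ 2 * h + (1 + r + r ^ 2 - s * (2 + r) - 2 * (2 + r)) * hs

/-- After division by the first term, every term is a monomial in `etaP q`, `etaP (q^2)`, `etaS q`
and their translates. The polynomial that remains lies in the ideal of the relations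
`etaS_relation` and `etaP_relation` once multiplied by powers of `1 + etaP (q^2)` and `2 + etaP
(q^2)`. The next two identities have the same proof. -/
theorem B2_thetaQuotient_zero {q : ℂ} (hq0 : q ≠ 0) (hq : ‖q‖ < 1) : Theta 4 q ^ 8 *
      Theta 6 q ^ 4 / (Theta 1 q ^ 4 * Theta 8 q ^ 4 * Theta 12 q ^ 2) - 2 * q * Theta 2 q ^ 8 *
      Theta 3 q ^ 2 * Theta 12 q ^ 2 / (Theta 1 q ^ 6 * Theta 4 q ^ 2 * Theta 6 q ^ 2) - 2 * q *
      Theta 4 q * Theta 6 q * Theta 12 q / Theta 2 q - Theta 4 q ^ 4 * Theta 12 q ^ 4 /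
      (Theta 2 q ^ 2 * Theta 8 q ^ 2 * Theta 24 q ^ 2) = 0 := by
  obtain ⟨n1, n2, n3, n4, n6, n12⟩ := Theta_ne_zero_twelve hq
  obtain ⟨-, n8, -, n24⟩ := Theta_ne_zero_twentyfour hq
  have e0 := etaP_eq q
  have e1 := one_sub_etaP hq0 hq
  have e4 := two_add_etaP hq0 hq
  have f0 := etaP_sq_eq q
  have f3 := one_add_two_mul_etaP_sq hq0 hq
  have f4 := two_add_etaP_sq hq0 hq
  have g0 := etaS_eq q
  have g1 := one_add_etaS hq0 hq
  have r1 : 2 * q * Theta 2 q ^ 8 * Theta 3 q ^ 2 * Theta 12 q ^ 2 / (Theta 1 q ^ 6 *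
      Theta 4 q ^ 2 * Theta 6 q ^ 2) = Theta 4 q ^ 8 * Theta 6 q ^ 4 / (Theta 1 q ^ 4 *
      Theta 8 q ^ 4 * Theta 12 q ^ 2) * (etaP q * (2 + etaP (q ^ 2)) * (1 + etaS q) / (2 * (1 +
      2 * etaP (q ^ 2)))) := by
    rw [g1, f4, f3, e0]
    field_simp
  have r2 : 2 * q * Theta 4 q * Theta 6 q * Theta 12 q / Theta 2 q = Theta 4 q ^ 8 *
      Theta 6 q ^ 4 / (Theta 1 q ^ 4 * Theta 8 q ^ 4 * Theta 12 q ^ 2) * (2 * (1 - etaP q) * etaP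
      (q ^ 2) / ((2 + etaP q) * etaS q * (1 + etaS q))) := by
    rw [g1, g0, f0, e4, e1]
    field_simp
  have r3 : Theta 4 q ^ 4 * Theta 12 q ^ 4 / (Theta 2 q ^ 2 * Theta 8 q ^ 2 * Theta 24 q ^ 2) =
      Theta 4 q ^ 8 * Theta 6 q ^ 4 / (Theta 1 q ^ 4 * Theta 8 q ^ 4 * Theta 12 q ^ 2) * (2 *
      (1 - etaP q) / ((2 + etaP q) * (1 + etaS q))) := by
    rw [g1, e4, e1]
    field_simp
  rw [r1, r2, r3]
  have m4 := two_add_etaP_ne_zero hq0 hq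
  have m8 := one_add_two_mul_etaP_ne_zero (pow_ne_zero 2 hq0) (norm_pow_lt_one hq two_pos)
  have m10 := etaS_ne_zero hq0 hq
  have m11 := one_add_etaS_ne_zero hq0 hq
  have hs := etaS_relation hq0 hq
  have hp := etaP_relation hq0 hq
  have k1 := one_add_etaP_ne_zero (pow_ne_zero 2 hq0) (norm_pow_lt_one hq two_pos)
  have k2 := two_add_etaP_ne_zero (pow_ne_zero 2 hq0) (norm_pow_lt_one hq two_pos)
  clear e0 e1 e4 f0 f3 f4 g0 g1 r1 r2 r3
  generalize etaP q = p at *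
  generalize etaP (q ^ 2) = r at *
  generalize etaS q = s at *
  have h : 2 * s ^ 2 - 2 * r + 4 * r * s ^ 2 - 4 * r ^ 2 + p * s - 3 * p * s ^ 2 - 2 *
      p * s ^ 3 + 2 * p * r + 5 * p * r * s - p * r * s ^ 3 + 4 * p * r ^ 2 - p ^ 2
      * s - 2 * p ^ 2 * s ^ 2 - p ^ 2 * s ^ 3 + (-1/2) * p ^ 2 * r * s - p ^ 2 *
      r * s ^ 2 + (-1/2) * p ^ 2 * r * s ^ 3 = 0 := by
    -- The powers clear the denominators that arise on eliminating `p` by `hp` and `s²` by `hs`;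
    -- the coefficients below are the cofactors of this elimination.
    refine mul_left_cancel₀ (mul_ne_zero (pow_ne_zero 4 k1) (pow_ne_zero 4 k2)) ?_
    linear_combination (16 * s - 80 * s ^ 2 - 96 * s ^ 3 - 32 * s ^ 4 + 32 * r + 128 * r
      * s - 320 * r * s ^ 2 - 352 * r * s ^ 3 - 96 * r * s ^ 4 + 192 * r ^ 2 + 384 * r ^
      2 * s - 512 * r ^ 2 * s ^ 2 - 552 * r ^ 2 * s ^ 3 - 120 * r ^ 2 * s ^ 4 + 464 * r ^
      3 + 568 * r ^ 3 * s - 424 * r ^ 3 * s ^ 2 - 480 * r ^ 3 * s ^ 3 - 80 * r ^ 3 * s ^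
      4 + 592 * r ^ 4 + 461 * r ^ 4 * s - 193 * r ^ 4 * s ^ 2 - 250 * r ^ 4 * s ^ 3 - 30
      * r ^ 4 * s ^ 4 + 434 * r ^ 5 + 210 * r ^ 5 * s - 46 * r ^ 5 * s ^ 2 - 78 * r ^ 5 * s
      ^ 3 - 6 * r ^ 5 * s ^ 4 + 184 * r ^ 6 + (101/2) * r ^ 6 * s + (-9/2) * r ^ 6 * s ^ 2 +
      (-27/2) * r ^ 6 * s ^ 3 + (-1/2) * r ^ 6 * s ^ 4 + 42 * r ^ 7 + 5 * r ^ 7 * s - r ^ 7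
      * s ^ 3 + 4 * r ^ 8 - 16 * p * s - 32 * p * s ^ 2 - 16 * p * s ^ 3 - 72 * p * r
      * s - 144 * p * r * s ^ 2 - 72 * p * r * s ^ 3 - 136 * p * r ^ 2 * s - 272 * p *
      r ^ 2 * s ^ 2 - 136 * p * r ^ 2 * s ^ 3 - 140 * p * r ^ 3 * s - 280 * p * r ^ 3 * s
      ^ 2 - 140 * p * r ^ 3 * s ^ 3 - 85 * p * r ^ 4 * s - 170 * p * r ^ 4 * s ^ 2 -
      85 * p * r ^ 4 * s ^ 3 + (-61/2) * p * r ^ 5 * s - 61 * p * r ^ 5 * s ^ 2 + (-61/2) *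
      p * r ^ 5 * s ^ 3 - 6 * p * r ^ 6 * s - 12 * p * r ^ 6 * s ^ 2 - 6 * p * r ^ 6 * s
      ^ 3 + (-1/2) * p * r ^ 7 * s - p * r ^ 7 * s ^ 2 + (-1/2) * p * r ^ 7 * s ^ 3) * hp +
      (32 - 80 * s - 96 * s ^ 2 - 32 * s ^ 3 + 160 * r - 384 * r * s - 368 * r * s
      ^ 2 - 96 * r * s ^ 3 + 368 * r ^ 2 - 736 * r ^ 2 * s - 592 * r ^ 2 * s ^ 2 - 120
      * r ^ 2 * s ^ 3 + 512 * r ^ 3 - 744 * r ^ 3 * s - 520 * r ^ 3 * s ^ 2 - 80 * r ^ 3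
      * s ^ 3 + 466 * r ^ 4 - 433 * r ^ 4 * s - 270 * r ^ 4 * s ^ 2 - 30 * r ^ 4 * s ^ 3
      + 278 * r ^ 5 - 146 * r ^ 5 * s - 83 * r ^ 5 * s ^ 2 - 6 * r ^ 5 * s ^ 3 + 104 * r
      ^ 6 + (-53/2) * r ^ 6 * s - 14 * r ^ 6 * s ^ 2 + (-1/2) * r ^ 6 * s ^ 3 + 22 * r ^ 7 -
      2 * r ^ 7 * s - r ^ 7 * s ^ 2 + 2 * r ^ 8) * hs
  linear_combination (norm := skip) Theta 4 q ^ 8 * Theta 6 q ^ 4 / (Theta 1 q ^ 4 * Theta 8 q ^ 4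
      * Theta 12 q ^ 2) / ((2 + p) * (1 + 2 * r) * s * (1 + s)) * h
  field_simp
  ring

theorem B2_thetaQuotient_one {q : ℂ} (hq0 : q ≠ 0) (hq : ‖q‖ < 1) : Theta 2 q ^ 7 *
      Theta 3 q ^ 2 * Theta 6 q / (Theta 1 q ^ 6 * Theta 4 q * Theta 12 q) - Theta 2 q *
      Theta 8 q ^ 2 * Theta 12 q ^ 11 / (2 * q * Theta 4 q ^ 5 * Theta 6 q * Theta 24 q ^ 6) +
      Theta 3 q * Theta 4 q ^ 8 * Theta 6 q ^ 2 / (2 * q * Theta 1 q ^ 3 * Theta 8 q ^ 5 *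
      Theta 24 q) - 3 * Theta 2 q ^ 8 * Theta 3 q ^ 2 * Theta 12 q ^ 6 / (2 * Theta 1 q ^ 6 *
      Theta 4 q ^ 2 * Theta 6 q ^ 2 * Theta 8 q ^ 2 * Theta 24 q ^ 2) + 4 * q ^ 3 * Theta 2 q *
      Theta 12 q ^ 2 * Theta 24 q ^ 3 / (Theta 4 q ^ 2 * Theta 6 q * Theta 8 q) - Theta 4 q ^ 2 *
      Theta 6 q ^ 4 / (Theta 2 q ^ 2 * Theta 12 q ^ 2) - 2 * q * Theta 4 q ^ 5 * Theta 12 q *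
      Theta 24 q / (Theta 2 q ^ 2 * Theta 8 q ^ 3) = 0 := by
  obtain ⟨n1, n2, n3, n4, n6, n12⟩ := Theta_ne_zero_twelve hq
  obtain ⟨-, n8, -, n24⟩ := Theta_ne_zero_twentyfour hq
  have e0 := etaP_eq q
  have e1 := one_sub_etaP hq0 hq
  have e3 := one_add_two_mul_etaP hq0 hq
  have e4 := two_add_etaP hq0 hq
  have f0 := etaP_sq_eq q
  have f1 := one_sub_etaP_sq hq0 hq
  have f2 := one_add_etaP_sq hq0 hq
  have f3 := one_add_two_mul_etaP_sq hq0 hq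
  have f4 := two_add_etaP_sq hq0 hq
  have g0 := etaS_eq q
  have r1 : Theta 2 q * Theta 8 q ^ 2 * Theta 12 q ^ 11 / (2 * q * Theta 4 q ^ 5 * Theta 6 q *
      Theta 24 q ^ 6) = Theta 2 q ^ 7 * Theta 3 q ^ 2 * Theta 6 q / (Theta 1 q ^ 6 * Theta 4 q *
      Theta 12 q) * ((1 - etaP q) / ((1 + 2 * etaP q) * (2 + etaP (q ^ 2)) * etaS q)) := by
    rw [g0, f4, e3, e1]
    field_simp
  have r2 : Theta 3 q * Theta 4 q ^ 8 * Theta 6 q ^ 2 / (2 * q * Theta 1 q ^ 3 * Theta 8 q ^ 5 *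
      Theta 24 q) = Theta 2 q ^ 7 * Theta 3 q ^ 2 * Theta 6 q / (Theta 1 q ^ 6 * Theta 4 q *
      Theta 12 q) * (2 * (1 - etaP q) * (1 + 2 * etaP (q ^ 2)) / (etaP q * (1 - etaP (q ^ 2)) *
      (2 + etaP (q ^ 2)))) := by
    rw [f4, f3, f1, e1, e0]
    field_simp
  have r3 : 3 * Theta 2 q ^ 8 * Theta 3 q ^ 2 * Theta 12 q ^ 6 / (2 * Theta 1 q ^ 6 *
      Theta 4 q ^ 2 * Theta 6 q ^ 2 * Theta 8 q ^ 2 * Theta 24 q ^ 2) = Theta 2 q ^ 7 *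
      Theta 3 q ^ 2 * Theta 6 q / (Theta 1 q ^ 6 * Theta 4 q * Theta 12 q) * (3 / (2 + etaP (q ^
      2))) := by
    rw [f4]
    field_simp
  have r4 : 4 * q ^ 3 * Theta 2 q * Theta 12 q ^ 2 * Theta 24 q ^ 3 / (Theta 4 q ^ 2 * Theta 6 q *
      Theta 8 q) = Theta 2 q ^ 7 * Theta 3 q ^ 2 * Theta 6 q / (Theta 1 q ^ 6 * Theta 4 q *
      Theta 12 q) * (2 * etaP q * (1 - etaP q) * etaP (q ^ 2) / ((1 + 2 * etaP q) * (2 + etaP q) *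
      (1 + etaP (q ^ 2)))) := by
    rw [f2, f0, e4, e3, e1, e0]
    field_simp
    norm_num
  have r5 : Theta 4 q ^ 2 * Theta 6 q ^ 4 / (Theta 2 q ^ 2 * Theta 12 q ^ 2) = Theta 2 q ^ 7 *
      Theta 3 q ^ 2 * Theta 6 q / (Theta 1 q ^ 6 * Theta 4 q * Theta 12 q) * ((1 - etaP q) /
      (1 + 2 * etaP q)) := by
    rw [e3, e1]
    field_simp
  have r6 : 2 * q * Theta 4 q ^ 5 * Theta 12 q * Theta 24 q / (Theta 2 q ^ 2 * Theta 8 q ^ 3) =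
      Theta 2 q ^ 7 * Theta 3 q ^ 2 * Theta 6 q / (Theta 1 q ^ 6 * Theta 4 q * Theta 12 q) * (2 *
      (1 - etaP q) * etaS q / ((1 + 2 * etaP q) * (1 + etaP (q ^ 2)))) := by
    rw [g0, f2, e3, e1]
    field_simp
  rw [r1, r2, r3, r4, r5, r6]
  have m0 := etaP_ne_zero hq0 hq
  have m3 := one_add_two_mul_etaP_ne_zero hq0 hq
  have m4 := two_add_etaP_ne_zero hq0 hq
  have m6 := one_sub_etaP_ne_zero (pow_ne_zero 2 hq0) (norm_pow_lt_one hq two_pos)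
  have m7 := one_add_etaP_ne_zero (pow_ne_zero 2 hq0) (norm_pow_lt_one hq two_pos)
  have m9 := two_add_etaP_ne_zero (pow_ne_zero 2 hq0) (norm_pow_lt_one hq two_pos)
  have m10 := etaS_ne_zero hq0 hq
  have hs := etaS_relation hq0 hq
  have hp := etaP_relation hq0 hq
  have k1 := one_add_etaP_ne_zero (pow_ne_zero 2 hq0) (norm_pow_lt_one hq two_pos)
  have k2 := two_add_etaP_ne_zero (pow_ne_zero 2 hq0) (norm_pow_lt_one hq two_pos)
  clear e0 e1 e3 e4 f0 f1 f2 f3 f4 g0 r1 r2 r3 r4 r5 r6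
  generalize etaP q = p at *
  generalize etaP (q ^ 2) = r at *
  generalize etaS q = s at *
  have h : 4 * s + 12 * r * s + 8 * r ^ 2 * s - 2 * p - 8 * p * s ^ 2 + 18 * p * r * s + 4 *
      p * r * s ^ 2 + 2 * p * r ^ 2 + 18 * p * r ^ 2 * s + 4 * p * r ^ 2 * s ^ 2 + p ^ 2 - 9 *
      p ^ 2 * s + 4 * p ^ 2 * s ^ 2 - 8 * p ^ 2 * r * s - 2 * p ^ 2 * r * s ^ 2 - p ^
      2 * r ^ 2 - 11 * p ^ 2 * r ^ 2 * s - 2 * p ^ 2 * r ^ 2 * s ^ 2 - 8 * p ^ 2 * r ^ 3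
      * s + p ^ 3 - 4 * p ^ 3 * s + 4 * p ^ 3 * s ^ 2 - 13 * p ^ 3 * r * s - 2 * p ^ 3 *
      r * s ^ 2 - p ^ 3 * r ^ 2 - 6 * p ^ 3 * r ^ 2 * s - 2 * p ^ 3 * r ^ 2 * s ^ 2 -
      p ^ 3 * r ^ 3 * s = 0 := by
    -- The powers clear the denominators that arise on eliminating `p` by `hp` and `s²` by `hs`;
    -- the coefficients below are the cofactors of this elimination.
    refine mul_left_cancel₀ (mul_ne_zero (pow_ne_zero 6 k1) (pow_ne_zero 4 k2)) ?_
    linear_combination (-32 + 32 * s - 352 * s ^ 2 - 128 * s ^ 3 + 256 * s ^ 4 - 176 *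
      r + 352 * r * s - 2256 * r * s ^ 2 - 832 * r * s ^ 3 + 640 * r * s ^ 4 - 384 * r ^
      2 + 1648 * r ^ 2 * s - 6496 * r ^ 2 * s ^ 2 - 2592 * r ^ 2 * s ^ 3 + 448 * r ^ 2 * s ^
      4 - 408 * r ^ 3 + 4464 * r ^ 3 * s - 10824 * r ^ 3 * s ^ 2 - 4496 * r ^ 3 * s ^ 3 -
      224 * r ^ 3 * s ^ 4 - 114 * r ^ 4 + 7698 * r ^ 4 * s - 11638 * r ^ 4 * s ^ 2 -
      4696 * r ^ 4 * s ^ 3 - 560 * r ^ 4 * s ^ 4 + 273 * r ^ 5 + 8618 * r ^ 5 * s - 8569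
      * r ^ 5 * s ^ 2 - 3084 * r ^ 5 * s ^ 3 - 392 * r ^ 5 * s ^ 4 + 417 * r ^ 6 + 6280 * r
      ^ 6 * s - 4443 * r ^ 6 * s ^ 2 - 1286 * r ^ 6 * s ^ 3 - 140 * r ^ 6 * s ^ 4 + 288 *
      r ^ 7 + 2947 * r ^ 7 * s - 1618 * r ^ 7 * s ^ 2 - 331 * r ^ 7 * s ^ 3 - 26 * r ^ 7
      * s ^ 4 + 111 * r ^ 8 + 858 * r ^ 8 * s - 397 * r ^ 8 * s ^ 2 - 48 * r ^ 8 * s ^ 3 -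
      2 * r ^ 8 * s ^ 4 + 23 * r ^ 9 + 141 * r ^ 9 * s - 59 * r ^ 9 * s ^ 2 - 3 * r ^ 9 *
      s ^ 3 + 2 * r ^ 10 + 10 * r ^ 10 * s - 4 * r ^ 10 * s ^ 2 + 16 * p - 112 * p * s -
      64 * p * s ^ 2 + 128 * p * s ^ 3 + 112 * p * r - 912 * p * r * s - 576 * p * r * s
      ^ 2 + 512 * p * r * s ^ 3 + 296 * p * r ^ 2 - 3400 * p * r ^ 2 * s - 2160 * p * r ^ 2
      * s ^ 2 + 736 * p * r ^ 2 * s ^ 3 + 352 * p * r ^ 3 - 7616 * p * r ^ 3 * s - 4544 * p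
      * r ^ 3 * s ^ 2 + 288 * p * r ^ 3 * s ^ 3 + 97 * p * r ^ 4 - 11471 * p * r ^ 4 * s -
      6012 * p * r ^ 4 * s ^ 2 - 424 * p * r ^ 4 * s ^ 3 - 243 * p * r ^ 5 - 12347 * p
      * r ^ 5 * s - 5268 * p * r ^ 5 * s ^ 2 - 656 * p * r ^ 5 * s ^ 3 - 337 * p * r ^ 6
      - 9772 * p * r ^ 6 * s - 3113 * p * r ^ 6 * s ^ 2 - 414 * p * r ^ 6 * s ^ 3 -
      208 * p * r ^ 7 - 5680 * p * r ^ 7 * s - 1230 * p * r ^ 7 * s ^ 2 - 142 * p * r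
      ^ 7 * s ^ 3 - 71 * p * r ^ 8 - 2353 * p * r ^ 8 * s - 312 * p * r ^ 8 * s ^ 2 -
      26 * p * r ^ 8 * s ^ 3 - 13 * p * r ^ 9 - 653 * p * r ^ 9 * s - 46 * p * r ^ 9 *
      s ^ 2 - 2 * p * r ^ 9 * s ^ 3 - p * r ^ 10 - 108 * p * r ^ 10 * s - 3 * p *
      r ^ 10 * s ^ 2 - 8 * p * r ^ 11 * s + 16 * p ^ 2 - 64 * p ^ 2 * s + 64 * p ^ 2 * s ^ 2
      + 96 * p ^ 2 * r - 592 * p ^ 2 * r * s + 352 * p ^ 2 * r * s ^ 2 + 232 * p ^ 2 * r ^ 2 -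
      2336 * p ^ 2 * r ^ 2 * s + 768 * p ^ 2 * r ^ 2 * s ^ 2 + 264 * p ^ 2 * r ^ 3 - 5256 *
      p ^ 2 * r ^ 3 * s + 752 * p ^ 2 * r ^ 3 * s ^ 2 + 73 * p ^ 2 * r ^ 4 - 7548 * p ^ 2 * r ^
      4 * s + 68 * p ^ 2 * r ^ 4 * s ^ 2 - 180 * p ^ 2 * r ^ 5 - 7301 * p ^ 2 * r ^ 5 * s -
      642 * p ^ 2 * r ^ 5 * s ^ 2 - 259 * p ^ 2 * r ^ 6 - 4874 * p ^ 2 * r ^ 6 * s -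
      754 * p ^ 2 * r ^ 6 * s ^ 2 - 168 * p ^ 2 * r ^ 7 - 2255 * p ^ 2 * r ^ 7 * s -
      436 * p ^ 2 * r ^ 7 * s ^ 2 - 61 * p ^ 2 * r ^ 8 - 712 * p ^ 2 * r ^ 8 * s - 144
      * p ^ 2 * r ^ 8 * s ^ 2 - 12 * p ^ 2 * r ^ 9 - 147 * p ^ 2 * r ^ 9 * s - 26 * p ^ 2
      * r ^ 9 * s ^ 2 - p ^ 2 * r ^ 10 - 18 * p ^ 2 * r ^ 10 * s - 2 * p ^ 2 * r ^ 10
      * s ^ 2 - p ^ 2 * r ^ 11 * s) * hp + (32 - 352 * s - 128 * s ^ 2 + 256 * s ^ 3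
      + 112 * r - 2192 * r * s - 704 * r * s ^ 2 + 640 * r * s ^ 3 + 160 * r ^ 2 - 6368 *
      r ^ 2 * s - 2336 * r ^ 2 * s ^ 2 + 448 * r ^ 2 * s ^ 3 + 88 * r ^ 3 - 11320 * r ^ 3 *
      s - 4400 * r ^ 3 * s ^ 2 - 224 * r ^ 3 * s ^ 3 - 62 * r ^ 4 - 13302 * r ^ 4 * s
      - 4856 * r ^ 4 * s ^ 2 - 560 * r ^ 4 * s ^ 3 - 149 * r ^ 5 - 10589 * r ^ 5 * s -
      3284 * r ^ 5 * s ^ 2 - 392 * r ^ 5 * s ^ 3 - 119 * r ^ 6 - 5731 * r ^ 6 * s -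
      1382 * r ^ 6 * s ^ 2 - 140 * r ^ 6 * s ^ 3 - 50 * r ^ 7 - 2079 * r ^ 7 * s -
      353 * r ^ 7 * s ^ 2 - 26 * r ^ 7 * s ^ 3 - 11 * r ^ 8 - 485 * r ^ 8 * s - 50
      * r ^ 8 * s ^ 2 - 2 * r ^ 8 * s ^ 3 - r ^ 9 - 66 * r ^ 9 * s - 3 * r ^ 9 * s
      ^ 2 - 4 * r ^ 10 * s) * hs
  linear_combination (norm := skip) Theta 2 q ^ 7 * Theta 3 q ^ 2 * Theta 6 q / (Theta 1 q ^ 6 *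
      Theta 4 q * Theta 12 q) / (p * (1 + 2 * p) * (2 + p) * (1 - r) * (1 + r) * (2 + r) * s) * h
  have m3 : 1 + p * 2 ≠ 0 := by rwa [mul_comm p 2]
  field_simp
  ring

theorem B2_thetaQuotient_two {q : ℂ} (hq0 : q ≠ 0) (hq : ‖q‖ < 1) : Theta 6 q ^ 2 *
      Theta 8 q ^ 2 * Theta 12 q ^ 8 / (4 * q ^ 2 * Theta 4 q ^ 4 * Theta 24 q ^ 6) - Theta 3 q *
      Theta 4 q ^ 9 * Theta 6 q ^ 5 / (4 * q ^ 2 * Theta 1 q ^ 3 * Theta 2 q * Theta 8 q ^ 5 *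
      Theta 12 q ^ 3 * Theta 24 q) + 3 * Theta 2 q ^ 7 * Theta 3 q ^ 2 * Theta 6 q *
      Theta 12 q ^ 3 / (4 * q * Theta 1 q ^ 6 * Theta 4 q * Theta 8 q ^ 2 * Theta 24 q ^ 2) - 2 *
      q ^ 2 * Theta 6 q ^ 2 * Theta 24 q ^ 3 / (Theta 4 q * Theta 8 q * Theta 12 q) -
      2 * Theta 2 q * Theta 4 q ^ 7 * Theta 6 q * Theta 12 q / (Theta 1 q ^ 4 * Theta 8 q ^ 4) -
      q * Theta 12 q ^ 4 / Theta 6 q ^ 2 - Theta 4 q ^ 6 * Theta 6 q ^ 3 * Theta 24 q /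
      (Theta 2 q ^ 3 * Theta 8 q ^ 3 * Theta 12 q ^ 2) + Theta 4 q ^ 3 * Theta 12 q ^ 7 /
      (Theta 2 q * Theta 6 q ^ 3 * Theta 8 q ^ 2 * Theta 24 q ^ 2) + q ^ 2 * Theta 4 q ^ 6 *
      Theta 24 q ^ 4 / (Theta 2 q ^ 2 * Theta 8 q ^ 4 * Theta 12 q ^ 2) = 0 := by
  obtain ⟨n1, n2, n3, n4, n6, n12⟩ := Theta_ne_zero_twelve hq
  obtain ⟨-, n8, -, n24⟩ := Theta_ne_zero_twentyfour hq
  have e0 := etaP_eq q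
  have e1 := one_sub_etaP hq0 hq
  have e2 := one_add_etaP hq0 hq
  have e3 := one_add_two_mul_etaP hq0 hq
  have e4 := two_add_etaP hq0 hq
  have f0 := etaP_sq_eq q
  have f1 := one_sub_etaP_sq hq0 hq
  have f2 := one_add_etaP_sq hq0 hq
  have f3 := one_add_two_mul_etaP_sq hq0 hq
  have g0 := etaS_eq q
  have g1 := one_add_etaS hq0 hq
  have r1 : Theta 3 q * Theta 4 q ^ 9 * Theta 6 q ^ 5 / (4 * q ^ 2 * Theta 1 q ^ 3 * Theta 2 q *
      Theta 8 q ^ 5 * Theta 12 q ^ 3 * Theta 24 q) = Theta 6 q ^ 2 * Theta 8 q ^ 2 *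
      Theta 12 q ^ 8 / (4 * q ^ 2 * Theta 4 q ^ 4 * Theta 24 q ^ 6) * (2 * (1 + 2 * etaP q) * (1 +
      2 * etaP (q ^ 2)) ^ 2 / ((2 + etaP q) * (1 - etaP (q ^ 2)))) := by
    rw [f3, f1, e4, e3]
    field_simp
  have r2 : 3 * Theta 2 q ^ 7 * Theta 3 q ^ 2 * Theta 6 q * Theta 12 q ^ 3 / (4 * q *
      Theta 1 q ^ 6 * Theta 4 q * Theta 8 q ^ 2 * Theta 24 q ^ 2) = Theta 6 q ^ 2 *
      Theta 8 q ^ 2 * Theta 12 q ^ 8 / (4 * q ^ 2 * Theta 4 q ^ 4 * Theta 24 q ^ 6) * (3 *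
      (1 + 2 * etaP q) * etaS q / (1 - etaP q)) := by
    rw [g0, e3, e1]
    field_simp
  have r3 : 2 * q ^ 2 * Theta 6 q ^ 2 * Theta 24 q ^ 3 / (Theta 4 q * Theta 8 q * Theta 12 q) =
      Theta 6 q ^ 2 * Theta 8 q ^ 2 * Theta 12 q ^ 8 / (4 * q ^ 2 * Theta 4 q ^ 4 *
      Theta 24 q ^ 6) * (2 * etaP (q ^ 2) ^ 2 / (1 + etaP (q ^ 2))) := by
    rw [f2, f0]
    field_simp
    norm_num
  have r4 : 2 * Theta 2 q * Theta 4 q ^ 7 * Theta 6 q * Theta 12 q / (Theta 1 q ^ 4 *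
      Theta 8 q ^ 4) = Theta 6 q ^ 2 * Theta 8 q ^ 2 * Theta 12 q ^ 8 / (4 * q ^
      2 * Theta 4 q ^ 4 * Theta 24 q ^ 6) * (etaP q ^ 2 * (2 + etaP q) * (1 + 2 * etaP (q ^ 2)) *
      (1 + etaS q) / ((1 - etaP q) * (1 + etaP q))) := by
    rw [g1, f3, e4, e2, e1, e0]
    field_simp
    norm_num
  have r5 : q * Theta 12 q ^ 4 / Theta 6 q ^ 2 = Theta 6 q ^ 2 * Theta 8 q ^ 2 * Theta 12 q ^ 8 /
      (4 * q ^ 2 * Theta 4 q ^ 4 * Theta 24 q ^ 6) * (etaP q * (2 + etaP q) * etaP (q ^ 2) / (2 *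
      (1 + etaP q))) := by
    rw [f0, e4, e2, e0]
    field_simp
    norm_num
  have r6 : Theta 4 q ^ 6 * Theta 6 q ^ 3 * Theta 24 q / (Theta 2 q ^ 3 * Theta 8 q ^ 3 *
      Theta 12 q ^ 2) = Theta 6 q ^ 2 * Theta 8 q ^ 2 * Theta 12 q ^ 8 / (4 * q ^
      2 * Theta 4 q ^ 4 * Theta 24 q ^ 6) * (2 * etaP (q ^ 2) * (1 + 2 * etaP (q ^ 2)) / (1 + etaP
      (q ^ 2))) := by
    rw [f3, f2, f0]
    field_simp
    norm_num
  have r7 : Theta 4 q ^ 3 * Theta 12 q ^ 7 / (Theta 2 q * Theta 6 q ^ 3 * Theta 8 q ^ 2 *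
      Theta 24 q ^ 2) = Theta 6 q ^ 2 * Theta 8 q ^ 2 * Theta 12 q ^ 8 / (4 * q ^
      2 * Theta 4 q ^ 4 * Theta 24 q ^ 6) * (etaP q ^ 2 * (1 + 2 * etaP (q ^ 2)) / (1 + etaP q))
      := by
    rw [f3, e2, e0]
    field_simp
    norm_num
  have r8 : q ^ 2 * Theta 4 q ^ 6 * Theta 24 q ^ 4 / (Theta 2 q ^ 2 * Theta 8 q ^ 4 *
      Theta 12 q ^ 2) = Theta 6 q ^ 2 * Theta 8 q ^ 2 * Theta 12 q ^ 8 / (4 * q ^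
      2 * Theta 4 q ^ 4 * Theta 24 q ^ 6) * (etaP q ^ 2 * etaP (q ^ 2) * (1 + 2 * etaP (q ^ 2)) /
      (2 * (1 + etaP q))) := by
    rw [f3, f0, e2, e0]
    field_simp
    norm_num
  rw [r1, r2, r3, r4, r5, r6, r7, r8]
  have m1 := one_sub_etaP_ne_zero hq0 hq
  have m2 := one_add_etaP_ne_zero hq0 hq
  have m4 := two_add_etaP_ne_zero hq0 hq
  have m6 := one_sub_etaP_ne_zero (pow_ne_zero 2 hq0) (norm_pow_lt_one hq two_pos)
  have m7 := one_add_etaP_ne_zero (pow_ne_zero 2 hq0) (norm_pow_lt_one hq two_pos)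
  have hs := etaS_relation hq0 hq
  have hp := etaP_relation hq0 hq
  have k1 := one_add_etaP_ne_zero (pow_ne_zero 2 hq0) (norm_pow_lt_one hq two_pos)
  have k2 := two_add_etaP_ne_zero (pow_ne_zero 2 hq0) (norm_pow_lt_one hq two_pos)
  clear e0 e1 e2 e3 e4 f0 f1 f2 f3 g0 g1 r1 r2 r3 r4 r5 r6 r7 r8
  generalize etaP q = p at *
  generalize etaP (q ^ 2) = r at *
  generalize etaS q = s at *
  have h : 6 * s - 14 * r - 26 * r ^ 2 - 6 * r ^ 2 * s + 4 * r ^ 3 - 3 * p + 21 * p *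
      s - 24 * p * r - 37 * p * r ^ 2 - 21 * p * r ^ 2 * s - 8 * p * r ^ 3 - 2 * p
      ^ 2 + 17 * p ^ 2 * s + 11 * p ^ 2 * r - 8 * p ^ 2 * r * s + 30 * p ^ 2 * r ^ 2 - 17 *
      p ^ 2 * r ^ 2 * s - p ^ 2 * r ^ 3 + 8 * p ^ 2 * r ^ 3 * s - 2 * p ^ 2 * r ^ 4 -
      2 * p ^ 3 + 2 * p ^ 3 * s + 13 * p ^ 3 * r - 8 * p ^ 3 * r * s + 41 * p ^ 3 * r ^ 2 -
      2 * p ^ 3 * r ^ 2 * s + 19 * p ^ 3 * r ^ 3 + 8 * p ^ 3 * r ^ 3 * s + p ^ 3 * r ^ 4 - 2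
      * p ^ 4 - p ^ 4 * s - 4 * p ^ 4 * r - 2 * p ^ 4 * r * s + p ^ 4 * r ^ 2 + p ^ 4
      * r ^ 2 * s + 4 * p ^ 4 * r ^ 3 + 2 * p ^ 4 * r ^ 3 * s + p ^ 4 * r ^ 4 = 0 := by
    -- The powers clear the denominators that arise on eliminating `p` by `hp` and `s²` by `hs`;
    -- the coefficients below are the cofactors of this elimination.
    refine mul_left_cancel₀ (mul_ne_zero (pow_ne_zero 8 k1) (pow_ne_zero 4 k2)) ?_
    linear_combination (-48 + 272 * s + 416 * s ^ 2 - 128 * s ^ 3 - 128 * s ^ 4 - 800 *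
      r + 2768 * r * s + 3216 * r * s ^ 2 - 1472 * r * s ^ 3 - 704 * r * s ^ 4 - 5080 * r
      ^ 2 + 12904 * r ^ 2 * s + 11312 * r ^ 2 * s ^ 2 - 5280 * r ^ 2 * s ^ 3 - 1440 * r ^ 2
      * s ^ 4 - 17576 * r ^ 3 + 35664 * r ^ 3 * s + 24728 * r ^ 3 * s ^ 2 - 8496 * r ^ 3 * s
      ^ 3 - 1200 * r ^ 3 * s ^ 4 - 38587 * r ^ 4 + 63489 * r ^ 4 * s + 38402 * r ^ 4 * s ^ 2
      - 5400 * r ^ 4 * s ^ 3 + 168 * r ^ 4 * s ^ 4 - 58780 * r ^ 5 + 74787 * r ^ 5 * s +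
      45005 * r ^ 5 * s ^ 2 + 2604 * r ^ 5 * s ^ 3 + 1260 * r ^ 5 * s ^ 4 - 65833 * r ^ 6 +
      57887 * r ^ 6 * s + 40322 * r ^ 6 * s ^ 2 + 7602 * r ^ 6 * s ^ 3 + 1218 * r ^ 6 * s ^ 4 -
      55901 * r ^ 7 + 27790 * r ^ 7 * s + 27209 * r ^ 7 * s ^ 2 + 6495 * r ^ 7 * s ^ 3 + 615 *
      r ^ 7 * s ^ 4 - 36058 * r ^ 8 + 6459 * r ^ 8 * s + 13439 * r ^ 8 * s ^ 2 + 3072 * r ^ 8 *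
      s ^ 3 + 180 * r ^ 8 * s ^ 4 - 17251 * r ^ 9 - 741 * r ^ 9 * s + 4671 * r ^ 9 * s ^ 2 +
      860 * r ^ 9 * s ^ 3 + 29 * r ^ 9 * s ^ 4 - 5853 * r ^ 10 - 1003 * r ^ 10 * s + 1076 *
      r ^ 10 * s ^ 2 + 134 * r ^ 10 * s ^ 3 + 2 * r ^ 10 * s ^ 4 - 1314 * r ^ 11 - 298 * r ^
      11 * s + 147 * r ^ 11 * s ^ 2 + 9 * r ^ 11 * s ^ 3 - 173 * r ^ 12 - 40 * r ^ 12 * s +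
      9 * r ^ 12 * s ^ 2 - 10 * r ^ 13 - 2 * r ^ 13 * s - 32 * p + 208 * p * s - 64 *
      p * s ^ 2 - 64 * p * s ^ 3 - 112 * p * r + 1952 * p * r * s - 800 * p * r * s ^ 2 -
      448 * p * r * s ^ 3 + 960 * p * r ^ 2 + 8504 * p * r ^ 2 * s - 3552 * p * r ^ 2 * s ^
      2 - 1264 * p * r ^ 2 * s ^ 3 + 8152 * p * r ^ 3 + 22808 * p * r ^ 3 * s - 7856 * p * r
      ^ 3 * s ^ 2 - 1760 * p * r ^ 3 * s ^ 3 + 27710 * p * r ^ 4 + 42109 * p * r ^ 4 * s -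
      9028 * p * r ^ 4 * s ^ 2 - 956 * p * r ^ 4 * s ^ 3 + 55245 * p * r ^ 5 + 56728 * p * r
      ^ 5 * s - 3354 * p * r ^ 5 * s ^ 2 + 676 * p * r ^ 5 * s ^ 3 + 71645 * p * r ^ 6 + 57680
      * p * r ^ 6 * s + 5044 * p * r ^ 6 * s ^ 2 + 1615 * p * r ^ 6 * s ^ 3 + 62657 * p * r ^ 7 +
      45067 * p * r ^ 7 * s + 8822 * p * r ^ 7 * s ^ 2 + 1348 * p * r ^ 7 * s ^ 3 + 36908 * p * r
      ^ 8 + 27145 * p * r ^ 8 * s + 6747 * p * r ^ 8 * s ^ 2 + 640 * p * r ^ 8 * s ^ 3 + 13997 * p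
      * r ^ 9 + 12433 * p * r ^ 9 * s + 3056 * p * r ^ 9 * s ^ 2 + 182 * p * r ^ 9 * s ^ 3 + 2905
      * p * r ^ 10 + 4184 * p * r ^ 10 * s + 844 * p * r ^ 10 * s ^ 2 + 29 * p * r ^ 10 * s ^ 3 +
      57 * p * r ^ 11 + 971 * p * r ^ 11 * s + 132 * p * r ^ 11 * s ^ 2 + 2 * p * r ^ 11 * s ^ 3 -
      126 * p * r ^ 12 + 138 * p * r ^ 12 * s + 9 * p * r ^ 12 * s ^ 2 - 28 * p * r ^ 13 + 9
      * p * r ^ 13 * s - 2 * p * r ^ 14 - 32 * p ^ 2 - 32 * p ^ 2 * s - 32 * p ^ 2 * s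
      ^ 2 - 80 * p ^ 2 * r - 432 * p ^ 2 * r * s - 272 * p ^ 2 * r * s ^ 2 + 1152 * p ^ 2
      * r ^ 2 - 2256 * p ^ 2 * r ^ 2 * s - 976 * p ^ 2 * r ^ 2 * s ^ 2 + 8712 * p ^ 2 * r ^
      3 - 6264 * p ^ 2 * r ^ 3 * s - 1880 * p ^ 2 * r ^ 3 * s ^ 2 + 29390 * p ^ 2 * r ^ 4 -
      10074 * p ^ 2 * r ^ 4 * s - 1930 * p ^ 2 * r ^ 4 * s ^ 2 + 60783 * p ^ 2 * r ^ 5 -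
      8631 * p ^ 2 * r ^ 5 * s - 533 * p ^ 2 * r ^ 5 * s ^ 2 + 85077 * p ^ 2 * r ^ 6 -
      764 * p ^ 2 * r ^ 6 * s + 1272 * p ^ 2 * r ^ 6 * s ^ 2 + 84097 * p ^ 2 * r ^ 7 + 7524 * p
      ^ 2 * r ^ 7 * s + 1991 * p ^ 2 * r ^ 7 * s ^ 2 + 59696 * p ^ 2 * r ^ 8 + 9960 * p ^ 2 * r ^
      8 * s + 1480 * p ^ 2 * r ^ 8 * s ^ 2 + 30411 * p ^ 2 * r ^ 9 + 6966 * p ^ 2 * r ^ 9 * s +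
      665 * p ^ 2 * r ^ 9 * s ^ 2 + 10930 * p ^ 2 * r ^ 10 + 3036 * p ^ 2 * r ^ 10 * s + 184 * p ^
      2 * r ^ 10 * s ^ 2 + 2667 * p ^ 2 * r ^ 11 + 828 * p ^ 2 * r ^ 11 * s + 29 * p ^ 2 * r ^ 11
      * s ^ 2 + 410 * p ^ 2 * r ^ 12 + 130 * p ^ 2 * r ^ 12 * s + 2 * p ^ 2 * r ^ 12 * s ^ 2 + 34
      * p ^ 2 * r ^ 13 + 9 * p ^ 2 * r ^ 13 * s + p ^ 2 * r ^ 14 - 32 * p ^ 3 - 16 * p ^ 3 *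
      s - 320 * p ^ 3 * r - 160 * p ^ 3 * r * s - 1408 * p ^ 3 * r ^ 2 - 696 * p ^ 3 *
      r ^ 2 * s - 3536 * p ^ 3 * r ^ 3 - 1704 * p ^ 3 * r ^ 3 * s - 5402 * p ^ 3 * r ^ 4
      - 2481 * p ^ 3 * r ^ 4 * s - 4616 * p ^ 3 * r ^ 5 - 1896 * p ^ 3 * r ^ 5 * s -
      661 * p ^ 3 * r ^ 6 + 86 * p ^ 3 * r ^ 6 * s + 3686 * p ^ 3 * r ^ 7 + 1958 * p ^ 3 * r ^
      7 * s + 5322 * p ^ 3 * r ^ 8 + 2388 * p ^ 3 * r ^ 8 * s + 4094 * p ^ 3 * r ^ 9 + 1614 * p ^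
      3 * r ^ 9 * s + 2036 * p ^ 3 * r ^ 10 + 690 * p ^ 3 * r ^ 10 * s + 674 * p ^ 3 * r ^ 11 +
      186 * p ^ 3 * r ^ 11 * s + 144 * p ^ 3 * r ^ 12 + 29 * p ^ 3 * r ^ 12 * s + 18 * p ^ 3 * r ^
      13 + 2 * p ^ 3 * r ^ 13 * s + p ^ 3 * r ^ 14) * hp + (272 + 416 * s - 128 * s ^ 2 -
      128 * s ^ 3 + 2912 * r + 3088 * r * s - 1536 * r * s ^ 2 - 704 * r * s ^ 3 + 13544
      * r ^ 2 + 10160 * r ^ 2 * s - 5600 * r ^ 2 * s ^ 2 - 1440 * r ^ 2 * s ^ 3 + 36664 * r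
      ^ 3 + 21240 * r ^ 3 * s - 9056 * r ^ 3 * s ^ 2 - 1200 * r ^ 3 * s ^ 3 + 65225 * r ^ 4
      + 33858 * r ^ 4 * s - 5720 * r ^ 4 * s ^ 2 + 168 * r ^ 4 * s ^ 3 + 81204 * r ^ 5 + 43461
      * r ^ 5 * s + 2848 * r ^ 5 * s ^ 2 + 1260 * r ^ 5 * s ^ 3 + 72885 * r ^ 6 + 43194 * r ^ 6 *
      s + 8110 * r ^ 6 * s ^ 2 + 1218 * r ^ 6 * s ^ 3 + 47355 * r ^ 7 + 31443 * r ^ 7 * s + 6850 *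
      r ^ 7 * s ^ 2 + 615 * r ^ 7 * s ^ 3 + 21816 * r ^ 8 + 16095 * r ^ 8 * s + 3202 * r ^ 8 * s ^
      2 + 180 * r ^ 8 * s ^ 3 + 6751 * r ^ 9 + 5584 * r ^ 9 * s + 885 * r ^ 9 * s ^ 2 + 29 * r ^ 9
      * s ^ 3 + 1231 * r ^ 10 + 1244 * r ^ 10 * s + 136 * r ^ 10 * s ^ 2 + 2 * r ^ 10 * s ^ 3 + 76
      * r ^ 11 + 160 * r ^ 11 * s + 9 * r ^ 11 * s ^ 2 - 13 * r ^ 12 + 9 * r ^ 12 * s - 2 *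
      r ^ 13) * hs
  linear_combination (norm := skip) Theta 6 q ^ 2 * Theta 8 q ^ 2 * Theta 12 q ^ 8 / (4 * q ^ 2 *
      Theta 4 q ^ 4 * Theta 24 q ^ 6) / ((1 - p) * (1 + p) * (2 + p) * (1 - r) * (1 + r)) * h
  field_simp
  ring

/-! ### Trisection of `A₂` -/

theorem jac_pow_add {q : ℂ} (hq0 : q ≠ 0) (hq : ‖q‖ < 1) {N : ℕ} (hN : 0 < N) (m : ℕ) :
    jac (q ^ (N + m)) (q ^ N) = -(q ^ m)⁻¹ * jac (q ^ m) (q ^ N) := by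
  rw [pow_add, jac_mul_left_self (pow_ne_zero _ hq0) (norm_pow_lt_one hq hN) (pow_ne_zero _ hq0)]

theorem jac_pow_symm {q : ℂ} (hq0 : q ≠ 0) {N m n : ℕ} (h : m + n = N) :
    jac (q ^ m) (q ^ N) = jac (q ^ n) (q ^ N) := by
  rw [← jac_self_div (pow_ne_zero N hq0) (q ^ n), ← h, pow_add, mul_div_cancel_right₀]
  exact pow_ne_zero _ hq0

theorem jac_pow_ne_zero {q : ℂ} (hq0 : q ≠ 0) (hq : ‖q‖ < 1) {N m : ℕ} (hN : 0 < N)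
    (h : ¬ N ∣ m) : jac (q ^ m) (q ^ N) ≠ 0 :=
  jac_ne_zero (pow_ne_zero _ hq0) (norm_pow_lt_one hq hN) (pow_ne_zero _ hq0)
    (zpow_mul_pow_ne_one hq0 hq h)

/-- `jac_mul_appell_sub` for arguments that are powers of `q`. -/
theorem jac_pow_mul_appell_sub {q : ℂ} (hq0 : q ≠ 0) (hq : ‖q‖ < 1) {N : ℕ} (hN : 0 < N)
    (a : ℕ) {b l : ℕ} (hl : ¬ N ∣ l) (hb : ¬ N ∣ b) (hbl : ¬ N ∣ l + b) :
    jac (q ^ a) (q ^ N) * appell (q ^ N) (q ^ (l + a)) (q ^ (l + b))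
      - jac (q ^ (l + a)) (q ^ N) * appell (q ^ N) (q ^ a) (q ^ b)
      = -q ^ b * Theta N q ^ 3 * jac (q ^ l) (q ^ N) * jac (q ^ (l + a + b)) (q ^ N) /
        (jac (q ^ b) (q ^ N) * jac (q ^ (l + b)) (q ^ N)) := by
  have h := jac_mul_appell_sub (pow_ne_zero N hq0) (norm_pow_lt_one hq hN)
    (z := q ^ a) (w := q ^ b) (l := q ^ l) (pow_ne_zero _ hq0) (pow_ne_zero _ hq0)
    (pow_ne_zero _ hq0) (zpow_mul_pow_ne_one hq0 hq hl) (zpow_mul_pow_ne_one hq0 hq hb)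
    (by rw [← pow_add]; exact zpow_mul_pow_ne_one hq0 hq hbl)
  rwa [← pow_add, ← pow_add, ← pow_add, ← Theta_eq_qInf] at h

theorem jac_self_neg_cube {q : ℂ} (hq0 : q ≠ 0) (hq : ‖q‖ < 1) :
    jac q (-q ^ 3) = Theta 1 q * Theta 4 q * Theta 6 q ^ 5 /
      (Theta 2 q ^ 2 * Theta 3 q ^ 2 * Theta 12 q ^ 2) := by
  have h := jac_neg_self_cube (neg_ne_zero.2 hq0) (by rwa [norm_neg])
  rw [neg_neg, Theta_neg_of_even (by decide), Theta_neg_of_odd (by decide) hq, Theta_one_neg hq,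
    Theta_neg_of_even (m := 6) (by decide)] at h
  rw [show -q ^ 3 = (-q) ^ 3 by ring, h]
  obtain ⟨n1, n2, n3, n4, n6, n12⟩ := Theta_ne_zero_twelve hq
  norm_num
  field_simp

theorem jac_neg_self_neg_cube {q : ℂ} (hq0 : q ≠ 0) (hq : ‖q‖ < 1) :
    jac (-q) (-q ^ 3) = Theta 2 q ^ 3 / (Theta 1 q * Theta 4 q) := by
  rw [← Theta_one_neg hq, ← jac_self_cube (neg_ne_zero.2 hq0) (by rwa [norm_neg])]
  ring_nf

theorem jac_self_neg_cube_eq_sub {q : ℂ} (hq0 : q ≠ 0) (hq : ‖q‖ < 1) :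
    jac q (-q ^ 3) = jac (q ^ 5) (q ^ 12) - q * jac q (q ^ 12) := by
  have hp : ‖-q ^ 3‖ < 1 := by rw [norm_neg]; exact norm_pow_lt_one hq three_pos
  rw [jac_double (neg_ne_zero.2 (pow_ne_zero 3 hq0)) hp hq0]
  have h := jac_pow_symm hq0 (show 11 + 1 = 12 from rfl)
  rw [pow_one] at h
  rw [← h]
  ring_nf

theorem jac_neg_self_neg_cube_eq_add {q : ℂ} (hq0 : q ≠ 0) (hq : ‖q‖ < 1) :
    jac (-q) (-q ^ 3) = jac (q ^ 5) (q ^ 12) + q * jac q (q ^ 12) := by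
  have hp : ‖-q ^ 3‖ < 1 := by rw [norm_neg]; exact norm_pow_lt_one hq three_pos
  rw [jac_double (neg_ne_zero.2 (pow_ne_zero 3 hq0)) hp (neg_ne_zero.2 hq0)]
  have h := jac_pow_symm hq0 (show 11 + 1 = 12 from rfl)
  rw [pow_one] at h
  rw [← h]
  ring_nf

/-- The three components of `q * appell (q^4) (q^5) (q^2)` under trisection, in the variable
`q^3`. -/
def A2Part (q : ℂ) : Fin 3 → ℂ :=
  let a (m n : ℕ) := appell (q ^ 12) (q ^ m) (q ^ n)
  ![q * a 13 2 - q ^ 2 * a 13 6 - q ^ 4 * a 17 6 - q ^ 6 * a 21 6 + q ^ 5 * a 17 10,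
    a 9 2 + q ^ 8 * a 21 10, q * a 17 2 + q ^ 11 * a 25 10]

/-- The nine Appell sums of the 3-dissection, grouped by the residue of the exponent of `q` modulo
3. -/
theorem self_mul_appell_trisect {q : ℂ} (hq0 : q ≠ 0) (hq : ‖q‖ < 1) :
    q * appell (q ^ 4) (q ^ 5) (q ^ 2)
      = A2Part (q ^ 3) 0 + q * A2Part (q ^ 3) 1 + q ^ 2 * A2Part (q ^ 3) 2 := by
  rw [appell_triple (pow_ne_zero 4 hq0) (norm_pow_lt_one hq four_pos) (pow_ne_zero 5 hq0)
    (fun r => by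
      have := zpow_mul_pow_ne_one hq0 hq (N := 12) (m := 6) (by norm_num) r
      rwa [← pow_mul, ← pow_mul])]
  simp only [Finset.sum_range_succ, Finset.sum_range_zero, zero_add, A2Part, Matrix.cons_val_zero,
    Matrix.cons_val_one, Matrix.cons_val, ← pow_mul, ← pow_add, Nat.cast_zero, Nat.cast_one,
    Nat.cast_ofNat, th_zero, th_one (pow_ne_zero 4 hq0) (pow_ne_zero 5 hq0),
    th_two (pow_ne_zero 4 hq0) (pow_ne_zero 5 hq0), Nat.reduceMul, Nat.reduceAdd, mul_zero,
    add_zero, mul_one, pow_zero, one_mul]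
  ring

theorem jac_self_four_trisect {q : ℂ} (hq0 : q ≠ 0) (hq : ‖q‖ < 1) :
    jac q (q ^ 4) = jac (q ^ 3) (-(q ^ 3) ^ 3) - q * jac ((q ^ 3) ^ 3) ((q ^ 3) ^ 12) := by
  have hQ := norm_pow_lt_one hq three_pos
  have hQ0 := pow_ne_zero 3 hq0
  rw [jac_triple (pow_ne_zero 4 hq0) (norm_pow_lt_one hq four_pos) hq0,
    jac_self_neg_cube_eq_sub hQ0 hQ]
  have e1 := jac_pow_symm hQ0 (show 9 + 3 = 12 from rfl)
  have e2 := jac_pow_add hQ0 hQ (N := 12) (by norm_num) 1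
  rw [← e1]
  simp only [← pow_mul, ← pow_add, Nat.reduceMul, Nat.reduceAdd] at e2 ⊢
  rw [e2]
  field_simp
  ring

/-- The values at `q^m` of theta functions with base `q^12`, reduced to `1 ≤ m ≤ 6`. -/
theorem jac_twelve_reduce {q : ℂ} (hq0 : q ≠ 0) (hq : ‖q‖ < 1) :
    jac (q ^ 8) (q ^ 12) = jac (q ^ 4) (q ^ 12) ∧ jac (q ^ 9) (q ^ 12) = jac (q ^ 3) (q ^ 12) ∧
    jac (q ^ 10) (q ^ 12) = jac (q ^ 2) (q ^ 12) ∧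
    jac (q ^ 13) (q ^ 12) = -jac q (q ^ 12) / q ∧
    jac (q ^ 15) (q ^ 12) = -jac (q ^ 3) (q ^ 12) / q ^ 3 ∧
    jac (q ^ 17) (q ^ 12) = -jac (q ^ 5) (q ^ 12) / q ^ 5 ∧
    jac (q ^ 19) (q ^ 12) = -jac (q ^ 5) (q ^ 12) / q ^ 7 ∧
    jac (q ^ 21) (q ^ 12) = -jac (q ^ 3) (q ^ 12) / q ^ 9 ∧
    jac (q ^ 23) (q ^ 12) = -jac q (q ^ 12) / q ^ 11 ∧
    jac (q ^ 25) (q ^ 12) = jac q (q ^ 12) / q ^ 14 ∧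
    jac (q ^ 27) (q ^ 12) = jac (q ^ 3) (q ^ 12) / q ^ 18 ∧
    jac (q ^ 31) (q ^ 12) = jac (q ^ 5) (q ^ 12) / q ^ 26 := by
  have e (m : ℕ) := jac_pow_add hq0 hq (N := 12) (by norm_num) m
  have e7 := jac_pow_symm hq0 (show 7 + 5 = 12 from rfl)
  have e8 := jac_pow_symm hq0 (show 8 + 4 = 12 from rfl)
  have e9 := jac_pow_symm hq0 (show 9 + 3 = 12 from rfl)
  have e10 := jac_pow_symm hq0 (show 10 + 2 = 12 from rfl)
  have e11 := jac_pow_symm hq0 (show 11 + 1 = 12 from rfl)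
  have e13 := e 1
  have e15 := e 3
  have e17 := e 5
  have e19 := e 7
  have e21 := e 9
  have e23 := e 11
  have e25 := e 13
  have e27 := e 15
  have e31 := e 19
  simp only [Nat.reduceAdd, pow_one] at e11 e13 e15 e17 e19 e21 e23 e25 e27 e31
  rw [e31, e27, e25, e23, e21, e19, e17, e15, e13, e11, e10, e9, e8, e7]
  refine ⟨rfl, rfl, rfl, ?_, ?_, ?_, ?_, ?_, ?_, ?_, ?_, ?_⟩ <;> field_simp

/-- Two changes of parameters bring the Appell sums of the component to the one that occurs in `A2
(q^3)`. -/
theorem A2Part_two_eq {q : ℂ} (hq0 : q ≠ 0) (hq : ‖q‖ < 1) :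
    jac (q ^ 3) (q ^ 12) * A2Part q 2
      = q ^ 5 * jac q (-q ^ 3) * appell (q ^ 12) (q ^ 21) (q ^ 6)
        + Theta 12 q ^ 3 * jac (q ^ 4) (q ^ 12) /
          (jac (q ^ 6) (q ^ 12) * jac (q ^ 2) (q ^ 12)) * jac (-q) (-q ^ 3) := by
  obtain ⟨-, -, t10, -, -, t17, -, t21, t23, t25, -, t31⟩ := jac_twelve_reduce hq0 hq
  have n2 := jac_pow_ne_zero hq0 hq (N := 12) (m := 2) (by norm_num) (by norm_num)
  have n6 := jac_pow_ne_zero hq0 hq (N := 12) (m := 6) (by norm_num) (by norm_num)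
  have h1 := jac_pow_mul_appell_sub hq0 hq (N := 12) (by norm_num) 17 (b := 2) (l := 4)
    (by norm_num) (by norm_num) (by norm_num)
  have h2 := jac_pow_mul_appell_sub hq0 hq (N := 12) (by norm_num) 21 (b := 6) (l := 4)
    (by norm_num) (by norm_num) (by norm_num)
  simp only [Nat.reduceAdd, t10, t17, t21, t23, t25, t31] at h1 h2
  simp only [A2Part, Matrix.cons_val, jac_self_neg_cube_eq_sub hq0 hq,
    jac_neg_self_neg_cube_eq_add hq0 hq]
  linear_combination (norm := (field_simp; ring)) q ^ 10 * h1 - q ^ 20 * h2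

/-- Four changes of parameters express the component by `A2Part q 1` and the Appell sum that
occurs in `A2 (q^3)`. -/
theorem A2Part_zero_eq {q : ℂ} (hq0 : q ≠ 0) (hq : ‖q‖ < 1) :
    jac (q ^ 3) (q ^ 12) * A2Part q 0 = -jac q (-q ^ 3) * A2Part q 1
      - q ^ 6 * jac (q ^ 3) (q ^ 12) * appell (q ^ 12) (q ^ 21) (q ^ 6)
        + Theta 12 q ^ 3 * jac (q ^ 4) (q ^ 12) / jac (q ^ 2) (q ^ 12) ^ 2
          * jac (-q) (-q ^ 3) := by
  obtain ⟨t8, t9, t10, t13, t15, t17, t19, t21, t23, t25, t27, -⟩ := jac_twelve_reduce hq0 hq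
  have n2 := jac_pow_ne_zero hq0 hq (N := 12) (m := 2) (by norm_num) (by norm_num)
  have n6 := jac_pow_ne_zero hq0 hq (N := 12) (m := 6) (by norm_num) (by norm_num)
  have h1 := jac_pow_mul_appell_sub hq0 hq (N := 12) (by norm_num) 13 (b := 2) (l := 8)
    (by norm_num) (by norm_num) (by norm_num)
  have h2 := jac_pow_mul_appell_sub hq0 hq (N := 12) (by norm_num) 17 (b := 6) (l := 4)
    (by norm_num) (by norm_num) (by norm_num)
  have h3 := jac_pow_mul_appell_sub hq0 hq (N := 12) (by norm_num) 9 (b := 2) (l := 4)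
    (by norm_num) (by norm_num) (by norm_num)
  have h4 := jac_pow_mul_appell_sub hq0 hq (N := 12) (by norm_num) 9 (b := 2) (l := 8)
    (by norm_num) (by norm_num) (by norm_num)
  simp only [Nat.reduceAdd, t8, t9, t10, t13, t15, t17, t19, t21, t23, t27] at h1 h2 h3 h4
  simp only [A2Part, Matrix.cons_val_zero, Matrix.cons_val_one,
    jac_self_neg_cube_eq_sub hq0 hq, jac_neg_self_neg_cube_eq_add hq0 hq]
  linear_combination (norm := (field_simp; ring))
    q ^ 10 * h1 - q ^ 13 * h2 - q ^ 2 * h3 + q ^ 5 * h4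

/-- The reflection `w ↦ p w⁻¹`, followed by a shift of `z`; the theta functions that arise cancel.
-/
theorem appell_pow_fifteen {q : ℂ} (hq0 : q ≠ 0) (hq : ‖q‖ < 1) {n : ℕ} (hn : ¬ 12 ∣ n) :
    appell (q ^ 12) (q ^ 15) (q ^ 12 * (q ^ n)⁻¹)
      = q ^ n / q ^ 3 * appell (q ^ 12) (q ^ 21) (q ^ n) := by
  have hp := norm_pow_lt_one hq (m := 12) (by norm_num)
  have h1 : ∀ r : ℤ, (q ^ 12) ^ r * (q ^ n)⁻¹ ≠ 1 := fun r => by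
    rw [← zpow_natCast q n, ← zpow_neg]
    exact zpow_mul_zpow_ne_one hq0 hq (by simpa [Int.dvd_neg] using mod_cast hn) r
  rw [appell_mul_right (pow_ne_zero _ hq0) hp (pow_ne_zero _ hq0)
      (inv_ne_zero (pow_ne_zero n hq0)) h1,
    appell_inv (pow_ne_zero _ hq0) _ (pow_ne_zero n hq0),
    show (q ^ 12) ^ 2 / q ^ 15 = q ^ 9 by field_simp, show q ^ 21 = q ^ 12 * q ^ 9 by ring,
    appell_mul_left (pow_ne_zero _ hq0) hp (pow_ne_zero _ hq0) (pow_ne_zero _ hq0)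
      (zpow_mul_pow_ne_one hq0 hq hn)]
  obtain ⟨-, t9, -, -, t15, -⟩ := jac_twelve_reduce hq0 hq
  rw [t9, t15]
  have := pow_ne_zero n hq0
  field_simp
  ring

theorem A2_cube_eq {q : ℂ} (hq0 : q ≠ 0) (hq : ‖q‖ < 1) :
    A2 (q ^ 3) = q ^ 6 * appell (q ^ 12) (q ^ 21) (q ^ 6) / jac (q ^ 3) (q ^ 12) := by
  have h := appell_pow_fifteen hq0 hq (n := 6) (by norm_num)
  rw [show q ^ 12 * (q ^ 6)⁻¹ = q ^ 6 by field_simp] at h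
  rw [A2_eq_div (pow_ne_zero 3 hq0) (norm_pow_lt_one hq three_pos)]
  simp only [← pow_mul, Nat.reduceMul]
  rw [h]
  field_simp

/-- The component of `A₂` with index 1 carries the Appell sums of `φ₆(-q)`. -/
theorem phi6_neg_eq_A2Part {q : ℂ} (hq0 : q ≠ 0) (hq : ‖q‖ < 1) :
    phi6 (-q) = (2 * A2Part q 1 - Theta 3 (-q) ^ 3 / jac q (-q ^ 3)) / jac (q ^ 3) (q ^ 12) := by
  have h := appell_pow_fifteen hq0 hq (n := 10) (by norm_num)
  rw [show q ^ 12 * (q ^ 10)⁻¹ = q ^ 2 by field_simp] at h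
  rw [phi6_neg_eq hq0 hq, h, Theta_eq_qInf, show (-q) ^ 3 = -q ^ 3 by ring]
  simp only [A2Part, Matrix.cons_val_one, Matrix.cons_val_zero]
  field_simp

/-- The products of the components of `A2` with the components of `jac q (q^4)` under
trisection. Since `jac q (q^4)` has no component of index 2, these are three linear equations;
verifying them for the claimed `C0`, `C1`, `C2` avoids inverting the theta function. -/
theorem A2_components {q : ℂ} (hq0 : q ≠ 0) (hq : ‖q‖ < 1) {C0 C1 C2 : ℂ}
    (h0 : C0 = -phi6 (-q) / 2 + Theta 2 q ^ 11 * Theta 6 q ^ 2 /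
      (2 * Theta 1 q ^ 7 * Theta 4 q ^ 4 * Theta 12 q))
    (h1 : C1 = Theta 2 q ^ 4 * Theta 3 q ^ 2 * Theta 4 q / (Theta 1 q ^ 5 * Theta 6 q))
    (h2 : C2 = A2 (q ^ 3) / q + 2 * (Theta 2 q ^ 3 * Theta 4 q * Theta 6 q ^ 2 /
      (Theta 1 q ^ 4 * Theta 3 q))) :
    jac q (-q ^ 3) * C0 - q * jac (q ^ 3) (q ^ 12) * C2 = A2Part q 0 ∧
    jac q (-q ^ 3) * C1 - jac (q ^ 3) (q ^ 12) * C0 = A2Part q 1 ∧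
    jac q (-q ^ 3) * C2 - jac (q ^ 3) (q ^ 12) * C1 = A2Part q 2 := by
  obtain ⟨n1, n2, n3, n4, n6, n12⟩ := Theta_ne_zero_twelve hq
  have e0 := A2Part_zero_eq hq0 hq
  have e2 := A2Part_two_eq hq0 hq
  have i0 := A2_thetaQuotient_zero hq0 hq
  have i1 := A2_thetaQuotient_one hq0 hq
  have i2 := A2_thetaQuotient_two hq0 hq
  obtain ⟨⟨t2, t4, t6⟩, -⟩ := jac_even_twelve hq0 hq
  have t3 := jac_cube_twelve hq0 hq
  have hd : jac (q ^ 3) (q ^ 12) ≠ 0 := by rw [t3]; positivity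
  rw [phi6_neg_eq_A2Part hq0 hq, Theta_neg_of_odd (by decide) hq] at h0
  rw [A2_cube_eq hq0 hq] at h2
  simp only [Nat.reduceMul] at h0
  rw [jac_neg_self_neg_cube hq0 hq, t2, t4] at e0
  rw [jac_neg_self_neg_cube hq0 hq, t2, t4, t6] at e2
  refine ⟨mul_left_cancel₀ hd ?_, ?_, mul_left_cancel₀ hd ?_⟩
  · rw [e0, h0, h2, jac_self_neg_cube hq0 hq, t3]
    linear_combination (norm := (field_simp; ring)) Theta 3 q * Theta 12 q / Theta 6 q * i0
  · rw [h0, h1, jac_self_neg_cube hq0 hq, t3]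
    linear_combination (norm := (field_simp; ring)) i1
  · rw [e2, h1, h2, jac_self_neg_cube hq0 hq, t3]
    linear_combination (norm := (field_simp; ring)) Theta 3 q * Theta 12 q / Theta 6 q * i2

/-- Trisection of `A2`: with `Q = q^3`, the coefficients of `1`, `q` and `q^2`. -/
theorem A2_trisect {q : ℂ} (hq0 : q ≠ 0) (hq : ‖q‖ < 1) :
    A2 q = (-phi6 (-q ^ 3) / 2 + Theta 2 (q ^ 3) ^ 11 * Theta 6 (q ^ 3) ^ 2 /
        (2 * Theta 1 (q ^ 3) ^ 7 * Theta 4 (q ^ 3) ^ 4 * Theta 12 (q ^ 3)))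
      + q * (Theta 2 (q ^ 3) ^ 4 * Theta 3 (q ^ 3) ^ 2 * Theta 4 (q ^ 3) /
        (Theta 1 (q ^ 3) ^ 5 * Theta 6 (q ^ 3)))
      + q ^ 2 * (A2 ((q ^ 3) ^ 3) / q ^ 3 + 2 * (Theta 2 (q ^ 3) ^ 3 * Theta 4 (q ^ 3) *
        Theta 6 (q ^ 3) ^ 2 / (Theta 1 (q ^ 3) ^ 4 * Theta 3 (q ^ 3)))) := by
  obtain ⟨e0, e1, e2⟩ := A2_components (pow_ne_zero 3 hq0) (norm_pow_lt_one hq three_pos)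
    rfl rfl rfl
  rw [A2_eq_div hq0 hq, self_mul_appell_trisect hq0 hq,
    div_eq_iff (jac_self_pow_four_ne_zero hq0 hq), jac_self_four_trisect hq0 hq, ← e0, ← e1, ← e2]
  ring

/-! ### Trisection of `B₂` -/

theorem jac_neg_self_four {q : ℂ} (hq0 : q ≠ 0) (hq : ‖q‖ < 1) :
    jac (-q) (q ^ 4) = Theta 2 q ^ 2 / Theta 1 q := by
  have h := jac_self_four (neg_ne_zero.2 hq0) (by rwa [norm_neg])
  rw [Theta_one_neg hq, Theta_neg_of_even (by decide), Theta_neg_of_even (m := 2) (by decide)] at h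
  rw [show q ^ 4 = (-q) ^ 4 by ring, h]
  obtain ⟨n1, n2, n3, n4, n6, n12⟩ := Theta_ne_zero_twelve hq
  field_simp

/-- Trisection of the triangular number theta function. -/
theorem jac_neg_self_four_trisect {q : ℂ} (hq0 : q ≠ 0) (hq : ‖q‖ < 1) :
    jac (-q) (q ^ 4) = jac (-q ^ 3) ((q ^ 3) ^ 3) + q * jac (-(q ^ 3) ^ 3) ((q ^ 3) ^ 12) := by
  have hQ := norm_pow_lt_one hq three_pos
  have hQ0 := pow_ne_zero 3 hq0
  have e0 : jac (-q ^ 33) (q ^ 36) = jac (-q ^ 3) (q ^ 36) := by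
    rw [← jac_self_div (pow_ne_zero 36 hq0)]
    congr 1
    field_simp
  have e1 : jac (-q ^ 27) (q ^ 36) = jac (-q ^ 9) (q ^ 36) := by
    rw [← jac_self_div (pow_ne_zero 36 hq0)]
    congr 1
    field_simp
  have e2 : jac (-q ^ 39) (q ^ 36) = jac (-q ^ 3) (q ^ 36) / q ^ 3 := by
    rw [show -q ^ 39 = q ^ 36 * -q ^ 3 by ring, jac_mul_left_self (pow_ne_zero _ hq0)
      (norm_pow_lt_one hq (by norm_num)) (neg_ne_zero.2 hQ0)]
    field_simp
  have h1 := jac_triple (pow_ne_zero 4 hq0) (norm_pow_lt_one hq four_pos) (neg_ne_zero.2 hq0)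
  have h2 := jac_double (p := (q ^ 3) ^ 3) (pow_ne_zero 3 hQ0) (norm_pow_lt_one hQ three_pos)
    (neg_ne_zero.2 hQ0)
  rw [h1, h2]
  ring_nf at e0 e1 e2 ⊢
  rw [e0, e1, e2]
  field_simp

/-- Trisection of the theta function in the denominator of `B2_eq_sub`. -/
theorem jac_sq_four_trisect {q : ℂ} (hq0 : q ≠ 0) (hq : ‖q‖ < 1) :
    jac (q ^ 2) (q ^ 4) = jac ((q ^ 3) ^ 6) ((q ^ 3) ^ 12)
      - 2 * q ^ 2 * jac ((q ^ 3) ^ 2) ((q ^ 3) ^ 12) := by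
  have hQ := norm_pow_lt_one hq three_pos
  have hQ0 := pow_ne_zero 3 hq0
  rw [jac_triple (pow_ne_zero 4 hq0) (norm_pow_lt_one hq four_pos) (pow_ne_zero 2 hq0)]
  have e1 := jac_pow_symm hQ0 (show 10 + 2 = 12 from rfl)
  have e2 := jac_pow_add hQ0 hQ (N := 12) (by norm_num) 2
  simp only [← pow_mul, ← pow_add, Nat.reduceMul, Nat.reduceAdd] at e1 e2 ⊢
  rw [e1, e2]
  field_simp
  ring

/-- The theta quotient in `B2_eq_sub` is the square of a triangular number theta function, whose
trisection is `jac_neg_self_four_trisect`. -/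
theorem qInf_cube_div_jac_sq_four {q : ℂ} (hq0 : q ≠ 0) (hq : ‖q‖ < 1) :
    qInf (q ^ 4) (q ^ 4) ^ 3 / jac (q ^ 2) (q ^ 4) = jac (-q ^ 2) ((q ^ 2) ^ 4) ^ 2 := by
  have h := jac_self_sq (pow_ne_zero 2 hq0) (norm_pow_lt_one hq two_pos)
  rw [← pow_mul] at h
  rw [jac_neg_self_four (pow_ne_zero 2 hq0) (norm_pow_lt_one hq two_pos), ← Theta_eq_qInf, h]
  simp only [Theta_pow, Nat.reduceMul]
  obtain ⟨n1, n2, n3, n4, n6, n12⟩ := Theta_ne_zero_twelve hq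
  field_simp

/-- The three components of `appell (q^4) (q^2) (q^(-2))` under trisection, in the variable
`q^3`. -/
def B2Part (q : ℂ) : Fin 3 → ℂ :=
  let a (m : ℕ) (w : ℂ) := appell (q ^ 12) (q ^ m) w
  ![2 * a 6 (q ^ 2)⁻¹, 2 * a 10 (q ^ 2)⁻¹ / q,
    -2 * a 10 (q ^ 2) + 2 * q ^ 2 * a 14 (q ^ 6) + q ^ 4 * a 18 (q ^ 6)]

/-- The nine Appell sums of the 3-dissection, brought to the positive arguments `q^2` and `q^6`
and grouped by the residue of the exponent of `q` modulo 3. -/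
theorem appell_trisect_B2 {q : ℂ} (hq0 : q ≠ 0) (hq : ‖q‖ < 1) :
    appell (q ^ 4) (q ^ 2) (q ^ (-2 : ℤ))
      = B2Part (q ^ 3) 0 + q * B2Part (q ^ 3) 1 + q ^ 2 * B2Part (q ^ 3) 2 := by
  have hQ := norm_pow_lt_one hq three_pos
  have hQ0 := pow_ne_zero 3 hq0
  have hP : ‖(q ^ 3) ^ 12‖ < 1 := norm_pow_lt_one hQ (by norm_num)
  have hP0 := pow_ne_zero 12 hQ0
  rw [appell_triple (pow_ne_zero 4 hq0) (norm_pow_lt_one hq four_pos) (pow_ne_zero 2 hq0)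
    (fun r => by
      have := zpow_mul_zpow_ne_one hq0 hq (N := 12) (m := -6) (by norm_num) r
      rwa [← pow_mul, ← zpow_natCast (q ^ (-2 : ℤ)), ← zpow_mul])]
  have hw : ∀ r : ℤ, ((q ^ 3) ^ 12) ^ r * ((q ^ 3) ^ 6)⁻¹ ≠ 1 := fun r => by
    have := zpow_mul_zpow_ne_one hQ0 hQ (N := 12) (m := -6) (by norm_num) r
    simpa [zpow_neg] using this
  have i1 := appell_inv hP0 ((q ^ 3) ^ 6) (w := (q ^ 3) ^ 2) (pow_ne_zero 2 hQ0)
  have i2 := appell_inv hP0 ((q ^ 3) ^ 10) (w := (q ^ 3) ^ 2) (pow_ne_zero 2 hQ0)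
  have i3 := appell_inv hP0 ((q ^ 3) ^ 14) (w := (q ^ 3) ^ 2) (pow_ne_zero 2 hQ0)
  have i4 := appell_inv hP0 ((q ^ 3) ^ 10) (w := (q ^ 3) ^ 6) (pow_ne_zero 6 hQ0)
  have i5 := appell_mul_right hP0 hP (z := (q ^ 3) ^ 10) (w := ((q ^ 3) ^ 6)⁻¹)
    (pow_ne_zero _ hQ0) (inv_ne_zero (pow_ne_zero _ hQ0)) hw
  have i6 := appell_mul_left hP0 hP (z := (q ^ 3) ^ 10) (w := (q ^ 3) ^ 6)
    (pow_ne_zero _ hQ0) (pow_ne_zero _ hQ0) (zpow_mul_pow_ne_one hQ0 hQ (by norm_num))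
  have w0 : (q ^ 2)⁻¹ ^ 3 = (q ^ 6)⁻¹ := by rw [inv_pow, ← pow_mul]
  have w1 : q ^ 12 * (q ^ 6)⁻¹ = q ^ 6 := by field_simp
  have w2 : q ^ 24 * (q ^ 6)⁻¹ = q ^ 18 := by field_simp
  have w3 : q ^ (-2 : ℤ) = (q ^ 2)⁻¹ := by rw [zpow_neg]; norm_cast
  have w4 : q ^ 72 / q ^ 18 = q ^ 54 := by field_simp
  have w5 : q ^ 72 / q ^ 30 = q ^ 42 := by field_simp
  have w6 : q ^ 72 / q ^ 42 = q ^ 30 := by field_simp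
  have w7 : q ^ 36 * (q ^ 18)⁻¹ = q ^ 18 := by field_simp
  simp only [← pow_mul, ← pow_add, Nat.reduceMul, Nat.reduceAdd, w4, w5, w6, w7]
    at i1 i2 i3 i4 i5 i6
  simp only [Finset.sum_range_succ, Finset.sum_range_zero, zero_add, B2Part, Matrix.cons_val_zero,
    Matrix.cons_val_one, Matrix.cons_val, Nat.cast_zero, Nat.cast_one, w0,
    Nat.cast_ofNat, th_zero, th_one (pow_ne_zero 4 hq0) (pow_ne_zero 2 hq0),
    th_two (pow_ne_zero 4 hq0) (pow_ne_zero 2 hq0), ← pow_mul, ← pow_add, Nat.reduceMul,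
    Nat.reduceAdd, mul_zero, add_zero, mul_one, pow_zero, one_mul, w1, w2, w3]
  rw [i6, i5, i1, i2, i3, i4]
  field_simp
  ring

/-- Comparison of `appell (q^12)` at a power of `q` with the sums in `phi6_eq` and `psi6_eq`. -/
theorem jac_mul_appell_sub_neg_pow {q : ℂ} (hq0 : q ≠ 0) (hq : ‖q‖ < 1) (a n : ℕ) {c : ℂ}
    (hc : q ^ 8 * c = q ^ n) (hc1 : ∀ r : ℤ, (q ^ 12) ^ r * c ≠ 1) :
    jac (-q ^ a) (q ^ 12) * appell (q ^ 12) (q ^ (n + a)) c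
      - jac (q ^ (n + a)) (q ^ 12) * appell (q ^ 12) (-q ^ a) (-q ^ (-8 : ℤ))
      = Theta 12 q ^ 3 * jac (-q ^ n) (q ^ 12) * jac (-(q ^ a * c)) (q ^ 12) /
        (jac (-q ^ 4) (q ^ 12) * jac c (q ^ 12)) := by
  have e : c = -q ^ n * -q ^ (-8 : ℤ) := by
    rw [← hc, zpow_neg]
    norm_cast
    field_simp
  have h := jac_mul_appell_sub (pow_ne_zero 12 hq0) (norm_pow_lt_one hq (by norm_num))
    (z := -q ^ a) (w := -q ^ (-8 : ℤ)) (l := -q ^ n) (neg_ne_zero.2 (pow_ne_zero _ hq0))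
    (neg_ne_zero.2 (zpow_ne_zero _ hq0)) (neg_ne_zero.2 (pow_ne_zero _ hq0))
    (zpow_mul_neg_pow_ne_one hq0 hq _ _) (zpow_mul_neg_zpow_ne_one hq0 hq _ _) (by rwa [← e])
  have e8 : jac (-q ^ (-8 : ℤ)) (q ^ 12) = jac (-q ^ 4) (q ^ 12) / q ^ 8 := by
    have h1 := jac_inv (pow_ne_zero 12 hq0) (norm_pow_lt_one hq (by norm_num)) (x := -q ^ 8)
      (neg_ne_zero.2 (pow_ne_zero _ hq0))
    have h2 := jac_self_div (pow_ne_zero 12 hq0) (-q ^ 4)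
    rw [show q ^ 12 / -q ^ 4 = -q ^ 8 by field_simp] at h2
    rw [show -q ^ (-8 : ℤ) = (-q ^ 8)⁻¹ by rw [inv_neg, zpow_neg]; norm_cast, h1, h2]
    field_simp
  rw [← e, e8, ← Theta_eq_qInf, show -q ^ n * -q ^ a = q ^ (n + a) by ring,
    show q ^ (n + a) * -q ^ (-8 : ℤ) = -(q ^ a * c) by rw [e, pow_add]; ring] at h
  rw [h, zpow_neg]
  norm_cast
  field_simp

/-- The equations satisfied by the components of `q * B2 q` under trisection: the terms of
`B2_eq_sub` are compared after multiplication by `jac (q^2) (q^4)`. -/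
theorem B2_components {q : ℂ} (hq0 : q ≠ 0) (hq : ‖q‖ < 1) {G0 G1 G2 : ℂ}
    (h0 : G0 = -phi6 (q ^ 4) + Theta 4 q ^ 8 * Theta 6 q ^ 2 /
      (Theta 1 q ^ 4 * Theta 8 q ^ 4 * Theta 12 q))
    (h1 : G1 = Theta 2 q ^ 7 * Theta 3 q ^ 2 / (Theta 1 q ^ 6 * Theta 4 q * Theta 6 q))
    (h2 : G2 = psi6 (q ^ 4) / q ^ 2 + 1 / (4 * q ^ 2) *
        (Theta 8 q ^ 2 * Theta 12 q ^ 9 / (Theta 4 q ^ 4 * Theta 24 q ^ 6)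
          - Theta 3 q * Theta 4 q ^ 9 * Theta 6 q ^ 3 / (Theta 1 q ^ 3 * Theta 2 q *
            Theta 8 q ^ 5 * Theta 12 q ^ 2 * Theta 24 q))
      + 3 / (4 * q) * (Theta 2 q ^ 7 * Theta 3 q ^ 2 * Theta 12 q ^ 4 /
          (Theta 1 q ^ 6 * Theta 4 q * Theta 6 q * Theta 8 q ^ 2 * Theta 24 q ^ 2))
      - 2 * q ^ 2 * (Theta 24 q ^ 3 / (Theta 4 q * Theta 8 q))) :
    jac (q ^ 6) (q ^ 12) * G0 - 2 * q * jac (q ^ 2) (q ^ 12) * G1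
      = 2 * q * jac (-q ^ 2) ((q ^ 2) ^ 3) * jac (-(q ^ 2) ^ 3) ((q ^ 2) ^ 12) - B2Part q 0 ∧
    jac (q ^ 6) (q ^ 12) * G1 - 2 * q * jac (q ^ 2) (q ^ 12) * G2
      = jac (-q ^ 2) ((q ^ 2) ^ 3) ^ 2 - B2Part q 1 ∧
    jac (q ^ 6) (q ^ 12) * G2 - 2 * jac (q ^ 2) (q ^ 12) * G0
      = q * jac (-(q ^ 2) ^ 3) ((q ^ 2) ^ 12) ^ 2 - B2Part q 2 := by
  have hp : ‖q ^ 12‖ < 1 := norm_pow_lt_one hq (by norm_num)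
  have hp0 := pow_ne_zero 12 hq0
  have c2 : ∀ r : ℤ, (q ^ 12) ^ r * (q ^ 2)⁻¹ ≠ 1 := fun r => by
    have := zpow_mul_zpow_ne_one hq0 hq (N := 12) (m := -2) (by norm_num) r
    simpa [zpow_neg] using this
  have k1 := jac_mul_appell_sub_neg_pow hq0 hq 0 6 (c := (q ^ 2)⁻¹) (by field_simp) c2
  have k2 := jac_mul_appell_sub_neg_pow hq0 hq 4 6 (c := (q ^ 2)⁻¹) (by field_simp) c2
  have k3 := jac_mul_appell_sub_neg_pow hq0 hq 0 10 (c := q ^ 2) (by ring)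
    (zpow_mul_pow_ne_one hq0 hq (by norm_num))
  have k4 := jac_mul_appell_sub_neg_pow hq0 hq 0 14 (c := q ^ 6) (by ring)
    (zpow_mul_pow_ne_one hq0 hq (by norm_num))
  have k5 := jac_mul_appell_sub_neg_pow hq0 hq 4 14 (c := q ^ 6) (by ring)
    (zpow_mul_pow_ne_one hq0 hq (by norm_num))
  have s2 : jac (q ^ 2)⁻¹ (q ^ 12) = -(q ^ 2)⁻¹ * jac (q ^ 2) (q ^ 12) :=
    jac_inv hp0 hp (pow_ne_zero 2 hq0)
  have s10 := jac_pow_symm hq0 (show 10 + 2 = 12 from rfl)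
  have s14 := jac_pow_add hq0 hq (N := 12) (by norm_num) 2
  have s18 := jac_pow_add hq0 hq (N := 12) (by norm_num) 6
  have u2 : jac (-(q ^ 2)⁻¹) (q ^ 12) = (q ^ 2)⁻¹ * jac (-q ^ 2) (q ^ 12) := by
    have := jac_inv hp0 hp (neg_ne_zero.2 (pow_ne_zero 2 hq0))
    rw [inv_neg, neg_neg] at this
    exact this
  have u10 : jac (-q ^ 10) (q ^ 12) = jac (-q ^ 2) (q ^ 12) := by
    have := jac_self_div hp0 (-q ^ 2)
    rwa [show q ^ 12 / -q ^ 2 = -q ^ 10 by field_simp] at this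
  have u14 : jac (-q ^ 14) (q ^ 12) = (q ^ 2)⁻¹ * jac (-q ^ 2) (q ^ 12) := by
    have := jac_mul_left_self hp0 hp (neg_ne_zero.2 (pow_ne_zero 2 hq0))
    rwa [inv_neg, neg_neg, show q ^ 12 * -q ^ 2 = -q ^ 14 by ring] at this
  have v2 : q ^ 4 * (q ^ 2)⁻¹ = q ^ 2 := by field_simp
  have v6 : q ^ 4 * q ^ 6 = q ^ 10 := by ring
  simp only [Nat.reduceAdd] at s14 s18
  simp only [pow_zero, one_mul, add_zero, Nat.reduceAdd, v2, v6, s2, s10, s14, s18, u2, u10, u14]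
    at k1 k2 k3 k4 k5
  have f : phi6 (q ^ 4) = 2 * appell (q ^ 12) (-1) (-q ^ (-8 : ℤ)) / jac (-1) (q ^ 12) := by
    rw [phi6_eq (pow_ne_zero 4 hq0) (norm_pow_lt_one hq four_pos), ← pow_mul,
      ← zpow_natCast q 4, ← zpow_mul]
    norm_num
  have g : psi6 (q ^ 4) = appell (q ^ 12) (-q ^ 4) (-q ^ (-8 : ℤ)) / jac (-q ^ 4) (q ^ 12) := by
    rw [psi6_eq (pow_ne_zero 4 hq0) (norm_pow_lt_one hq four_pos), ← pow_mul,
      ← zpow_natCast q 4, ← zpow_mul]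
    norm_num
  obtain ⟨n1, n2, n3, n4, n6, n12⟩ := Theta_ne_zero_twelve hq
  obtain ⟨-, n8, -, n24⟩ := Theta_ne_zero_twentyfour hq
  have i0 := B2_thetaQuotient_zero hq0 hq
  have i1 := B2_thetaQuotient_one hq0 hq
  have i2 := B2_thetaQuotient_two hq0 hq
  obtain ⟨⟨t2, t4, t6⟩, m0, m2, m4, m6⟩ := jac_even_twelve hq0 hq
  have hA := jac_neg_self_cube (pow_ne_zero 2 hq0) (norm_pow_lt_one hq two_pos)
  have hB := jac_neg_cube_twelve (pow_ne_zero 2 hq0) (norm_pow_lt_one hq two_pos)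
  simp only [Theta_pow, Nat.reduceMul] at hA hB
  rw [f, m0] at h0
  rw [g, m4] at h2
  rw [m0, m2, m4, m6, t2, t6] at k1
  rw [m2, m4, m6, t2] at k2
  rw [m0, m2, m4, t2] at k3
  rw [m0, m2, m4, m6, t2, t6] at k4
  rw [m2, m4, t6] at k5
  rw [hA, hB, t2, t6, h0, h1, h2]
  simp only [B2Part, Matrix.cons_val_zero, Matrix.cons_val_one, Matrix.cons_val]
  clear f g h0 h1 h2 hA hB t2 t4 t6 m0 m2 m4 m6
  -- The two Appell sums of `φ₆(q⁴)` and `ψ₆(q⁴)` are now independent unknowns, which cancel in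
  -- each of the three equations.
  generalize appell (q ^ 12) (-1) (-q ^ (-8 : ℤ)) = R at *
  generalize appell (q ^ 12) (-q ^ 4) (-q ^ (-8 : ℤ)) = R' at *
  refine ⟨?_, ?_, ?_⟩
  · linear_combination (norm := (field_simp; ring)) i0 + Theta 12 q / Theta 24 q ^ 2 * k1
  · linear_combination (norm := (field_simp; ring)) i1 +
      2 * Theta 4 q * Theta 24 q / (q * Theta 8 q * Theta 12 q ^ 2) * k2
  · linear_combination (norm := (field_simp; ring)) i2 - Theta 12 q / Theta 24 q ^ 2 * k3 +
      q ^ 2 * Theta 12 q / Theta 24 q ^ 2 * k4 +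
      q ^ 4 * Theta 4 q * Theta 24 q / (Theta 8 q * Theta 12 q ^ 2) * k5

/-- Trisection of `B2`: with `Q = q^3`, the coefficients of `1`, `q` and `q^2` in `q * B2 q`. -/
theorem B2_trisect {q : ℂ} (hq0 : q ≠ 0) (hq : ‖q‖ < 1) {G0 G1 G2 : ℂ}
    (h0 : G0 = -phi6 ((q ^ 3) ^ 4) + Theta 4 (q ^ 3) ^ 8 * Theta 6 (q ^ 3) ^ 2 /
      (Theta 1 (q ^ 3) ^ 4 * Theta 8 (q ^ 3) ^ 4 * Theta 12 (q ^ 3)))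
    (h1 : G1 = Theta 2 (q ^ 3) ^ 7 * Theta 3 (q ^ 3) ^ 2 /
      (Theta 1 (q ^ 3) ^ 6 * Theta 4 (q ^ 3) * Theta 6 (q ^ 3)))
    (h2 : G2 = psi6 ((q ^ 3) ^ 4) / (q ^ 3) ^ 2 + 1 / (4 * (q ^ 3) ^ 2) *
        (Theta 8 (q ^ 3) ^ 2 * Theta 12 (q ^ 3) ^ 9 / (Theta 4 (q ^ 3) ^ 4 * Theta 24 (q ^ 3) ^ 6)
          - Theta 3 (q ^ 3) * Theta 4 (q ^ 3) ^ 9 * Theta 6 (q ^ 3) ^ 3 / (Theta 1 (q ^ 3) ^ 3 *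
            Theta 2 (q ^ 3) * Theta 8 (q ^ 3) ^ 5 * Theta 12 (q ^ 3) ^ 2 * Theta 24 (q ^ 3)))
      + 3 / (4 * q ^ 3) * (Theta 2 (q ^ 3) ^ 7 * Theta 3 (q ^ 3) ^ 2 * Theta 12 (q ^ 3) ^ 4 /
          (Theta 1 (q ^ 3) ^ 6 * Theta 4 (q ^ 3) * Theta 6 (q ^ 3) * Theta 8 (q ^ 3) ^ 2 *
            Theta 24 (q ^ 3) ^ 2))
      - 2 * (q ^ 3) ^ 2 * (Theta 24 (q ^ 3) ^ 3 / (Theta 4 (q ^ 3) * Theta 8 (q ^ 3)))) :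
    q * B2 q = G0 + q * G1 + q ^ 2 * G2 := by
  obtain ⟨e0, e1, e2⟩ := B2_components (pow_ne_zero 3 hq0) (norm_pow_lt_one hq three_pos) h0 h1 h2
  have hne : jac (q ^ 2) (q ^ 4) ≠ 0 := jac_pow_ne_zero hq0 hq (by norm_num) (by norm_num)
  refine mul_left_cancel₀ hne ?_
  have ht := jac_neg_self_four_trisect (pow_ne_zero 2 hq0) (norm_pow_lt_one hq two_pos)
  rw [show (q ^ 2) ^ 3 = (q ^ 3) ^ 2 by ring] at ht
  rw [B2_eq_sub hq0 hq, qInf_cube_div_jac_sq_four hq0 hq, appell_trisect_B2 hq0 hq, ht,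
    jac_sq_four_trisect hq0 hq]
  linear_combination -e0 - q * e1 - q ^ 2 * e2

/-! ### Sums of theta quotients, and the trisection of `μ₂` -/

theorem IsThetaQuotient.mul {f g : ℂ → ℂ} (hf : IsThetaQuotient f) (hg : IsThetaQuotient g) :
    IsThetaQuotient fun q => f q * g q := by
  obtain ⟨k, e, hf⟩ := hf
  obtain ⟨l, d, hg⟩ := hg
  refine ⟨k + l, e + d, fun q h0 h1 => ?_⟩
  have hq0 : q ≠ 0 := norm_pos_iff.1 h0
  simp only [hf q h0 h1, hg q h0 h1]
  rw [zpow_add₀ hq0, Finsupp.prod_add_index' (fun m => zpow_zero _)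
    (fun m a b => zpow_add₀ (Theta_ne_zero h1 m.pos) a b)]
  ring

theorem IsThetaQuotient.zpow {f : ℂ → ℂ} (hf : IsThetaQuotient f) (n : ℤ) :
    IsThetaQuotient fun q => f q ^ n := by
  obtain ⟨k, e, hf⟩ := hf
  refine ⟨k * n, e.mapRange (· * n) (zero_mul n), fun q h0 h1 => ?_⟩
  simp only [hf q h0 h1]
  rw [mul_zpow, zpow_mul, Finsupp.prod_mapRange_index (fun m => zpow_zero _),
    Finsupp.prod, Finsupp.prod, ← Finset.prod_zpow]
  simp only [zpow_mul]

theorem IsThetaQuotient.pow {f : ℂ → ℂ} (hf : IsThetaQuotient f) (n : ℕ) :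
    IsThetaQuotient fun q => f q ^ n := by
  simpa using hf.zpow n

theorem IsThetaQuotient.div {f g : ℂ → ℂ} (hf : IsThetaQuotient f) (hg : IsThetaQuotient g) :
    IsThetaQuotient fun q => f q / g q := by
  simpa [div_eq_mul_inv] using hf.mul (hg.zpow (-1))

theorem isThetaQuotient_id : IsThetaQuotient fun q => q :=
  ⟨1, 0, fun q _ _ => by simp⟩

theorem isThetaQuotient_Theta (m : ℕ+) : IsThetaQuotient (Theta m) :=
  ⟨0, Finsupp.single m 1, fun q _ _ => by
    rw [Finsupp.prod_single_index (zpow_zero _), zpow_zero, zpow_one, one_mul]⟩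

/-- The relation `U08_eq_A2` with its theta quotient written in terms of the `Theta m`. -/
theorem U08_eq_A2_thetaQuotient {q : ℂ} (hq0 : q ≠ 0) (hq : ‖q‖ < 1) :
    U08 q = -2 * A2 (-q) + Theta 1 q * Theta 4 q ^ 10 / (Theta 2 q ^ 6 * Theta 8 q ^ 4) := by
  obtain ⟨n1, n2, n3, n4, n6, n12⟩ := Theta_ne_zero_twelve hq
  obtain ⟨-, n8, -, n24⟩ := Theta_ne_zero_twentyfour hq
  have h2 := pow_ne_zero 2 hq0
  have h2' := norm_pow_lt_one hq two_pos
  have a1 : jac (-q ^ 2) (q ^ 4) = Theta 4 q ^ 5 / (Theta 2 q ^ 2 * Theta 8 q ^ 2) := by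
    have h := jac_self_sq (neg_ne_zero.2 h2) (by rwa [norm_neg])
    rw [Theta_one_neg h2', Theta_neg_of_even (by decide)] at h
    simp only [Theta_pow, Nat.reduceMul] at h
    rw [show q ^ 4 = (-q ^ 2) ^ 2 by ring, h]
    field_simp
  have a2 : jac (q ^ 2) (q ^ 4) = Theta 2 q ^ 2 / Theta 4 q := by
    have h := jac_self_sq h2 h2'
    simpa only [Theta_pow, Nat.reduceMul, ← pow_mul] using h
  have a3 : jac (-1) (q ^ 4) = 2 * Theta 8 q ^ 2 / Theta 4 q := by
    simpa only [Theta_pow, Nat.reduceMul] using jac_neg_one_eq (norm_pow_lt_one hq four_pos)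
  rw [U08_eq_A2 hq0 hq, a1, a2, a3, jac_neg_self_four hq0 hq, ← Theta_eq_qInf]
  field_simp

theorem jac_self_sq_trisect {q : ℂ} (hq0 : q ≠ 0) (hq : ‖q‖ < 1) :
    jac q (q ^ 2) = jac ((q ^ 3) ^ 3) ((q ^ 3) ^ 6) - 2 * q * jac (q ^ 3) ((q ^ 3) ^ 6) := by
  have hQ := norm_pow_lt_one hq three_pos
  have hQ0 := pow_ne_zero 3 hq0
  rw [jac_triple (pow_ne_zero 2 hq0) (norm_pow_lt_one hq two_pos) hq0]
  have e1 := jac_pow_symm hQ0 (show 5 + 1 = 6 from rfl)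
  have e2 := jac_pow_add hQ0 hQ (N := 6) (by norm_num) 1
  simp only [← pow_mul, ← pow_add, Nat.reduceMul, Nat.reduceAdd] at e1 e2 ⊢
  rw [e1, e2]
  field_simp
  ring

/-- Trisection of the theta quotient in `mu2_eq_A2`. Multiplied by `jac (-q) (q^4)`, it becomes
the square of `jac q (q^2)`, and both of these theta functions have a simple trisection. -/
theorem Theta_cube_div_trisect {q : ℂ} (hq0 : q ≠ 0) (hq : ‖q‖ < 1) {x t0 t1 t2 : ℂ}
    (hx : x = q ^ 3)
    (h0 : t0 = 2 * Theta 1 x ^ 7 * Theta 4 x ^ 3 * Theta 6 x ^ 2 / (Theta 2 x ^ 10 * Theta 12 x)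
      - Theta 1 x ^ 4 * Theta 3 x * Theta 12 x / (Theta 2 x * Theta 4 x ^ 3 * Theta 6 x))
    (h1 : t1 = -4 * Theta 1 x ^ 5 * Theta 4 x ^ 6 * Theta 6 x ^ 5 /
        (Theta 2 x ^ 11 * Theta 3 x ^ 2 * Theta 12 x ^ 2)
      - Theta 2 x ^ 7 * Theta 12 x ^ 2 / (Theta 1 x * Theta 4 x ^ 6 * Theta 6 x))
    (h2 : t2 = 9 * Theta 1 x ^ 4 * Theta 3 x * Theta 6 x ^ 4 / Theta 2 x ^ 8) :
    qInf q q ^ 3 / jac (-q) (q ^ 4) ^ 2 = t0 + q * t1 + q ^ 2 * t2 := by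
  have hQ := norm_pow_lt_one hq three_pos
  have hQ0 := pow_ne_zero 3 hq0
  have hψ : jac (-q) (q ^ 4) ≠ 0 := jac_ne_zero (pow_ne_zero 4 hq0) (norm_pow_lt_one hq four_pos)
    (neg_ne_zero.2 hq0) (by simpa using zpow_mul_neg_pow_ne_one hq0 hq 4 1)
  have e : qInf q q ^ 3 / jac (-q) (q ^ 4) ^ 2 * jac (-q) (q ^ 4) = jac q (q ^ 2) ^ 2 := by
    rw [jac_neg_self_four hq0 hq, jac_self_sq hq0 hq,
      show qInf q q = Theta 1 q by rw [Theta_eq_qInf, pow_one]]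
    obtain ⟨n1, n2, n3, n4, n6, n12⟩ := Theta_ne_zero_twelve hq
    field_simp
  refine mul_right_cancel₀ hψ ?_
  rw [e, jac_self_sq_trisect hq0 hq, jac_neg_self_four_trisect hq0 hq, ← hx]
  rw [← hx] at hQ hQ0
  rw [jac_cube_six hQ0 hQ, jac_self_six hQ0 hQ, jac_neg_self_cube hQ0 hQ,
    jac_neg_cube_twelve hQ0 hQ, h0, h1, h2]
  have i0 := mu2_thetaQuotient_zero hQ0 hQ
  have i1 := mu2_thetaQuotient_one hQ0 hQ
  have i2 := mu2_thetaQuotient_two hQ0 hQ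
  obtain ⟨n1, n2, n3, n4, n6, n12⟩ := Theta_ne_zero_twelve hQ
  have e3 : q ^ 3 = x := hx.symm
  linear_combination (norm := (field_simp; ring)) -i0 - q * i1 - q ^ 2 * i2
    - 9 * Theta 1 x ^ 4 * Theta 6 x ^ 6 / Theta 2 x ^ 8 * e3

/-- The relation `mu2_eq_A2`, the trisection of `A₂(-q)`, and the replacement of `A₂(-x³)` by
`U_{0,8}(x³)`. -/
theorem mu2_trisect {q : ℂ} (hq0 : q ≠ 0) (hq : ‖q‖ < 1) {x : ℂ} (hx : x = q ^ 3) :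
    mu2 q = 2 * phi6 x
        - Theta 1 x ^ 4 * Theta 3 x * Theta 12 x / (Theta 2 x * Theta 4 x ^ 3 * Theta 6 x)
      - q * (Theta 2 x ^ 7 * Theta 12 x ^ 2 / (Theta 1 x * Theta 4 x ^ 6 * Theta 6 x))
      + q ^ 2 * (-2 * U08 (x ^ 3) / x
        + 9 * (Theta 1 x ^ 4 * Theta 3 x * Theta 6 x ^ 4 / Theta 2 x ^ 8)
        - 8 * (Theta 1 x ^ 4 * Theta 3 x * Theta 4 x ^ 5 * Theta 12 x /
          (Theta 2 x ^ 9 * Theta 6 x))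
        + 2 * (Theta 3 x * Theta 12 x ^ 10 / (x * Theta 6 x ^ 6 * Theta 24 x ^ 4))) := by
  have hQ := norm_pow_lt_one hq three_pos
  have hQ0 := pow_ne_zero 3 hq0
  rw [← hx] at hQ hQ0
  have hU := U08_eq_A2_thetaQuotient (pow_ne_zero 3 hQ0) (norm_pow_lt_one hQ three_pos)
  simp only [Theta_pow, Nat.reduceMul] at hU
  rw [mu2_eq_A2 hq0 hq, Theta_cube_div_trisect hq0 hq hx rfl rfl rfl,
    A2_trisect (neg_ne_zero.2 hq0) (by rwa [norm_neg]), show (-q) ^ 3 = -x by rw [hx]; ring,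
    show (-x) ^ 3 = -x ^ 3 by ring, Theta_one_neg hQ, Theta_neg_of_even (by decide),
    Theta_neg_of_even (m := 4) (by decide), Theta_neg_of_even (m := 6) (by decide),
    Theta_neg_of_even (m := 12) (by decide), Theta_neg_of_odd (m := 3) (by decide) hQ, neg_neg]
  simp only [Nat.reduceMul]
  obtain ⟨n1, n2, n3, n4, n6, n12⟩ := Theta_ne_zero_twelve hQ
  obtain ⟨-, n8, -, n24⟩ := Theta_ne_zero_twentyfour hQ
  rw [hU]
  field_simp
  ring

end MockTheta

end

theorem mainTheorem1 :
    (∀ q : ℂ, 0 < ‖q‖ → ‖q‖ < 1 →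
      A2 q = A2 (q ^ 9) / q - phi6 (-q ^ 3) / 2
        + Theta 6 q ^ 11 * Theta 18 q ^ 2 / (2 * Theta 3 q ^ 7 * Theta 12 q ^ 4 * Theta 36 q)
        + q * (Theta 6 q ^ 4 * Theta 9 q ^ 2 * Theta 12 q / (Theta 3 q ^ 5 * Theta 18 q))
        + 2 * q ^ 2 * (Theta 6 q ^ 3 * Theta 12 q * Theta 18 q ^ 2 /
            (Theta 3 q ^ 4 * Theta 9 q))) ∧
    (∀ q : ℂ, 0 < ‖q‖ → ‖q‖ < 1 →
      B2 q = psi6 (q ^ 12) / q ^ 5 - phi6 (q ^ 12) / q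
        + 1 / (4 * q ^ 5) *
          (Theta 24 q ^ 2 * Theta 36 q ^ 9 / (Theta 12 q ^ 4 * Theta 72 q ^ 6)
            - Theta 9 q * Theta 12 q ^ 9 * Theta 18 q ^ 3 /
              (Theta 3 q ^ 3 * Theta 6 q * Theta 24 q ^ 5 * Theta 36 q ^ 2 * Theta 72 q))
        + 3 / (4 * q ^ 2) * (Theta 6 q ^ 7 * Theta 9 q ^ 2 * Theta 36 q ^ 4 /
            (Theta 3 q ^ 6 * Theta 12 q * Theta 18 q * Theta 24 q ^ 2 * Theta 72 q ^ 2))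
        + 1 / q * (Theta 12 q ^ 8 * Theta 18 q ^ 2 /
            (Theta 3 q ^ 4 * Theta 24 q ^ 4 * Theta 36 q))
        + Theta 6 q ^ 7 * Theta 9 q ^ 2 / (Theta 3 q ^ 6 * Theta 12 q * Theta 18 q)
        - 2 * q ^ 7 * (Theta 72 q ^ 3 / (Theta 12 q * Theta 24 q))) ∧
    (∃ F : ℂ → ℂ, IsSumOfThetaQuotients F ∧ ∀ q : ℂ, 0 < ‖q‖ → ‖q‖ < 1 →
      mu2 q = 2 * phi6 (q ^ 3) - 2 / q * U08 (q ^ 9)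
        - Theta 3 q ^ 4 * Theta 9 q * Theta 36 q / (Theta 6 q * Theta 12 q ^ 3 * Theta 18 q)
        - q * (Theta 6 q ^ 7 * Theta 36 q ^ 2 / (Theta 3 q * Theta 12 q ^ 6 * Theta 18 q))
        + q ^ 2 * F (q ^ 3)) := by
  refine ⟨fun q h0 hq => ?_, fun q h0 hq => ?_, ?_⟩
  · have hq0 : q ≠ 0 := norm_pos_iff.1 h0
    have h := A2_trisect hq0 hq
    simp only [Theta_pow, ← pow_mul, Nat.reduceMul] at h
    rw [h]
    field_simp
    ring
  · have hq0 : q ≠ 0 := norm_pos_iff.1 h0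
    have h := B2_trisect hq0 hq rfl rfl rfl
    simp only [Theta_pow, ← pow_mul, Nat.reduceMul] at h
    refine mul_left_cancel₀ hq0 (h.trans ?_)
    field_simp
    ring
  -- `F` is the coefficient of `q^2` in `mu2_trisect`, apart from the term with `U08`.
  · refine ⟨fun q => 9 * (Theta 1 q ^ 4 * Theta 3 q * Theta 6 q ^ 4 / Theta 2 q ^ 8)
        - 8 * (Theta 1 q ^ 4 * Theta 3 q * Theta 4 q ^ 5 * Theta 12 q /
          (Theta 2 q ^ 9 * Theta 6 q))
        + 2 * (Theta 3 q * Theta 12 q ^ 10 / (q * Theta 6 q ^ 6 * Theta 24 q ^ 4)), ?_,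
      fun q h0 hq => ?_⟩
    · have t (m : ℕ+) := isThetaQuotient_Theta m
      refine ⟨3, ![9, -8, 2], ![_, _, _], Fin.forall_fin_succ.2
        ⟨((((t 1).pow 4).mul (t 3)).mul ((t 6).pow 4)).div ((t 2).pow 8), Fin.forall_fin_two.2
          ⟨(((((t 1).pow 4).mul (t 3)).mul ((t 4).pow 5)).mul (t 12)).div
              (((t 2).pow 9).mul (t 6)),
            ((t 3).mul ((t 12).pow 10)).div
              ((isThetaQuotient_id.mul ((t 6).pow 6)).mul ((t 24).pow 4))⟩⟩, fun q _ _ => ?_⟩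
      rw [Fin.sum_univ_three]
      simp
      ring
    · have hq0 : q ≠ 0 := norm_pos_iff.1 h0
      have h := mu2_trisect hq0 hq rfl
      have e : q ^ 2 * (-2 * U08 (q ^ 9) / q ^ 3) = -(2 / q * U08 (q ^ 9)) := by field_simp
      simp only [Theta_pow, ← pow_mul, Nat.reduceMul] at h ⊢
      rw [h]
      linear_combination e
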